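/- **Setting.** Let $\tau>0$, $V:[0,\infty)\to\mathbb R$ and $\kappa:(0,\infty)\to\mathbb R$ satisfy: (A1) $V\in C^1([0,\infty))\cap C^2((0,\infty))$; $V'$ is positive and bounded on $(0,\infty)$ and $V'(u)\to0$ as $u\to\infty$; there is a global maximum point $U_M\in(0,\infty)$ of $V'$ such that $U_M$ is the only zero of $V''$ in $(0,\infty)$. (A2) $\kappa\in C^1((0,\infty))$ and $\kappa>0$. Put $K_0=V'(0)$, $K_M=V'(U_M)$, $c_0=-V(0)$. For $K\in(K_0,K_M)$ let $u_M(K)\in(0,U_M)$ be the unique local maximum point of $u\mapsto Ku-V(u)$ there, for $K\in(0,K_M)$ let $u_m(K)\in(U_M,\infty)$ be its unique local minimum point there, and set $c_M(K)=Ku_M-V(u_M)$, $c_m(K)=Ku_m-V(u_m)$, $c_1(K)=\max\{c_0,c_m(K)\}$. Let $K_1\in(K_0,K_M)$ be the number with $c_m<c_0$ on $(0,K_1)$, $c_m(K_1)=c_0$ and $c_m>c_0$ on $(K_1,K_M)$. Let $$\mathcal D_1=\{(K,c): K_0<K<K_M,\ c_1(K)<c<c_M(K)\},$$ $$\mathcal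 D_2=\{(K,c): K_0<K<K_1,\ c=c_0\}\cup\{(K,c): 0<K<K_1,\ c_m(K)<c<c_0\}.$$ Let $f(u)=(Ku-V(u)-c)/K$, $g_1(u)=\dfrac1{\tau\kappa(1/u)}$, $g_2(u)=\dfrac{u}{2\tau\kappa(1/u)}$, and consider, for $\mu\in\mathbb R$, the solutions on all of $\mathbb R$ with $u>0$ of $$u_z=w,\qquad w_z=g_1(u)f(u)+g_2(u)\,(f'(u)+\mu)\,w. \tag{1}$$ The positive zeros of $f$ are $u_1<u_0<u_2$ if $(K,c)\in\mathcal D_1$ and $u_0<u_2$ if $(K,c)\in\mathcal D_2$. Put $\omega_0=\sqrt{-g_1(u_0)f'(u_0)}$. Convergence of subsets of $\mathbb R^2$ is meant in the Hausdorff distance. A homoclinic orbit of $(\bar u,0)$ is the orbit of a solution of (1) other than the equilibrium that tends to $(\bar u,0)$ as $z\to\pm\infty$. A heteroclinic cycle is the union of an orbit of (1) in $\{w>0\}$ from $(u_1,0)$ to $(u_2,0)$ and an orbit of (1), for the same $\mu$, in $\{w<0\}$ from $(u_2,0)$ to $(u_1,0)$. Fix $K$ satisfying $$K\in(K_1,K_M),\quad\text{or}\quad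 \int_1^\infty\frac{d\rho}{\rho^3\kappa(\rho)}=\infty\ \text{ and }\ K\in(K_0,K_1]. \tag{C}$$ **Proposition 6.2.** The following objects exist and are unique, and have the limits stated. There is exactly one $c_*\in(c_1(K),c_M(K))$ for which (1) with $c=c_*$ has a heteroclinic cycle for some $\mu$; this value $\mu=\mu_*$ and the cycle $\mathcal O_*$ are unique. Write $\mathcal D_{1,1}$, $\mathcal D_{1,2}$, $\mathcal D_{1,3}$ for the parts $c>c_*$, $c<c_*$, $c=c_*$ of $\mathcal D_1$, and let $$Q=(u_1,u_0)\text{ on }\mathcal D_{1,1},\qquad Q=(u_0,u_2)\text{ on }\mathcal D_{1,2}\cup\mathcal D_2,\qquad Q=(u_1,u_0)\cup(u_0,u_2)\text{ on }\mathcal D_{1,3}.$$ For each $q\in Q$ there is exactly one $\mu=\mu_{per}(q)$ such that (1) has a periodic solution with $(u(0),w(0))=(q,0)$; let $Z_{per}(q)$ be its fundamental period and $\mathcal O_{per}(q)$ its orbit. On $\mathcal D_{1,1}$ with $j=1$, and on $\mathcal D_{1,2}\cup\mathcal D_2$ with $j=2$, there is exactly one $\mu=\mu^j_{pul}$ for which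 (1) has a homoclinic orbit of $(u_j,0)$; this orbit $\mathcal O^j_{pul}$ is unique. (a) If $(K,c)\in\mathcal D_1\cup\mathcal D_2$, then, as $q\to u_0$ in $Q$, $$\mu_{per}\to-f'(u_0),\qquad Z_{per}\to\frac{2\pi}{\omega_0},\qquad \mathcal O_{per}\to\{(u_0,0)\}.$$ (b) If $(K,c)\in\mathcal D_{1,1}$, then $\mu_{per}\to\mu^1_{pul}$, $Z_{per}\to\infty$ and $\mathcal O_{per}\to\mathcal O^1_{pul}$ as $q\to u_1$ in $Q$. (c) If $(K,c)\in\mathcal D_{1,2}\cup\mathcal D_2$, then $\mu_{per}\to\mu^2_{pul}$, $Z_{per}\to\infty$ and $\mathcal O_{per}\to\mathcal O^2_{pul}$ as $q\to u_2$ in $Q$. (d) If $(K,c)\in\mathcal D_{1,3}$, then $\mu_{per}\to\mu_*$, $Z_{per}\to\infty$ and $\mathcal O_{per}\to\mathcal O_*$ as $q\to u_1$ in $Q$, and also as $q\to u_2$ in $Q$. -/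

import Mathlib

open Set Filter Topology

noncomputable section

/-- The data of the model: optimal velocity function `V`, viscosity coefficient `κ`
(a function of the density), relaxation time `τ`, and the inflection point `UM` of `V`. -/
structure TrafficModel where
  V : ℝ → ℝ
  κ : ℝ → ℝ
  τ : ℝ
  UM : ℝ

/-- The Euclidean plane of the variables `(u, w)`. -/
abbrev PhasePlane : Type := EuclideanSpace ℝ (Fin 2)

/-- Convergence `O q → A` along the filter `l`, for the Hausdorff distance. -/
def OrbitTendsto (O : ℝ → Set PhasePlane) (l : Filter ℝ) (A : Set PhasePlane) : Prop :=
  Tendsto (fun q => Metric.hausdorffEDist (O q) A) l (𝓝 0)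

namespace TrafficModel

/-- Assumption (A1) on the optimal velocity function. -/
structure A1 (M : TrafficModel) : Prop where
  contDiffOn_one : ContDiffOn ℝ 1 M.V (Ici 0)
  contDiffOn_two : ContDiffOn ℝ 2 M.V (Ioi 0)
  deriv_pos : ∀ u : ℝ, 0 < u → 0 < deriv M.V u
  deriv_bdd : ∃ B : ℝ, ∀ u : ℝ, 0 < u → deriv M.V u ≤ B
  deriv_tendsto : Tendsto (deriv M.V) atTop (𝓝 0)
  UM_pos : 0 < M.UM
  UM_max : ∀ u : ℝ, 0 < u → deriv M.V u ≤ deriv M.V M.UM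
  UM_root : ∀ u : ℝ, 0 < u → (deriv (deriv M.V) u = 0 ↔ u = M.UM)

/-- Assumption (A2) on the viscosity coefficient. -/
structure A2 (M : TrafficModel) : Prop where
  contDiffOn : ContDiffOn ℝ 1 M.κ (Ioi 0)
  pos : ∀ ρ : ℝ, 0 < ρ → 0 < M.κ ρ

/-- Assumption (H): the integral of `1 / (ρ ^ 3 κ(ρ))` over `(1, ∞)` is infinite. -/
def H (M : TrafficModel) : Prop :=
  ∫⁻ ρ in Ioi (1 : ℝ), ENNReal.ofReal (1 / (ρ ^ 3 * M.κ ρ)) = ⊤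

/-! ### The parameter regions -/

/-- `K₀ = V'(0)` (a one-sided derivative). -/
def K0 (M : TrafficModel) : ℝ := derivWithin M.V (Ici 0) 0

def KM (M : TrafficModel) : ℝ := deriv M.V M.UM

/-- The local maximum point of `K u - V u` in `(0, UM)`
(it exists and is unique for `K₀ < K < K_M`). -/
def uM (M : TrafficModel) (K : ℝ) : ℝ :=
  Classical.epsilon fun u : ℝ => u ∈ Ioo 0 M.UM ∧ IsLocalMax (fun v => K * v - M.V v) u

/-- The local minimum point of `K u - V u` in `(UM, ∞)`
(it exists and is unique for `0 < K < K_M`). -/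
def um (M : TrafficModel) (K : ℝ) : ℝ :=
  Classical.epsilon fun u : ℝ => u ∈ Ioi M.UM ∧ IsLocalMin (fun v => K * v - M.V v) u

def c0 (M : TrafficModel) : ℝ := -M.V 0

def cM (M : TrafficModel) (K : ℝ) : ℝ := K * M.uM K - M.V (M.uM K)

def cm (M : TrafficModel) (K : ℝ) : ℝ := K * M.um K - M.V (M.um K)

def c1 (M : TrafficModel) (K : ℝ) : ℝ := max M.c0 (M.cm K)

/-- The number `K₁` in `(K₀, K_M)` at which `c_m(K) - c₀` changes sign from negative
to positive (it exists and is unique). -/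
def K1 (M : TrafficModel) : ℝ :=
  Classical.epsilon fun k : ℝ => k ∈ Ioo M.K0 M.KM ∧
    (∀ K ∈ Ioo 0 k, M.cm K < M.c0) ∧ M.cm k = M.c0 ∧ ∀ K ∈ Ioo k M.KM, M.c0 < M.cm K

def D1 (M : TrafficModel) : Set (ℝ × ℝ) :=
  {p | M.K0 < p.1 ∧ p.1 < M.KM ∧ M.c1 p.1 < p.2 ∧ p.2 < M.cM p.1}

def D2 (M : TrafficModel) : Set (ℝ × ℝ) :=
  {p | M.K0 < p.1 ∧ p.1 < M.K1 ∧ p.2 = M.c0} ∪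
  {p | 0 < p.1 ∧ p.1 < M.K1 ∧ M.cm p.1 < p.2 ∧ p.2 < M.c0}

/-- Condition (C). -/
def C (M : TrafficModel) (K : ℝ) : Prop :=
  K ∈ Ioo M.K1 M.KM ∨ (M.H ∧ K ∈ Ioc M.K0 M.K1)

/-! ### The planar system -/

def f (M : TrafficModel) (K c u : ℝ) : ℝ := (K * u - M.V u - c) / K

def h (M : TrafficModel) (K c u μ : ℝ) : ℝ := deriv (M.f K c) u + μ

def g1 (M : TrafficModel) (u : ℝ) : ℝ := 1 / (M.τ * M.κ u⁻¹)

def g2 (M : TrafficModel) (u : ℝ) : ℝ := u / (2 * M.τ * M.κ u⁻¹)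

/-- The frequency `ω₀ = √(-g₁(u₀) f'(u₀))`. -/
def omega0 (M : TrafficModel) (K c u0 : ℝ) : ℝ :=
  Real.sqrt (-(M.g1 u0 * deriv (M.f K c) u0))

/-- `(u, w)` is a global solution with `u > 0` of
`u' = w`, `w' = g₁(u) f(u) + g₂(u) h(u, μ) w`. -/
def IsSolution (M : TrafficModel) (K c μ : ℝ) (u w : ℝ → ℝ) : Prop :=
  ∀ z : ℝ, 0 < u z ∧ HasDerivAt u (w z) z ∧
    HasDerivAt w (M.g1 (u z) * M.f K c (u z) + M.g2 (u z) * M.h K c (u z) μ * w z) z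

/-- `u₁ < u₀ < u₂` are exactly the positive zeros of `f`. -/
def ThreeZeros (M : TrafficModel) (K c u1 u0 u2 : ℝ) : Prop :=
  0 < u1 ∧ u1 < u0 ∧ u0 < u2 ∧
    ∀ u : ℝ, 0 < u → (M.f K c u = 0 ↔ u = u1 ∨ u = u0 ∨ u = u2)

/-- `u₀ < u₂` are exactly the positive zeros of `f`. -/
def TwoZeros (M : TrafficModel) (K c u0 u2 : ℝ) : Prop :=
  0 < u0 ∧ u0 < u2 ∧ ∀ u : ℝ, 0 < u → (M.f K c u = 0 ↔ u = u0 ∨ u = u2)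

/-- The solution `(u, w)` runs from `(a, 0)` at `-∞` to `(b, 0)` at `∞`. -/
def Connects (M : TrafficModel) (K c μ a b : ℝ) (u w : ℝ → ℝ) : Prop :=
  M.IsSolution K c μ u w ∧
    Tendsto u atBot (𝓝 a) ∧ Tendsto u atTop (𝓝 b) ∧
    Tendsto w atBot (𝓝 0) ∧ Tendsto w atTop (𝓝 0)

/-- The trajectory of `(u, w)` over a set of times `T`. -/
def trajectory (u w : ℝ → ℝ) (T : Set ℝ) : Set PhasePlane :=
  (fun z => !₂[u z, w z]) '' T

/-- `O` is a homoclinic orbit of the equilibrium `(ubar, 0)`. -/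
def IsPulseOrbit (M : TrafficModel) (K c ubar μ : ℝ) (O : Set PhasePlane) : Prop :=
  ∃ u w : ℝ → ℝ, M.Connects K c μ ubar ubar u w ∧
    (∃ z, ¬ (u z = ubar ∧ w z = 0)) ∧ O = trajectory u w univ

/-- `O` is a heteroclinic cycle: the union of a heteroclinic orbit from `(u₁, 0)` to `(u₂, 0)`
in `w > 0` and a heteroclinic orbit from `(u₂, 0)` to `(u₁, 0)` in `w < 0`, where
`u₁` and `u₂` are the smallest and the largest of the three positive zeros of `f`. -/
def IsHeteroclinicCycle (M : TrafficModel) (K c μ : ℝ) (O : Set PhasePlane) : Prop :=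
  ∃ u1 u0 u2 : ℝ, M.ThreeZeros K c u1 u0 u2 ∧
    ∃ ub wb uf wf : ℝ → ℝ,
      (M.Connects K c μ u1 u2 ub wb ∧ ∀ z, 0 < wb z) ∧
      (M.Connects K c μ u2 u1 uf wf ∧ ∀ z, wf z < 0) ∧
      O = trajectory ub wb univ ∪ trajectory uf wf univ

/-- `Z > 0` is a period of `(u, w)`. -/
def IsPeriod (u w : ℝ → ℝ) (Z : ℝ) : Prop :=
  0 < Z ∧ ∀ z, u (z + Z) = u z ∧ w (z + Z) = w z

/-- `O` is the orbit of a periodic solution with `(u, w)(0) = (q, 0)`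
and fundamental period `Z`. -/
def IsPeriodicOrbit (M : TrafficModel) (K c q μ Z : ℝ) (O : Set PhasePlane) : Prop :=
  ∃ u w : ℝ → ℝ, M.IsSolution K c μ u w ∧ u 0 = q ∧ w 0 = 0 ∧
    IsPeriod u w Z ∧ (∀ Z', IsPeriod u w Z' → Z ≤ Z') ∧ O = trajectory u w (Ico 0 Z)

/-- For each `q ∈ Q` there is exactly one `μ` for which the system has a periodic solution
starting at `(q, 0)`; this value is `μper q`, the fundamental period is `Zper q`
and the orbit is `Oper q`. -/
def IsPeriodicFamily (M : TrafficModel) (K c : ℝ) (Q : Set ℝ)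
    (μper Zper : ℝ → ℝ) (Oper : ℝ → Set PhasePlane) : Prop :=
  ∀ q ∈ Q, ∀ (μ Z : ℝ) (O : Set PhasePlane),
    M.IsPeriodicOrbit K c q μ Z O ↔ μ = μper q ∧ Z = Zper q ∧ O = Oper q

/-- The Hopf-type limit as `q → u₀` in `Q`. -/
def HopfLimit (M : TrafficModel) (K c u0 : ℝ) (Q : Set ℝ)
    (μper Zper : ℝ → ℝ) (Oper : ℝ → Set PhasePlane) : Prop :=
  Tendsto μper (𝓝[Q] u0) (𝓝 (-deriv (M.f K c) u0)) ∧
  Tendsto Zper (𝓝[Q] u0) (𝓝 (2 * Real.pi / M.omega0 K c u0)) ∧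
  OrbitTendsto Oper (𝓝[Q] u0) {!₂[u0, 0]}

end TrafficModel

end

noncomputable section

/-! ### Elementary facts about real functions -/

/-! In the upper half plane an orbit of `u' = w`, `w' = a u + b u * w` is the graph of a function
`v` with `v' = a / v + b`, and time reversal turns the lower half plane into the upper one for `-b`.
In the model `a = g₁ f`, and the coefficient of `w` is `b + μ g` with `b = g₂ f'` and `g = g₂ > 0`,
so branches are monotone in `μ`. The singularity at `v = 0` is harmless: `(v₁ - v₂) (a / v₁ - a /
v₂) ≤ 0` for `a ≥ 0`, so squared differences obey estimates that remain valid for branches leaving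
the axis.

Let `a` change sign from plus to minus at `m = u₀`, with `p < m < q`. The height over `m` of the
branch leaving `(p, 0)` grows with `μ`, that of the branch arriving at `(q, 0)` decreases, and
exactly one value, `crit`, makes them meet. Two arcs cannot be ordered (`IsArc.not_ordered`): the
one favoured on the left would be above the other on the left of the centre and below it on the
right, while their difference cannot decrease in between. Hence `crit` increases strictly with `p`
and with `q`.

A closed orbit with extremes `p` and `q` needs the same `μ` above and below the axis, that is,
`critGap = 0` for the sum `critGap` of the critical values of `b` and `-b`. The gap is strictly
monotone and continuous in each end, positive when `p` is near the centre and negative when `q` is.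
So an end has at most one partner, and once a pair with gap zero is known, every end strictly inside
it has a partner that varies as expected in the limits. If both ends of the outer pair are
equilibria it is a heteroclinic cycle, if one is, a homoclinic orbit. Conversely, the extremes of
any periodic or homoclinic solution form such a pair, by strict monotonicity of `crit`
(`Scene.crit_of_periodic`, `Scene.crit_of_pulse`); uniqueness for the initial value problem does the
rest.

The sign of the gap at `(u₁, u₂)` decides which equilibrium bounds the family. When `c` grows, `a`
decreases, `u₁` and `u₂` move right and `u₀` moves left, so this gap is strictly increasing in `c`.
It is positive near `c_M`, where `u₁` and `u₀` merge, and negative near `c₁`: there either `u₀` and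
`u₂` merge, or `u₁` tends to `0`, and then (C) makes a primitive of `g₂` tend to `-∞` at `0`, which
pushes the branches from points near `0` arbitrarily high. The single zero of the gap is `c_*`. On
`D₂` the same blow-up gives a negative gap directly.

The limits follow from continuity of `crit` and uniform closeness of arcs. The period blows up
because the distance to an equilibrium changes at most exponentially in time. At the centre, the
divergence `b + μ g` must vanish somewhere on each closed orbit, which gives `μ → -b / g = -f'(u₀)`,
and the angle in scaled coordinates turns at a speed close to `ω₀`. -/

theorem antitoneOn_Icc_of_hasDerivAt {f f' : ℝ → ℝ} {x y : ℝ} (hc : ContinuousOn f (Icc x y))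
    (hd : ∀ u ∈ Ioo x y, HasDerivAt f (f' u) u) (h : ∀ u ∈ Ioo x y, f' u ≤ 0) :
    AntitoneOn f (Icc x y) := by
  apply antitoneOn_of_deriv_nonpos (convex_Icc x y) hc
  · rw [interior_Icc]
    exact fun u hu => (hd u hu).differentiableAt.differentiableWithinAt
  · rw [interior_Icc]
    intro u hu
    rw [(hd u hu).deriv]
    exact h u hu

theorem monotoneOn_Icc_of_hasDerivAt {f f' : ℝ → ℝ} {x y : ℝ} (hc : ContinuousOn f (Icc x y))
    (hd : ∀ u ∈ Ioo x y, HasDerivAt f (f' u) u) (h : ∀ u ∈ Ioo x y, 0 ≤ f' u) :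
    MonotoneOn f (Icc x y) := by
  apply monotoneOn_of_deriv_nonneg (convex_Icc x y) hc
  · rw [interior_Icc]
    exact fun u hu => (hd u hu).differentiableAt.differentiableWithinAt
  · rw [interior_Icc]
    intro u hu
    rw [(hd u hu).deriv]
    exact h u hu

theorem exists_last_zero {f : ℝ → ℝ} {x z : ℝ} (hxz : x ≤ z) (hc : ContinuousOn f (Icc x z))
    (hx : f x ≤ 0) (hz : 0 < f z) : ∃ t ∈ Ico x z, f t = 0 ∧ ∀ u ∈ Ioc t z, 0 < f u := by
  set S : Set ℝ := Icc x z ∩ f ⁻¹' Iic 0 with hS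
  have hSc : IsClosed S := hc.preimage_isClosed_of_isClosed isClosed_Icc isClosed_Iic
  have hSne : S.Nonempty := ⟨x, ⟨le_rfl, hxz⟩, hx⟩
  have hSb : BddAbove S := ⟨z, fun u hu => hu.1.2⟩
  have ht : sSup S ∈ S := hSc.csSup_mem hSne hSb
  set t := sSup S
  have htz : t < z := lt_of_le_of_ne ht.1.2 (fun h => by
    have := ht.2
    rw [h] at this
    exact absurd hz (not_lt.2 this))
  have hpos : ∀ u ∈ Ioc t z, 0 < f u := by
    intro u hu
    by_contra hcon
    have : u ∈ S := ⟨⟨ht.1.1.trans hu.1.le, hu.2⟩, not_lt.1 hcon⟩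
    exact absurd (le_csSup hSb this) (not_le.2 hu.1)
  refine ⟨t, ⟨ht.1.1, htz⟩, le_antisymm ht.2 ?_, hpos⟩
  have hcw : ContinuousWithinAt f (Ioc t z) t :=
    (hc t ht.1).mono (fun u hu => ⟨ht.1.1.trans hu.1.le, hu.2⟩)
  have hcl : t ∈ closure (Ioc t z) := by
    rw [closure_Ioc htz.ne]
    exact ⟨le_rfl, htz.le⟩
  have := hcw.mem_closure_image hcl
  have h2 : closure (f '' Ioc t z) ⊆ Ici 0 := by
    apply closure_minimal _ isClosed_Ici
    rintro _ ⟨u, hu, rfl⟩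
    exact (hpos u hu).le
  exact h2 this

theorem exists_first_zero {f : ℝ → ℝ} {x z : ℝ} (hxz : x ≤ z) (hc : ContinuousOn f (Icc x z))
    (hx : 0 < f x) (hz : f z ≤ 0) : ∃ t ∈ Ioc x z, f t = 0 ∧ ∀ u ∈ Ico x t, 0 < f u := by
  have hc' : ContinuousOn (fun u => f (-u)) (Icc (-z) (-x)) :=
    hc.comp continuousOn_neg (fun u hu => ⟨by linarith [hu.2], by linarith [hu.1]⟩)
  obtain ⟨t, ht, h0, hpos⟩ := exists_last_zero (f := fun u => f (-u)) (neg_le_neg hxz) hc'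
    (by simpa using hz) (by simpa using hx)
  refine ⟨-t, ⟨by linarith [ht.2], by linarith [ht.1]⟩, h0, fun u hu => ?_⟩
  have := hpos (-u) ⟨by linarith [hu.2], by linarith [hu.1]⟩
  simpa using this

/-- Used with `S` the maximum of a quantity over an interval, to close an energy estimate in which
this maximum occurs on both sides. -/
theorem le_add_sqrt_of_sq_le {S c E : ℝ} (hc : 0 ≤ c) (h : S ^ 2 ≤ E + c * S) :
    S ≤ c + Real.sqrt E := by
  by_contra hcon
  push Not at hcon
  have hE := Real.sqrt_nonneg E
  have h1 : E < (Real.sqrt E + (S - c - Real.sqrt E)) * S := by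
    by_cases hE0 : 0 ≤ E
    · nlinarith [Real.sq_sqrt hE0]
    · nlinarith
  nlinarith

/-- A field that is bounded everywhere cannot leave the ball of radius `L * (t - s)`, so
Picard–Lindelöf applies on the whole interval and not only locally. -/
theorem exists_ode_solution_Icc {E : Type*} [NormedAddCommGroup E] [NormedSpace ℝ E]
    [CompleteSpace E] {F : ℝ → E → E} {s t t₀ : ℝ} (ht₀ : t₀ ∈ Icc s t) {K L : NNReal}
    (hK : ∀ τ ∈ Icc s t, LipschitzWith K (F τ)) (hc : ∀ x, ContinuousOn (fun τ => F τ x) (Icc s t))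
    (hL : ∀ τ ∈ Icc s t, ∀ x, ‖F τ x‖ ≤ L) (x₀ : E) :
    ∃ α : ℝ → E, α t₀ = x₀ ∧ ∀ τ ∈ Icc s t, HasDerivWithinAt α (F τ (α τ)) (Icc s t) τ := by
  have hst : s ≤ t := ht₀.1.trans ht₀.2
  have : IsPicardLindelof F (⟨t₀, ht₀⟩ : Icc s t) x₀ (L * (t - s).toNNReal) 0 L K := by
    refine ⟨fun τ hτ => (hK τ hτ).lipschitzOnWith, fun x _ => hc x, fun τ hτ x _ => hL τ hτ x, ?_⟩
    have h1 : max (t - t₀) (t₀ - s) ≤ t - s :=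
      max_le (by linarith [ht₀.1]) (by linarith [ht₀.2])
    simp only [NNReal.coe_mul, Real.coe_toNNReal _ (sub_nonneg.2 hst), NNReal.coe_zero, sub_zero]
    exact mul_le_mul_of_nonneg_left h1 L.2
  exact this.exists_eq_forall_mem_Icc_hasDerivWithinAt₀

/-! ### Graphs of orbits in a half plane -/

/-- `v` is positive on `(x, y)`, continuous on `[x, y]`, and its graph is an orbit of
`u' = w`, `w' = a u + b u * w`. -/
structure IsGraph (a b : ℝ → ℝ) (x y : ℝ) (v : ℝ → ℝ) : Prop where
  cont : ContinuousOn v (Icc x y)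
  pos : ∀ u ∈ Ioo x y, 0 < v u
  deriv : ∀ u ∈ Ioo x y, HasDerivAt v (a u / v u + b u) u

/-- The coefficients after the reflection `u ↦ -u`. -/
def oddRefl (a : ℝ → ℝ) : ℝ → ℝ := fun x => -a (-x)

@[simp] theorem oddRefl_oddRefl (a : ℝ → ℝ) : oddRefl (oddRefl a) = a := by
  funext x; simp [oddRefl]

namespace IsGraph

variable {a b a₁ a₂ b₁ b₂ v v₁ v₂ : ℝ → ℝ} {x y x' y' : ℝ}

theorem mono (h : IsGraph a b x y v) (hx : x ≤ x') (hy : y' ≤ y) : IsGraph a b x' y' v :=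
  ⟨h.cont.mono (Icc_subset_Icc hx hy), fun u hu => h.pos u (Ioo_subset_Ioo hx hy hu),
    fun u hu => h.deriv u (Ioo_subset_Ioo hx hy hu)⟩

theorem nonneg (h : IsGraph a b x y v) (hxy : x < y) {u : ℝ} (hu : u ∈ Icc x y) : 0 ≤ v u := by
  have h1 : closure (Ioo x y) = Icc x y := closure_Ioo hxy.ne
  rw [← h1] at hu
  have hc : ContinuousWithinAt v (Ioo x y) u :=
    (h.cont u (h1 ▸ hu)).mono Ioo_subset_Icc_self
  have h2 : closure (v '' Ioo x y) ⊆ Ici 0 := by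
    apply closure_minimal _ isClosed_Ici
    rintro _ ⟨u, hu, rfl⟩
    exact (h.pos u hu).le
  exact h2 (hc.mem_closure_image hu)

/-- Reversing space and time together preserves the upper half plane. Statements about branches that
leave a left end point therefore have mirror images for branches that arrive at a right end point.
-/
theorem refl (h : IsGraph a b x y v) :
    IsGraph (oddRefl a) (oddRefl b) (-y) (-x) (fun u => v (-u)) := by
  refine ⟨h.cont.comp continuousOn_neg (fun u hu => ⟨by linarith [hu.2], by linarith [hu.1]⟩),
    fun u hu => h.pos _ ⟨by linarith [hu.2], by linarith [hu.1]⟩, fun u hu => ?_⟩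
  have := (h.deriv (-u) ⟨by linarith [hu.2], by linarith [hu.1]⟩).comp u (hasDerivAt_neg u)
  refine this.congr_deriv ?_
  simp only [oddRefl]
  ring

/-- The map `V ↦ A / V` is decreasing, so it contributes with the good sign. Only the difference of
the numerators survives, and its factor `1 / V₁` is absorbed by `V₁ - V₂ ≤ V₁`. No lower bound on
the heights enters. -/
theorem sub_mul_div_sub_le {A₁ A₂ V₁ V₂ δ : ℝ} (h1 : 0 < V₁) (h2 : 0 < V₂) (hA1 : 0 ≤ A₁)
    (hA2 : 0 ≤ A₂) (hδ : |A₁ - A₂| ≤ δ) : (V₁ - V₂) * (A₁ / V₁ - A₂ / V₂) ≤ δ := by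
  have key : ∀ {A₁ A₂ V₁ V₂ : ℝ}, 0 < V₁ → 0 < V₂ → 0 ≤ A₂ → A₁ - A₂ ≤ δ → 0 ≤ δ →
      V₂ ≤ V₁ → (V₁ - V₂) * (A₁ / V₁ - A₂ / V₂) ≤ δ := by
    intro A₁ A₂ V₁ V₂ h1 h2 hA2 hd hδ0 h
    have h3 : A₂ / V₁ ≤ A₂ / V₂ := div_le_div_of_nonneg_left hA2 h2 h
    have h4 : A₁ / V₁ - A₂ / V₂ ≤ δ / V₁ := by
      have : A₁ / V₁ - A₂ / V₁ ≤ δ / V₁ := by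
        rw [← sub_div]
        exact div_le_div_of_nonneg_right hd h1.le
      linarith
    calc (V₁ - V₂) * (A₁ / V₁ - A₂ / V₂) ≤ (V₁ - V₂) * (δ / V₁) :=
          mul_le_mul_of_nonneg_left h4 (by linarith)
      _ ≤ V₁ * (δ / V₁) := mul_le_mul_of_nonneg_right (by linarith) (by positivity)
      _ = δ := by field_simp
  have hδ0 : 0 ≤ δ := (abs_nonneg _).trans hδ
  rcases le_total V₂ V₁ with h | h
  · exact key h1 h2 hA2 ((le_abs_self _).trans hδ) hδ0 h
  · have := key h2 h1 hA1 ((neg_sub A₁ A₂ ▸ neg_le_abs (A₁ - A₂)).trans hδ) hδ0 h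
    linarith

/-- Continuous dependence on the coefficients and on the initial value. -/
theorem abs_sub_le {δ β : ℝ} (h1 : IsGraph a₁ b₁ x y v₁) (h2 : IsGraph a₂ b₂ x y v₂)
    (ha1 : ∀ u ∈ Ioo x y, 0 ≤ a₁ u) (ha2 : ∀ u ∈ Ioo x y, 0 ≤ a₂ u)
    (hδ0 : 0 ≤ δ) (hβ0 : 0 ≤ β) (hδ : ∀ u ∈ Ioo x y, |a₁ u - a₂ u| ≤ δ)
    (hβ : ∀ u ∈ Ioo x y, |b₁ u - b₂ u| ≤ β) {u : ℝ} (hu : u ∈ Icc x y) :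
    |v₁ u - v₂ u| ≤ 2 * β * (y - x) + Real.sqrt ((v₁ x - v₂ x) ^ 2 + 2 * δ * (y - x)) := by
  have hxy : x ≤ y := hu.1.trans hu.2
  have hcd : ContinuousOn (fun u => v₁ u - v₂ u) (Icc x y) := h1.cont.sub h2.cont
  obtain ⟨z, hz, hmax⟩ := isCompact_Icc.exists_isMaxOn ⟨x, left_mem_Icc.2 hxy⟩ hcd.abs
  have hmax' : ∀ u ∈ Icc x y, |v₁ u - v₂ u| ≤ |v₁ z - v₂ z| := fun u hu => hmax hu
  set S := |v₁ z - v₂ z| with hS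
  refine (hmax' u hu).trans ?_
  -- The squared difference has slope at most `2 δ + 2 β S`, with `S` the maximum of the difference;
  -- the resulting quadratic inequality for `S` is then solved.
  have hanti : AntitoneOn (fun u => (v₁ u - v₂ u) ^ 2 - (2 * δ + 2 * β * S) * (u - x))
      (Icc x y) := by
    apply antitoneOn_Icc_of_hasDerivAt
      (f' := fun u => 2 * (v₁ u - v₂ u) * ((a₁ u / v₁ u + b₁ u) - (a₂ u / v₂ u + b₂ u))
        - (2 * δ + 2 * β * S))
    · exact (hcd.pow 2).sub (by fun_prop)
    · intro u hu
      have hd := (((h1.deriv u hu).sub (h2.deriv u hu)).pow 2).sub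
        (((hasDerivAt_id u).sub_const x).const_mul (2 * δ + 2 * β * S))
      refine hd.congr_deriv ?_
      simp
    · intro u hu
      have e1 := sub_mul_div_sub_le (h1.pos u hu) (h2.pos u hu) (ha1 u hu) (ha2 u hu) (hδ u hu)
      have e2 : (v₁ u - v₂ u) * (b₁ u - b₂ u) ≤ β * S := by
        calc (v₁ u - v₂ u) * (b₁ u - b₂ u) ≤ |(v₁ u - v₂ u) * (b₁ u - b₂ u)| := le_abs_self _
          _ = |b₁ u - b₂ u| * |v₁ u - v₂ u| := by rw [abs_mul, mul_comm]
          _ ≤ β * S := mul_le_mul (hβ u hu) (hmax' u (Ioo_subset_Icc_self hu)) (abs_nonneg _) hβ0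
      nlinarith
  have hz' := hanti (left_mem_Icc.2 hxy) hz hz.1
  simp only [sub_self, mul_zero, sub_zero] at hz'
  apply le_add_sqrt_of_sq_le (by have := sub_nonneg.2 hxy; positivity)
  have hS2 : S ^ 2 = (v₁ z - v₂ z) ^ 2 := sq_abs _
  rw [hS2]
  have h3 : (2 * δ + 2 * β * S) * (z - x) ≤ (2 * δ + 2 * β * S) * (y - x) :=
    mul_le_mul_of_nonneg_left (by linarith [hz.2]) (by positivity)
  nlinarith

/-- From `v * v' = a + b * v`, the square of `v` has slope at most `2 A + 2 B * max v`. The bound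
tends to zero with the length of the interval if the initial height does. -/
theorem le_bound {A B : ℝ} (h : IsGraph a b x y v) (hA0 : 0 ≤ A) (hB0 : 0 ≤ B)
    (hA : ∀ u ∈ Ioo x y, a u ≤ A) (hB : ∀ u ∈ Ioo x y, b u ≤ B) {u : ℝ} (hu : u ∈ Icc x y) :
    v u ≤ 2 * B * (y - x) + Real.sqrt (v x ^ 2 + 2 * A * (y - x)) := by
  have hxy : x ≤ y := hu.1.trans hu.2
  obtain ⟨z, hz, hmax⟩ := isCompact_Icc.exists_isMaxOn ⟨x, left_mem_Icc.2 hxy⟩ h.cont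
  have hmax' : ∀ u ∈ Icc x y, v u ≤ v z := fun u hu => hmax hu
  refine (hmax' u hu).trans ?_
  rcases eq_or_lt_of_le hxy with rfl | hlt
  · have : z = x := le_antisymm hz.2 hz.1
    subst this
    simpa using Real.le_sqrt_of_sq_le (le_refl (v z ^ 2))
  have hS0 : 0 ≤ v z := h.nonneg hlt hz
  have hanti : AntitoneOn (fun u => (v u) ^ 2 - (2 * A + 2 * B * v z) * (u - x)) (Icc x y) := by
    apply antitoneOn_Icc_of_hasDerivAt
      (f' := fun u => 2 * v u * (a u / v u + b u) - (2 * A + 2 * B * v z))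
    · exact (h.cont.pow 2).sub (by fun_prop)
    · intro u hu
      have hd := ((h.deriv u hu).pow 2).sub
        (((hasDerivAt_id u).sub_const x).const_mul (2 * A + 2 * B * v z))
      refine hd.congr_deriv ?_
      simp
    · intro u hu
      have hv := h.pos u hu
      have e1 : v u * (a u / v u + b u) = a u + b u * v u := by field_simp
      have e2 : b u * v u ≤ B * v z :=
        (mul_le_mul_of_nonneg_right (hB u hu) hv.le).trans
          (mul_le_mul_of_nonneg_left (hmax' u (Ioo_subset_Icc_self hu)) hB0)
      nlinarith [hA u hu]
  have hz' := hanti (left_mem_Icc.2 hxy) hz hz.1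
  simp only [sub_self, mul_zero, sub_zero] at hz'
  apply le_add_sqrt_of_sq_le (by have := sub_nonneg.2 hxy; positivity)
  have h3 : (2 * A + 2 * B * v z) * (z - x) ≤ (2 * A + 2 * B * v z) * (y - x) :=
    mul_le_mul_of_nonneg_left (by linarith [hz.2]) (by positivity)
  nlinarith

/-- Comparison. -/
theorem le_of_le (h1 : IsGraph a₁ b₁ x y v₁) (h2 : IsGraph a₂ b₂ x y v₂)
    (ha1 : ∀ u ∈ Ioo x y, 0 ≤ a₁ u) (ha : ∀ u ∈ Ioo x y, a₁ u ≤ a₂ u)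
    (hb : ∀ u ∈ Ioo x y, b₁ u ≤ b₂ u) (hx : v₁ x ≤ v₂ x) {u : ℝ} (hu : u ∈ Icc x y) :
    v₁ u ≤ v₂ u := by
  by_contra hcon
  push Not at hcon
  -- After the last contact `v₁ > v₂`, and there `a₁ / v₁ ≤ a₁ / v₂ ≤ a₂ / v₂`, so the difference
  -- cannot have grown.
  obtain ⟨t, ht, h0, hpos⟩ := exists_last_zero (f := fun s => v₁ s - v₂ s) hu.1
    ((h1.cont.sub h2.cont).mono (Icc_subset_Icc le_rfl hu.2)) (by linarith) (by linarith)
  have hanti : AntitoneOn (fun s => v₁ s - v₂ s) (Icc t u) := by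
    have hsub : Ioo t u ⊆ Ioo x y := Ioo_subset_Ioo ht.1 hu.2
    apply antitoneOn_Icc_of_hasDerivAt
      (f' := fun u => (a₁ u / v₁ u + b₁ u) - (a₂ u / v₂ u + b₂ u))
    · exact (h1.cont.sub h2.cont).mono (Icc_subset_Icc ht.1 hu.2)
    · exact fun s hs => (h1.deriv s (hsub hs)).sub (h2.deriv s (hsub hs))
    · intro s hs
      have p1 := h1.pos s (hsub hs)
      have p2 := h2.pos s (hsub hs)
      have hgt := hpos s ⟨hs.1, hs.2.le⟩
      have e1 : a₁ s / v₁ s ≤ a₁ s / v₂ s :=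
        div_le_div_of_nonneg_left (ha1 s (hsub hs)) p2 (by linarith)
      have e2 : a₁ s / v₂ s ≤ a₂ s / v₂ s :=
        div_le_div_of_nonneg_right (ha s (hsub hs)) p2.le
      linarith [hb s (hsub hs)]
  have := hanti ⟨le_rfl, ht.2.le⟩ ⟨ht.2.le, le_rfl⟩ ht.2.le
  simp only at this h0
  linarith

/-- Strict comparison at the right end point of the interval. -/
theorem lt_of_lt {A : ℝ} (h1 : IsGraph a₁ b₁ x y v₁) (h2 : IsGraph a₂ b₂ x y v₂) (hxy : x ≤ y)
    (ha1 : ∀ u ∈ Ioo x y, 0 ≤ a₁ u) (hA : ∀ u ∈ Ioo x y, a₁ u ≤ A)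
    (ha : ∀ u ∈ Ioo x y, a₁ u ≤ a₂ u)
    (hb : ∀ u ∈ Ioo x y, b₁ u ≤ b₂ u) (hx : v₁ x < v₂ x) (hp : ∀ u ∈ Icc x y, 0 < v₁ u) :
    v₁ y < v₂ y := by
  have hle : ∀ u ∈ Icc x y, v₁ u ≤ v₂ u := fun u hu => h1.le_of_le h2 ha1 ha hb hx.le hu
  obtain ⟨z, hz, hmin⟩ := isCompact_Icc.exists_isMinOn ⟨x, left_mem_Icc.2 hxy⟩ h1.cont
  have hν : 0 < v₁ z := hp z hz
  have hmin' : ∀ u ∈ Icc x y, v₁ z ≤ v₁ u := fun u hu => hmin hu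
  -- A Lipschitz constant of `v ↦ a₁ / v` above the minimum of `v₁`; the exponential weight with
  -- this rate makes the gap between the graphs nondecreasing.
  set C := A / v₁ z ^ 2
  have hmono : MonotoneOn (fun s => (v₂ s - v₁ s) * Real.exp (C * s)) (Icc x y) := by
    apply monotoneOn_Icc_of_hasDerivAt
      (f' := fun u => ((a₂ u / v₂ u + b₂ u) - (a₁ u / v₁ u + b₁ u)) * Real.exp (C * u)
        + (v₂ u - v₁ u) * (Real.exp (C * u) * C))
    · exact (h2.cont.sub h1.cont).mul (by fun_prop)
    · intro s hs
      have := ((h2.deriv s hs).sub (h1.deriv s hs)).mul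
        (((hasDerivAt_id s).const_mul C).exp)
      exact this.congr_deriv (by simp)
    · intro s hs
      have p1 := h1.pos s hs
      have p2 := h2.pos s hs
      have hs' := Ioo_subset_Icc_self hs
      have e0 := hle s hs'
      have e1 : a₁ s / v₂ s ≤ a₂ s / v₂ s := div_le_div_of_nonneg_right (ha s hs) p2.le
      have e2 : a₁ s / v₁ s - a₁ s / v₂ s ≤ C * (v₂ s - v₁ s) := by
        have e3 : a₁ s / v₁ s - a₁ s / v₂ s = a₁ s / (v₁ s * v₂ s) * (v₂ s - v₁ s) := by
          field_simp
        rw [e3]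
        apply mul_le_mul_of_nonneg_right _ (by linarith)
        apply div_le_div₀ ((ha1 s hs).trans (hA s hs)) (hA s hs) (by positivity)
        nlinarith [hmin' s hs']
      have e4 : 0 ≤ ((a₂ s / v₂ s + b₂ s) - (a₁ s / v₁ s + b₁ s)) + (v₂ s - v₁ s) * C := by
        linarith [hb s hs]
      have := mul_nonneg e4 (Real.exp_pos (C * s)).le
      linarith
  have := hmono (left_mem_Icc.2 hxy) (right_mem_Icc.2 hxy) hxy
  simp only at this
  have h3 : 0 < (v₂ x - v₁ x) * Real.exp (C * x) := mul_pos (by linarith) (Real.exp_pos _)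
  have h4 : 0 < (v₂ y - v₁ y) * Real.exp (C * y) := h3.trans_le this
  have := (mul_pos_iff_of_pos_right (Real.exp_pos _)).1 h4
  linarith

/-- Strict comparison at the right end point for strictly ordered coefficients. -/
theorem lt_of_lt_coeff {A : ℝ} (h1 : IsGraph a₁ b₁ x y v₁) (h2 : IsGraph a₂ b₂ x y v₂)
    (hxy : x < y) (ha1 : ∀ u ∈ Ioo x y, 0 ≤ a₁ u) (hA : ∀ u ∈ Ioo x y, a₁ u ≤ A)
    (ha : ∀ u ∈ Ioo x y, a₁ u ≤ a₂ u)
    (hb : ∀ u ∈ Ioo x y, b₁ u < b₂ u) (hx : v₁ x ≤ v₂ x) (hp : 0 < v₁ y) :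
    v₁ y < v₂ y := by
  have hle : ∀ u ∈ Icc x y, v₁ u ≤ v₂ u :=
    fun u hu => h1.le_of_le h2 ha1 ha (fun s hs => (hb s hs).le) hx hu
  obtain ⟨s, hs⟩ := nonempty_Ioo.2 hxy
  -- A contact at an interior point would be a minimum of `v₂ - v₁`, where the slopes agree although
  -- `b₁ < b₂`.
  have hlt : v₁ s < v₂ s := by
    refine lt_of_le_of_ne (hle s (Ioo_subset_Icc_self hs)) fun heq => ?_
    have hmin : IsLocalMin (fun u => v₂ u - v₁ u) s := by
      filter_upwards [Icc_mem_nhds hs.1 hs.2] with u hu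
      have := hle u hu
      linarith
    have hd := hmin.hasDerivAt_eq_zero ((h2.deriv s hs).sub (h1.deriv s hs))
    have e1 : a₁ s / v₁ s ≤ a₂ s / v₂ s := by
      rw [← heq]
      exact div_le_div_of_nonneg_right (ha s hs) (h1.pos s hs).le
    linarith [hb s hs]
  have hsub : Ioo s y ⊆ Ioo x y := Ioo_subset_Ioo hs.1.le le_rfl
  refine (h1.mono hs.1.le le_rfl).lt_of_lt (h2.mono hs.1.le le_rfl) hs.2.le
    (fun u hu => ha1 u (hsub hu)) (fun u hu => hA u (hsub hu)) (fun u hu => ha u (hsub hu))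
    (fun u hu => (hb u (hsub hu)).le) hlt fun u hu => ?_
  rcases eq_or_lt_of_le hu.2 with rfl | h
  · exact hp
  · exact h1.pos u ⟨hs.1.trans_le hu.1, h⟩

end IsGraph

/-! ### Existence and uniqueness of the branch that leaves the axis -/

theorem exists_abs_bound_Icc {f : ℝ → ℝ} {x y : ℝ} (hf : ContinuousOn f (Icc x y)) :
    ∃ B : ℝ, 0 ≤ B ∧ ∀ u ∈ Icc x y, |f u| ≤ B := by
  obtain ⟨B, hB⟩ := isCompact_Icc.exists_bound_of_continuousOn hf
  exact ⟨max B 0, le_max_right _ _, fun u hu => (hB u hu).trans (le_max_left _ _)⟩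

namespace IsGraph

variable {a b : ℝ → ℝ} {p m : ℝ}

/-- Below the height `ε / (B + 1)` the slope is at least `(B + 1) - B > 0`, so a solution that
starts there never falls below it. Truncating the singular factor at this height therefore does not
change the solution and makes the equation Lipschitz. -/
theorem exists_of_pos (hpm : p ≤ m) (hac : ContinuousOn a (Icc p m))
    (hbc : ContinuousOn b (Icc p m)) {B : ℝ} (hB0 : 0 ≤ B) (hB : ∀ u ∈ Icc p m, |b u| ≤ B) {ε : ℝ}
    (hε : 0 < ε) (ha : ∀ u ∈ Icc p m, ε ≤ a u) :
    ∃ v, IsGraph a b p m v ∧ v p = ε / (B + 1) := by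
  obtain ⟨A, hA0, hA⟩ := exists_abs_bound_Icc hac
  set e := ε / (B + 1) with he
  have he0 : 0 < e := by positivity
  have hLip : ∀ τ ∈ Icc p m, LipschitzWith (A / (e * e)).toNNReal
      (fun v => a τ / max v e + b τ) := by
    intro τ hτ
    apply LipschitzWith.of_dist_le_mul
    intro v w
    rw [Real.coe_toNNReal _ (by positivity), Real.dist_eq, Real.dist_eq]
    have p1 : 0 < max v e := lt_max_of_lt_right he0
    have p2 : 0 < max w e := lt_max_of_lt_right he0
    have e1 : a τ / max v e + b τ - (a τ / max w e + b τ)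
        = a τ / (max v e * max w e) * (max w e - max v e) := by
      field_simp; ring
    rw [e1, abs_mul]
    apply mul_le_mul
    · rw [abs_div, abs_of_pos (mul_pos p1 p2)]
      exact div_le_div₀ hA0 (hA τ hτ) (by positivity)
        (mul_le_mul (le_max_right _ _) (le_max_right _ _) he0.le p1.le)
    · rw [abs_sub_comm v w]
      exact abs_max_sub_max_le_abs w v e
    · exact abs_nonneg _
    · positivity
  obtain ⟨v, hv0, hv⟩ := exists_ode_solution_Icc (left_mem_Icc.2 hpm) hLip
    (fun x => (hac.div_const _).add hbc) (L := (A / e + B).toNNReal) (by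
      intro τ hτ x
      rw [Real.coe_toNNReal _ (by positivity), Real.norm_eq_abs]
      refine (abs_add_le _ _).trans (add_le_add ?_ (hB τ hτ))
      rw [abs_div, abs_of_pos (lt_max_of_lt_right he0)]
      exact div_le_div₀ hA0 (hA τ hτ) he0 (le_max_right _ _)) e
  have hvc : ContinuousOn v (Icc p m) := fun u hu => (hv u hu).continuousWithinAt
  have hvd : ∀ u ∈ Ioo p m, HasDerivAt v (a u / max (v u) e + b u) u := fun u hu =>
    (hv u (Ioo_subset_Icc_self hu)).hasDerivAt (Icc_mem_nhds hu.1 hu.2)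
  have hge : ∀ u ∈ Icc p m, e ≤ v u := by
    intro z hz
    by_contra hcon
    push Not at hcon
    obtain ⟨t, ht, h0, hpos⟩ := exists_last_zero (f := fun s => e - v s) hz.1
      ((continuousOn_const.sub hvc).mono (Icc_subset_Icc le_rfl hz.2)) (by simp [hv0])
      (by linarith)
    have hsub : Ioo t z ⊆ Ioo p m := Ioo_subset_Ioo ht.1 hz.2
    have hmono : MonotoneOn v (Icc t z) := by
      apply monotoneOn_Icc_of_hasDerivAt (hvc.mono (Icc_subset_Icc ht.1 hz.2))
        (fun u hu => hvd u (hsub hu))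
      intro u hu
      have hu' := Ioo_subset_Icc_self (hsub hu)
      have h1 := hpos u ⟨hu.1, hu.2.le⟩
      rw [max_eq_right (by linarith)]
      have h2 : ε / e ≤ a u / e := div_le_div_of_nonneg_right (ha u hu') he0.le
      have h3 : ε / e = B + 1 := by rw [he]; field_simp
      have h4 := (abs_le.1 (hB u hu')).1
      linarith
    have := hmono ⟨le_rfl, ht.2.le⟩ ⟨ht.2.le, le_rfl⟩ ht.2.le
    linarith
  refine ⟨v, ⟨hvc, fun u hu => he0.trans_le (hge u (Ioo_subset_Icc_self hu)), fun u hu => ?_⟩, hv0⟩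
  have := hvd u hu
  rwa [max_eq_left (hge u (Ioo_subset_Icc_self hu))] at this

/-- Existence of the orbit that starts at `(p, 0)`. -/
theorem exists_branch (hpm : p ≤ m) (hac : ContinuousOn a (Icc p m))
    (hbc : ContinuousOn b (Icc p m)) (ha : ∀ u ∈ Ioo p m, 0 < a u) :
    ∃ v, IsGraph a b p m v ∧ v p = 0 := by
  rcases eq_or_lt_of_le hpm with rfl | hlt
  · exact ⟨fun _ => 0, ⟨continuousOn_const, by simp, by simp⟩, rfl⟩
  have ha0 : ∀ u ∈ Icc p m, 0 ≤ a u := by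
    intro u hu
    rw [← closure_Ioo hlt.ne] at hu
    have hc : ContinuousWithinAt a (Ioo p m) u :=
      (hac u (by rwa [← closure_Ioo hlt.ne])).mono Ioo_subset_Icc_self
    have h2 : closure (a '' Ioo p m) ⊆ Ici 0 := by
      apply closure_minimal _ isClosed_Ici
      rintro _ ⟨u, hu, rfl⟩
      exact (ha u hu).le
    exact h2 (hc.mem_closure_image hu)
  obtain ⟨B, hB0, hB⟩ := exists_abs_bound_Icc hbc
  -- The branch is the limit of the solutions for `a + ε n` that start at a small positive height.
  -- The dependence estimate, which is insensitive to the height, shows that they are uniformly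
  -- Cauchy.
  set ε : ℕ → ℝ := fun n => 1 / (n + 1) with hε
  have hεpos : ∀ n, 0 < ε n := fun n => by simp only [hε]; positivity
  have hεlim : Tendsto ε atTop (𝓝 0) := tendsto_one_div_add_atTop_nhds_zero_nat
  have hex : ∀ n, ∃ v, IsGraph (fun u => a u + ε n) b p m v ∧ v p = ε n / (B + 1) := fun n =>
    exists_of_pos (a := fun u => a u + ε n) hpm (hac.add continuousOn_const) hbc hB0 hB (hεpos n)
      (fun u hu => by linarith [ha0 u hu])
  choose V hV hV0 using hex
  have hcauchy : UniformCauchySeqOn V atTop (Icc p m) := by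
    rw [Metric.uniformCauchySeqOn_iff]
    intro η hη
    have hlim : Tendsto (fun x : ℝ × ℝ =>
        Real.sqrt ((x.1 / (B + 1) - x.2 / (B + 1)) ^ 2 + 2 * |x.1 - x.2| * (m - p)))
        (𝓝 (0, 0)) (𝓝 0) := by
      have : Continuous (fun x : ℝ × ℝ =>
        Real.sqrt ((x.1 / (B + 1) - x.2 / (B + 1)) ^ 2 + 2 * |x.1 - x.2| * (m - p))) := by
        fun_prop
      have h := this.tendsto (0, 0)
      simpa using h
    have h2 : Tendsto (fun n : ℕ × ℕ => (ε n.1, ε n.2)) atTop (𝓝 (0, 0)) := by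
      rw [← prod_atTop_atTop_eq, nhds_prod_eq]
      exact hεlim.prodMap hεlim
    have h3 := (hlim.comp h2).eventually (gt_mem_nhds hη)
    rw [eventually_atTop] at h3
    obtain ⟨⟨N1, N2⟩, hN⟩ := h3
    refine ⟨max N1 N2, fun k hk n hn u hu => ?_⟩
    rw [Real.dist_eq]
    have h4 := (hV k).abs_sub_le (hV n) (δ := |ε k - ε n|) (β := 0)
      (fun u hu => by linarith [ha0 u (Ioo_subset_Icc_self hu), hεpos k])
      (fun u hu => by linarith [ha0 u (Ioo_subset_Icc_self hu), hεpos n]) (abs_nonneg _) le_rfl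
      (fun u _ => by simp) (fun u _ => by simp) hu
    have h5 := hN (k, n) ⟨(le_max_left _ _).trans hk, (le_max_right _ _).trans hn⟩
    rw [hV0, hV0] at h4
    simp only [Function.comp_apply] at h5
    linarith
  have hpt : ∀ u ∈ Icc p m, ∃ l, Tendsto (fun n => V n u) atTop (𝓝 l) := fun u hu =>
    cauchySeq_tendsto_of_complete (hcauchy.cauchySeq hu)
  choose! v hv using hpt
  have hunif : TendstoUniformlyOn V v atTop (Icc p m) :=
    hcauchy.tendstoUniformlyOn_of_tendsto hv
  have hvc : ContinuousOn v (Icc p m) :=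
    hunif.continuousOn (Frequently.of_forall fun n => (hV n).cont)
  have hvp : v p = 0 := by
    have h1 := hv p (left_mem_Icc.2 hpm)
    have h2 : Tendsto (fun n => V n p) atTop (𝓝 0) := by
      simp only [hV0]
      simpa using hεlim.div_const (B + 1)
    exact tendsto_nhds_unique h1 h2
  have hpos : ∀ u ∈ Ioo p m, 0 < v u := by
    intro u hu
    set x' := (p + u) / 2
    have hx1 : p < x' := by simp only [x']; linarith [hu.1]
    have hx2 : x' < u := by simp only [x']; linarith [hu.1]
    have hsub : Icc x' u ⊆ Ioo p m := Icc_subset_Ioo hx1 hu.2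
    obtain ⟨z, hz, hmin⟩ := isCompact_Icc.exists_isMinOn ⟨x', left_mem_Icc.2 hx2.le⟩
      (hac.mono (hsub.trans Ioo_subset_Icc_self))
    have hα := ha z (hsub hz)
    have hmin' : ∀ s ∈ Icc x' u, a z ≤ a s := fun s hs => hmin hs
    set α := a z
    have hl : 0 < u - x' := by linarith
    -- The line `σ * (s - x')` solves the equation with force `(σ + B) * σ * (s - x')` and
    -- coefficient `-B`. With `σ` this small it lies below every approximation, so the limit stays
    -- positive.
    obtain ⟨σ, hσ0, hσ⟩ : ∃ σ : ℝ, 0 < σ ∧ (σ + B) * σ * (u - x') ≤ α := by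
      have : Tendsto (fun σ : ℝ => (σ + B) * σ * (u - x')) (𝓝[>] 0) (𝓝 0) := by
        have h : Continuous (fun σ : ℝ => (σ + B) * σ * (u - x')) := by fun_prop
        have h1 := h.tendsto 0
        simp only [mul_zero, zero_mul] at h1
        exact h1.mono_left nhdsWithin_le_nhds
      obtain ⟨σ, h1, h2⟩ := ((this.eventually (ge_mem_nhds hα)).and self_mem_nhdsWithin).exists
      exact ⟨σ, h2, h1⟩
    have hg : IsGraph (fun s => (σ + B) * σ * (s - x')) (fun _ => -B) x' u
        (fun s => σ * (s - x')) := by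
      refine ⟨by fun_prop, fun s hs => mul_pos hσ0 (by linarith [hs.1]), fun s hs => ?_⟩
      have h1 : (0:ℝ) < s - x' := by linarith [hs.1]
      have := ((hasDerivAt_id s).sub_const x').const_mul σ
      refine this.congr_deriv ?_
      field_simp
      ring
    have hle : ∀ n, σ * (u - x') ≤ V n u := by
      intro n
      have hs' : Ioo x' u ⊆ Icc p m :=
        Ioo_subset_Icc_self.trans (hsub.trans Ioo_subset_Icc_self)
      apply hg.le_of_le ((hV n).mono hx1.le hu.2.le)
      · intro s hs
        have h1 : (0:ℝ) < s - x' := by linarith [hs.1]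
        positivity
      · intro s hs
        have h1 : (σ + B) * σ * (s - x') ≤ (σ + B) * σ * (u - x') :=
          mul_le_mul_of_nonneg_left (by linarith [hs.2]) (by positivity)
        have h2 := hmin' s (Ioo_subset_Icc_self hs)
        have h3 := hεpos n
        linarith
      · intro s hs
        exact (abs_le.1 (hB s (hs' hs))).1
      · have := (hV n).pos x' ⟨hx1, hx2.trans hu.2⟩
        simp only [sub_self, mul_zero]
        exact this.le
      · exact right_mem_Icc.2 hx2.le
    have := ge_of_tendsto' (hv u (Ioo_subset_Icc_self hu)) hle
    exact (mul_pos hσ0 hl).trans_le this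
  refine ⟨v, ⟨hvc, hpos, fun u hu => ?_⟩, hvp⟩
  -- The derivative of the square contains no quotient, so it converges uniformly; the equation for
  -- `v` is recovered by taking the root.
  have hsq : HasDerivAt (fun s => v s ^ 2) (2 * a u + 2 * (b u * v u)) u := by
    apply hasDerivAt_of_tendstoUniformlyOn (s := Ioo p m) (f := fun n s => V n s ^ 2) (l := atTop)
      (f' := fun n s => 2 * (a s + ε n) + 2 * (b s * V n s))
      (g' := fun s => 2 * a s + 2 * (b s * v s)) isOpen_Ioo
    · rw [Metric.tendstoUniformlyOn_iff]
      intro η hη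
      rw [Metric.tendstoUniformlyOn_iff] at hunif
      have h1 := hunif (η / (4 * (B + 1))) (by positivity)
      have h2 := hεlim.eventually (gt_mem_nhds (show (0:ℝ) < η / 4 by positivity))
      filter_upwards [h1, h2] with n hn1 hn2 s hs
      have hs' := Ioo_subset_Icc_self hs
      have h3 := hn1 s hs'
      rw [Real.dist_eq] at h3 ⊢
      have h4 := hB s hs'
      have h5 : 2 * a s + 2 * (b s * v s) - (2 * (a s + ε n) + 2 * (b s * V n s))
          = -(2 * ε n) + 2 * (b s * (v s - V n s)) := by ring
      rw [h5]
      have h6 : |b s * (v s - V n s)| ≤ η / 4 := by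
        rw [abs_mul]
        calc |b s| * |v s - V n s| ≤ (B + 1) * (η / (4 * (B + 1))) :=
              mul_le_mul (by linarith) h3.le (abs_nonneg _) (by positivity)
          _ = η / 4 := by field_simp
      have h7 := abs_le.1 h6
      have h8 := hεpos n
      rw [abs_lt]
      constructor <;> linarith
    · refine Eventually.of_forall fun n s hs => ?_
      have hvs := (hV n).pos s hs
      refine (((hV n).deriv s hs).pow 2).congr_deriv ?_
      simp only [Nat.cast_ofNat, Nat.add_one_sub_one, pow_one]
      field_simp
    · intro s hs
      exact (hv s (Ioo_subset_Icc_self hs)).pow 2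
    · exact hu
  have h1 := hsq.sqrt (by have := hpos u hu; positivity)
  have h2 : (fun s => Real.sqrt (v s ^ 2)) =ᶠ[𝓝 u] v := by
    filter_upwards [isOpen_Ioo.mem_nhds hu] with s hs
    exact Real.sqrt_sq (hpos s hs).le
  have h3 := h1.congr_of_eventuallyEq h2.symm
  refine h3.congr_deriv ?_
  have := hpos u hu
  rw [Real.sqrt_sq this.le]
  field_simp

/-- The dependence estimate does not degenerate at height zero, so uniqueness also holds for
branches that start on the axis, where the equation is singular. -/
theorem branch_unique {v₁ v₂ : ℝ → ℝ} (h1 : IsGraph a b p m v₁) (h2 : IsGraph a b p m v₂)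
    (ha : ∀ u ∈ Ioo p m, 0 ≤ a u) (h : v₁ p = v₂ p) {u : ℝ} (hu : u ∈ Icc p m) : v₁ u = v₂ u := by
  have := h1.abs_sub_le h2 ha ha le_rfl le_rfl (by simp) (by simp) hu
  rw [h] at this
  simp only [mul_zero, zero_mul, sub_self, ne_eq, OfNat.ofNat_ne_zero, not_false_eq_true, zero_pow,
    add_zero, Real.sqrt_zero, abs_nonpos_iff] at this
  linarith

end IsGraph

namespace IsGraph

variable {a b a₁ a₂ b₁ b₂ v v₁ v₂ : ℝ → ℝ} {x y p m : ℝ}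

/-- Here `v₁` may vanish at `x`: by continuity the strict inequality holds at a point slightly to
the right, where `v₁` is positive. -/
theorem lt_of_lt' {A : ℝ} (h1 : IsGraph a₁ b₁ x y v₁) (h2 : IsGraph a₂ b₂ x y v₂) (hxy : x < y)
    (ha1 : ∀ u ∈ Ioo x y, 0 ≤ a₁ u) (hA : ∀ u ∈ Ioo x y, a₁ u ≤ A)
    (ha : ∀ u ∈ Ioo x y, a₁ u ≤ a₂ u)
    (hb : ∀ u ∈ Ioo x y, b₁ u ≤ b₂ u) (hx : v₁ x < v₂ x) (hp : 0 < v₁ y) :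
    v₁ y < v₂ y := by
  have hc : ContinuousWithinAt (fun u => v₂ u - v₁ u) (Ioo x y) x :=
    ((h2.cont.sub h1.cont) x (left_mem_Icc.2 hxy.le)).mono Ioo_subset_Icc_self
  have hne : (𝓝[Ioo x y] x).NeBot := by
    rw [← mem_closure_iff_nhdsWithin_neBot, closure_Ioo hxy.ne]
    exact left_mem_Icc.2 hxy.le
  obtain ⟨s, hs1, hs⟩ := ((hc.eventually (lt_mem_nhds (sub_pos.2 hx))).and
    self_mem_nhdsWithin).exists
  have hsub : Ioo s y ⊆ Ioo x y := Ioo_subset_Ioo hs.1.le le_rfl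
  refine (h1.mono hs.1.le le_rfl).lt_of_lt (h2.mono hs.1.le le_rfl) hs.2.le
    (fun u hu => ha1 u (hsub hu)) (fun u hu => hA u (hsub hu)) (fun u hu => ha u (hsub hu))
    (fun u hu => hb u (hsub hu)) (by linarith) fun u hu => ?_
  rcases eq_or_lt_of_le hu.2 with rfl | h
  · exact hp
  · exact h1.pos u ⟨hs.1.trans_le hu.1, h⟩

/-- At a non-degenerate or doubly degenerate centre the branch does not die. -/
theorem pos_right_of_quadratic {k B : ℝ} (h : IsGraph a b p m v) (hpm : p < m) (hk : 0 < k)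
    (hB : 0 < B) (ha : ∀ u ∈ Ioo p m, k * (m - u) ^ 2 ≤ a u)
    (hb : ∀ u ∈ Ioo p m, -(B * (m - u)) ≤ b u) : 0 < v m := by
  by_contra hcon
  -- If `v` died at `m`, the slope bound `v' ≥ -B (m - u)` would give `v ≤ B / 2 * (m - u) ^ 2`.
  -- Then `a / v ≥ 2 k / B` stays away from zero.
  have hmono : MonotoneOn (fun u => v u - B / 2 * (m - u) ^ 2) (Icc p m) := by
    apply monotoneOn_Icc_of_hasDerivAt (f' := fun u => a u / v u + b u + B * (m - u))
    · exact h.cont.sub (by fun_prop)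
    · intro u hu
      refine ((h.deriv u hu).sub ((((hasDerivAt_id u).const_sub m).pow 2).const_mul
        (B / 2))).congr_deriv ?_
      simp only [id, Nat.cast_ofNat, Nat.add_one_sub_one, pow_one]
      ring
    · intro u hu
      have h1 : 0 ≤ a u / v u :=
        div_nonneg ((by positivity : 0 ≤ k * (m - u) ^ 2).trans (ha u hu)) (h.pos u hu).le
      linarith [hb u hu]
  have hle : ∀ u ∈ Ioo p m, v u ≤ B / 2 * (m - u) ^ 2 := by
    intro u hu
    have := hmono (Ioo_subset_Icc_self hu) (right_mem_Icc.2 hpm.le) hu.2.le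
    simp only [sub_self] at this
    linarith
  -- To the right of this point `B * (m - u) ≤ 2 * k / B`, so `a / v` outweighs `b` and `v` cannot
  -- decrease to zero.
  set p' := max p (m - 2 * k / B ^ 2) with hp'
  have hpp : p ≤ p' := le_max_left _ _
  have hpm' : p' < m := max_lt hpm (by have : 0 < 2 * k / B ^ 2 := by positivity
                                       linarith)
  have hsub : Ioo p' m ⊆ Ioo p m := Ioo_subset_Ioo hpp le_rfl
  have hm : MonotoneOn v (Icc p' m) := by
    apply monotoneOn_Icc_of_hasDerivAt (h.cont.mono (Icc_subset_Icc hpp le_rfl))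
      (fun u hu => h.deriv u (hsub hu))
    intro u hu
    have hmu : 0 < m - u := by linarith [hu.2]
    have h1 : 2 * k / B ≤ a u / v u := by
      rw [div_le_div_iff₀ hB (h.pos u (hsub hu))]
      have h2 := ha u (hsub hu)
      have h3 := hle u (hsub hu)
      nlinarith
    have h4 : B * (m - u) ≤ 2 * k / B := by
      have : m - u ≤ 2 * k / B ^ 2 := by linarith [hu.1, le_max_right p (m - 2 * k / B ^ 2)]
      calc B * (m - u) ≤ B * (2 * k / B ^ 2) := mul_le_mul_of_nonneg_left this hB.le
        _ = 2 * k / B := by field_simp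
    linarith [hb u (hsub hu)]
  obtain ⟨s, hs⟩ := nonempty_Ioo.2 hpm'
  have := hm (Ioo_subset_Icc_self hs) (right_mem_Icc.2 hpm'.le) hs.2.le
  exact hcon ((h.pos s (hsub hs)).trans_le this)

end IsGraph

/-! ### Heights of the branches over the centre -/

/-- `a` is continuous on `[p, m]` and positive inside. -/
structure LeftCell (a : ℝ → ℝ) (p m : ℝ) : Prop where
  le : p ≤ m
  cont : ContinuousOn a (Icc p m)
  pos : ∀ u ∈ Ioo p m, 0 < a u

/-- `a` is continuous on `[m, q]` and negative inside. -/
structure RightCell (a : ℝ → ℝ) (m q : ℝ) : Prop where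
  le : m ≤ q
  cont : ContinuousOn a (Icc m q)
  neg : ∀ u ∈ Ioo m q, a u < 0

theorem ContinuousOn.oddRefl {a : ℝ → ℝ} {x y : ℝ} (h : ContinuousOn a (Icc x y)) :
    ContinuousOn (oddRefl a) (Icc (-y) (-x)) :=
  (h.comp continuousOn_neg (fun u hu => ⟨by linarith [hu.2], by linarith [hu.1]⟩)).neg

theorem RightCell.refl {a : ℝ → ℝ} {m q : ℝ} (h : RightCell a m q) :
    LeftCell (oddRefl a) (-q) (-m) :=
  ⟨neg_le_neg h.le, h.cont.oddRefl, fun u hu => by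
    have := h.neg (-u) ⟨by linarith [hu.2], by linarith [hu.1]⟩
    simp only [oddRefl]
    linarith⟩

/-- The upper branch of the orbit through `(p, 0)`. -/
def branch (a b : ℝ → ℝ) (p m : ℝ) : ℝ → ℝ :=
  Classical.epsilon fun v => IsGraph a b p m v ∧ v p = 0

/-- The height at `m` of the upper branch of the orbit that starts at `(p, 0)`. -/
def leftVal (a b : ℝ → ℝ) (p m : ℝ) : ℝ := branch a b p m m

/-- The height at `m` of the upper branch of the orbit that ends at `(q, 0)`. -/
def rightVal (a b : ℝ → ℝ) (m q : ℝ) : ℝ := leftVal (oddRefl a) (oddRefl b) (-q) (-m)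

namespace LeftCell

variable {a b a₁ a₂ b₁ b₂ v : ℝ → ℝ} {p p₁ p₂ m : ℝ}

theorem mono (h : LeftCell a p m) (hp : p ≤ p₁) (hm : p₁ ≤ m) : LeftCell a p₁ m :=
  ⟨hm, h.cont.mono (Icc_subset_Icc hp le_rfl), fun u hu => h.pos u (Ioo_subset_Ioo hp le_rfl hu)⟩

theorem spec (h : LeftCell a p m) (hb : ContinuousOn b (Icc p m)) :
    IsGraph a b p m (branch a b p m) ∧ branch a b p m p = 0 :=
  Classical.epsilon_spec (IsGraph.exists_branch h.le h.cont hb h.pos)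

theorem eq_leftVal (h : LeftCell a p m) (hb : ContinuousOn b (Icc p m)) (hv : IsGraph a b p m v)
    (hv0 : v p = 0) : v m = leftVal a b p m :=
  hv.branch_unique (h.spec hb).1 (fun u hu => (h.pos u hu).le) (hv0.trans (h.spec hb).2.symm)
    (right_mem_Icc.2 h.le)

theorem leftVal_self (h : LeftCell a m m) (hb : ContinuousOn b (Icc m m)) :
    leftVal a b m m = 0 := (h.spec hb).2

theorem leftVal_nonneg (h : LeftCell a p m) (hb : ContinuousOn b (Icc p m)) :
    0 ≤ leftVal a b p m := by
  rcases eq_or_lt_of_le h.le with rfl | hlt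
  · rw [h.leftVal_self hb]
  · exact (h.spec hb).1.nonneg hlt (right_mem_Icc.2 hlt.le)

theorem branch_nonneg (h : LeftCell a p m) (hb : ContinuousOn b (Icc p m)) {u : ℝ}
    (hu : u ∈ Icc p m) : 0 ≤ branch a b p m u := by
  rcases eq_or_lt_of_le h.le with rfl | hlt
  · have : u = p := le_antisymm hu.2 hu.1
    rw [this, (h.spec hb).2]
  · exact (h.spec hb).1.nonneg hlt hu

theorem leftVal_mono (h1 : LeftCell a₁ p₁ m) (hb1 : ContinuousOn b₁ (Icc p₁ m))
    (h2 : LeftCell a₂ p₂ m) (hb2 : ContinuousOn b₂ (Icc p₂ m)) (hp : p₂ ≤ p₁)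
    (ha : ∀ u ∈ Ioo p₁ m, a₁ u ≤ a₂ u) (hb : ∀ u ∈ Ioo p₁ m, b₁ u ≤ b₂ u) :
    leftVal a₁ b₁ p₁ m ≤ leftVal a₂ b₂ p₂ m := by
  refine (h1.spec hb1).1.le_of_le ((h2.spec hb2).1.mono hp le_rfl) (fun u hu => (h1.pos u hu).le)
    ha hb ?_ (right_mem_Icc.2 h1.le)
  rw [(h1.spec hb1).2]
  exact h2.branch_nonneg hb2 ⟨hp, h1.le⟩

theorem le_leftVal {β : ℝ} (h : LeftCell a p m) (hb : ContinuousOn b (Icc p m))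
    (hbβ : ∀ u ∈ Ioo p m, β ≤ b u) : β * (m - p) ≤ leftVal a b p m := by
  have hs := (h.spec hb).1
  have : MonotoneOn (fun u => branch a b p m u - β * (u - p)) (Icc p m) := by
    apply monotoneOn_Icc_of_hasDerivAt
      (f' := fun u => a u / branch a b p m u + b u - β)
    · exact hs.cont.sub (by fun_prop)
    · intro u hu
      refine ((hs.deriv u hu).sub (((hasDerivAt_id u).sub_const p).const_mul β)).congr_deriv ?_
      simp
    · intro u hu
      have := div_nonneg (h.pos u hu).le (hs.pos u hu).le
      linarith [hbβ u hu]
  have := this (left_mem_Icc.2 h.le) (right_mem_Icc.2 h.le) h.le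
  simp only [(h.spec hb).2, sub_self, mul_zero] at this
  simp only [leftVal]
  linarith

/-- Dependence of the branch on the starting point and on `b`. -/
theorem abs_branch_sub_le {A B β : ℝ} (h : LeftCell a p₁ m) (hb1 : ContinuousOn b₁ (Icc p₁ m))
    (hb2 : ContinuousOn b₂ (Icc p₂ m)) (hp : p₁ ≤ p₂) (hpm : p₂ ≤ m) (hA : 0 ≤ A)
    (hB : 0 ≤ B) (hβ : 0 ≤ β) (haA : ∀ u ∈ Ioo p₁ p₂, a u ≤ A) (hbB : ∀ u ∈ Ioo p₁ p₂, b₁ u ≤ B)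
    (hbβ : ∀ u ∈ Ioo p₂ m, |b₁ u - b₂ u| ≤ β) {u : ℝ} (hu : u ∈ Icc p₂ m) :
    |branch a b₁ p₁ m u - branch a b₂ p₂ m u| ≤
      2 * β * (m - p₂) + (2 * B * (p₂ - p₁) + Real.sqrt (2 * A * (p₂ - p₁))) := by
  have h2 := h.mono hp hpm
  have hs1 := (h.spec hb1)
  have hs2 := (h2.spec hb2)
  have e1 := (hs1.1.mono hp le_rfl).abs_sub_le hs2.1 (δ := 0) (β := β)
    (fun u hu => (h2.pos u hu).le) (fun u hu => (h2.pos u hu).le) le_rfl hβ (by simp) hbβ hu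
  have e2 := (hs1.1.mono le_rfl hpm).le_bound hA hB haA hbB (right_mem_Icc.2 hp)
  have e3 := h.branch_nonneg hb1 (u := p₂) ⟨hp, hpm⟩
  rw [hs1.2] at e2
  rw [hs2.2, mul_zero, zero_mul, add_zero, sub_zero, Real.sqrt_sq e3] at e1
  simp only [ne_eq, OfNat.ofNat_ne_zero, not_false_eq_true, zero_pow, zero_add] at e2
  linarith

theorem continuousOn_leftVal (h : LeftCell a p m) (hb : ContinuousOn b (Icc p m)) :
    ContinuousOn (fun x => leftVal a b x m) (Icc p m) := by
  obtain ⟨A, hA0, hA⟩ := exists_abs_bound_Icc h.cont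
  obtain ⟨B, hB0, hB⟩ := exists_abs_bound_Icc hb
  -- This bounds the height that the branch from the left starting point has gained when it passes
  -- over the other starting point.
  set ω : ℝ → ℝ := fun t => 2 * B * t + Real.sqrt (2 * A * t) with hω
  have hωc : Continuous ω := by fun_prop
  have key : ∀ x ∈ Icc p m, ∀ y ∈ Icc p m, x ≤ y →
      |leftVal a b x m - leftVal a b y m| ≤ ω |x - y| := by
    intro x hx y hy hxy
    have hsub : Ioo x y ⊆ Icc p m := fun u hu => ⟨hx.1.trans hu.1.le, hu.2.le.trans hy.2⟩
    have := (h.mono hx.1 hx.2).abs_branch_sub_le (hb.mono (Icc_subset_Icc hx.1 le_rfl))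
      (hb.mono (Icc_subset_Icc hy.1 le_rfl)) hxy hy.2 hA0 hB0 le_rfl
      (fun u hu => (le_abs_self _).trans (hA u (hsub hu)))
      (fun u hu => (le_abs_self _).trans (hB u (hsub hu))) (by simp) (right_mem_Icc.2 hy.2)
    rw [abs_sub_comm x y, abs_of_nonneg (sub_nonneg.2 hxy)]
    simpa [hω, leftVal] using this
  intro x hx
  have h1 : Tendsto (fun y => ω |y - x|) (𝓝[Icc p m] x) (𝓝 0) := by
    have : Continuous (fun y => ω |y - x|) := hωc.comp (by fun_prop)
    have h2 := this.tendsto x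
    simp only [hω, sub_self, abs_zero, mul_zero, Real.sqrt_zero, add_zero] at h2
    exact h2.mono_left nhdsWithin_le_nhds
  refine tendsto_iff_dist_tendsto_zero.2 (squeeze_zero' (Eventually.of_forall fun _ => dist_nonneg)
    ?_ h1)
  filter_upwards [self_mem_nhdsWithin] with y hy
  rw [Real.dist_eq]
  rcases le_total x y with hxy | hxy
  · rw [abs_sub_comm, abs_sub_comm y x]
    exact key x hx y hy hxy
  · exact key y hy x hx hxy

theorem abs_leftVal_sub_le {β : ℝ} (h : LeftCell a p m) (hb1 : ContinuousOn b₁ (Icc p m))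
    (hb2 : ContinuousOn b₂ (Icc p m)) (hβ : 0 ≤ β)
    (hbβ : ∀ u ∈ Ioo p m, |b₁ u - b₂ u| ≤ β) :
    |leftVal a b₁ p m - leftVal a b₂ p m| ≤ 2 * β * (m - p) := by
  have := h.abs_branch_sub_le hb1 hb2 le_rfl h.le le_rfl le_rfl hβ (by simp) (by simp) hbβ
    (right_mem_Icc.2 h.le)
  simpa [leftVal] using this

end LeftCell

/-! ### Arcs above the axis, and why they cannot be ordered -/

/-- The upper half of a closed orbit, or a heteroclinic orbit, between `(p, 0)` and `(q, 0)`. -/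
structure IsArc (a b : ℝ → ℝ) (p q : ℝ) (v : ℝ → ℝ) : Prop extends IsGraph a b p q v where
  left : v p = 0
  right : v q = 0

namespace IsArc

variable {a b a₁ a₂ b₁ b₂ v v₁ v₂ : ℝ → ℝ} {p q m p₁ p₂ q₁ q₂ m₁ m₂ : ℝ}

theorem refl (h : IsArc a b p q v) :
    IsArc (oddRefl a) (oddRefl b) (-q) (-p) (fun u => v (-u)) :=
  ⟨h.toIsGraph.refl, by simpa using h.right, by simpa using h.left⟩

theorem eq_leftVal (h : IsArc a b p q v) (hl : LeftCell a p m) (hmq : m ≤ q)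
    (hb : ContinuousOn b (Icc p m)) : v m = leftVal a b p m :=
  hl.eq_leftVal hb (h.toIsGraph.mono le_rfl hmq) h.left

theorem eq_rightVal (h : IsArc a b p q v) (hr : RightCell a m q) (hpm : p ≤ m)
    (hb : ContinuousOn b (Icc m q)) : v m = rightVal a b m q := by
  have := h.refl.eq_leftVal hr.refl (neg_le_neg hpm) hb.oddRefl
  simpa [rightVal] using this

/-- Matching the two branches. -/
theorem exists_of_eq (hpm : p < m) (hmq : m < q) (hl : LeftCell a p m) (hr : RightCell a m q)
    (hb : ContinuousOn b (Icc p q)) (heq : leftVal a b p m = rightVal a b m q)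
    (hpos : 0 < leftVal a b p m) : ∃ v, IsArc a b p q v := by
  have hbl : ContinuousOn b (Icc p m) := hb.mono (Icc_subset_Icc le_rfl hmq.le)
  have hbr : ContinuousOn b (Icc m q) := hb.mono (Icc_subset_Icc hpm.le le_rfl)
  set v₁ := branch a b p m
  set v₂ : ℝ → ℝ := fun u => branch (oddRefl a) (oddRefl b) (-q) (-m) (-u)
  have h1 := hl.spec hbl
  have h2' := hr.refl.spec hbr.oddRefl
  have h2 : IsGraph a b m q v₂ := by
    have := h2'.1.refl
    simpa using this
  have h12 : v₁ m = v₂ m := by simpa [leftVal, rightVal] using heq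
  set v : ℝ → ℝ := fun u => if u ≤ m then v₁ u else v₂ u with hv
  have hvl : EqOn v v₁ (Icc p m) := fun u hu => by simp only [hv, if_pos hu.2]
  have hvr : EqOn v v₂ (Icc m q) := fun u hu => by
    rcases eq_or_lt_of_le hu.1 with rfl | h
    · simp [hv, h12]
    · simp only [hv, if_neg (not_le.2 h)]
  have hac : ContinuousOn a (Icc p q) := by
    rw [← Icc_union_Icc_eq_Icc hpm.le hmq.le]
    exact hl.cont.union_of_isClosed hr.cont isClosed_Icc isClosed_Icc
  have hcv : ContinuousOn v (Icc p q) := by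
    rw [← Icc_union_Icc_eq_Icc hpm.le hmq.le]
    exact (h1.1.cont.congr hvl).union_of_isClosed (h2.cont.congr hvr) isClosed_Icc isClosed_Icc
  have hvm : 0 < v m := by simpa [hv, leftVal, v₁] using hpos
  have hdl : ∀ u ∈ Ioo p m, HasDerivAt v (a u / v u + b u) u := by
    intro u hu
    have : v =ᶠ[𝓝 u] v₁ := by
      filter_upwards [isOpen_Ioo.mem_nhds hu] with s hs using hvl (Ioo_subset_Icc_self hs)
    rw [this.eq_of_nhds]
    exact (h1.1.deriv u hu).congr_of_eventuallyEq this
  have hdr : ∀ u ∈ Ioo m q, HasDerivAt v (a u / v u + b u) u := by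
    intro u hu
    have : v =ᶠ[𝓝 u] v₂ := by
      filter_upwards [isOpen_Ioo.mem_nhds hu] with s hs using hvr (Ioo_subset_Icc_self hs)
    rw [this.eq_of_nhds]
    exact (h2.deriv u hu).congr_of_eventuallyEq this
  have hmem : m ∈ Ioo p q := ⟨hpm, hmq⟩
  have hnhds : Icc p q ∈ 𝓝 m := Icc_mem_nhds hpm hmq
  have hcvm : ContinuousAt v m := hcv.continuousAt hnhds
  have hcm : ContinuousAt (fun u => a u / v u + b u) m :=
    ((hac.continuousAt hnhds).div hcvm hvm.ne').add (hb.continuousAt hnhds)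
  -- At the junction the derivative exists because the one-sided derivatives have the same limit;
  -- this needs `v m > 0`.
  have hdm : HasDerivAt v (a m / v m + b m) m := by
    have e1 : HasDerivWithinAt v (a m / v m + b m) (Iic m) m := by
      apply hasDerivWithinAt_Iic_of_tendsto_deriv (s := Ioo p m)
      · exact fun u hu => (hdl u hu).differentiableAt.differentiableWithinAt
      · exact hcvm.continuousWithinAt
      · exact Ioo_mem_nhdsLT hpm
      · refine (hcm.tendsto.mono_left nhdsWithin_le_nhds).congr' ?_
        filter_upwards [Ioo_mem_nhdsLT hpm] with u hu using (hdl u hu).deriv.symm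
    have e2 : HasDerivWithinAt v (a m / v m + b m) (Ici m) m := by
      apply hasDerivWithinAt_Ici_of_tendsto_deriv (s := Ioo m q)
      · exact fun u hu => (hdr u hu).differentiableAt.differentiableWithinAt
      · exact hcvm.continuousWithinAt
      · exact Ioo_mem_nhdsGT hmq
      · refine (hcm.tendsto.mono_left nhdsWithin_le_nhds).congr' ?_
        filter_upwards [Ioo_mem_nhdsGT hmq] with u hu using (hdr u hu).deriv.symm
    have := e1.union e2
    rwa [Iic_union_Ici, hasDerivWithinAt_univ] at this
  refine ⟨v, ⟨hcv, fun u hu => ?_, fun u hu => ?_⟩, ?_, ?_⟩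
  · rcases lt_trichotomy u m with h | rfl | h
    · rw [hvl ⟨hu.1.le, h.le⟩]
      exact h1.1.pos u ⟨hu.1, h⟩
    · exact hvm
    · rw [hvr ⟨h.le, hu.2.le⟩]
      exact h2.pos u ⟨h, hu.2⟩
  · rcases lt_trichotomy u m with h | rfl | h
    · exact hdl u ⟨hu.1, h⟩
    · exact hdm
    · exact hdr u ⟨h, hu.2⟩
  · rw [hvl (left_mem_Icc.2 hpm.le)]
    exact h1.2
  · rw [hvr (right_mem_Icc.2 hmq.le)]
    exact h2'.2

theorem lt_at_of_lt (h1 : IsGraph a₁ b₁ p₁ m v₁) (h2 : IsGraph a₂ b₂ p₂ m v₂) (hp : p₁ ≤ p₂)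
    (hpm : p₂ < m) (hv2 : v₂ p₂ = 0) (hl : LeftCell a₂ p₂ m)
    (ha : ∀ u ∈ Ioo p₂ m, a₂ u ≤ a₁ u) (hb : ∀ u ∈ Ioo p₂ m, b₂ u ≤ b₁ u) (hpos : 0 < v₂ m)
    (hs : p₁ < p₂ ∨ ∀ u ∈ Ioo p₂ m, b₂ u < b₁ u) : v₂ m < v₁ m := by
  obtain ⟨A, hA0, hA⟩ := exists_abs_bound_Icc hl.cont
  have hA' : ∀ u ∈ Ioo p₂ m, a₂ u ≤ A := fun u hu =>
    (le_abs_self _).trans (hA u (Ioo_subset_Icc_self hu))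
  have ha0 : ∀ u ∈ Ioo p₂ m, 0 ≤ a₂ u := fun u hu => (hl.pos u hu).le
  rcases hs with hs | hs
  · refine h2.lt_of_lt' (h1.mono hp le_rfl) hpm ha0 hA' ha hb ?_ hpos
    rw [hv2]
    exact h1.pos p₂ ⟨hs, hpm⟩
  · refine h2.lt_of_lt_coeff (h1.mono hp le_rfl) hpm ha0 hA' ha hs ?_ hpos
    rw [hv2]
    exact h1.nonneg (hp.trans_lt hpm) ⟨hp, hpm.le⟩

theorem le_at_of_le (h1 : IsGraph a₁ b₁ p₁ m v₁) (h2 : IsGraph a₂ b₂ p₂ m v₂) (hp : p₁ ≤ p₂)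
    (hpm : p₂ < m) (hv2 : v₂ p₂ = 0) (hl : LeftCell a₂ p₂ m)
    (ha : ∀ u ∈ Ioo p₂ m, a₂ u ≤ a₁ u) (hb : ∀ u ∈ Ioo p₂ m, b₂ u ≤ b₁ u) : v₂ m ≤ v₁ m := by
  refine h2.le_of_le (h1.mono hp le_rfl) (fun u hu => (hl.pos u hu).le) ha hb ?_
    (right_mem_Icc.2 hpm.le)
  rw [hv2]
  exact h1.nonneg (hp.trans_lt hpm) ⟨hp, hpm.le⟩

/-- Two arcs cannot be ordered. -/
theorem not_ordered (h1 : IsArc a₁ b₁ p₁ q₁ v₁) (h2 : IsArc a₂ b₂ p₂ q₂ v₂) (hp : p₁ ≤ p₂)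
    (hpm : p₂ < m₂) (hm : m₂ ≤ m₁) (hmq : m₁ < q₁) (hq : q₁ ≤ q₂) (hl1 : LeftCell a₁ p₁ m₁)
    (hr1 : RightCell a₁ m₁ q₁) (hl2 : LeftCell a₂ p₂ m₂) (hr2 : RightCell a₂ m₂ q₂)
    (ha : ∀ u ∈ Icc p₂ q₁, a₂ u ≤ a₁ u) (hb : ∀ u ∈ Icc p₂ q₁, b₂ u ≤ b₁ u)
    (hs : p₁ < p₂ ∨ q₁ < q₂ ∨ ∀ u ∈ Ioo p₂ q₁, b₂ u < b₁ u) : False := by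
  have hm2q1 : m₂ < q₁ := hm.trans_lt hmq
  have hp2m1 : p₂ < m₁ := hpm.trans_le hm
  have i1 : Ioo p₂ m₂ ⊆ Icc p₂ q₁ := fun u hu => ⟨hu.1.le, (hu.2.trans hm2q1).le⟩
  have i2 : Ioo m₁ q₁ ⊆ Icc p₂ q₁ := fun u hu => ⟨(hp2m1.trans hu.1).le, hu.2.le⟩
  have g1l := h1.toIsGraph.mono le_rfl hm2q1.le
  have g2l := h2.toIsGraph.mono le_rfl (hm2q1.le.trans hq)
  have g1r := (h1.toIsGraph.mono (hp.trans hp2m1.le) le_rfl).refl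
  have g2r := (h2.toIsGraph.mono hp2m1.le le_rfl).refl
  have har : ∀ u ∈ Ioo (-q₁) (-m₁), oddRefl a₁ u ≤ oddRefl a₂ u := fun u hu =>
    neg_le_neg (ha _ (i2 ⟨by linarith [hu.2], by linarith [hu.1]⟩))
  have hbr : ∀ u ∈ Ioo (-q₁) (-m₁), oddRefl b₁ u ≤ oddRefl b₂ u := fun u hu =>
    neg_le_neg (hb _ (i2 ⟨by linarith [hu.2], by linarith [hu.1]⟩))
  -- The first arc starts further left with larger coefficients, hence is above at `m₂`; seen from
  -- the right end it must be below at `m₁`.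
  have e1 : v₂ m₂ ≤ v₁ m₂ := le_at_of_le g1l g2l hp hpm h2.left hl2
    (fun u hu => ha u (i1 hu)) (fun u hu => hb u (i1 hu))
  have e2 : v₁ m₁ ≤ v₂ m₁ := by
    have := le_at_of_le g2r g1r (neg_le_neg hq) (neg_lt_neg hmq) h1.refl.left hr1.refl har hbr
    simpa using this
  -- Between the centres `a₁` is positive and `a₂` negative, so the difference `v₁ - v₂` cannot
  -- decrease. Strictness at one place then gives the contradiction.
  have e3 : v₁ m₂ - v₂ m₂ ≤ v₁ m₁ - v₂ m₁ := by
    have hsub : ∀ u ∈ Ioo m₂ m₁, u ∈ Ioo p₁ q₁ ∧ u ∈ Ioo p₂ q₂ ∧ u ∈ Icc p₂ q₁ ∧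
        u ∈ Ioo p₁ m₁ ∧ u ∈ Ioo m₂ q₂ := by
      intro u hu
      have := hu.1
      have := hu.2
      refine ⟨⟨?_, ?_⟩, ⟨?_, ?_⟩, ⟨?_, ?_⟩, ⟨?_, ?_⟩, ?_, ?_⟩ <;> linarith
    have : MonotoneOn (fun u => v₁ u - v₂ u) (Icc m₂ m₁) := by
      apply monotoneOn_Icc_of_hasDerivAt
        (f' := fun u => (a₁ u / v₁ u + b₁ u) - (a₂ u / v₂ u + b₂ u))
      · exact (h1.cont.mono (Icc_subset_Icc (hp.trans hpm.le) hmq.le)).sub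
          (h2.cont.mono (Icc_subset_Icc hpm.le (hmq.le.trans hq)))
      · exact fun u hu => (h1.deriv u (hsub u hu).1).sub (h2.deriv u (hsub u hu).2.1)
      · intro u hu
        obtain ⟨s1, s2, s3, s4, s5⟩ := hsub u hu
        have t1 := div_nonneg (hl1.pos u s4).le (h1.pos u s1).le
        have t2 := div_nonpos_of_nonpos_of_nonneg (hr2.neg u s5).le (h2.pos u s2).le
        linarith [hb u s3]
    exact this (left_mem_Icc.2 hm) (right_mem_Icc.2 hm) hm
  have pos2 : 0 < v₂ m₂ := h2.pos m₂ ⟨hpm, hm2q1.trans_le hq⟩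
  have pos1 : 0 < v₁ m₁ := h1.pos m₁ ⟨hp.trans_lt hp2m1, hmq⟩
  rcases hs with hs | hs | hs
  · have := lt_at_of_lt g1l g2l hp hpm h2.left hl2
      (fun u hu => ha u (i1 hu)) (fun u hu => hb u (i1 hu)) pos2 (Or.inl hs)
    linarith
  · have := lt_at_of_lt g2r g1r (neg_le_neg hq) (neg_lt_neg hmq) h1.refl.left hr1.refl
      har hbr (by simpa using pos1) (Or.inl (neg_lt_neg hs))
    simp only [neg_neg] at this
    linarith
  · have := lt_at_of_lt g1l g2l hp hpm h2.left hl2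
      (fun u hu => ha u (i1 hu)) (fun u hu => hb u (i1 hu)) pos2
      (Or.inr fun u hu => hs u ⟨hu.1, hu.2.trans hm2q1⟩)
    linarith

end IsArc

/-! ### The critical value of `μ` in one half plane -/

/-- The coefficient `b + μ g`. -/
def pert (b g : ℝ → ℝ) (μ : ℝ) : ℝ → ℝ := fun u => b u + μ * g u

/-- This is how the lower half plane is reached: reversing time changes the sign of the coefficient
of `w`, which amounts to replacing `(b, μ)` by `(-b, -μ)` with the same positive `g`. -/
theorem pert_neg (b g : ℝ → ℝ) (μ : ℝ) : pert (-b) g (-μ) = -pert b g μ := by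
  funext u
  simp only [pert, Pi.neg_apply]
  ring

theorem oddRefl_pert (b g : ℝ → ℝ) (μ : ℝ) :
    oddRefl (pert b g μ) = pert (oddRefl b) (fun u => g (-u)) (-μ) := by
  funext u
  simp only [pert, oddRefl]
  ring

/-- `a` changes sign from plus to minus at `m ∈ (p, q)`, and `g > 0`. -/
structure Cell (a b g : ℝ → ℝ) (p m q : ℝ) : Prop where
  hpm : p < m
  hmq : m < q
  ca : ContinuousOn a (Icc p q)
  cb : ContinuousOn b (Icc p q)
  cg : ContinuousOn g (Icc p q)
  apos : ∀ u ∈ Ioo p m, 0 < a u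
  aneg : ∀ u ∈ Ioo m q, a u < 0
  gpos : ∀ u ∈ Icc p q, 0 < g u
  nondeg : ∃ k > 0, ∀ᶠ u in 𝓝 m, k * (u - m) ^ 2 ≤ |a u|
  db : DifferentiableAt ℝ b m
  dg : DifferentiableAt ℝ g m

/-- The value of `μ` for which `(p, 0)` is connected with `(q, 0)` in the upper half plane. -/
def crit (a b g : ℝ → ℝ) (p q : ℝ) : ℝ :=
  Classical.epsilon fun μ => ∃ v, IsArc a (pert b g μ) p q v

/-- Differentiability and `b m ≥ 0` bound `b` below by a multiple of `-(m - u)`, which is what the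
quadratic lower bound on `a` can compensate. A quadratic bound is asked for, rather than a linear
one, so that double zeros of `a` are included. -/
theorem leftVal_pos {a b : ℝ → ℝ} {p m : ℝ} (h : LeftCell a p m) (hpm : p < m)
    (hb : ContinuousOn b (Icc p m)) (hk : ∃ k > 0, ∀ᶠ u in 𝓝[<] m, k * (u - m) ^ 2 ≤ |a u|)
    (hbd : DifferentiableAt ℝ b m) (hbm : 0 ≤ b m) : 0 < leftVal a b p m := by
  have hs := (h.spec hb).1
  obtain ⟨k, hk0, hk⟩ := hk
  have hO := hbd.isBigO_sub
  obtain ⟨B, hB⟩ := hO.bound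
  have h1 : ∀ᶠ u in 𝓝[<] m, k * (u - m) ^ 2 ≤ |a u| ∧ ‖b u - b m‖ ≤ B * ‖u - m‖ ∧ u ∈ Ioo p m :=
    hk.and ((hB.filter_mono nhdsWithin_le_nhds).and (Ioo_mem_nhdsLT hpm))
  obtain ⟨x, hx, hxs⟩ := (mem_nhdsLT_iff_exists_Ioo_subset' (show m - 1 < m by linarith)).1 h1
  set p' := max x p
  have hp'm : p' < m := max_lt hx hpm
  have hsub : Ioo p' m ⊆ Ioo x m := Ioo_subset_Ioo (le_max_left _ _) le_rfl
  change 0 < branch a b p m m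
  refine (hs.mono (le_max_right x p) le_rfl).pos_right_of_quadratic hp'm hk0
    -- The constant of the asymptotic bound need not be positive.
    (B := |B| + 1) (by positivity) (fun u hu => ?_) (fun u hu => ?_)
  · obtain ⟨t1, -, t3⟩ := hxs (hsub hu)
    rw [abs_of_pos (h.pos u t3)] at t1
    linarith [sq_nonneg (u - m), show (m - u) ^ 2 = (u - m) ^ 2 by ring,
      show k * (m - u) ^ 2 = k * (u - m) ^ 2 by ring]
  · obtain ⟨-, t2, t3⟩ := hxs (hsub hu)
    rw [Real.norm_eq_abs, Real.norm_eq_abs, abs_sub_comm u m,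
      abs_of_pos (show 0 < m - u by linarith [t3.2])] at t2
    have t4 := (abs_le.1 t2).1
    have t5 : B * (m - u) ≤ (|B| + 1) * (m - u) :=
      mul_le_mul_of_nonneg_right (by linarith [le_abs_self B]) (by linarith [t3.2])
    linarith

namespace Cell

variable {a b g : ℝ → ℝ} {p m q p' q' μ : ℝ}

theorem sub (h : Cell a b g p m q) (hp : p ≤ p') (hpm : p' < m) (hq : q' ≤ q) (hmq : m < q') :
    Cell a b g p' m q' :=
  ⟨hpm, hmq, h.ca.mono (Icc_subset_Icc hp hq), h.cb.mono (Icc_subset_Icc hp hq),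
    h.cg.mono (Icc_subset_Icc hp hq), fun u hu => h.apos u (Ioo_subset_Ioo hp le_rfl hu),
    fun u hu => h.aneg u (Ioo_subset_Ioo le_rfl hq hu),
    fun u hu => h.gpos u (Icc_subset_Icc hp hq hu), h.nondeg, h.db, h.dg⟩

theorem neg (h : Cell a b g p m q) : Cell a (-b) g p m q :=
  ⟨h.hpm, h.hmq, h.ca, h.cb.neg, h.cg, h.apos, h.aneg, h.gpos, h.nondeg, h.db.neg, h.dg⟩

theorem refl (h : Cell a b g p m q) :
    Cell (oddRefl a) (oddRefl b) (fun u => g (-u)) (-q) (-m) (-p) := by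
  refine ⟨neg_lt_neg h.hmq, neg_lt_neg h.hpm, h.ca.oddRefl, h.cb.oddRefl,
    h.cg.comp continuousOn_neg (fun u hu => ⟨by linarith [hu.2], by linarith [hu.1]⟩),
    fun u hu => ?_, fun u hu => ?_, fun u hu => ?_, ?_, ?_, ?_⟩
  · have := h.aneg (-u) ⟨by linarith [hu.2], by linarith [hu.1]⟩
    simp only [oddRefl]; linarith
  · have := h.apos (-u) ⟨by linarith [hu.2], by linarith [hu.1]⟩
    simp only [oddRefl]; linarith
  · exact h.gpos (-u) ⟨by linarith [hu.2], by linarith [hu.1]⟩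
  · obtain ⟨k, hk, hev⟩ := h.nondeg
    refine ⟨k, hk, ?_⟩
    have ht : Tendsto (fun u : ℝ => -u) (𝓝 (-m)) (𝓝 m) := by
      simpa using (continuous_neg (G := ℝ)).tendsto (-m)
    filter_upwards [ht.eventually hev] with u hu
    simp only [oddRefl, abs_neg]
    linarith [show k * (u - -m) ^ 2 = k * (-u - m) ^ 2 by ring]
  · have : DifferentiableAt ℝ (fun u => b (-u)) (-m) := by
      apply DifferentiableAt.comp (g := b)
      · simpa using h.db
      · exact differentiableAt_id.neg
    exact this.neg
  · apply DifferentiableAt.comp (g := g)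
    · simpa using h.dg
    · exact differentiableAt_id.neg

theorem left (h : Cell a b g p m q) : LeftCell a p m :=
  ⟨h.hpm.le, h.ca.mono (Icc_subset_Icc le_rfl h.hmq.le), h.apos⟩

theorem right (h : Cell a b g p m q) : RightCell a m q :=
  ⟨h.hmq.le, h.ca.mono (Icc_subset_Icc h.hpm.le le_rfl), h.aneg⟩

theorem cpert (h : Cell a b g p m q) (μ : ℝ) : ContinuousOn (pert b g μ) (Icc p q) :=
  h.cb.add (continuousOn_const.mul h.cg)

theorem cpertl (h : Cell a b g p m q) (μ : ℝ) : ContinuousOn (pert b g μ) (Icc p m) :=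
  (h.cpert μ).mono (Icc_subset_Icc le_rfl h.hmq.le)

theorem cpertr (h : Cell a b g p m q) (μ : ℝ) : ContinuousOn (pert b g μ) (Icc m q) :=
  (h.cpert μ).mono (Icc_subset_Icc h.hpm.le le_rfl)

theorem leftVal_pert_pos (h : Cell a b g p m q) (hμ : 0 ≤ pert b g μ m) :
    0 < leftVal a (pert b g μ) p m := by
  obtain ⟨k, hk, hev⟩ := h.nondeg
  exact leftVal_pos h.left h.hpm (h.cpertl μ) ⟨k, hk, hev.filter_mono nhdsWithin_le_nhds⟩
    (h.db.add (h.dg.const_mul μ)) hμ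

theorem rightVal_eq (μ : ℝ) : rightVal a (pert b g μ) m q =
    leftVal (oddRefl a) (pert (oddRefl b) (fun u => g (-u)) (-μ)) (-q) (-m) := by
  rw [rightVal, oddRefl_pert]

theorem rightVal_pert_pos (h : Cell a b g p m q) (hμ : pert b g μ m ≤ 0) :
    0 < rightVal a (pert b g μ) m q := by
  rw [rightVal_eq]
  apply h.refl.leftVal_pert_pos
  simp only [pert, oddRefl, neg_neg] at hμ ⊢
  linarith

theorem rightVal_nonneg (h : Cell a b g p m q) : 0 ≤ rightVal a (pert b g μ) m q :=
  h.right.refl.leftVal_nonneg (h.cpertr μ).oddRefl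

theorem leftVal_mono (h : Cell a b g p m q) : Monotone (fun μ => leftVal a (pert b g μ) p m) := by
  intro μ₁ μ₂ hμ
  refine h.left.leftVal_mono (h.cpertl μ₁) h.left (h.cpertl μ₂) le_rfl (fun _ _ => le_rfl) ?_
  intro u hu
  have := (h.gpos u ⟨hu.1.le, (hu.2.trans h.hmq).le⟩).le
  simp only [pert]
  nlinarith

theorem rightVal_anti (h : Cell a b g p m q) :
    Antitone (fun μ => rightVal a (pert b g μ) m q) := by
  intro μ₁ μ₂ hμ
  simp only [rightVal_eq]
  exact h.refl.leftVal_mono (neg_le_neg hμ)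

theorem continuous_leftVal (h : Cell a b g p m q) :
    Continuous (fun μ => leftVal a (pert b g μ) p m) := by
  obtain ⟨G, hG0, hG⟩ := exists_abs_bound_Icc h.cg
  have hL : LipschitzWith (2 * G * (m - p)).toNNReal (fun μ => leftVal a (pert b g μ) p m) := by
    apply LipschitzWith.of_dist_le_mul
    intro μ₁ μ₂
    have := h.hpm
    rw [Real.coe_toNNReal _ (mul_nonneg (by positivity) (by linarith)), Real.dist_eq, Real.dist_eq]
    have := h.left.abs_leftVal_sub_le (h.cpertl μ₁) (h.cpertl μ₂) (β := G * |μ₁ - μ₂|)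
      (by positivity) (fun u hu => by
        have h1 : pert b g μ₁ u - pert b g μ₂ u = (μ₁ - μ₂) * g u := by simp only [pert]; ring
        rw [h1, abs_mul, mul_comm]
        exact mul_le_mul_of_nonneg_right (hG u ⟨hu.1.le, (hu.2.trans h.hmq).le⟩) (abs_nonneg _))
    linarith
  exact hL.continuous

theorem continuous_rightVal (h : Cell a b g p m q) :
    Continuous (fun μ => rightVal a (pert b g μ) m q) := by
  simp only [rightVal_eq]
  exact h.refl.continuous_leftVal.comp continuous_neg

theorem exists_leftVal_gt (h : Cell a b g p m q) (N : ℝ) :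
    ∃ μ, 0 ≤ μ ∧ N < leftVal a (pert b g μ) p m := by
  obtain ⟨B, hB0, hB⟩ := exists_abs_bound_Icc h.cb
  obtain ⟨z, hz, hmin⟩ := isCompact_Icc.exists_isMinOn
    ⟨p, left_mem_Icc.2 (h.hpm.trans h.hmq).le⟩ h.cg
  have hmin' : ∀ u ∈ Icc p q, g z ≤ g u := fun u hu => hmin hu
  have hgz := h.gpos z hz
  have hpm : 0 < m - p := sub_pos.2 h.hpm
  -- Then `b + μ g` is at least `(|N| + 1) / (m - p)`, and a branch with this slope rises by `|N| +
  -- 1` before it reaches `m`.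
  set μ := ((|N| + 1) / (m - p) + B) / g z
  have hμ0 : 0 ≤ μ := by positivity
  refine ⟨μ, hμ0, ?_⟩
  have := h.left.le_leftVal (h.cpertl μ) (β := -B + μ * g z) (fun u hu => by
    have hu' : u ∈ Icc p q := ⟨hu.1.le, (hu.2.trans h.hmq).le⟩
    have := (abs_le.1 (hB u hu')).1
    have := mul_le_mul_of_nonneg_left (hmin' u hu') hμ0
    simp only [pert]
    linarith)
  have e : (-B + μ * g z) * (m - p) = |N| + 1 := by
    simp only [μ]
    field_simp
    ring
  linarith [le_abs_self N]

theorem exists_crit (h : Cell a b g p m q) : ∃ μ, ∃ v, IsArc a (pert b g μ) p q v := by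
  obtain ⟨μ₂, hμ2, h2⟩ := h.exists_leftVal_gt (rightVal a (pert b g 0) m q)
  obtain ⟨μ₁, hμ1, h1⟩ := h.refl.exists_leftVal_gt (leftVal a (pert b g 0) p m)
  have e1 := h.rightVal_anti hμ2
  have e2 := h.leftVal_mono (neg_nonpos.2 hμ1)
  simp only at e1 e2
  have e3 : rightVal a (pert b g (-μ₁)) m q = leftVal (oddRefl a)
      (pert (oddRefl b) (fun u => g (-u)) μ₁) (-q) (-m) := by rw [rightVal_eq, neg_neg]
  have hcont : Continuous (fun μ => leftVal a (pert b g μ) p m - rightVal a (pert b g μ) m q) :=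
    h.continuous_leftVal.sub h.continuous_rightVal
  obtain ⟨μ, -, hμ⟩ := intermediate_value_Icc (show -μ₁ ≤ μ₂ by linarith) hcont.continuousOn
    (show (0:ℝ) ∈ Icc _ _ from ⟨by linarith, by linarith⟩)
  have heq : leftVal a (pert b g μ) p m = rightVal a (pert b g μ) m q := by linarith
  refine ⟨μ, IsArc.exists_of_eq h.hpm h.hmq h.left h.right (h.cpert μ) heq ?_⟩
  -- The branches must meet above the axis, not on it. Whatever the sign of the coefficient at `m`,
  -- one of the two heights is positive, and they are equal.
  rcases le_total 0 (pert b g μ m) with h0 | h0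
  · exact h.leftVal_pert_pos h0
  · rw [heq]
    exact h.rightVal_pert_pos h0

theorem crit_spec (h : Cell a b g p m q) : ∃ v, IsArc a (pert b g (crit a b g p q)) p q v :=
  Classical.epsilon_spec h.exists_crit

theorem lt_of_arcs (h : Cell a b g p m q') (hp : p ≤ p') (hpm : p' < m) (hmq : m < q)
    (hq : q ≤ q') (hne : p < p' ∨ q < q') {μ μ' : ℝ} {v v' : ℝ → ℝ}
    (h1 : IsArc a (pert b g μ) p q v) (h2 : IsArc a (pert b g μ') p' q' v') : μ < μ' := by
  by_contra hcon
  push Not at hcon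
  have c1 := h.sub le_rfl h.hpm hq hmq
  have c2 := h.sub hp hpm le_rfl h.hmq
  refine h1.not_ordered h2 hp hpm le_rfl hmq hq c1.left c1.right c2.left c2.right
    (fun _ _ => le_rfl) (fun u hu => ?_) (by tauto)
  have := (h.gpos u ⟨hp.trans hu.1, hu.2.trans hq⟩).le
  simp only [pert]
  nlinarith

theorem arc_unique (h : Cell a b g p m q) {μ μ' : ℝ} {v v' : ℝ → ℝ}
    (h1 : IsArc a (pert b g μ) p q v) (h2 : IsArc a (pert b g μ') p q v') : μ = μ' := by
  have key : ∀ {μ μ' : ℝ} {v v' : ℝ → ℝ}, IsArc a (pert b g μ) p q v →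
      IsArc a (pert b g μ') p q v' → ¬ μ' < μ := by
    intro μ μ' v v' h1 h2 hlt
    refine h1.not_ordered h2 le_rfl h.hpm le_rfl h.hmq le_rfl h.left h.right h.left h.right
      (fun _ _ => le_rfl) (fun u hu => ?_) (Or.inr (Or.inr fun u hu => ?_))
    · have := h.gpos u hu
      simp only [pert]
      nlinarith
    · have := h.gpos u (Ioo_subset_Icc_self hu)
      simp only [pert]
      nlinarith
  exact le_antisymm (not_lt.1 (key h1 h2)) (not_lt.1 (key h2 h1))

theorem eq_crit (h : Cell a b g p m q) {v : ℝ → ℝ} (hv : IsArc a (pert b g μ) p q v) :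
    μ = crit a b g p q := by
  obtain ⟨v', hv'⟩ := h.crit_spec
  exact h.arc_unique hv hv'

/-- Moving the start to the right lowers the left branch, moving the end to the right raises the
right branch, and a larger `μ` is needed to make up for either. All uniqueness statements rest on
this strictness. -/
theorem crit_strictMono (h : Cell a b g p m q') (hp : p ≤ p') (hpm : p' < m) (hmq : m < q)
    (hq : q ≤ q') (hne : p < p' ∨ q < q') : crit a b g p q < crit a b g p' q' := by
  obtain ⟨v, hv⟩ := (h.sub le_rfl h.hpm hq hmq).crit_spec
  obtain ⟨v', hv'⟩ := (h.sub hp hpm le_rfl h.hmq).crit_spec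
  exact h.lt_of_arcs hp hpm hmq hq hne hv hv'

theorem crit_refl (h : Cell a b g p m q) :
    crit (oddRefl a) (oddRefl b) (fun u => g (-u)) (-q) (-p) = -crit a b g p q := by
  obtain ⟨v, hv⟩ := h.crit_spec
  have := hv.refl
  rw [oddRefl_pert] at this
  exact (h.refl.eq_crit this).symm

theorem crit_vals (h : Cell a b g p m q) :
    leftVal a (pert b g (crit a b g p q)) p m = rightVal a (pert b g (crit a b g p q)) m q ∧
      0 < leftVal a (pert b g (crit a b g p q)) p m := by
  obtain ⟨v, hv⟩ := h.crit_spec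
  rw [← hv.eq_leftVal h.left h.hmq.le (h.cpertl _), ← hv.eq_rightVal h.right h.hpm.le (h.cpertr _)]
  exact ⟨rfl, hv.pos m ⟨h.hpm, h.hmq⟩⟩

/-- Bounds on `crit` are thus comparisons of two heights at a single `μ`. Since heights depend
continuously on the data, such strict bounds persist under perturbation. -/
theorem crit_lt_iff (h : Cell a b g p m q) :
    crit a b g p q < μ ↔ rightVal a (pert b g μ) m q < leftVal a (pert b g μ) p m := by
  obtain ⟨e1, e2⟩ := h.crit_vals
  constructor
  · intro hlt
    have hr := h.rightVal_anti hlt.le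
    have hb1 := h.left.spec (h.cpertl μ)
    have hb2 := h.left.spec (h.cpertl (crit a b g p q))
    have hs := IsArc.lt_at_of_lt hb1.1 hb2.1 le_rfl h.hpm hb2.2 h.left (fun _ _ => le_rfl)
      (fun u hu => by
        have := h.gpos u ⟨hu.1.le, (hu.2.trans h.hmq).le⟩
        simp only [pert]; nlinarith) e2 (Or.inr fun u hu => by
        have := h.gpos u ⟨hu.1.le, (hu.2.trans h.hmq).le⟩
        simp only [pert]; nlinarith)
    simp only [leftVal] at e1 hs hr ⊢
    linarith
  · intro hlt
    by_contra hcon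
    push Not at hcon
    have e3 := h.leftVal_mono hcon
    have e4 := h.rightVal_anti hcon
    simp only at e3 e4
    linarith

theorem lt_crit_iff (h : Cell a b g p m q) :
    μ < crit a b g p q ↔ leftVal a (pert b g μ) p m < rightVal a (pert b g μ) m q := by
  have := h.refl.crit_lt_iff (μ := -μ)
  rw [h.crit_refl, neg_lt_neg_iff, rightVal_eq, neg_neg] at this
  rw [this, rightVal_eq]
  simp

theorem continuousOn_crit_left (h : Cell a b g p m q) :
    ContinuousOn (fun x => crit a b g x q) (Ico p m) := by
  intro x hx
  have hc : ∀ y ∈ Ico p m, Cell a b g y m q := fun y hy => h.sub hy.1 hy.2 le_rfl h.hmq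
  have hlc : ∀ μ, Tendsto (fun y => leftVal a (pert b g μ) y m) (𝓝[Ico p m] x)
      (𝓝 (leftVal a (pert b g μ) x m)) := fun μ =>
    ((h.left.continuousOn_leftVal (h.cpertl μ)) x (Ico_subset_Icc_self hx)).mono
      Ico_subset_Icc_self
  refine tendsto_order.2 ⟨fun μ hμ => ?_, fun μ hμ => ?_⟩
  · filter_upwards [(hlc μ).eventually (gt_mem_nhds ((hc x hx).lt_crit_iff.1 hμ)),
      self_mem_nhdsWithin] with y hy hy'
    exact (hc y hy').lt_crit_iff.2 hy
  · filter_upwards [(hlc μ).eventually (lt_mem_nhds ((hc x hx).crit_lt_iff.1 hμ)),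
      self_mem_nhdsWithin] with y hy hy'
    exact (hc y hy').crit_lt_iff.2 hy

theorem continuousOn_crit_right (h : Cell a b g p m q) :
    ContinuousOn (fun x => crit a b g p x) (Ioc m q) := by
  have h1 : ContinuousOn (fun x => -crit (oddRefl a) (oddRefl b) (fun u => g (-u)) (-x) (-p))
      (Ioc m q) :=
    (h.refl.continuousOn_crit_left.comp continuousOn_neg
      (fun u hu => ⟨neg_le_neg hu.2, neg_lt_neg hu.1⟩)).neg
  refine h1.congr fun x hx => ?_
  simp only [(h.sub le_rfl h.hpm hx.2 hx.1).crit_refl, neg_neg]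

/-- As the starting point approaches the centre, the left height tends to zero while the right
height is fixed and positive. -/
theorem eventually_lt_crit (h : Cell a b g p m q) (hμ : pert b g μ m ≤ 0) :
    ∀ᶠ x in 𝓝[<] m, μ < crit a b g x q := by
  have h0 : leftVal a (pert b g μ) m m = 0 :=
    (h.left.mono h.hpm.le le_rfl).leftVal_self ((h.cpertl μ).mono (Icc_subset_Icc h.hpm.le le_rfl))
  have h1 : Tendsto (fun y => leftVal a (pert b g μ) y m) (𝓝[Ico p m] m) (𝓝 0) := by
    rw [← h0]
    exact ((h.left.continuousOn_leftVal (h.cpertl μ)) m (right_mem_Icc.2 h.hpm.le)).mono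
      Ico_subset_Icc_self
  rw [nhdsWithin_Ico_eq_nhdsLT h.hpm] at h1
  filter_upwards [h1.eventually (gt_mem_nhds (h.rightVal_pert_pos hμ)),
    Ico_mem_nhdsLT h.hpm] with y hy hy'
  exact (h.sub hy'.1 hy'.2 le_rfl h.hmq).lt_crit_iff.2 hy

theorem eventually_crit_lt (h : Cell a b g p m q) (hμ : 0 ≤ pert b g μ m) :
    ∀ᶠ x in 𝓝[>] m, crit a b g p x < μ := by
  have h1 := h.refl.eventually_lt_crit (μ := -μ) (by
    rw [← oddRefl_pert]; simpa [oddRefl] using hμ)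
  have h2 : Tendsto (fun x : ℝ => -x) (𝓝[>] m) (𝓝[<] (-m)) := tendsto_neg_nhdsGT
  filter_upwards [h2.eventually h1, Ioc_mem_nhdsGT h.hmq] with x hx hx'
  rw [(h.sub le_rfl h.hpm hx'.2 hx'.1).crit_refl] at hx
  linarith

end Cell

/-! ### The gap between the two half planes -/

/-- The difference between the values of `μ` for which `(p, 0)` and `(q, 0)` are connected in the
upper and in the lower half plane. -/
def critGap (a b g : ℝ → ℝ) (p q : ℝ) : ℝ := crit a b g p q + crit a (-b) g p q

namespace Cell

variable {a b g : ℝ → ℝ} {p m q p' q' μ : ℝ}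

theorem critGap_strictMono (h : Cell a b g p m q') (hp : p ≤ p') (hpm : p' < m) (hmq : m < q)
    (hq : q ≤ q') (hne : p < p' ∨ q < q') : critGap a b g p q < critGap a b g p' q' :=
  add_lt_add (h.crit_strictMono hp hpm hmq hq hne) (h.neg.crit_strictMono hp hpm hmq hq hne)

theorem continuousOn_critGap_left (h : Cell a b g p m q) :
    ContinuousOn (fun x => critGap a b g x q) (Ico p m) :=
  h.continuousOn_crit_left.add h.neg.continuousOn_crit_left

theorem continuousOn_critGap_right (h : Cell a b g p m q) :
    ContinuousOn (fun x => critGap a b g p x) (Ioc m q) :=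
  h.continuousOn_crit_right.add h.neg.continuousOn_crit_right

theorem pert_centre (h : Cell a b g p m q) :
    pert b g (-(b m / g m)) m = 0 ∧ pert (-b) g (b m / g m) m = 0 := by
  have := (h.gpos m ⟨h.hpm.le, h.hmq.le⟩).ne'
  simp only [pert, Pi.neg_apply]
  constructor <;> field_simp <;> ring

/-- The value `-(b m / g m)` annihilates the coefficient at the centre, and its negative does so for
`-b`. Both critical values exceed these, and the two add up to zero. -/
theorem eventually_critGap_pos (h : Cell a b g p m q) : ∀ᶠ x in 𝓝[<] m, 0 < critGap a b g x q := by
  filter_upwards [h.eventually_lt_crit h.pert_centre.1.le,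
    h.neg.eventually_lt_crit h.pert_centre.2.le] with x h1 h2
  simp only [critGap]
  linarith

theorem eventually_critGap_neg (h : Cell a b g p m q) : ∀ᶠ x in 𝓝[>] m, critGap a b g p x < 0 := by
  filter_upwards [h.eventually_crit_lt h.pert_centre.1.ge,
    h.neg.eventually_crit_lt h.pert_centre.2.ge] with x h1 h2
  simp only [critGap]
  linarith

/-- On a closed orbit the divergence `b + μ g` vanishes somewhere. -/
theorem exists_pert_eq_zero (h : Cell a b g p m q) (h0 : critGap a b g p q = 0) :
    ∃ ξ ∈ Icc p q, pert b g (crit a b g p q) ξ = 0 := by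
  obtain ⟨v₁, h1⟩ := h.crit_spec
  obtain ⟨v₂, h2⟩ := h.neg.crit_spec
  have e : crit a (-b) g p q = -crit a b g p q := by
    simp only [critGap] at h0
    linarith
  rw [e, pert_neg] at h2
  set B := pert b g (crit a b g p q)
  by_contra hcon
  push Not at hcon
  have hcB : ContinuousOn B (Icc p q) := h.cpert _
  -- The upper arc belongs to `B` and the reversed lower arc to `-B`. If `B` had a fixed sign, these
  -- two arcs with common ends would be ordered.
  have hsign : (∀ u ∈ Icc p q, 0 < B u) ∨ ∀ u ∈ Icc p q, B u < 0 := by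
    by_contra hns
    push Not at hns
    obtain ⟨⟨x, hx, hx0⟩, y, hy, hy0⟩ := hns
    obtain ⟨z, hz, hz0⟩ := isPreconnected_Icc.intermediate_value hx hy hcB ⟨hx0, hy0⟩
    exact hcon z hz hz0
  rcases hsign with hs | hs
  · refine h1.not_ordered h2 le_rfl h.hpm le_rfl h.hmq le_rfl h.left h.right h.left h.right
      (fun _ _ => le_rfl) (fun u hu => ?_) (Or.inr (Or.inr fun u hu => ?_))
    · have := hs u hu
      simp only [Pi.neg_apply]; linarith
    · have := hs u (Ioo_subset_Icc_self hu)
      simp only [Pi.neg_apply]; linarith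
  · refine h2.not_ordered h1 le_rfl h.hpm le_rfl h.hmq le_rfl h.left h.right h.left h.right
      (fun _ _ => le_rfl) (fun u hu => ?_) (Or.inr (Or.inr fun u hu => ?_))
    · have := hs u hu
      simp only [Pi.neg_apply]; linarith
    · have := hs u (Ioo_subset_Icc_self hu)
      simp only [Pi.neg_apply]; linarith

end Cell

/-! ### The planar flow: uniqueness, symmetries, global solutions of a frozen field -/

/-- `(u, w)` is a solution on `ℝ` of `u' = w`, `w' = a u + b u * w` with `u ∈ J`. -/
def IsOrbit (a b : ℝ → ℝ) (J : Set ℝ) (u w : ℝ → ℝ) : Prop :=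
  ∀ z : ℝ, u z ∈ J ∧ HasDerivAt u (w z) z ∧ HasDerivAt w (a (u z) + b (u z) * w z) z

/-- Lipschitz continuity on the compact subintervals of `J`. -/
def LocLip (a : ℝ → ℝ) (J : Set ℝ) : Prop :=
  ∀ x y, Icc x y ⊆ J → ∃ K, LipschitzOnWith K a (Icc x y)

theorem LocLip.of_contDiffOn {a : ℝ → ℝ} {J : Set ℝ} (hJ : IsOpen J) (h : ContDiffOn ℝ 1 a J) :
    LocLip a J := by
  intro x y hxy
  have hd : ContinuousOn (deriv a) (Icc x y) :=
    (h.continuousOn_deriv_of_isOpen hJ le_rfl).mono hxy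
  obtain ⟨B, hB0, hB⟩ := exists_abs_bound_Icc hd
  refine ⟨B.toNNReal, (convex_Icc x y).lipschitzOnWith_of_nnnorm_deriv_le (fun z hz => ?_)
    fun z hz => ?_⟩
  · exact (h.differentiableOn one_ne_zero).differentiableAt (hJ.mem_nhds (hxy hz))
  · rw [← NNReal.coe_le_coe, coe_nnnorm, Real.norm_eq_abs, Real.coe_toNNReal _ hB0]
    exact hB z hz

/-- The vector field. -/
def planarField (a b : ℝ → ℝ) (x : ℝ × ℝ) : ℝ × ℝ := (x.2, a x.1 + b x.1 * x.2)

theorem planarField_lipschitzOn {a b : ℝ → ℝ} {p q : ℝ} {Ka Kb : NNReal}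
    (ha : LipschitzOnWith Ka a (Icc p q)) (hb : LipschitzOnWith Kb b (Icc p q)) (M : ℝ) :
    ∃ K, LipschitzOnWith K (planarField a b) (Icc p q ×ˢ Icc (-M) M) := by
  obtain ⟨B, hB0, hB⟩ := exists_abs_bound_Icc hb.continuousOn
  refine ⟨1 + Ka + B.toNNReal + |M|.toNNReal * Kb, LipschitzOnWith.of_dist_le_mul ?_⟩
  rintro ⟨u, w⟩ ⟨hu, hw⟩ ⟨u', w'⟩ ⟨hu', hw'⟩
  simp only at hu hw hu' hw'
  have hd1 : |u - u'| ≤ dist (u, w) (u', w') := by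
    rw [Prod.dist_eq, Real.dist_eq]; exact le_max_left _ _
  have hd2 : |w - w'| ≤ dist (u, w) (u', w') := by
    rw [Prod.dist_eq, Real.dist_eq, Real.dist_eq]; exact le_max_right _ _
  set D := dist (u, w) (u', w')
  have hD : 0 ≤ D := dist_nonneg
  push_cast
  rw [Real.coe_toNNReal _ hB0, Real.coe_toNNReal _ (abs_nonneg M)]
  have k1 := ha.dist_le_mul u hu u' hu'
  have k2 := hb.dist_le_mul u hu u' hu'
  rw [Real.dist_eq, Real.dist_eq] at k1 k2
  have hKa : (0:ℝ) ≤ Ka := Ka.2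
  have hKb : (0:ℝ) ≤ Kb := Kb.2
  have hwM : |w'| ≤ |M| := by
    apply (abs_le.2 hw').trans (le_abs_self M)
  have e0 : |b u * w - b u' * w'| ≤ B * D + |M| * (Kb * D) := by
    have : b u * w - b u' * w' = b u * (w - w') + w' * (b u - b u') := by ring
    rw [this]
    refine (abs_add_le _ _).trans (add_le_add ?_ ?_)
    · rw [abs_mul]
      exact mul_le_mul (hB u hu) hd2 (abs_nonneg _) hB0
    · rw [abs_mul]
      exact mul_le_mul hwM (k2.trans (mul_le_mul_of_nonneg_left hd1 hKb)) (abs_nonneg _)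
        (abs_nonneg _)
  have e1 : |a u - a u'| ≤ Ka * D := k1.trans (mul_le_mul_of_nonneg_left hd1 hKa)
  rw [planarField, planarField, Prod.dist_eq, Real.dist_eq, Real.dist_eq]
  simp only
  have t1 : 0 ≤ Ka * D := mul_nonneg hKa hD
  have t2 : 0 ≤ B * D := mul_nonneg hB0 hD
  have t3 : 0 ≤ |M| * (Kb * D) := mul_nonneg (abs_nonneg _) (mul_nonneg hKb hD)
  apply max_le
  · nlinarith
  · have : a u + b u * w - (a u' + b u' * w') = (a u - a u') + (b u * w - b u' * w') := by ring
    rw [this]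
    have := abs_add_le (a u - a u') (b u * w - b u' * w')
    nlinarith

namespace IsOrbit

variable {a b u w u₁ u₂ w₁ w₂ : ℝ → ℝ} {J : Set ℝ}

theorem continuous_fst (h : IsOrbit a b J u w) : Continuous u :=
  continuous_iff_continuousAt.2 fun z => (h z).2.1.continuousAt

theorem continuous_snd (h : IsOrbit a b J u w) : Continuous w :=
  continuous_iff_continuousAt.2 fun z => (h z).2.2.continuousAt

theorem exists_box (h : IsOrbit a b J u w) (s t : ℝ) :
    ∃ M, (∀ z ∈ Icc s t, |w z| ≤ M) := by
  obtain ⟨M, -, hM⟩ := exists_abs_bound_Icc (h.continuous_snd.continuousOn (s := Icc s t))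
  exact ⟨M, hM⟩

theorem hasDerivAt_prod (h : IsOrbit a b J u w) (z : ℝ) :
    HasDerivAt (fun z => (u z, w z)) (planarField a b (u z, w z)) z :=
  (h z).2.1.prodMk (h z).2.2

/-- Uniqueness for the initial value problem. -/
theorem unique (hJ : J.OrdConnected) (ha : LocLip a J) (hb : LocLip b J)
    (h1 : IsOrbit a b J u₁ w₁) (h2 : IsOrbit a b J u₂ w₂) {t₀ : ℝ} (hu : u₁ t₀ = u₂ t₀)
    (hw : w₁ t₀ = w₂ t₀) : u₁ = u₂ ∧ w₁ = w₂ := by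
  suffices h : ∀ t, (u₁ t, w₁ t) = (u₂ t, w₂ t) from
    ⟨funext fun t => congrArg Prod.fst (h t), funext fun t => congrArg Prod.snd (h t)⟩
  intro t
  set s := min t t₀ - 1
  set r := max t t₀ + 1
  have hs1 : s < t := by have := min_le_left t t₀; simp only [s]; linarith
  have hs2 : s < t₀ := by have := min_le_right t t₀; simp only [s]; linarith
  have hr1 : t < r := by have := le_max_left t t₀; simp only [r]; linarith
  have hr2 : t₀ < r := by have := le_max_right t t₀; simp only [r]; linarith
  have hne : (Icc s r).Nonempty := ⟨t, hs1.le, hr1.le⟩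
  obtain ⟨x1, hx1, hx1m⟩ := isCompact_Icc.exists_isMinOn hne h1.continuous_fst.continuousOn
  obtain ⟨y1, hy1, hy1m⟩ := isCompact_Icc.exists_isMaxOn hne h1.continuous_fst.continuousOn
  obtain ⟨x2, hx2, hx2m⟩ := isCompact_Icc.exists_isMinOn hne h2.continuous_fst.continuousOn
  obtain ⟨y2, hy2, hy2m⟩ := isCompact_Icc.exists_isMaxOn hne h2.continuous_fst.continuousOn
  obtain ⟨M1, hM1⟩ := h1.exists_box s r
  obtain ⟨M2, hM2⟩ := h2.exists_box s r
  set P := min (u₁ x1) (u₂ x2)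
  set Q := max (u₁ y1) (u₂ y2)
  have hPQ : Icc P Q ⊆ J := by
    apply hJ.out
    · rcases min_choice (u₁ x1) (u₂ x2) with h | h <;> simp only [P, h]
      exacts [(h1 _).1, (h2 _).1]
    · rcases max_choice (u₁ y1) (u₂ y2) with h | h <;> simp only [Q, h]
      exacts [(h1 _).1, (h2 _).1]
  obtain ⟨Ka, hKa⟩ := ha P Q hPQ
  obtain ⟨Kb, hKb⟩ := hb P Q hPQ
  obtain ⟨K, hK⟩ := planarField_lipschitzOn hKa hKb (max M1 M2)
  have := ODE_solution_unique_of_mem_Ioo (v := fun _ => planarField a b)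
    (s := fun _ => Icc P Q ×ˢ Icc (-(max M1 M2)) (max M1 M2)) (a := s) (b := r) (t₀ := t₀)
    (fun _ _ => hK) ⟨hs2, hr2⟩ (f := fun t => (u₁ t, w₁ t)) (g := fun t => (u₂ t, w₂ t))
    (fun z hz => ⟨h1.hasDerivAt_prod z, ⟨⟨(min_le_left _ _).trans (hx1m (Ioo_subset_Icc_self hz)),
      (hy1m (Ioo_subset_Icc_self hz)).trans (le_max_left _ _)⟩,
      abs_le.1 ((hM1 z (Ioo_subset_Icc_self hz)).trans (le_max_left _ _))⟩⟩)
    (fun z hz => ⟨h2.hasDerivAt_prod z, ⟨⟨(min_le_right _ _).trans (hx2m (Ioo_subset_Icc_self hz)),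
      (hy2m (Ioo_subset_Icc_self hz)).trans (le_max_right _ _)⟩,
      abs_le.1 ((hM2 z (Ioo_subset_Icc_self hz)).trans (le_max_right _ _))⟩⟩)
    (by simp [hu, hw])
  exact this ⟨hs1, hr1⟩

theorem shift (h : IsOrbit a b J u w) (T : ℝ) :
    IsOrbit a b J (fun z => u (z + T)) (fun z => w (z + T)) := fun z =>
  ⟨(h _).1, (h _).2.1.comp_add_const z T, (h _).2.2.comp_add_const z T⟩

/-- Time reversal. -/
theorem reverse (h : IsOrbit a b J u w) :
    IsOrbit a (-b) J (fun z => u (-z)) (fun z => -w (-z)) := by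
  intro z
  refine ⟨(h _).1, ?_, ?_⟩
  · exact ((h (-z)).2.1.comp z (hasDerivAt_neg z)).congr_deriv (by simp)
  · exact ((h (-z)).2.2.comp z (hasDerivAt_neg z)).neg.congr_deriv (by simp)

/-- Reflection in space. -/
theorem spaceRefl (h : IsOrbit a b J u w) :
    IsOrbit (oddRefl a) (fun x => b (-x)) (Neg.neg ⁻¹' J) (fun z => -u z) (fun z => -w z) := by
  intro z
  refine ⟨by simpa using (h z).1, (h z).2.1.neg, (h z).2.2.neg.congr_deriv ?_⟩
  simp only [oddRefl, neg_neg]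
  ring

/-- Reflection in space and time. -/
theorem spaceTimeRefl (h : IsOrbit a b J u w) :
    IsOrbit (oddRefl a) (oddRefl b) (Neg.neg ⁻¹' J) (fun z => -u (-z)) (fun z => w (-z)) := by
  have := h.reverse.spaceRefl
  simp only [neg_neg] at this
  exact this

end IsOrbit

theorem exists_global_solution {E : Type*} [NormedAddCommGroup E] [NormedSpace ℝ E]
    [CompleteSpace E] {F : E → E} {K L : NNReal} (hK : LipschitzWith K F) (hL : ∀ x, ‖F x‖ ≤ L)
    (x₀ : E) : ∃ γ : ℝ → E, γ 0 = x₀ ∧ ∀ t, HasDerivAt γ (F (γ t)) t := by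
  have hex : ∀ n : ℕ, ∃ α : ℝ → E, α 0 = x₀ ∧
      ∀ τ ∈ Ioo (-(n + 1 : ℝ)) (n + 1), HasDerivAt α (F (α τ)) τ := by
    intro n
    obtain ⟨α, h0, hα⟩ := exists_ode_solution_Icc (F := fun _ => F) (s := -(n + 1 : ℝ))
      (t := n + 1) (t₀ := 0) ⟨by have : (0:ℝ) ≤ n := n.cast_nonneg
                                 linarith, by positivity⟩ (fun _ _ => hK)
      (fun x => continuousOn_const) (fun _ _ => hL) x₀
    exact ⟨α, h0, fun τ hτ => (hα τ (Ioo_subset_Icc_self hτ)).hasDerivAt (Icc_mem_nhds hτ.1 hτ.2)⟩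
  choose α h0 hα using hex
  have hagree : ∀ n k : ℕ, n ≤ k → ∀ t ∈ Ioo (-(n + 1 : ℝ)) (n + 1), α n t = α k t := by
    intro n k hnk t ht
    have hnk' : (n : ℝ) ≤ k := Nat.cast_le.2 hnk
    have hn0 : (0:ℝ) ≤ n := n.cast_nonneg
    refine ODE_solution_unique_of_mem_Ioo (v := fun _ => F) (s := fun _ => univ) (K := K)
      (fun _ _ => hK.lipschitzOnWith) (t₀ := 0) (a := -(n + 1 : ℝ)) (b := n + 1)
      ⟨by linarith, by linarith⟩ (fun z hz => ⟨hα n z hz, mem_univ _⟩)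
      (fun z hz => ⟨hα k z ⟨by linarith [hz.1], by linarith [hz.2]⟩, mem_univ _⟩)
      ((h0 n).trans (h0 k).symm) ht
  -- The solution with index `n` lives on an interval of radius `n + 1`, so `t` is an interior point
  -- of the domain with index `⌈|t|⌉₊`. Near `t` all these choices agree with the next one.
  refine ⟨fun t => α ⌈|t|⌉₊ t, by simp [h0], fun t => ?_⟩
  set N := ⌈|t|⌉₊ + 1
  have hmem : ∀ s : ℝ, s ∈ Ioo (-((⌈|s|⌉₊ : ℝ) + 1)) ((⌈|s|⌉₊ : ℝ) + 1) := by
    intro s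
    have := Nat.le_ceil |s|
    have h1 := abs_le.1 this
    exact ⟨by linarith [h1.1], by linarith [h1.2]⟩
  have heq : (fun s => α ⌈|s|⌉₊ s) =ᶠ[𝓝 t] α N := by
    have hlt : |t| < N := by
      simp only [N]
      push_cast
      linarith [Nat.le_ceil |t|]
    filter_upwards [(continuous_abs.tendsto t).eventually (gt_mem_nhds hlt)] with s hs
    exact hagree _ _ (Nat.ceil_le.2 hs.le) s (hmem s)
  have hd : HasDerivAt (α N) (F (α N t)) t := by
    apply hα
    have h1 := hmem t
    simp only [N]
    push_cast
    exact ⟨by linarith [h1.1], by linarith [h1.2]⟩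
  rw [← heq.eq_of_nhds] at hd
  exact hd.congr_of_eventuallyEq heq

/-- The projection of `ℝ` onto `[p, q]`. -/
def clamp (p q x : ℝ) : ℝ := max p (min q x)

theorem clamp_mem {p q : ℝ} (h : p ≤ q) (x : ℝ) : clamp p q x ∈ Icc p q :=
  ⟨le_max_left _ _, max_le h (min_le_left _ _)⟩

theorem clamp_of_mem {p q x : ℝ} (h : x ∈ Icc p q) : clamp p q x = x := by
  simp [clamp, min_eq_right h.2, max_eq_right h.1]

theorem clamp_neg {p q : ℝ} (h : p ≤ q) (x : ℝ) : clamp (-q) (-p) (-x) = -clamp p q x := by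
  simp only [clamp, min_neg_neg, max_neg_neg]
  rw [max_comm p x, max_min_distrib_left, max_eq_right h, max_comm p x]

theorem lipschitzWith_clamp (p q : ℝ) : LipschitzWith 1 (clamp p q) :=
  (LipschitzWith.id.const_min q).const_max p

/-- The vector field, frozen outside of `[p, q] × [-M, M]`. -/
def clampField (a b : ℝ → ℝ) (p q M : ℝ) (x : ℝ × ℝ) : ℝ × ℝ :=
  planarField a b (clamp p q x.1, clamp (-M) M x.2)

/-- `γ` is an integral curve of the frozen field. -/
def IsClampOrbit (a b : ℝ → ℝ) (p q M : ℝ) (γ : ℝ → ℝ × ℝ) : Prop :=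
  ∀ t, HasDerivAt γ (clampField a b p q M (γ t)) t

/-- The coefficients are Lipschitz on `[p, q]`. -/
structure LipPair (a b : ℝ → ℝ) (p q : ℝ) : Prop where
  lipA : ∃ K, LipschitzOnWith K a (Icc p q)
  lipB : ∃ K, LipschitzOnWith K b (Icc p q)

namespace LipPair

variable {a b : ℝ → ℝ} {p q M : ℝ}

theorem ca (h : LipPair a b p q) : ContinuousOn a (Icc p q) := h.lipA.choose_spec.continuousOn

theorem cb (h : LipPair a b p q) : ContinuousOn b (Icc p q) := h.lipB.choose_spec.continuousOn

theorem neg (h : LipPair a b p q) : LipPair a (-b) p q :=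
  ⟨h.lipA, by obtain ⟨K, hK⟩ := h.lipB; exact ⟨K, hK.neg⟩⟩

theorem oddRefl (h : LipPair a b p q) : LipPair (oddRefl a) (oddRefl b) (-q) (-p) := by
  have key : ∀ {f : ℝ → ℝ}, (∃ K, LipschitzOnWith K f (Icc p q)) →
      ∃ K, LipschitzOnWith K (_root_.oddRefl f) (Icc (-q) (-p)) := by
    rintro f ⟨K, hK⟩
    have h1 : LipschitzOnWith (K * 1) (f ∘ Neg.neg) (Icc (-q) (-p)) :=
      hK.comp (LipschitzWith.id.neg.lipschitzOnWith)
        (fun x hx => ⟨show p ≤ -x by linarith [hx.2], show -x ≤ q by linarith [hx.1]⟩)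
    exact ⟨_, h1.neg⟩
  exact ⟨key h.lipA, key h.lipB⟩

theorem lipschitz (h : LipPair a b p q) (hpq : p ≤ q) (hM : 0 ≤ M) :
    ∃ K, LipschitzWith K (clampField a b p q M) := by
  obtain ⟨Ka, hKa⟩ := h.lipA
  obtain ⟨Kb, hKb⟩ := h.lipB
  obtain ⟨K, hK⟩ := planarField_lipschitzOn hKa hKb M
  have h1 : LipschitzWith 1 (fun x : ℝ × ℝ => (clamp p q x.1, clamp (-M) M x.2)) := by
    have e1 := (lipschitzWith_clamp p q).comp (LipschitzWith.prod_fst (α := ℝ) (β := ℝ))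
    have e2 := (lipschitzWith_clamp (-M) M).comp (LipschitzWith.prod_snd (α := ℝ) (β := ℝ))
    simpa using e1.prodMk e2
  refine ⟨K * 1, ?_⟩
  have h2 := hK.comp (h1.lipschitzOnWith (s := univ))
    (fun x _ => ⟨clamp_mem hpq _, clamp_mem (by linarith) _⟩)
  exact lipschitzOnWith_univ.1 h2

/-- The frozen field is bounded and globally Lipschitz, so its curves are global. Those that stay in
the box solve the original system, which avoids any discussion of maximal intervals of existence. -/
theorem exists_clampOrbit (h : LipPair a b p q) (hpq : p ≤ q) (hM : 0 ≤ M) (x₀ : ℝ × ℝ) :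
    ∃ γ, γ 0 = x₀ ∧ IsClampOrbit a b p q M γ := by
  obtain ⟨K, hK⟩ := h.lipschitz hpq hM
  obtain ⟨A, hA0, hA⟩ := exists_abs_bound_Icc h.ca
  obtain ⟨B, hB0, hB⟩ := exists_abs_bound_Icc h.cb
  have hb : ∀ x, ‖clampField a b p q M x‖ ≤ (M + A + B * M).toNNReal := by
    intro x
    have m1 := clamp_mem hpq x.1
    have m2 : |clamp (-M) M x.2| ≤ M := abs_le.2 (clamp_mem (by linarith) x.2)
    rw [Real.coe_toNNReal _ (by positivity), clampField, planarField, Prod.norm_def,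
      Real.norm_eq_abs, Real.norm_eq_abs]
    have hBM : 0 ≤ B * M := by positivity
    apply max_le
    · simp only; linarith
    · refine (abs_add_le _ _).trans ?_
      rw [abs_mul]
      have := mul_le_mul (hB _ m1) m2 (abs_nonneg _) hB0
      have := hA _ m1
      simp only at *
      linarith
  exact exists_global_solution hK hb x₀

theorem clampOrbit_unique (h : LipPair a b p q) (hpq : p ≤ q) (hM : 0 ≤ M) {γ δ : ℝ → ℝ × ℝ}
    (hγ : IsClampOrbit a b p q M γ) (hδ : IsClampOrbit a b p q M δ) {t : ℝ} (ht : γ t = δ t) :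
    γ = δ := by
  obtain ⟨K, hK⟩ := h.lipschitz hpq hM
  exact ODE_solution_unique_univ (v := fun _ => clampField a b p q M) (s := fun _ => univ)
    (fun _ => hK.lipschitzOnWith) (fun t => ⟨hγ t, mem_univ _⟩) (fun t => ⟨hδ t, mem_univ _⟩) ht

end LipPair

namespace IsClampOrbit

variable {a b : ℝ → ℝ} {p q M : ℝ} {γ : ℝ → ℝ × ℝ}

theorem continuous (h : IsClampOrbit a b p q M γ) : Continuous γ :=
  continuous_iff_continuousAt.2 fun t => (h t).continuousAt

theorem hasDerivAt_fst (h : IsClampOrbit a b p q M γ) {t : ℝ} (hw : |(γ t).2| ≤ M) :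
    HasDerivAt (fun t => (γ t).1) (γ t).2 t := by
  have h1 := hasFDerivAt_fst.comp_hasDerivAt t (h t)
  refine h1.congr_deriv ?_
  simp [clampField, planarField, clamp_of_mem (abs_le.1 hw)]

theorem hasDerivAt_snd (h : IsClampOrbit a b p q M γ) {t : ℝ} (hu : (γ t).1 ∈ Icc p q)
    (hw : |(γ t).2| ≤ M) :
    HasDerivAt (fun t => (γ t).2) (a (γ t).1 + b (γ t).1 * (γ t).2) t := by
  have h1 := hasFDerivAt_snd.comp_hasDerivAt t (h t)
  refine h1.congr_deriv ?_
  simp [clampField, planarField, clamp_of_mem (abs_le.1 hw), clamp_of_mem hu]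

theorem shift (h : IsClampOrbit a b p q M γ) (T : ℝ) :
    IsClampOrbit a b p q M (fun t => γ (t + T)) := fun t => (h (t + T)).comp_add_const t T

theorem reverse (h : IsClampOrbit a b p q M γ) (hM : 0 ≤ M) :
    IsClampOrbit a (-b) p q M (fun t => ((γ (-t)).1, -(γ (-t)).2)) := by
  intro t
  have h0 := (h (-t)).scomp t (hasDerivAt_neg t)
  have h1 := hasFDerivAt_fst.comp_hasDerivAt t h0
  have h2 := (hasFDerivAt_snd.comp_hasDerivAt t h0).neg
  refine (h1.prodMk h2).congr_deriv ?_
  have e : clamp (-M) M (-(γ (-t)).2) = -clamp (-M) M (γ (-t)).2 := by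
    simpa using clamp_neg (show -M ≤ M by linarith) (γ (-t)).2
  simp [clampField, planarField, e]

theorem spaceTimeRefl (h : IsClampOrbit a b p q M γ) (hpq : p ≤ q) :
    IsClampOrbit (oddRefl a) (oddRefl b) (-q) (-p) M (fun t => (-(γ (-t)).1, (γ (-t)).2)) := by
  intro t
  have h0 := (h (-t)).scomp t (hasDerivAt_neg t)
  have h1 := (hasFDerivAt_fst.comp_hasDerivAt t h0).neg
  have h2 := hasFDerivAt_snd.comp_hasDerivAt t h0
  refine (h1.prodMk h2).congr_deriv ?_
  simp only [clampField, planarField, clamp_neg hpq, oddRefl, neg_neg]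
  simp
  ring

end IsClampOrbit

/-- By the mean value theorem on `[z, z + 1]` the derivative takes the value `f (z + 1) - f z`,
which tends to zero, at points going to infinity. -/
theorem eq_zero_of_tendsto_deriv {f f' : ℝ → ℝ} {l L : ℝ}
    (hd : ∀ z, 0 ≤ z → HasDerivAt f (f' z) z) (hf : Tendsto f atTop (𝓝 L))
    (hf' : Tendsto f' atTop (𝓝 l)) : l = 0 := by
  have h1 : ∀ z, 0 ≤ z → ∃ ξ, z ≤ ξ ∧ f' ξ = f (z + 1) - f z := by
    intro z hz
    obtain ⟨ξ, hξ, h⟩ := exists_hasDerivAt_eq_slope f f' (show z < z + 1 by linarith)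
      (fun x hx => (hd x (hz.trans hx.1)).continuousAt.continuousWithinAt)
      (fun x hx => hd x (hz.trans hx.1.le))
    exact ⟨ξ, hξ.1.le, by rw [h]; simp⟩
  choose! ξ hξ1 hξ2 using h1
  have h2 : Tendsto ξ atTop atTop :=
    tendsto_atTop_mono' atTop ((eventually_ge_atTop 0).mono fun z hz => hξ1 z hz) tendsto_id
  have h3 : Tendsto (fun z => f (z + 1) - f z) atTop (𝓝 (L - L)) :=
    (hf.comp (tendsto_atTop_add_const_right _ 1 tendsto_id)).sub hf
  have h4 : Tendsto (fun z => f' (ξ z)) atTop (𝓝 (L - L)) :=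
    h3.congr' ((eventually_ge_atTop 0).mono fun z hz => (hξ2 z hz).symm)
  rw [sub_self] at h4
  exact tendsto_nhds_unique (hf'.comp h2) h4

/-! ### From arcs to solutions in time -/

namespace IsArc

variable {a b V : ℝ → ℝ} {p q x₀ M : ℝ} {γ : ℝ → ℝ × ℝ}

theorem nonneg (hV : IsArc a b p q V) {u : ℝ} (hu : u ∈ Icc p q) : 0 ≤ V u := by
  rcases eq_or_lt_of_le (hu.1.trans hu.2) with rfl | h
  · rw [le_antisymm hu.2 hu.1, hV.left]
  · exact hV.toIsGraph.nonneg h hu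

theorem abs_le (hV : IsArc a b p q V) (hM : ∀ u ∈ Icc p q, V u < M) {u : ℝ} (hu : u ∈ Icc p q) :
    |V u| ≤ M := by
  rw [abs_of_nonneg (hV.nonneg hu)]
  exact (hM u hu).le

/-- An integral curve on the arc at time `t` stays there for a while. -/
theorem exists_stay (hV : IsArc a b p q V) (hl : LipPair a b p q) (hM : ∀ u ∈ Icc p q, V u < M)
    (hγ : IsClampOrbit a b p q M γ) {t : ℝ} (h1 : (γ t).1 ∈ Ioo p q) (h2 : (γ t).2 = V (γ t).1) :
    ∃ η > 0, ∀ y ∈ Icc t (t + η), (γ y).1 ∈ Ioo p q ∧ (γ y).2 = V (γ y).1 := by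
  have hc1 : Continuous (fun z => (γ z).1) := hγ.continuous.fst
  have hc2 : Continuous (fun z => (γ z).2) := hγ.continuous.snd
  have hV0 := hV.pos _ h1
  have hcV : ContinuousAt V (γ t).1 := (hV.deriv _ h1).continuousAt
  obtain ⟨A, hA0, hA⟩ := exists_abs_bound_Icc hl.ca
  have ev : ∀ᶠ y in 𝓝 t, (γ y).1 ∈ Ioo p q ∧ (0 < (γ y).2 ∧ (γ y).2 < M) ∧
      V (γ t).1 / 2 < V (γ y).1 := by
    refine ((hc1.tendsto t).eventually_mem (isOpen_Ioo.mem_nhds h1)).and (.and ?_ ?_)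
    · exact (hc2.tendsto t).eventually_mem (isOpen_Ioo.mem_nhds (by
        rw [h2]; exact ⟨hV0, hM _ (Ioo_subset_Icc_self h1)⟩))
    · exact (hcV.tendsto.comp (hc1.tendsto t)).eventually (lt_mem_nhds (by linarith))
  obtain ⟨ε, hε, hball⟩ := Metric.eventually_nhds_iff.1 ev
  have hev : ∀ y ∈ Icc t (t + ε / 2), (γ y).1 ∈ Ioo p q ∧ (0 < (γ y).2 ∧ (γ y).2 < M) ∧
      V (γ t).1 / 2 < V (γ y).1 := fun y hy => hball (by
    rw [Real.dist_eq, abs_lt]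
    constructor <;> linarith [hy.1, hy.2])
  -- The defect `w - V u` satisfies the linear equation with rate `-(a / V)`, bounded while `V`
  -- stays above half its initial value. So it remains zero.
  have hd1 : ∀ y ∈ Icc t (t + ε / 2), HasDerivAt (fun z => (γ z).2 - V (γ z).1)
      (-(a (γ y).1 / V (γ y).1) * ((γ y).2 - V (γ y).1)) y := by
    intro y hy
    obtain ⟨e1, e2, e3⟩ := hev y hy
    have hw : |(γ y).2| ≤ M := by rw [abs_of_pos e2.1]; exact e2.2.le
    have hVp := hV.pos _ e1
    refine ((hγ.hasDerivAt_snd (Ioo_subset_Icc_self e1) hw).sub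
      ((hV.deriv _ e1).comp y (hγ.hasDerivAt_fst hw))).congr_deriv ?_
    field_simp
    ring
  have hzero := eq_zero_of_abs_deriv_le_mul_abs_self_of_eq_zero_right
    (f := fun z => (γ z).2 - V (γ z).1) (a := t) (b := t + ε / 2) (K := A / (V (γ t).1 / 2))
    (f' := fun y => -(a (γ y).1 / V (γ y).1) * ((γ y).2 - V (γ y).1))
    (fun y hy => (hd1 y hy).continuousAt.continuousWithinAt)
    (fun y hy => (hd1 y (Ico_subset_Icc_self hy)).hasDerivWithinAt) (by simp [h2])
    (fun y hy => by
      obtain ⟨e1, e2, e3⟩ := hev y (Ico_subset_Icc_self hy)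
      rw [norm_mul, norm_neg]
      refine mul_le_mul_of_nonneg_right ?_ (norm_nonneg _)
      rw [Real.norm_eq_abs, abs_div, abs_of_pos (hV.pos _ e1)]
      exact div_le_div₀ hA0 (hA _ (Ioo_subset_Icc_self e1)) (by linarith) e3.le)
  refine ⟨ε / 2, by positivity, fun y hy => ⟨(hev y hy).1, ?_⟩⟩
  have := hzero y hy
  linarith

/-- At the supremum of the good times the curve is still on the closed arc, and it could be
continued there unless it has reached the right end. Which alternative occurs depends on whether the
right end is an equilibrium. -/
theorem forward_dichotomy (hV : IsArc a b p q V) (hl : LipPair a b p q)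
    (hM : ∀ u ∈ Icc p q, V u < M)
    (hγ : IsClampOrbit a b p q M γ) (hx₀ : x₀ ∈ Ioo p q) (h0 : γ 0 = (x₀, V x₀)) :
    (∀ z, 0 ≤ z → (γ z).1 ∈ Ioo p q ∧ (γ z).2 = V (γ z).1) ∨
    ∃ β > 0, γ β = (q, 0) ∧ ∀ z ∈ Ico 0 β, (γ z).1 ∈ Ioo p q ∧ (γ z).2 = V (γ z).1 := by
  set G : ℝ → Prop := fun z => (γ z).1 ∈ Ioo p q ∧ (γ z).2 = V (γ z).1 with hG
  have hc1 : Continuous (fun z => (γ z).1) := hγ.continuous.fst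
  have hc2 : Continuous (fun z => (γ z).2) := hγ.continuous.snd
  set S : Set ℝ := {z | 0 ≤ z ∧ ∀ y ∈ Icc 0 z, G y} with hS
  have hG0 : G 0 := by simp [hG, h0, hx₀.1, hx₀.2]
  have h0S : (0:ℝ) ∈ S := ⟨le_rfl, fun y hy => by rwa [le_antisymm hy.2 hy.1]⟩
  by_cases hb : BddAbove S
  swap
  · left
    intro z hz
    rw [not_bddAbove_iff] at hb
    obtain ⟨s, hs, hzs⟩ := hb z
    exact hs.2 z ⟨hz, hzs.le⟩
  right
  set β := sSup S
  have hβ0 : 0 ≤ β := le_csSup hb h0S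
  have hgood : ∀ z ∈ Ico 0 β, G z := by
    intro z hz
    obtain ⟨s, hs, hzs⟩ := exists_lt_of_lt_csSup ⟨0, h0S⟩ hz.2
    exact hs.2 z ⟨hz.1, hzs.le⟩
  have hnot : ¬ G β := by
    intro hGβ
    obtain ⟨η, hη, hst⟩ := hV.exists_stay hl hM hγ hGβ.1 hGβ.2
    have : β + η ∈ S := by
      refine ⟨by linarith, fun y hy => ?_⟩
      rcases lt_or_ge y β with h | h
      · exact hgood y ⟨hy.1, h⟩
      · exact hst y ⟨h, hy.2⟩
    linarith [le_csSup hb this]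
  have hβ : 0 < β := lt_of_le_of_ne hβ0 (fun h => hnot (h ▸ hG0))
  have hmono : MonotoneOn (fun z => (γ z).1) (Icc 0 β) := by
    apply monotoneOn_Icc_of_hasDerivAt (f' := fun z => (γ z).2) hc1.continuousOn
    · intro z hz
      obtain ⟨e1, e2⟩ := hgood z (Ioo_subset_Ico_self hz)
      apply hγ.hasDerivAt_fst
      rw [e2]
      exact hV.abs_le hM (Ioo_subset_Icc_self e1)
    · intro z hz
      obtain ⟨e1, e2⟩ := hgood z (Ioo_subset_Ico_self hz)
      rw [e2]
      exact (hV.pos _ e1).le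
  have hpβ : p < (γ β).1 := by
    have := hmono (left_mem_Icc.2 hβ0) (right_mem_Icc.2 hβ0) hβ0
    simp only [h0] at this
    linarith [hx₀.1]
  have hne : (𝓝[Ico 0 β] β).NeBot := by
    rw [← mem_closure_iff_nhdsWithin_neBot, closure_Ico hβ.ne]
    exact right_mem_Icc.2 hβ0
  have hqβ : (γ β).1 ≤ q := by
    refine le_of_tendsto ((hc1.tendsto β).mono_left (nhdsWithin_le_nhds (s := Ico 0 β))) ?_
    filter_upwards [self_mem_nhdsWithin] with z hz using (hgood z hz).1.2.le
  have hVβ : (γ β).2 = V (γ β).1 := by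
    have t1 : Tendsto (fun z => V (γ z).1) (𝓝[Ico 0 β] β) (𝓝 (V (γ β).1)) := by
      refine (hV.cont _ ⟨hpβ.le, hqβ⟩).tendsto.comp (tendsto_nhdsWithin_iff.2
        ⟨(hc1.tendsto β).mono_left nhdsWithin_le_nhds, ?_⟩)
      filter_upwards [self_mem_nhdsWithin] with z hz using Ioo_subset_Icc_self (hgood z hz).1
    refine tendsto_nhds_unique ((hc2.tendsto β).mono_left (nhdsWithin_le_nhds (s := Ico 0 β))) ?_
    refine t1.congr' ?_
    filter_upwards [self_mem_nhdsWithin] with z hz using (hgood z hz).2.symm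
  have hq : (γ β).1 = q := by
    by_contra hne
    exact hnot ⟨⟨hpβ, lt_of_le_of_ne hqβ hne⟩, hVβ⟩
  refine ⟨β, hβ, Prod.ext hq ?_, hgood⟩
  rw [hVβ, hq, hV.right]

/-- The first coordinate increases to a limit `L`, the second tends to `V L`, and being the
derivative of a convergent function its limit is zero. Inside the interval `V` is positive, so `L =
q`. -/
theorem tendsto_of_forever (hV : IsArc a b p q V)
    (hM : ∀ u ∈ Icc p q, V u < M) (hγ : IsClampOrbit a b p q M γ)
    (hG : ∀ z, 0 ≤ z → (γ z).1 ∈ Ioo p q ∧ (γ z).2 = V (γ z).1) :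
    Tendsto γ atTop (𝓝 (q, 0)) := by
  have hd : ∀ z, 0 ≤ z → HasDerivAt (fun z => (γ z).1) (γ z).2 z := by
    intro z hz
    obtain ⟨e1, e2⟩ := hG z hz
    apply hγ.hasDerivAt_fst
    rw [e2]
    exact hV.abs_le hM (Ioo_subset_Icc_self e1)
  have hmono : MonotoneOn (fun z => (γ z).1) (Ici 0) := by
    intro x hx y hy hxy
    have : MonotoneOn (fun z => (γ z).1) (Icc x y) := by
      apply monotoneOn_Icc_of_hasDerivAt (f' := fun z => (γ z).2) hγ.continuous.fst.continuousOn
      · exact fun z hz => hd z (le_trans hx hz.1.le)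
      · intro z hz
        obtain ⟨e1, e2⟩ := hG z (le_trans hx hz.1.le)
        rw [e2]
        exact (hV.pos _ e1).le
    exact this (left_mem_Icc.2 hxy) (right_mem_Icc.2 hxy) hxy
  obtain ⟨L, hL⟩ : ∃ L, Tendsto (fun z => (γ z).1) atTop (𝓝 L) := by
    have hm : Monotone (fun z => (γ (max 0 z)).1) := fun x y hxy =>
      hmono (mem_Ici.2 (le_max_left _ _)) (mem_Ici.2 (le_max_left _ _)) (max_le_max le_rfl hxy)
    have hb : BddAbove (range fun z => (γ (max 0 z)).1) := by
      refine ⟨q, ?_⟩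
      rintro _ ⟨z, rfl⟩
      exact (hG _ (le_max_left _ _)).1.2.le
    refine ⟨_, (tendsto_atTop_ciSup hm hb).congr' ?_⟩
    filter_upwards [eventually_ge_atTop 0] with z hz
    rw [max_eq_right hz]
  have hLp : p < L := by
    refine (hG 0 le_rfl).1.1.trans_le (ge_of_tendsto hL ?_)
    filter_upwards [eventually_ge_atTop 0] with z hz
    exact hmono self_mem_Ici hz hz
  have hLq : L ≤ q := by
    refine le_of_tendsto hL ?_
    filter_upwards [eventually_ge_atTop 0] with z hz using (hG z hz).1.2.le
  have h2 : Tendsto (fun z => (γ z).2) atTop (𝓝 (V L)) := by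
    have : Tendsto (fun z => V (γ z).1) atTop (𝓝 (V L)) := by
      refine (hV.cont L ⟨hLp.le, hLq⟩).tendsto.comp (tendsto_nhdsWithin_iff.2 ⟨hL, ?_⟩)
      filter_upwards [eventually_ge_atTop 0] with z hz using Ioo_subset_Icc_self (hG z hz).1
    refine this.congr' ?_
    filter_upwards [eventually_ge_atTop 0] with z hz using (hG z hz).2.symm
  have hVL : V L = 0 := eq_zero_of_tendsto_deriv hd hL h2
  have hLeq : L = q := by
    by_contra hne
    exact (hV.pos L ⟨hLp, lt_of_le_of_ne hLq hne⟩).ne' hVL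
  rw [hVL] at h2
  rw [hLeq] at hL
  exact hL.prodMk_nhds h2

/-- Converging to `(q, 0)` in infinite time would make the derivative of `w` tend to `a q`, which
must then be zero. -/
theorem forward_of_neg (hV : IsArc a b p q V) (hl : LipPair a b p q)
    (hM : ∀ u ∈ Icc p q, V u < M) (hγ : IsClampOrbit a b p q M γ) (hx₀ : x₀ ∈ Ioo p q)
    (h0 : γ 0 = (x₀, V x₀)) (haq : a q ≠ 0) :
    ∃ β > 0, γ β = (q, 0) ∧ ∀ z ∈ Ico 0 β, (γ z).1 ∈ Ioo p q ∧ (γ z).2 = V (γ z).1 := by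
  rcases hV.forward_dichotomy hl hM hγ hx₀ h0 with h | h
  swap
  · exact h
  exfalso
  have ht := hV.tendsto_of_forever hM hγ h
  have h1 : Tendsto (fun z => (γ z).1) atTop (𝓝 q) := (continuous_fst.tendsto _).comp ht
  have h2 : Tendsto (fun z => (γ z).2) atTop (𝓝 0) := (continuous_snd.tendsto _).comp ht
  have hq : q ∈ Icc p q := right_mem_Icc.2 (hx₀.1.trans hx₀.2).le
  have h1' : Tendsto (fun z => (γ z).1) atTop (𝓝[Icc p q] q) := tendsto_nhdsWithin_iff.2 ⟨h1, by
    filter_upwards [eventually_ge_atTop 0] with z hz using Ioo_subset_Icc_self (h z hz).1⟩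
  have h3 : Tendsto (fun z => a (γ z).1 + b (γ z).1 * (γ z).2) atTop (𝓝 (a q + b q * 0)) :=
    ((hl.ca q hq).tendsto.comp h1').add (((hl.cb q hq).tendsto.comp h1').mul h2)
  have := eq_zero_of_tendsto_deriv (fun z hz => hγ.hasDerivAt_snd
    (Ioo_subset_Icc_self (h z hz).1) (by
      rw [(h z hz).2]; exact hV.abs_le hM (Ioo_subset_Icc_self (h z hz).1))) h2 h3
  simp only [mul_zero, add_zero] at this
  exact haq this

/-- An equilibrium cannot be reached in finite time, by uniqueness. -/
theorem forward_of_zero (hV : IsArc a b p q V) (hl : LipPair a b p q)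
    (hM : ∀ u ∈ Icc p q, V u < M) (hγ : IsClampOrbit a b p q M γ) (hx₀ : x₀ ∈ Ioo p q)
    (h0 : γ 0 = (x₀, V x₀)) (haq : a q = 0) :
    (∀ z, 0 ≤ z → (γ z).1 ∈ Ioo p q ∧ (γ z).2 = V (γ z).1) ∧ Tendsto γ atTop (𝓝 (q, 0)) := by
  rcases hV.forward_dichotomy hl hM hγ hx₀ h0 with h | ⟨β, hβ, hβq, -⟩
  · exact ⟨h, hV.tendsto_of_forever hM hγ h⟩
  exfalso
  have hpq := (hx₀.1.trans hx₀.2).le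
  have hM0 : 0 ≤ M := by
    have := hM q (right_mem_Icc.2 hpq)
    rw [hV.right] at this
    exact this.le
  have hconst : IsClampOrbit a b p q M (fun _ => (q, 0)) := by
    intro t
    refine (hasDerivAt_const t _).congr_deriv ?_
    have e1 := clamp_of_mem (right_mem_Icc.2 hpq)
    have e2 : clamp (-M) M 0 = 0 := clamp_of_mem ⟨by linarith, hM0⟩
    simp only [clampField, planarField, e1, e2, haq, mul_zero, add_zero]
    rfl
  have := hl.clampOrbit_unique hpq hM0 hγ hconst hβq
  rw [this] at h0
  have := congrArg Prod.fst h0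
  simp only at this
  linarith [hx₀.2]

theorem reflBound (hM : ∀ u ∈ Icc p q, V u < M) : ∀ u ∈ Icc (-q) (-p), V (-u) < M :=
  fun u hu => hM _ ⟨by linarith [hu.2], by linarith [hu.1]⟩

theorem backward_of_pos (hV : IsArc a b p q V) (hl : LipPair a b p q)
    (hM : ∀ u ∈ Icc p q, V u < M) (hγ : IsClampOrbit a b p q M γ) (hx₀ : x₀ ∈ Ioo p q)
    (h0 : γ 0 = (x₀, V x₀)) (hap : a p ≠ 0) :
    ∃ α < 0, γ α = (p, 0) ∧ ∀ z ∈ Ioc α 0, (γ z).1 ∈ Ioo p q ∧ (γ z).2 = V (γ z).1 := by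
  have hpq := (hx₀.1.trans hx₀.2).le
  obtain ⟨β, hβ, h1, h2⟩ := hV.refl.forward_of_neg hl.oddRefl (reflBound hM)
    (hγ.spaceTimeRefl hpq) (x₀ := -x₀) ⟨neg_lt_neg hx₀.2, neg_lt_neg hx₀.1⟩ (by simp [h0])
    (by simpa [oddRefl] using hap)
  refine ⟨-β, by linarith, ?_, fun z hz => ?_⟩
  · have e1 := congrArg Prod.fst h1
    have e2 := congrArg Prod.snd h1
    simp only [neg_inj] at e1 e2
    exact Prod.ext e1 e2
  · have := h2 (-z) ⟨by linarith [hz.2], by linarith [hz.1]⟩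
    simp only [neg_neg] at this
    exact ⟨⟨by linarith [this.1.2], by linarith [this.1.1]⟩, this.2⟩

theorem backward_of_zero (hV : IsArc a b p q V) (hl : LipPair a b p q)
    (hM : ∀ u ∈ Icc p q, V u < M) (hγ : IsClampOrbit a b p q M γ) (hx₀ : x₀ ∈ Ioo p q)
    (h0 : γ 0 = (x₀, V x₀)) (hap : a p = 0) :
    (∀ z, z ≤ 0 → (γ z).1 ∈ Ioo p q ∧ (γ z).2 = V (γ z).1) ∧ Tendsto γ atBot (𝓝 (p, 0)) := by
  have hpq := (hx₀.1.trans hx₀.2).le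
  obtain ⟨h1, h2⟩ := hV.refl.forward_of_zero hl.oddRefl (reflBound hM)
    (hγ.spaceTimeRefl hpq) (x₀ := -x₀) ⟨neg_lt_neg hx₀.2, neg_lt_neg hx₀.1⟩ (by simp [h0])
    (by simp [oddRefl, hap])
  refine ⟨fun z hz => ?_, ?_⟩
  · have := h1 (-z) (by linarith)
    simp only [neg_neg] at this
    exact ⟨⟨by linarith [this.1.2], by linarith [this.1.1]⟩, this.2⟩
  · have h3 := h2.comp tendsto_neg_atBot_atTop
    have h4 : Tendsto (fun x : ℝ × ℝ => (-x.1, x.2)) (𝓝 (-p, 0)) (𝓝 (p, 0)) := by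
      have : Continuous (fun x : ℝ × ℝ => (-x.1, x.2)) := by fun_prop
      simpa using this.tendsto (-p, 0)
    refine (h4.comp h3).congr fun z => ?_
    simp

/-- The integral curve that starts at the left end point of an arc. -/
theorem exists_upper (hV : IsArc a b p q V) (hl : LipPair a b p q) (hpq : p < q)
    (hM : ∀ u ∈ Icc p q, V u < M) (hap : a p ≠ 0) :
    ∃ γ, IsClampOrbit a b p q M γ ∧ γ 0 = (p, 0) ∧
      (a q ≠ 0 → ∃ T > 0, γ T = (q, 0) ∧ ∀ z ∈ Ioo 0 T, (γ z).1 ∈ Ioo p q ∧ (γ z).2 = V (γ z).1) ∧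
      (a q = 0 → (∀ z, 0 < z → (γ z).1 ∈ Ioo p q ∧ (γ z).2 = V (γ z).1) ∧
        Tendsto γ atTop (𝓝 (q, 0))) := by
  have hM0 : 0 ≤ M := by
    have := hM q (right_mem_Icc.2 hpq.le)
    rw [hV.right] at this
    exact this.le
  obtain ⟨x₀, hx₀⟩ := nonempty_Ioo.2 hpq
  obtain ⟨γ, h0, hγ⟩ := hl.exists_clampOrbit hpq.le hM0 (x₀, V x₀)
  obtain ⟨α, hα, hαp, hαV⟩ := hV.backward_of_pos hl hM hγ hx₀ h0 hap
  refine ⟨fun t => γ (t + α), hγ.shift α, by simpa using hαp, fun hq => ?_, fun hq => ?_⟩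
  · obtain ⟨β, hβ, hβq, hβV⟩ := hV.forward_of_neg hl hM hγ hx₀ h0 hq
    refine ⟨β - α, by linarith, by simpa using hβq, fun z hz => ?_⟩
    rcases le_or_gt (z + α) 0 with h | h
    · exact hαV _ ⟨by linarith [hz.1], h⟩
    · exact hβV _ ⟨h.le, by linarith [hz.2]⟩
  · obtain ⟨h1, h2⟩ := hV.forward_of_zero hl hM hγ hx₀ h0 hq
    refine ⟨fun z hz => ?_, h2.comp (tendsto_atTop_add_const_right _ _ tendsto_id)⟩
    rcases le_or_gt (z + α) 0 with h | h
    · exact hαV _ ⟨by linarith, h⟩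
    · exact h1 _ h.le

theorem exists_bound₂ {V₁ V₂ : ℝ → ℝ} (h1 : ContinuousOn V₁ (Icc p q))
    (h2 : ContinuousOn V₂ (Icc p q)) :
    ∃ M, (∀ u ∈ Icc p q, V₁ u < M) ∧ ∀ u ∈ Icc p q, V₂ u < M := by
  obtain ⟨B1, -, hB1⟩ := exists_abs_bound_Icc h1
  obtain ⟨B2, -, hB2⟩ := exists_abs_bound_Icc h2
  refine ⟨max B1 B2 + 1, fun u hu => ?_, fun u hu => ?_⟩
  · linarith [(le_abs_self _).trans (hB1 u hu), le_max_left B1 B2]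
  · linarith [(le_abs_self _).trans (hB2 u hu), le_max_right B1 B2]

end IsArc

theorem IsClampOrbit.isOrbit {a b : ℝ → ℝ} {p q M : ℝ} {γ : ℝ → ℝ × ℝ} {J : Set ℝ}
    (h : IsClampOrbit a b p q M γ) (hJ : Icc p q ⊆ J)
    (hbox : ∀ z, (γ z).1 ∈ Icc p q ∧ |(γ z).2| ≤ M) :
    IsOrbit a b J (fun z => (γ z).1) (fun z => (γ z).2) := fun z =>
  ⟨hJ (hbox z).1, h.hasDerivAt_fst (hbox z).2, h.hasDerivAt_snd (hbox z).1 (hbox z).2⟩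

variable {a b V₁ V₂ : ℝ → ℝ} {p q : ℝ} {J : Set ℝ}

/-- Two arcs with the same end points form a closed orbit. -/
theorem exists_closed_orbit (h1 : IsArc a b p q V₁) (h2 : IsArc a (-b) p q V₂)
    (hl : LipPair a b p q) (hpq : p < q) (hJ : Icc p q ⊆ J) (hap : a p ≠ 0) (haq : a q ≠ 0) :
    ∃ u w T Z, IsOrbit a b J u w ∧ 0 < T ∧ T < Z ∧ (∀ z, u (z + Z) = u z ∧ w (z + Z) = w z) ∧
      u 0 = p ∧ w 0 = 0 ∧ u T = q ∧ w T = 0 ∧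
      (∀ z ∈ Ioo 0 T, u z ∈ Ioo p q ∧ w z = V₁ (u z)) ∧
      ∀ z ∈ Ioo T Z, u z ∈ Ioo p q ∧ w z = -V₂ (u z) := by
  obtain ⟨M, hM1, hM2⟩ := IsArc.exists_bound₂ h1.cont h2.cont
  have hM0 : 0 ≤ M := by
    have := hM1 q (right_mem_Icc.2 hpq.le)
    rw [h1.right] at this
    exact this.le
  obtain ⟨γ, hγ, hγ0, hγq, -⟩ := h1.exists_upper hl hpq hM1 hap
  obtain ⟨δ, hδ, hδ0, hδq, -⟩ := h2.exists_upper hl.neg hpq hM2 hap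
  obtain ⟨T, hT, hTq, hTV⟩ := hγq haq
  obtain ⟨T', hT', hTq', hTV'⟩ := hδq haq
  have hδr := hδ.reverse hM0
  rw [neg_neg] at hδr
  -- The time reversal of the curve over the second arc passes through `(p, 0)` at time zero, hence
  -- it is the past of `γ`.
  have heq := hl.clampOrbit_unique hpq.le hM0 hγ hδr (t := 0) (by simp [hγ0, hδ0])
  -- `γ` is at `(q, 0)` both at time `T`, along the upper arc, and at time `-T'`, along the lower
  -- one.
  have hper : (fun t => γ (t + (T + T'))) = γ := by
    refine hl.clampOrbit_unique hpq.le hM0 (hγ.shift _) hγ (t := -T') ?_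
    have e1 : γ (-T') = (q, 0) := by rw [heq]; simp [hTq']
    rw [e1]
    simpa using hTq
  have hper' : ∀ z, γ (z + (T + T')) = γ z := fun z => congrFun hper z
  have hlow : ∀ z ∈ Ioo T (T + T'), (γ z).1 ∈ Ioo p q ∧ (γ z).2 = -V₂ (γ z).1 := by
    intro z hz
    have e1 : γ z = ((δ (T + T' - z)).1, -(δ (T + T' - z)).2) := by
      have := hper' (z - (T + T'))
      rw [sub_add_cancel] at this
      rw [this, heq]
      simp
    have e2 := hTV' (T + T' - z) ⟨by linarith [hz.2], by linarith [hz.1]⟩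
    rw [e1]
    exact ⟨e2.1, by simp only [e2.2]⟩
  have hbox : ∀ z, (γ z).1 ∈ Icc p q ∧ |(γ z).2| ≤ M := by
    intro z
    obtain ⟨y, hy, hyz⟩ := Function.Periodic.exists_mem_Ico₀ (f := γ) hper'
      (by linarith : 0 < T + T') z
    rw [hyz]
    rcases eq_or_lt_of_le hy.1 with h | h
    · rw [← h, hγ0]
      exact ⟨left_mem_Icc.2 hpq.le, by simpa using hM0⟩
    rcases lt_trichotomy y T with h' | h' | h'
    · obtain ⟨e1, e2⟩ := hTV y ⟨h, h'⟩
      exact ⟨Ioo_subset_Icc_self e1, e2 ▸ h1.abs_le hM1 (Ioo_subset_Icc_self e1)⟩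
    · rw [h', hTq]
      exact ⟨right_mem_Icc.2 hpq.le, by simpa using hM0⟩
    · obtain ⟨e1, e2⟩ := hlow y ⟨h', hy.2⟩
      refine ⟨Ioo_subset_Icc_self e1, ?_⟩
      rw [e2, abs_neg]
      exact h2.abs_le hM2 (Ioo_subset_Icc_self e1)
  exact ⟨fun z => (γ z).1, fun z => (γ z).2, T, T + T', hγ.isOrbit hJ hbox, hT, by linarith,
    fun z => by simp only [hper', and_self], by simp [hγ0], by simp [hγ0], by simp [hTq],
    by simp [hTq], hTV, hlow⟩

/-- Two arcs that end at the same equilibrium form a homoclinic orbit. -/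
theorem exists_homoclinic_orbit (h1 : IsArc a b p q V₁) (h2 : IsArc a (-b) p q V₂)
    (hl : LipPair a b p q) (hpq : p < q) (hJ : Icc p q ⊆ J) (hap : a p ≠ 0) (haq : a q = 0) :
    ∃ u w, IsOrbit a b J u w ∧ u 0 = p ∧ w 0 = 0 ∧
      (∀ z, 0 < z → u z ∈ Ioo p q ∧ w z = V₁ (u z)) ∧
      (∀ z, z < 0 → u z ∈ Ioo p q ∧ w z = -V₂ (u z)) ∧
      Tendsto u atBot (𝓝 q) ∧ Tendsto u atTop (𝓝 q) ∧
      Tendsto w atBot (𝓝 0) ∧ Tendsto w atTop (𝓝 0) := by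
  obtain ⟨M, hM1, hM2⟩ := IsArc.exists_bound₂ h1.cont h2.cont
  have hM0 : 0 ≤ M := by
    have := hM1 q (right_mem_Icc.2 hpq.le)
    rw [h1.right] at this
    exact this.le
  obtain ⟨γ, hγ, hγ0, -, hγq⟩ := h1.exists_upper hl hpq hM1 hap
  obtain ⟨δ, hδ, hδ0, -, hδq⟩ := h2.exists_upper hl.neg hpq hM2 hap
  obtain ⟨hTV, hTt⟩ := hγq haq
  obtain ⟨hTV', hTt'⟩ := hδq haq
  have hδr := hδ.reverse hM0
  rw [neg_neg] at hδr
  have heq := hl.clampOrbit_unique hpq.le hM0 hγ hδr (t := 0) (by simp [hγ0, hδ0])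
  have hlow : ∀ z, z < 0 → (γ z).1 ∈ Ioo p q ∧ (γ z).2 = -V₂ (γ z).1 := by
    intro z hz
    have e2 := hTV' (-z) (by linarith)
    rw [heq]
    exact ⟨e2.1, by simp only [e2.2]⟩
  have hbox : ∀ z, (γ z).1 ∈ Icc p q ∧ |(γ z).2| ≤ M := by
    intro z
    rcases lt_trichotomy z 0 with h | h | h
    · obtain ⟨e1, e2⟩ := hlow z h
      refine ⟨Ioo_subset_Icc_self e1, ?_⟩
      rw [e2, abs_neg]
      exact h2.abs_le hM2 (Ioo_subset_Icc_self e1)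
    · rw [h, hγ0]
      exact ⟨left_mem_Icc.2 hpq.le, by simpa using hM0⟩
    · obtain ⟨e1, e2⟩ := hTV z h
      exact ⟨Ioo_subset_Icc_self e1, e2 ▸ h1.abs_le hM1 (Ioo_subset_Icc_self e1)⟩
  have hTb : Tendsto γ atBot (𝓝 (q, 0)) := by
    have h3 := hTt'.comp tendsto_neg_atBot_atTop
    have h4 : Tendsto (fun x : ℝ × ℝ => (x.1, -x.2)) (𝓝 (q, 0)) (𝓝 (q, 0)) := by
      have : Continuous (fun x : ℝ × ℝ => (x.1, -x.2)) := by fun_prop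
      simpa using this.tendsto (q, 0)
    rw [heq]
    exact h4.comp h3
  exact ⟨fun z => (γ z).1, fun z => (γ z).2, hγ.isOrbit hJ hbox, by simp [hγ0], by simp [hγ0],
    hTV, hlow, (continuous_fst.tendsto _).comp hTb, (continuous_fst.tendsto _).comp hTt,
    (continuous_snd.tendsto _).comp hTb, (continuous_snd.tendsto _).comp hTt⟩

/-- An arc between two equilibria is a heteroclinic orbit. -/
theorem exists_heteroclinic_orbit {m : ℝ} (h1 : IsArc a b p q V₁) (hl : LipPair a b p q)
    (hJ : Icc p q ⊆ J) (hap : a p = 0) (haq : a q = 0) (hm : m ∈ Ioo p q) :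
    ∃ u w, IsOrbit a b J u w ∧ u 0 = m ∧ (∀ z, u z ∈ Ioo p q ∧ w z = V₁ (u z)) ∧
      Tendsto u atBot (𝓝 p) ∧ Tendsto u atTop (𝓝 q) ∧
      Tendsto w atBot (𝓝 0) ∧ Tendsto w atTop (𝓝 0) := by
  obtain ⟨M, hM1, -⟩ := IsArc.exists_bound₂ h1.cont h1.cont
  have hpq : p < q := hm.1.trans hm.2
  have hM0 : 0 ≤ M := by
    have := hM1 q (right_mem_Icc.2 hpq.le)
    rw [h1.right] at this
    exact this.le
  obtain ⟨γ, h0, hγ⟩ := hl.exists_clampOrbit hpq.le hM0 (m, V₁ m)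
  obtain ⟨hf1, hf2⟩ := h1.forward_of_zero hl hM1 hγ hm h0 haq
  obtain ⟨hb1, hb2⟩ := h1.backward_of_zero hl hM1 hγ hm h0 hap
  have hV : ∀ z, (γ z).1 ∈ Ioo p q ∧ (γ z).2 = V₁ (γ z).1 := fun z =>
    (le_total 0 z).elim (hf1 z) (hb1 z)
  have hbox : ∀ z, (γ z).1 ∈ Icc p q ∧ |(γ z).2| ≤ M := fun z =>
    ⟨Ioo_subset_Icc_self (hV z).1, (hV z).2 ▸ h1.abs_le hM1 (Ioo_subset_Icc_self (hV z).1)⟩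
  exact ⟨fun z => (γ z).1, fun z => (γ z).2, hγ.isOrbit hJ hbox, by simp [h0], hV,
    (continuous_fst.tendsto _).comp hb2, (continuous_fst.tendsto _).comp hf2,
    (continuous_snd.tendsto _).comp hb2, (continuous_snd.tendsto _).comp hf2⟩

/-! ### From solutions in time back to arcs -/

namespace IsOrbit

variable {a b u w : ℝ → ℝ} {J : Set ℝ} {A B m : ℝ}

theorem strictMonoOn_of_pos (h : IsOrbit a b J u w) {T : Set ℝ} (hT : T.OrdConnected)
    (hpos : ∀ z ∈ T, 0 < w z) : StrictMonoOn u T := by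
  apply strictMonoOn_of_deriv_pos hT.convex h.continuous_fst.continuousOn
  intro z hz
  rw [(h z).2.1.deriv]
  exact hpos z (interior_subset hz)

/-- Along an orbit the squared distance `(w - V u) ^ 2` to the branch is nonincreasing in time
because `a ≥ 0`, and it tends to zero at the start. The filter `l` covers a departure at finite time
as well as one from an equilibrium at `-∞`. -/
theorem height_eq_leftVal {l : Filter ℝ} [l.NeBot] (h : IsOrbit a b J u w) (hl : LeftCell a A m)
    (hb : ContinuousOn b (Icc A m)) {zm : ℝ} (hzm : u zm = m)
    (hT : ∀ᶠ y in l, y ≤ zm ∧ ∀ x ∈ Icc y zm, 0 < w x ∧ A < u x) (hu : Tendsto u l (𝓝 A))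
    (hw : Tendsto w l (𝓝 0)) : w zm = leftVal a b A m := by
  obtain ⟨hV, hVA⟩ := hl.spec hb
  set V := branch a b A m with hVdef
  have hmono : ∀ y, (y ≤ zm ∧ ∀ x ∈ Icc y zm, 0 < w x ∧ A < u x) → ∀ x ∈ Icc y zm,
      u x ∈ Icc A m := by
    rintro y ⟨hy, hx⟩ x hxm
    refine ⟨(hx x hxm).2.le, ?_⟩
    rw [← hzm]
    exact (h.strictMonoOn_of_pos ordConnected_Icc (fun z hz => (hx z hz).1)).monotoneOn hxm
      (right_mem_Icc.2 hy) hxm.2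
  have hsq : ∀ y, (y ≤ zm ∧ ∀ x ∈ Icc y zm, 0 < w x ∧ A < u x) →
      (w zm - V (u zm)) ^ 2 ≤ (w y - V (u y)) ^ 2 := by
    intro y hyT
    have hin := hmono y hyT
    obtain ⟨hy, hx⟩ := hyT
    have hsm := h.strictMonoOn_of_pos ordConnected_Icc (fun z hz => (hx z hz).1)
    have hin' : ∀ x ∈ Ioo y zm, u x ∈ Ioo A m := fun x hx' =>
      ⟨(hx x (Ioo_subset_Icc_self hx')).2, by
        rw [← hzm]
        exact hsm (Ioo_subset_Icc_self hx') (right_mem_Icc.2 hy) hx'.2⟩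
    have hanti : AntitoneOn (fun z => (w z - V (u z)) ^ 2) (Icc y zm) := by
      apply antitoneOn_Icc_of_hasDerivAt
        (f' := fun z => -(2 * (a (u z) / V (u z)) * (w z - V (u z)) ^ 2))
      · refine (h.continuous_snd.continuousOn.sub ?_).pow 2
        exact hV.cont.comp h.continuous_fst.continuousOn hin
      · intro z hz
        have hp := hV.pos _ (hin' z hz)
        have hd := ((h z).2.2.sub ((hV.deriv _ (hin' z hz)).comp z (h z).2.1)).pow 2
        refine hd.congr_deriv ?_
        simp only [Pi.sub_apply, Function.comp_apply, Nat.cast_ofNat, Nat.add_one_sub_one, pow_one]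
        field_simp
        ring
      · intro z hz
        have hp := hV.pos _ (hin' z hz)
        have ha := hl.pos _ (hin' z hz)
        have : 0 ≤ 2 * (a (u z) / V (u z)) * (w z - V (u z)) ^ 2 := by positivity
        linarith
    exact hanti (left_mem_Icc.2 hy) (right_mem_Icc.2 hy) hy
  have hlim : Tendsto (fun y => (w y - V (u y)) ^ 2) l (𝓝 0) := by
    have h1 : Tendsto u l (𝓝[Icc A m] A) := tendsto_nhdsWithin_iff.2 ⟨hu, by
      filter_upwards [hT] with y hy using hmono y hy y (left_mem_Icc.2 hy.1)⟩
    have h2 : Tendsto (fun y => V (u y)) l (𝓝 (V A)) :=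
      (hV.cont A (left_mem_Icc.2 hl.le)).tendsto.comp h1
    have h3 := (hw.sub h2).pow 2
    simpa [hVA] using h3
  have hle : (w zm - V (u zm)) ^ 2 ≤ 0 := ge_of_tendsto hlim (hT.mono hsq)
  have h0 : w zm - V (u zm) = 0 := by
    have := le_antisymm hle (sq_nonneg _)
    simpa using this
  rw [hzm] at h0
  simp only [leftVal]
  linarith

theorem height_eq_rightVal {l : Filter ℝ} [l.NeBot] (h : IsOrbit a b J u w)
    (hr : RightCell a m B) (hb : ContinuousOn b (Icc m B)) {zm : ℝ} (hzm : u zm = m)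
    (hT : ∀ᶠ y in l, zm ≤ y ∧ ∀ x ∈ Icc zm y, 0 < w x ∧ u x < B) (hu : Tendsto u l (𝓝 B))
    (hw : Tendsto w l (𝓝 0)) : w zm = rightVal a b m B := by
  have := h.spaceTimeRefl.height_eq_leftVal (l := map Neg.neg l) hr.refl hb.oddRefl
    (zm := -zm) (by simp [hzm]) ?_ ?_ ?_
  · simpa [rightVal] using this
  · rw [eventually_map]
    filter_upwards [hT] with y hy
    refine ⟨neg_le_neg hy.1, fun x hx => ?_⟩
    have := hy.2 (-x) ⟨by linarith [hx.2], by linarith [hx.1]⟩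
    exact ⟨this.1, by linarith [this.2]⟩
  · rw [tendsto_map'_iff]
    refine hu.neg.congr fun y => ?_
    simp
  · rw [tendsto_map'_iff]
    refine hw.congr fun y => ?_
    simp

/-- A piece of an orbit in the upper half plane, from `(A, 0)` to `(B, 0)`. -/
theorem crit_eq_of_segment {g : ℝ → ℝ} {μ : ℝ} {l₁ l₂ : Filter ℝ} [l₁.NeBot] [l₂.NeBot]
    {T : Set ℝ} (h : IsOrbit a (pert b g μ) J u w) (hc : Cell a b g A m B) (hT : T.OrdConnected)
    (hTne : T.Nonempty) (hpos : ∀ z ∈ T, 0 < w z) (h1 : ∀ z ∈ T, ∀ᶠ y in l₁, y ∈ T ∧ y < z)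
    (h2 : ∀ z ∈ T, ∀ᶠ y in l₂, y ∈ T ∧ z < y) (hu1 : Tendsto u l₁ (𝓝 A))
    (hw1 : Tendsto w l₁ (𝓝 0)) (hu2 : Tendsto u l₂ (𝓝 B)) (hw2 : Tendsto w l₂ (𝓝 0)) :
    crit a b g A B = μ := by
  have hsm := h.strictMonoOn_of_pos hT hpos
  have hA : ∀ z ∈ T, A < u z := by
    intro z hz
    obtain ⟨y, hyT, hyz⟩ := (h1 z hz).exists
    refine lt_of_le_of_lt ?_ (hsm hyT hz hyz)
    refine le_of_tendsto hu1 ?_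
    filter_upwards [h1 y hyT] with x hx using (hsm hx.1 hyT hx.2).le
  have hB : ∀ z ∈ T, u z < B := by
    intro z hz
    obtain ⟨y, hyT, hyz⟩ := (h2 z hz).exists
    refine (hsm hz hyT hyz).trans_le ?_
    refine ge_of_tendsto hu2 ?_
    filter_upwards [h2 y hyT] with x hx using (hsm hyT hx.1 hx.2).le
  obtain ⟨z₀, hz₀⟩ := hTne
  obtain ⟨y1, hy1T, hy1⟩ := ((h1 z₀ hz₀).and (hu1.eventually (gt_mem_nhds hc.hpm))).exists
  obtain ⟨y2, hy2T, hy2⟩ := ((h2 z₀ hz₀).and (hu2.eventually (lt_mem_nhds hc.hmq))).exists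
  have hy12 : y1 ≤ y2 := (hy1T.2.trans hy2T.2).le
  obtain ⟨zm, hzm, hzm'⟩ := intermediate_value_Icc hy12 h.continuous_fst.continuousOn
    (show m ∈ Icc (u y1) (u y2) from ⟨hy1.le, hy2.le⟩)
  have hzmT : zm ∈ T := hT.out hy1T.1 hy2T.1 hzm
  have e1 := h.height_eq_leftVal hc.left (hc.cpertl μ) hzm' (l := l₁) (by
    filter_upwards [h1 zm hzmT] with y hy
    refine ⟨hy.2.le, fun x hx => ?_⟩
    have hxT := hT.out hy.1 hzmT hx
    exact ⟨hpos x hxT, hA x hxT⟩) hu1 hw1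
  have e2 := h.height_eq_rightVal hc.right (hc.cpertr μ) hzm' (l := l₂) (by
    filter_upwards [h2 zm hzmT] with y hy
    refine ⟨hy.2.le, fun x hx => ?_⟩
    have hxT := hT.out hzmT hy.1 hx
    exact ⟨hpos x hxT, hB x hxT⟩) hu2 hw2
  obtain ⟨v, hv⟩ := IsArc.exists_of_eq hc.hpm hc.hmq hc.left hc.right (hc.cpert μ)
    (e1.symm.trans e2) (e1 ▸ hpos zm hzmT)
  exact (hc.eq_crit hv).symm

theorem crit_eq_of_Ioo {g : ℝ → ℝ} {μ α β : ℝ} (h : IsOrbit a (pert b g μ) J u w) (hαβ : α < β)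
    (hc : Cell a b g (u α) m (u β)) (hα : w α = 0) (hβ : w β = 0)
    (hpos : ∀ z ∈ Ioo α β, 0 < w z) : crit a b g (u α) (u β) = μ := by
  have hn1 : (𝓝[>] α).NeBot := inferInstance
  have hn2 : (𝓝[<] β).NeBot := inferInstance
  refine h.crit_eq_of_segment (l₁ := 𝓝[>] α) (l₂ := 𝓝[<] β) hc ordConnected_Ioo
    (nonempty_Ioo.2 hαβ) hpos (fun z hz => ?_) (fun z hz => ?_) ?_ ?_ ?_ ?_
  · filter_upwards [Ioo_mem_nhdsGT hz.1] with y hy using ⟨⟨hy.1, hy.2.trans hz.2⟩, hy.2⟩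
  · filter_upwards [Ioo_mem_nhdsLT hz.2] with y hy using ⟨⟨hz.1.trans hy.1, hy.2⟩, hy.1⟩
  · exact (h.continuous_fst.tendsto α).mono_left nhdsWithin_le_nhds
  · exact hα ▸ (h.continuous_snd.tendsto α).mono_left nhdsWithin_le_nhds
  · exact (h.continuous_fst.tendsto β).mono_left nhdsWithin_le_nhds
  · exact hβ ▸ (h.continuous_snd.tendsto β).mono_left nhdsWithin_le_nhds

theorem crit_eq_of_Ioi {g : ℝ → ℝ} {μ α : ℝ} (h : IsOrbit a (pert b g μ) J u w)
    (hc : Cell a b g (u α) m B) (hα : w α = 0) (hpos : ∀ z ∈ Ioi α, 0 < w z)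
    (hu : Tendsto u atTop (𝓝 B)) (hw : Tendsto w atTop (𝓝 0)) : crit a b g (u α) B = μ := by
  refine h.crit_eq_of_segment (l₁ := 𝓝[>] α) (l₂ := atTop) hc ordConnected_Ioi
    nonempty_Ioi hpos (fun z hz => ?_) (fun z hz => ?_) ?_ ?_ hu hw
  · filter_upwards [Ioo_mem_nhdsGT hz] with y hy using ⟨hy.1, hy.2⟩
  · filter_upwards [eventually_gt_atTop z] with y hy using ⟨lt_trans hz hy, hy⟩
  · exact (h.continuous_fst.tendsto α).mono_left nhdsWithin_le_nhds
  · exact hα ▸ (h.continuous_snd.tendsto α).mono_left nhdsWithin_le_nhds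

theorem crit_eq_of_univ {g : ℝ → ℝ} {μ : ℝ} (h : IsOrbit a (pert b g μ) J u w)
    (hc : Cell a b g A m B) (hpos : ∀ z, 0 < w z)
    (hu1 : Tendsto u atBot (𝓝 A)) (hw1 : Tendsto w atBot (𝓝 0))
    (hu : Tendsto u atTop (𝓝 B)) (hw : Tendsto w atTop (𝓝 0)) : crit a b g A B = μ := by
  refine h.crit_eq_of_segment (l₁ := atBot) (l₂ := atTop) hc ordConnected_univ
    univ_nonempty (fun z _ => hpos z) (fun z hz => ?_) (fun z hz => ?_) hu1 hw1 hu hw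
  · filter_upwards [eventually_lt_atBot z] with y hy using ⟨mem_univ _, hy⟩
  · filter_upwards [eventually_gt_atTop z] with y hy using ⟨mem_univ _, hy⟩

end IsOrbit

theorem HasDerivAt.eventually_pos_right {f : ℝ → ℝ} {f' x : ℝ} (h : HasDerivAt f f' x)
    (h0 : f x = 0) (hf' : 0 < f') : ∀ᶠ y in 𝓝[>] x, 0 < f y := by
  have h1 := (hasDerivAt_iff_tendsto_slope.1 h).eventually (lt_mem_nhds hf')
  have h2 := h1.filter_mono (nhdsWithin_mono x (show Ioi x ⊆ {x}ᶜ from fun y hy => ne_of_gt hy))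
  filter_upwards [h2, self_mem_nhdsWithin] with y hy hxy
  rw [slope_def_field, h0, sub_zero] at hy
  exact (div_pos_iff_of_pos_right (sub_pos.2 hxy)).1 hy

theorem HasDerivAt.eventually_pos_left {f : ℝ → ℝ} {f' x : ℝ} (h : HasDerivAt f f' x)
    (h0 : f x = 0) (hf' : f' < 0) : ∀ᶠ y in 𝓝[<] x, 0 < f y := by
  have h1 := (hasDerivAt_iff_tendsto_slope.1 h).eventually (gt_mem_nhds hf')
  have h2 := h1.filter_mono (nhdsWithin_mono x (show Iio x ⊆ {x}ᶜ from fun y hy => ne_of_lt hy))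
  filter_upwards [h2, self_mem_nhdsWithin] with y hy hxy
  rw [slope_def_field, h0, sub_zero] at hy
  have hxy' : y - x < 0 := sub_neg.2 hxy
  by_contra hcon
  exact absurd hy (not_lt.2 (div_nonneg_of_nonpos (not_lt.1 hcon) hxy'.le))

namespace LocLip

variable {a b g : ℝ → ℝ} {J : Set ℝ}

theorem neg (h : LocLip a J) : LocLip (-a) J := fun x y hxy => by
  obtain ⟨K, hK⟩ := h x y hxy
  exact ⟨K, hK.neg⟩

theorem pert (hb : LocLip b J) (hg : LocLip g J) (μ : ℝ) : LocLip (pert b g μ) J := by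
  intro x y hxy
  obtain ⟨K, hK⟩ := hb x y hxy
  obtain ⟨L, hL⟩ := hg x y hxy
  refine ⟨K + ‖μ‖₊ * L, LipschitzOnWith.of_dist_le_mul fun u hu v hv => ?_⟩
  have h1 := hK.dist_le_mul u hu v hv
  have h2 := hL.dist_le_mul u hu v hv
  rw [Real.dist_eq] at h1 h2 ⊢
  have e : _root_.pert b g μ u - _root_.pert b g μ v = (b u - b v) + μ * (g u - g v) := by
    simp only [_root_.pert]
    ring
  rw [e]
  refine (abs_add_le _ _).trans ?_
  rw [abs_mul]
  push_cast
  rw [Real.norm_eq_abs]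
  have := mul_le_mul_of_nonneg_left h2 (abs_nonneg μ)
  linarith

theorem continuousOn_Icc (h : LocLip a J) {p q : ℝ} (hpq : Icc p q ⊆ J) :
    ContinuousOn a (Icc p q) := (h p q hpq).choose_spec.continuousOn

theorem preimage_neg (h : LocLip a J) : LocLip (fun x => a (-x)) (Neg.neg ⁻¹' J) := by
  intro x y hxy
  obtain ⟨K, hK⟩ := h (-y) (-x) (fun z hz => by
    have := hxy (show -z ∈ Icc x y from ⟨by linarith [hz.2], by linarith [hz.1]⟩)
    simpa using this)
  have h1 : LipschitzOnWith (K * 1) (a ∘ Neg.neg) (Icc x y) :=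
    hK.comp (LipschitzWith.id.neg.lipschitzOnWith)
      (fun z hz => ⟨show -y ≤ -z by linarith [hz.2], show -z ≤ -x by linarith [hz.1]⟩)
  exact ⟨_, h1⟩

theorem oddRefl (h : LocLip a J) : LocLip (oddRefl a) (Neg.neg ⁻¹' J) := h.preimage_neg.neg

theorem lipPair (ha : LocLip a J) (hb : LocLip b J) {p q : ℝ} (hpq : Icc p q ⊆ J) :
    LipPair a b p q := ⟨ha p q hpq, hb p q hpq⟩

end LocLip

theorem Set.OrdConnected.preimage_neg {J : Set ℝ} (h : J.OrdConnected) :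
    (Neg.neg ⁻¹' J).OrdConnected :=
  ⟨fun _ hx _ hy _ hz => h.out hy hx ⟨neg_le_neg hz.2, neg_le_neg hz.1⟩⟩

theorem isOrbit_const {a b : ℝ → ℝ} {J : Set ℝ} {x : ℝ} (hx : x ∈ J) (ha : a x = 0) :
    IsOrbit a b J (fun _ => x) (fun _ => 0) := fun z =>
  ⟨hx, hasDerivAt_const z x, by simpa [ha] using hasDerivAt_const z (0 : ℝ)⟩

namespace IsOrbit

variable {a b u w : ℝ → ℝ} {J : Set ℝ} {z : ℝ}

theorem const_of_eq (h : IsOrbit a b J u w) (hJ : J.OrdConnected) (ha : LocLip a J)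
    (hb : LocLip b J) (hw : w z = 0) (h0 : a (u z) = 0) (y : ℝ) : u y = u z ∧ w y = 0 := by
  have := unique hJ ha hb h (isOrbit_const (h z).1 h0) (t₀ := z) rfl hw
  exact ⟨congrFun this.1 y, congrFun this.2 y⟩

theorem snd_eq_zero_of_max (h : IsOrbit a b J u w) (hz : ∀ y, u y ≤ u z) : w z = 0 :=
  (show IsLocalMax u z from Eventually.of_forall hz).hasDerivAt_eq_zero (h z).2.1

theorem hasDerivAt_snd_of_eq (h : IsOrbit a b J u w) (hw : w z = 0) :
    HasDerivAt w (a (u z)) z := (h z).2.2.congr_deriv (by simp [hw])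

/-- If `a` were positive there, `w` would become positive right after `z` and `u` would exceed its
maximum. -/
theorem nonpos_of_max (h : IsOrbit a b J u w) (hz : ∀ y, u y ≤ u z) : a (u z) ≤ 0 := by
  have hw := h.snd_eq_zero_of_max hz
  by_contra hcon
  push Not at hcon
  obtain ⟨x, hx, hxs⟩ := (mem_nhdsGT_iff_exists_Ioo_subset' (show z < z + 1 by linarith)).1
    ((h.hasDerivAt_snd_of_eq hw).eventually_pos_right hw hcon)
  have hm : StrictMonoOn u (Icc z x) := by
    apply strictMonoOn_of_deriv_pos (convex_Icc z x) h.continuous_fst.continuousOn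
    intro y hy
    rw [(h y).2.1.deriv]
    rw [interior_Icc] at hy
    exact hxs hy
  have := hm (left_mem_Icc.2 (le_of_lt hx)) (right_mem_Icc.2 (le_of_lt hx)) hx
  linarith [hz x]

theorem neg_of_max (h : IsOrbit a b J u w) (hJ : J.OrdConnected) (ha : LocLip a J)
    (hb : LocLip b J) (hz : ∀ y, u y ≤ u z) {y : ℝ} (hne : u y ≠ u z) : a (u z) < 0 := by
  refine lt_of_le_of_ne (h.nonpos_of_max hz) fun h0 => hne ?_
  exact (h.const_of_eq hJ ha hb (h.snd_eq_zero_of_max hz) h0 y).1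

theorem pos_of_min (h : IsOrbit a b J u w) (hJ : J.OrdConnected) (ha : LocLip a J)
    (hb : LocLip b J) (hz : ∀ y, u z ≤ u y) {y : ℝ} (hne : u y ≠ u z) :
    w z = 0 ∧ 0 < a (u z) := by
  have hr := h.spaceRefl
  have hz' : ∀ y, -u y ≤ -u z := fun y => neg_le_neg (hz y)
  have h1 := hr.snd_eq_zero_of_max hz'
  have h2 := hr.neg_of_max hJ.preimage_neg ha.oddRefl hb.preimage_neg hz' (y := y)
    (by simpa using hne)
  simp only [oddRefl, neg_neg] at h2
  exact ⟨by simpa using h1, by linarith⟩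

end IsOrbit

/-! ### The extremes of a periodic or homoclinic solution form a matched pair -/

/-- The equilibrium `m` is a centre or a focus; the neighbouring equilibria, if any, are
`e < m < s`. -/
structure Scene (a b g : ℝ → ℝ) (J : Set ℝ) (e m s : ℝ) : Prop where
  hem : e < m
  hms : m < s
  ord : J.OrdConnected
  la : LocLip a J
  lb : LocLip b J
  lg : LocLip g J
  sub : Ioo e s ⊆ J
  gpos : ∀ x ∈ J, 0 < g x
  zero : a m = 0
  apos : ∀ x ∈ Ioo e m, 0 < a x
  aneg : ∀ x ∈ Ioo m s, a x < 0
  low : ∀ x ∈ J, x < s → 0 < a x → x ∈ Ioo e m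
  high : ∀ x ∈ J, e < x → a x < 0 → x ∈ Ioo m s
  nondeg : ∃ k > 0, ∀ᶠ u in 𝓝 m, k * (u - m) ^ 2 ≤ |a u|
  db : DifferentiableAt ℝ b m
  dg : DifferentiableAt ℝ g m

namespace Scene

variable {a b g u w : ℝ → ℝ} {J : Set ℝ} {e m s p q μ : ℝ}

theorem neg (S : Scene a b g J e m s) : Scene a (-b) g J e m s :=
  { S with lb := S.lb.neg, db := S.db.neg }

/-- The ends must be asked to lie in `J`: when `f` has only two positive zeros, `e = 0` lies outside
the half line `J`, where the coefficients are not controlled. -/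
theorem cell (S : Scene a b g J e m s) (hpJ : p ∈ J) (hp : e ≤ p) (hpm : p < m) (hqJ : q ∈ J)
    (hmq : m < q) (hq : q ≤ s) : Cell a b g p m q := by
  have hsub : Icc p q ⊆ J := S.ord.out hpJ hqJ
  exact ⟨hpm, hmq, S.la.continuousOn_Icc hsub, S.lb.continuousOn_Icc hsub,
    S.lg.continuousOn_Icc hsub, fun x hx => S.apos x ⟨hp.trans_lt hx.1, hx.2⟩,
    fun x hx => S.aneg x ⟨hx.1, hx.2.trans_le hq⟩, fun x hx => S.gpos x (hsub hx), S.nondeg,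
    S.db, S.dg⟩

theorem cell' (S : Scene a b g J e m s) (hp : p ∈ Ioo e m) (hq : q ∈ Ioo m s) :
    Cell a b g p m q :=
  S.cell (S.sub ⟨hp.1, hp.2.trans S.hms⟩) hp.1.le hp.2 (S.sub ⟨S.hem.trans hq.1, hq.2⟩) hq.1
    hq.2.le

theorem refl (S : Scene a b g J e m s) :
    Scene (oddRefl a) (fun x => b (-x)) (fun x => g (-x)) (Neg.neg ⁻¹' J) (-s) (-m) (-e) where
  hem := neg_lt_neg S.hms
  hms := neg_lt_neg S.hem
  ord := S.ord.preimage_neg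
  la := S.la.oddRefl
  lb := S.lb.preimage_neg
  lg := S.lg.preimage_neg
  sub := fun x hx => S.sub ⟨by linarith [hx.2], by linarith [hx.1]⟩
  gpos := fun x hx => S.gpos _ hx
  zero := by simp [oddRefl, S.zero]
  apos := fun x hx => by
    have := S.aneg (-x) ⟨by linarith [hx.2], by linarith [hx.1]⟩
    simp only [oddRefl]
    linarith
  aneg := fun x hx => by
    have := S.apos (-x) ⟨by linarith [hx.2], by linarith [hx.1]⟩
    simp only [oddRefl]
    linarith
  low := fun x hx hxs ha => by
    have := S.high (-x) hx (by linarith) (by simpa [oddRefl] using ha)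
    exact ⟨by linarith [this.2], by linarith [this.1]⟩
  high := fun x hx hxs ha => by
    have := S.low (-x) hx (by linarith) (by simpa [oddRefl] using ha)
    exact ⟨by linarith [this.2], by linarith [this.1]⟩
  nondeg := by
    obtain ⟨k, hk, hev⟩ := S.nondeg
    refine ⟨k, hk, ?_⟩
    have ht : Tendsto (fun u : ℝ => -u) (𝓝 (-m)) (𝓝 m) := by
      simpa using (continuous_neg (G := ℝ)).tendsto (-m)
    filter_upwards [ht.eventually hev] with u hu
    simp only [oddRefl, abs_neg]
    convert hu using 2
    ring
  db := by
    have := S.db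
    exact DifferentiableAt.comp (-m) (by simpa using this) differentiableAt_id.neg
  dg := by
    have := S.dg
    exact DifferentiableAt.comp (-m) (by simpa using this) differentiableAt_id.neg

/-- The part of an orbit that follows a zero of `w` in the upper half plane. -/
theorem exists_next_zero (S : Scene a b g J e m s) (h : IsOrbit a (pert b g μ) J u w)
    (hnc : ∃ y z, u y ≠ u z) {α γ : ℝ} (hα : w α = 0) (hpos : 0 < a (u α)) (hγ : w γ ≤ 0)
    (hαγ : α < γ) :
    ∃ β ∈ Ioc α γ, w β = 0 ∧ a (u β) < 0 ∧ u α < u β ∧ ∀ z ∈ Ioo α β, 0 < w z := by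
  have hev := (h.hasDerivAt_snd_of_eq hα).eventually_pos_right hα hpos
  obtain ⟨x, hx, hxs⟩ := (mem_nhdsGT_iff_exists_Ioo_subset' hαγ).1 hev
  obtain ⟨y, hy⟩ := nonempty_Ioo.2 (show α < x from hx)
  have hyγ : y < γ := by
    by_contra hcon
    push Not at hcon
    have : 0 < w γ := hxs ⟨hαγ, hcon.trans_lt hy.2⟩
    linarith
  obtain ⟨β, hβ, hβ0, hβp⟩ := exists_first_zero hyγ.le h.continuous_snd.continuousOn (hxs hy) hγ
  have hp : ∀ z ∈ Ioo α β, 0 < w z := by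
    intro z hz
    rcases lt_or_ge z y with hzy | hzy
    · exact hxs ⟨hz.1, hzy.trans hy.2⟩
    · exact hβp z ⟨hzy, hz.2⟩
  have hαβ : α < β := hy.1.trans hβ.1
  have hlt : u α < u β := by
    have hm : StrictMonoOn u (Icc α β) := by
      apply strictMonoOn_of_deriv_pos (convex_Icc α β) h.continuous_fst.continuousOn
      intro y hy
      rw [(h y).2.1.deriv]
      rw [interior_Icc] at hy
      exact hp y hy
    exact hm (left_mem_Icc.2 hαβ.le) (right_mem_Icc.2 hαβ.le) hαβ
  refine ⟨β, ⟨hαβ, hβ.2⟩, hβ0, ?_, hlt, hp⟩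
  -- Since `w` comes down to zero, `a` cannot be positive at `u β`; if it vanished, the solution
  -- would be an equilibrium.
  refine lt_of_le_of_ne ?_ fun h0 => ?_
  · by_contra hcon
    push Not at hcon
    have hd := (h.hasDerivAt_snd_of_eq hβ0).neg
    have hl := hd.eventually_pos_left (by simp [hβ0]) (by linarith)
    obtain ⟨z, hz1, hz2⟩ := (hl.and (Ioo_mem_nhdsLT hαβ)).exists
    have := hp z hz2
    simp only [Pi.neg_apply] at hz1
    linarith
  · obtain ⟨y, z, hyz⟩ := hnc
    have hc := h.const_of_eq S.ord S.la (S.lb.pert S.lg μ) hβ0 h0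
    exact hyz ((hc y).1.trans (hc z).1.symm)

/-- The part of an orbit that precedes a zero of `w` in the upper half plane. -/
theorem exists_previous_zero (S : Scene a b g J e m s) (h : IsOrbit a (pert b g μ) J u w)
    (hnc : ∃ y z, u y ≠ u z) {β γ : ℝ} (hβ : w β = 0) (hneg : a (u β) < 0) (hγ : w γ ≤ 0)
    (hγβ : γ < β) :
    ∃ α ∈ Ico γ β, w α = 0 ∧ 0 < a (u α) ∧ u α < u β ∧ ∀ z ∈ Ioo α β, 0 < w z := by
  -- Time reversal turns the past into the future but exchanges the half planes; the reflection in
  -- space exchanges them back.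
  have h' := h.reverse.spaceRefl
  have hS := S.refl.neg
  have e1 : (fun x => (-pert b g μ) (-x)) =
      pert (-fun x => b (-x)) (fun x => g (-x)) (-μ) := by
    funext x
    simp only [pert, Pi.neg_apply]
    ring
  rw [e1] at h'
  obtain ⟨α, hα, h0, h1, h2, h3⟩ := hS.exists_next_zero h' (α := -β) (γ := -γ) (by
    obtain ⟨y, z, hyz⟩ := hnc
    exact ⟨-y, -z, by simpa using hyz⟩) (by simpa using hβ)
    (by simpa [oddRefl] using hneg) (by simpa using hγ) (by linarith)
  refine ⟨-α, ⟨by linarith [hα.2], by linarith [hα.1]⟩, by simpa using h0,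
    by simpa [oddRefl] using h1, by simpa using h2, fun z hz => ?_⟩
  have := h3 (-z) ⟨by linarith [hz.2], by linarith [hz.1]⟩
  simpa using this

end Scene

theorem Continuous.exists_forall_ge_of_tendsto {f : ℝ → ℝ} {s x₀ : ℝ} (hf : Continuous f)
    (h1 : Tendsto f atBot (𝓝 s)) (h2 : Tendsto f atTop (𝓝 s)) (hx : s < f x₀) :
    ∃ x, ∀ y, f y ≤ f x := by
  apply hf.exists_forall_ge' x₀
  rw [cocompact_eq_atBot_atTop, eventually_sup]
  exact ⟨(h1.eventually (gt_mem_nhds hx)).mono fun _ h => le_of_lt h,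
    (h2.eventually (gt_mem_nhds hx)).mono fun _ h => le_of_lt h⟩

theorem Function.Periodic.exists_forall_ge {f : ℝ → ℝ} {Z : ℝ} (h : Function.Periodic f Z)
    (hf : Continuous f) (hZ : 0 < Z) : ∃ x, ∀ y, f y ≤ f x := by
  obtain ⟨x, -, hx⟩ := isCompact_Icc.exists_isMaxOn (nonempty_Icc.2 hZ.le) hf.continuousOn
  refine ⟨x, fun y => ?_⟩
  obtain ⟨y', hy', he⟩ := h.exists_mem_Ico₀ hZ y
  rw [he]
  exact hx (Ico_subset_Icc_self hy')

namespace Scene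

variable {a b g u w : ℝ → ℝ} {J : Set ℝ} {e m s p q μ Z za zb : ℝ}

/-- An orbit could a priori make several turns between its minimum and its maximum. The arc that
starts at the minimum and the arc that ends at the maximum are both critical for `μ`, and strict
monotonicity of `crit` in both ends forces them to coincide. -/
theorem crit_of_periodic (S : Scene a b g J e m s) (h : IsOrbit a (pert b g μ) J u w)
    (hper : Function.Periodic u Z) (hZ : 0 < Z) (hmin : ∀ y, u za ≤ u y)
    (hmax : ∀ y, u y ≤ u zb) (hp : u za ∈ Ioo e m) (hq : u zb ∈ Ioo m s) :
    crit a b g (u za) (u zb) = μ := by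
  obtain ⟨y, hy, hyu⟩ := hper.exists_mem_Ioc hZ zb za
  rw [hyu] at hmax hq ⊢
  have hpq : u za < u y := hp.2.trans hq.1
  have hnc : ∃ y z, u y ≠ u z := ⟨_, _, hpq.ne⟩
  have hwy : w y = 0 := h.snd_eq_zero_of_max hmax
  have hay : a (u y) < 0 := S.aneg _ hq
  obtain ⟨hwa, haa⟩ := h.pos_of_min S.ord S.la (S.lb.pert S.lg μ) hmin (y := y) hpq.ne'
  obtain ⟨α, hα, hα0, hα1, hα2, hα3⟩ := S.exists_previous_zero h hnc hwy hay hwa.le hy.1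
  obtain ⟨β, hβ, hβ0, hβ1, hβ2, hβ3⟩ := S.exists_next_zero h hnc hwa haa hwy.le hy.1
  have hA : u α ∈ Ioo e m := S.low _ (h α).1 ((hmax α).trans_lt hq.2) hα1
  have hB : u β ∈ Ioo m s := S.high _ (h β).1 (hp.1.trans_le (hmin β)) hβ1
  have e1 := h.crit_eq_of_Ioo hα.2 (S.cell' hA hq) hα0 hwy hα3
  have e2 := h.crit_eq_of_Ioo hβ.1 (S.cell' hp hB) hwa hβ0 hβ3
  -- The pair `(u za, u β)` lies weakly to the left of `(u α, u y)` in both coordinates, yet `crit`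
  -- takes the value `μ` at both.
  have key : ¬ (u za < u α ∨ u β < u y) := fun hne => by
    have := (S.cell' hp hq).crit_strictMono (hmin α) hA.2 hB.1 (hmax β) hne
    linarith
  push Not at key
  rw [← le_antisymm key.1 (hmin α)]
  exact e1

/-- The one-sided statement is applied to the orbit and to its time reversal. The conditions at time
zero exclude equilibria and, through the sign pattern of `a`, place the extremes in the two
intervals next to `m`. -/
theorem exists_matched_of_periodic (S : Scene a b g J e m s) (h : IsOrbit a (pert b g μ) J u w)
    (hper : Function.Periodic u Z) (hZ : 0 < Z) (h0 : u 0 ∈ Ioo e s) (hm : u 0 ≠ m)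
    (hw : w 0 = 0) :
    ∃ p ∈ Ioo e m, ∃ q ∈ Ioo m s, critGap a b g p q = 0 ∧ crit a b g p q = μ ∧
      ∃ z, u z = p ∧ w z = 0 := by
  obtain ⟨zb, hmax⟩ := hper.exists_forall_ge h.continuous_fst hZ
  obtain ⟨za, hmin'⟩ := Function.Periodic.exists_forall_ge (f := fun z => -u z)
    (fun z => by simp [hper z]) h.continuous_fst.neg hZ
  have hmin : ∀ y, u za ≤ u y := fun y => neg_le_neg_iff.1 (hmin' y)
  have hcoef := S.lb.pert S.lg μ
  have h00 : a (u 0) ≠ 0 := by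
    rcases lt_or_gt_of_ne hm with hlt | hlt
    · exact (S.apos _ ⟨h0.1, hlt⟩).ne'
    · exact (S.aneg _ ⟨hlt, h0.2⟩).ne
  have hne : u za ≠ u zb := by
    intro heq
    have hc : ∀ y, u y = u 0 := fun y =>
      (le_antisymm ((hmax y).trans (heq ▸ hmin 0)) ((hmax 0).trans (heq ▸ hmin y)))
    have hw' : ∀ y, w y = 0 := fun y => by
      have h1 : HasDerivAt u 0 y := by
        rw [show u = fun _ => u 0 from funext hc]
        exact hasDerivAt_const _ _
      exact (h y).2.1.unique h1
    have h2 : HasDerivAt w 0 0 := by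
      rw [show w = fun _ => 0 from funext hw']
      exact hasDerivAt_const _ _
    exact h00 ((h.hasDerivAt_snd_of_eq hw).unique h2)
  have haq := h.neg_of_max S.ord S.la hcoef hmax hne
  obtain ⟨hwa, hap⟩ := h.pos_of_min S.ord S.la hcoef hmin hne.symm
  have hp : u za ∈ Ioo e m := S.low _ (h za).1 ((hmin 0).trans_lt h0.2) hap
  have hq : u zb ∈ Ioo m s := S.high _ (h zb).1 (h0.1.trans_le (hmax 0)) haq
  have e1 := S.crit_of_periodic h hper hZ hmin hmax hp hq
  have hr := h.reverse
  rw [← pert_neg] at hr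
  have e2 := S.neg.crit_of_periodic hr (za := -za) (zb := -zb) (Z := Z)
    (fun z => by
      have := hper (-z - Z)
      simp only [sub_add_cancel] at this
      simp only [neg_add', this]) hZ (fun y => by simpa using hmin (-y))
    (fun y => by simpa using hmax (-y)) (by simpa using hp) (by simpa using hq)
  simp only [neg_neg] at e2
  exact ⟨_, hp, _, hq, by rw [critGap, e1, e2]; ring, e1, za, rfl, hwa⟩

/-- The final arc, from the last zero of `w` to the equilibrium, and the arc that leaves the minimum
are both critical for `μ`; unless the final arc starts at the minimum this contradicts strict
monotonicity of `crit`. -/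
theorem crit_of_pulse (S : Scene a b g J e m s) (hs : s ∈ J)
    (h : IsOrbit a (pert b g μ) J u w) (hu : Tendsto u atTop (𝓝 s)) (hw : Tendsto w atTop (𝓝 0))
    (hmin : ∀ y, u za ≤ u y) (hp : u za ∈ Ioo e m) (hlt : ∀ y, u y < s) :
    crit a b g (u za) s = μ := by
  have hnc : ∃ y z, u y ≠ u z := by
    obtain ⟨y, hy⟩ := (hu.eventually (lt_mem_nhds (hp.2.trans S.hms))).exists
    exact ⟨_, _, hy.ne'⟩
  obtain ⟨y₀, hy₀⟩ := hnc
  obtain ⟨z₀', hz₀'⟩ := eventually_atTop.1 (hu.eventually (lt_mem_nhds S.hms))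
  have hwa0 : w za = 0 ∧ 0 < a (u za) := by
    obtain ⟨y, hy⟩ := (hu.eventually (lt_mem_nhds (hp.2.trans S.hms))).exists
    exact h.pos_of_min S.ord S.la (S.lb.pert S.lg μ) hmin (y := y) hy.ne'
  obtain ⟨hwa, haa⟩ := hwa0
  set z₀ := max z₀' (za + 1)
  have hz₀ : ∀ z, z₀ ≤ z → u z ∈ Ioo m s := fun z hz =>
    ⟨hz₀' z ((le_max_left _ _).trans hz), hlt z⟩
  have hza : za < z₀ := lt_of_lt_of_le (by linarith) (le_max_right _ _)
  -- Where `u` lies in `(m, s)` the force is negative, so `w` cannot cross zero upwards. Once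
  -- nonpositive, it would keep `u` below `s` for ever.
  have htail : ∀ z, z₀ ≤ z → 0 < w z := by
    intro z₁ hz₁
    by_contra hcon
    push Not at hcon
    have hnp : ∀ z, z₁ ≤ z → w z ≤ 0 := by
      intro z₂ hz₂
      by_contra hc2
      push Not at hc2
      obtain ⟨t, ht, ht0, htp⟩ := exists_last_zero hz₂ h.continuous_snd.continuousOn hcon hc2
      have hd := (h.hasDerivAt_snd_of_eq ht0).neg
      have hneg := S.aneg _ (hz₀ t (hz₁.trans ht.1))
      have hev := hd.eventually_pos_right (by simp [ht0]) (by linarith)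
      obtain ⟨y, hy1, hy2⟩ := (hev.and (Ioc_mem_nhdsGT ht.2)).exists
      have := htp y hy2
      simp only [Pi.neg_apply] at hy1
      linarith
    have hanti : AntitoneOn u (Ici z₁) := by
      apply antitoneOn_of_deriv_nonpos (convex_Ici z₁) h.continuous_fst.continuousOn
        (fun z _ => (h z).2.1.differentiableAt.differentiableWithinAt)
      intro z hz
      rw [(h z).2.1.deriv]
      exact hnp z (interior_subset hz)
    have : s ≤ u z₁ := le_of_tendsto hu (by
      filter_upwards [eventually_ge_atTop z₁] with z hz
      exact hanti self_mem_Ici hz hz)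
    linarith [hlt z₁]
  obtain ⟨α, hα, hα0, hα1⟩ := exists_last_zero hza.le h.continuous_snd.continuousOn hwa.le
    (htail z₀ le_rfl)
  have hpos : ∀ z ∈ Ioi α, 0 < w z := fun z hz => by
    rcases le_total z z₀ with h1 | h1
    · exact hα1 z ⟨hz, h1⟩
    · exact htail z h1
  have haα : 0 < a (u α) := by
    refine lt_of_le_of_ne ?_ fun h0 => hy₀.elim fun z hz => hz ?_
    · by_contra hcon
      push Not at hcon
      have hev := (h.hasDerivAt_snd_of_eq hα0).neg.eventually_pos_right (by simp [hα0])
        (by linarith)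
      obtain ⟨y, hy1, hy2⟩ := (hev.and self_mem_nhdsWithin).exists
      have := hpos y hy2
      simp only [Pi.neg_apply] at hy1
      linarith
    · have hc := h.const_of_eq S.ord S.la (S.lb.pert S.lg μ) hα0 h0.symm
      exact (hc y₀).1.trans (hc z).1.symm
  have hA : u α ∈ Ioo e m := S.low _ (h α).1 (hlt α) haα
  have hcα := S.cell (S.sub ⟨hA.1, hlt α⟩) hA.1.le hA.2 hs S.hms le_rfl
  have e1 := h.crit_eq_of_Ioi hcα hα0 hpos hu hw
  rcases eq_or_lt_of_le (hmin α) with heq | hlt'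
  · rw [heq]; exact e1
  · have hne : za ≠ α := fun h => by rw [h] at hlt'; exact lt_irrefl _ hlt'
    obtain ⟨β, hβ, hβ0, hβ1, hβ2, hβ3⟩ := S.exists_next_zero h ⟨_, hy₀⟩ hwa haa hα0.le
      (lt_of_le_of_ne hα.1 hne)
    have hB : u β ∈ Ioo m s := S.high _ (h β).1 (hp.1.trans_le (hmin β)) hβ1
    have e2 := h.crit_eq_of_Ioo hβ.1 (S.cell' hp hB) hwa hβ0 hβ3
    have := (S.cell (S.sub ⟨hp.1, hlt za⟩) hp.1.le hp.2 hs S.hms le_rfl).crit_strictMono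
      (hmin α) hA.2 hB.1 hB.2.le (Or.inl hlt')
    linarith

/-- The solution stays below `s`: a maximum above `s` would lie where `a < 0`, which happens to the
right of `e` only between `m` and `s`, and touching `s` would make it constant. Its minimum is then
the free end. -/
theorem exists_matched_of_pulse (S : Scene a b g J e m s) (hs : s ∈ J) (has : a s = 0)
    (h : IsOrbit a (pert b g μ) J u w) (hub : Tendsto u atBot (𝓝 s)) (hu : Tendsto u atTop (𝓝 s))
    (hwb : Tendsto w atBot (𝓝 0)) (hw : Tendsto w atTop (𝓝 0))
    (hne : ∃ z, ¬ (u z = s ∧ w z = 0)) :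
    ∃ p ∈ Ioo e m, critGap a b g p s = 0 ∧ crit a b g p s = μ ∧ ∃ z, u z = p ∧ w z = 0 := by
  have hcoef := S.lb.pert S.lg μ
  have hle : ∀ y, u y ≤ s := by
    intro y
    by_contra hcon
    push Not at hcon
    obtain ⟨x, hx⟩ := h.continuous_fst.exists_forall_ge_of_tendsto hub hu hcon
    have hsx : s < u x := hcon.trans_le (hx y)
    obtain ⟨z, hz⟩ := (hu.eventually (gt_mem_nhds hsx)).exists
    have := h.neg_of_max S.ord S.la hcoef hx hz.ne
    have := S.high _ (h x).1 ((S.hem.trans S.hms).trans hsx) this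
    linarith [this.2]
  have hlt : ∀ y, u y < s := by
    intro y
    refine lt_of_le_of_ne (hle y) fun heq => ?_
    have hw0 := h.snd_eq_zero_of_max (z := y) (by rwa [heq])
    have hc := h.const_of_eq S.ord S.la hcoef hw0 (heq ▸ has)
    obtain ⟨z, hz⟩ := hne
    exact hz ⟨(hc z).1.trans heq, (hc z).2⟩
  obtain ⟨za, hza⟩ := h.continuous_fst.neg.exists_forall_ge_of_tendsto (x₀ := 0) hub.neg hu.neg
    (neg_lt_neg (hlt 0))
  have hmin : ∀ y, u za ≤ u y := fun y => neg_le_neg_iff.1 (hza y)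
  obtain ⟨y, hy⟩ := (hu.eventually (lt_mem_nhds (hlt za))).exists
  obtain ⟨hwa, hap⟩ := h.pos_of_min S.ord S.la hcoef hmin hy.ne'
  have hp := S.low _ (h za).1 (hlt za) hap
  have e1 := S.crit_of_pulse hs h hu hw hmin hp hlt
  have hr := h.reverse
  rw [← pert_neg] at hr
  have e2 := S.neg.crit_of_pulse hs hr (za := -za) (hub.comp tendsto_neg_atTop_atBot)
    (by simpa using (hwb.comp tendsto_neg_atTop_atBot).neg) (fun y => by simpa using hmin (-y))
    (by simpa using hp) (fun y => hlt (-y))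
  simp only [neg_neg] at e2
  exact ⟨_, hp, by rw [critGap, e1, e2]; ring, e1, za, rfl, hwa⟩

/-- The mirror image of `exists_matched_of_pulse`. -/
theorem exists_matched_of_pulse' (S : Scene a b g J e m s) (he : e ∈ J) (hae : a e = 0)
    (h : IsOrbit a (pert b g μ) J u w) (hub : Tendsto u atBot (𝓝 e)) (hu : Tendsto u atTop (𝓝 e))
    (hwb : Tendsto w atBot (𝓝 0)) (hw : Tendsto w atTop (𝓝 0))
    (hne : ∃ z, ¬ (u z = e ∧ w z = 0)) :
    ∃ q ∈ Ioo m s, critGap a b g e q = 0 ∧ crit a b g e q = μ ∧ ∃ z, u z = q ∧ w z = 0 := by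
  obtain ⟨p, hp, h0, h1, z, hz1, hz2⟩ := S.refl.exists_matched_of_pulse (u := fun z => -u z)
    (w := fun z => -w z) (μ := μ) (by simpa using he)
    (by simp [oddRefl, hae]) h.spaceRefl hub.neg hu.neg (by simpa using hwb.neg)
    (by simpa using hw.neg) (by
      obtain ⟨z, hz⟩ := hne
      exact ⟨z, by simpa using hz⟩)
  have hq : -p ∈ Ioo m s := ⟨by linarith [hp.2], by linarith [hp.1]⟩
  have hc : Cell a b g e m (-p) :=
    S.cell he le_rfl S.hem (S.sub ⟨S.hem.trans hq.1, hq.2⟩) hq.1 hq.2.le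
  have e1 := hc.crit_refl
  have e2 := hc.neg.crit_refl
  have o1 : oddRefl (-b) = fun x => b (-x) := by
    funext x
    simp [oddRefl]
  have o2 : oddRefl b = -fun x => b (-x) := by
    funext x
    simp [oddRefl]
  rw [o1, neg_neg] at e2
  rw [o2, neg_neg] at e1
  rw [critGap, e1, e2] at h0
  rw [e2] at h1
  refine ⟨-p, hq, by rw [critGap]; linarith, by linarith, z, by simp [← hz1], by simpa using hz2⟩

end Scene

/-! ### Hausdorff distance and convergence of arcs -/

/-- The graph of `f` over `[p, q]`. -/
def graphSet (f : ℝ → ℝ) (p q : ℝ) : Set PhasePlane := (fun x => !₂[x, f x]) '' Icc p q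

theorem edist_plane_le {x y x' y' ε : ℝ} (h : |x - x'| + |y - y'| ≤ ε) :
    edist (!₂[x, y] : PhasePlane) !₂[x', y'] ≤ ENNReal.ofReal ε := by
  rw [edist_dist]
  apply ENNReal.ofReal_le_ofReal
  refine le_trans ?_ h
  rw [EuclideanSpace.dist_eq, Fin.sum_univ_two, Real.dist_eq, Real.dist_eq]
  simp only [Matrix.cons_val_zero, Matrix.cons_val_one]
  apply Real.sqrt_le_iff.2 ⟨by positivity, ?_⟩
  nlinarith [abs_nonneg (x - x'), abs_nonneg (y - y')]

theorem abs_clamp_sub_le {p q p' q' δ x : ℝ} (hp : |p - p'| ≤ δ) (hq : |q - q'| ≤ δ)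
    (hx : x ∈ Icc p q) : |x - clamp p' q' x| ≤ δ := by
  have hp' := abs_le.1 hp
  have hq' := abs_le.1 hq
  have hδ := (abs_nonneg _).trans hp
  obtain ⟨h1, h2⟩ := hx
  rw [abs_le, clamp]
  constructor
  · have : max p' (min q' x) ≤ x + δ := max_le (by linarith) ((min_le_right _ _).trans (by linarith))
    linarith
  · have : x - δ ≤ max p' (min q' x) :=
      (le_min (by linarith) (by linarith)).trans (le_max_right _ _)
    linarith

/-- Graphs over different intervals are compared after projecting one abscissa to both intervals,
which costs at most the displacement of the ends. -/
theorem hausdorffEDist_graphSet_le {f f' : ℝ → ℝ} {p q p' q' δ η : ℝ} (hpq : p ≤ q)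
    (hpq' : p' ≤ q') (hp : |p - p'| ≤ δ) (hq : |q - q'| ≤ δ)
    (hf : ∀ x, |f (clamp p q x) - f' (clamp p' q' x)| ≤ η) :
    Metric.hausdorffEDist (graphSet f p q) (graphSet f' p' q') ≤ ENNReal.ofReal (δ + η) := by
  apply Metric.hausdorffEDist_le_of_mem_edist
  · rintro _ ⟨x, hx, rfl⟩
    refine ⟨_, ⟨clamp p' q' x, clamp_mem hpq' x, rfl⟩, edist_plane_le ?_⟩
    have h1 := hf x
    rw [clamp_of_mem hx] at h1
    exact add_le_add (abs_clamp_sub_le hp hq hx) h1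
  · rintro _ ⟨x, hx, rfl⟩
    refine ⟨_, ⟨clamp p q x, clamp_mem hpq x, rfl⟩, edist_plane_le ?_⟩
    have h1 := hf x
    rw [clamp_of_mem hx, abs_sub_comm] at h1
    exact add_le_add (abs_clamp_sub_le (by rwa [abs_sub_comm]) (by rwa [abs_sub_comm]) hx) h1

/-- Replacing `x` by `max p' x` extends the shorter branch by zero to the left. On the extra piece
the longer branch is itself small. -/
theorem IsGraph.abs_max_sub_le {a β β' V V' : ℝ → ℝ} {p p' m A B δ x : ℝ}
    (h : IsGraph a β p m V) (h' : IsGraph a β' p' m V') (hV : V p = 0) (hV' : V' p' = 0)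
    (hp : p ≤ p') (hp' : p' < m) (hA : 0 ≤ A) (hB : 0 ≤ B) (hδ : 0 ≤ δ)
    (ha0 : ∀ u ∈ Ioo p m, 0 ≤ a u) (haA : ∀ u ∈ Ioo p m, a u ≤ A) (hβB : ∀ u ∈ Ioo p m, β u ≤ B)
    (hβ : ∀ u ∈ Ioo p m, |β u - β' u| ≤ δ) (hx : x ≤ m) :
    |V (max p x) - V' (max p' x)| ≤
      2 * δ * (m - p) + (2 * B * (p' - p) + Real.sqrt (2 * A * (p' - p))) := by
  have hpm : p < m := hp.trans_lt hp'
  have hs : Ioo p' m ⊆ Ioo p m := Ioo_subset_Ioo hp le_rfl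
  have hb : ∀ u ∈ Icc p p', V u ≤ 2 * B * (p' - p) + Real.sqrt (2 * A * (p' - p)) := fun u hu => by
    have := (h.mono le_rfl hp'.le).le_bound hA hB
      (fun u hu => haA u ⟨hu.1, hu.2.trans hp'⟩) (fun u hu => hβB u ⟨hu.1, hu.2.trans hp'⟩) hu
    simpa [hV] using this
  rcases le_total p' x with hx' | hx'
  · rw [max_eq_right hx', max_eq_right (hp.trans hx')]
    have := (h.mono hp le_rfl).abs_sub_le h' (fun u hu => ha0 u (hs hu))
      (fun u hu => ha0 u (hs hu)) le_rfl hδ (by simp) (fun u hu => hβ u (hs hu)) ⟨hx', hx⟩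
    rw [hV', sub_zero, mul_zero, zero_mul, add_zero,
      Real.sqrt_sq (h.nonneg hpm ⟨hp, hp'.le⟩)] at this
    have h1 := hb p' ⟨hp, le_rfl⟩
    have h2 : 2 * δ * (m - p') ≤ 2 * δ * (m - p) := by gcongr
    linarith
  · rw [max_eq_left hx', hV', sub_zero]
    have hm : max p x ∈ Icc p p' := ⟨le_max_left _ _, max_le hp hx'⟩
    rw [abs_of_nonneg (h.nonneg hpm ⟨hm.1, hm.2.trans hp'.le⟩)]
    have h1 := hb _ hm
    have h2 : 0 ≤ 2 * δ * (m - p) := mul_nonneg (by positivity) (by linarith)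
    linarith

/-- Left of the centre the arcs are followed from their left ends, right of it, by reflection, from
their right ends; in each case the force has the sign that the dependence estimate needs. -/
theorem IsArc.abs_clamp_sub_le {a β β' V V' : ℝ → ℝ} {p p' q q' m A B δ : ℝ}
    (h : IsArc a β p q V) (h' : IsArc a β' p' q' V') (hp : p ≤ p') (hpm : p' < m) (hmq : m < q')
    (hq : q' ≤ q) (hl : LeftCell a p m) (hr : RightCell a m q) (hA : 0 ≤ A) (hB : 0 ≤ B)
    (hδ : 0 ≤ δ) (haA : ∀ u ∈ Icc p q, |a u| ≤ A) (hβB : ∀ u ∈ Icc p q, |β u| ≤ B)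
    (hβ : ∀ u ∈ Icc p q, |β u - β' u| ≤ δ) (x : ℝ) :
    |V (clamp p q x) - V' (clamp p' q' x)| ≤ 2 * δ * (q - p) +
      (2 * B * ((p' - p) + (q - q')) + Real.sqrt (2 * A * ((p' - p) + (q - q')))) := by
  have hmono : ∀ d, 0 ≤ d → d ≤ (p' - p) + (q - q') → ∀ l, l ≤ q - p →
      2 * δ * l + (2 * B * d + Real.sqrt (2 * A * d)) ≤ 2 * δ * (q - p) +
      (2 * B * ((p' - p) + (q - q')) + Real.sqrt (2 * A * ((p' - p) + (q - q')))) := by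
    intro d hd hd' l hl
    gcongr
  rcases le_total x m with hx | hx
  · have e1 : clamp p q x = max p x := by
      rw [clamp, min_eq_right (hx.trans (hmq.trans_le hq).le)]
    have e2 : clamp p' q' x = max p' x := by
      rw [clamp, min_eq_right (hx.trans hmq.le)]
    rw [e1, e2]
    have i1 : Ioo p m ⊆ Icc p q := fun u hu => ⟨hu.1.le, (hu.2.trans (hmq.trans_le hq)).le⟩
    refine ((h.toIsGraph.mono le_rfl (hmq.trans_le hq).le).abs_max_sub_le
      (h'.toIsGraph.mono le_rfl hmq.le) h.left h'.left hp hpm hA hB hδ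
      (fun u hu => (hl.pos u hu).le) (fun u hu => (le_abs_self _).trans (haA u (i1 hu)))
      (fun u hu => (le_abs_self _).trans (hβB u (i1 hu))) (fun u hu => hβ u (i1 hu)) hx).trans ?_
    exact hmono _ (by linarith) (by linarith) _ (by linarith)
  · have e1 : clamp p q x = -max (-q) (-x) := by
      rw [clamp, max_eq_right (le_min (by linarith) (by linarith)), max_neg_neg, neg_neg]
    have e2 : clamp p' q' x = -max (-q') (-x) := by
      rw [clamp, max_eq_right (le_min (by linarith) (by linarith)), max_neg_neg, neg_neg]
    rw [e1, e2]
    have i1 : ∀ u ∈ Ioo (-q) (-m), -u ∈ Icc p q := fun u hu =>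
      ⟨by linarith [hu.2], by linarith [hu.1]⟩
    have hpp : -q' < -m := neg_lt_neg hmq
    refine ((h.refl.toIsGraph.mono le_rfl (by linarith)).abs_max_sub_le (V := fun u => V (-u))
      (V' := fun u => V' (-u)) (m := -m)
      (h'.refl.toIsGraph.mono le_rfl (by linarith)) (by simpa using h.right)
      (by simpa using h'.right) (neg_le_neg hq) hpp hA hB hδ
      (fun u hu => (hr.refl.pos u hu).le)
      (fun u hu => (neg_le_abs _).trans (haA _ (i1 u hu)))
      (fun u hu => (neg_le_abs _).trans (hβB _ (i1 u hu))) (fun u hu => ?_) (neg_le_neg hx)).trans ?_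
    · have := hβ _ (i1 u hu)
      rw [abs_sub_comm] at this
      simp only [oddRefl]
      rwa [neg_sub_neg]
    · have := hmono (-q' - -q) (by linarith) (by linarith) (-m - -q) (by linarith)
      exact this

/-- The arc from `(p, 0)` to `(q, 0)` in the upper half plane. -/
def upperArc (a b g : ℝ → ℝ) (p q : ℝ) : ℝ → ℝ :=
  Classical.epsilon fun v => IsArc a (pert b g (crit a b g p q)) p q v

/-- The union of the upper and the lower arc. -/
def loopSet (a b g : ℝ → ℝ) (p q : ℝ) : Set PhasePlane :=
  graphSet (upperArc a b g p q) p q ∪ graphSet (fun x => -upperArc a (-b) g p q x) p q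

theorem tendsto_hausdorffEDist_of_le {ι : Type*} {l : Filter ι} {s : ι → Set PhasePlane}
    {t : Set PhasePlane} {ε : ι → ℝ} (hε : Tendsto ε l (𝓝 0))
    (h : ∀ᶠ i in l, Metric.hausdorffEDist (s i) t ≤ ENNReal.ofReal (ε i)) :
    Tendsto (fun i => Metric.hausdorffEDist (s i) t) l (𝓝 0) := by
  have h1 : Tendsto (fun i => ENNReal.ofReal (ε i)) l (𝓝 0) := by
    simpa using ENNReal.tendsto_ofReal hε
  exact tendsto_of_tendsto_of_tendsto_of_le_of_le' tendsto_const_nhds h1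
    (Eventually.of_forall fun _ => zero_le) h

theorem tendsto_hausdorffEDist_union {ι : Type*} {l : Filter ι} {s s' : ι → Set PhasePlane}
    {t t' : Set PhasePlane} (h : Tendsto (fun i => Metric.hausdorffEDist (s i) t) l (𝓝 0))
    (h' : Tendsto (fun i => Metric.hausdorffEDist (s' i) t') l (𝓝 0)) :
    Tendsto (fun i => Metric.hausdorffEDist (s i ∪ s' i) (t ∪ t')) l (𝓝 0) := by
  have h1 := h.max h'
  rw [max_self] at h1
  exact tendsto_of_tendsto_of_tendsto_of_le_of_le tendsto_const_nhds h1 (fun _ => zero_le)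
    fun _ => Metric.hausdorffEDist_union_le

namespace Cell

variable {a b g : ℝ → ℝ} {p m q μ : ℝ} {ι : Type*} {l : Filter ι} {P R : ι → ℝ}

theorem upperArc_spec (h : Cell a b g p m q) :
    IsArc a (pert b g (crit a b g p q)) p q (upperArc a b g p q) :=
  Classical.epsilon_spec h.crit_spec

/-- Joint continuity follows from separate continuity and monotonicity: the value is squeezed
between those obtained by moving only one end. -/
theorem tendsto_crit (h : Cell a b g p m q) (hP : ∀ᶠ i in l, P i ∈ Ico p m)
    (hR : ∀ᶠ i in l, R i ∈ Ioc m q) (hPt : Tendsto P l (𝓝 p)) (hRt : Tendsto R l (𝓝 q)) :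
    Tendsto (fun i => crit a b g (P i) (R i)) l (𝓝 (crit a b g p q)) := by
  have h1 : Tendsto (fun i => crit a b g (P i) q) l (𝓝 (crit a b g p q)) :=
    ((h.continuousOn_crit_left p ⟨le_rfl, h.hpm⟩).tendsto).comp
      (tendsto_nhdsWithin_iff.2 ⟨hPt, hP⟩)
  have h2 : Tendsto (fun i => crit a b g p (R i)) l (𝓝 (crit a b g p q)) :=
    ((h.continuousOn_crit_right q ⟨h.hmq, le_rfl⟩).tendsto).comp
      (tendsto_nhdsWithin_iff.2 ⟨hRt, hR⟩)
  refine tendsto_of_tendsto_of_tendsto_of_le_of_le' h2 h1 ?_ ?_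
  · filter_upwards [hP, hR] with i hi hi'
    rcases eq_or_lt_of_le hi.1 with he | hlt
    · rw [← he]
    · exact ((h.sub le_rfl h.hpm hi'.2 hi'.1).crit_strictMono hi.1 hi.2 hi'.1 le_rfl
        (Or.inl hlt)).le
  · filter_upwards [hP, hR] with i hi hi'
    rcases eq_or_lt_of_le hi'.2 with he | hlt
    · rw [he]
    · exact ((h.sub hi.1 hi.2 le_rfl h.hmq).crit_strictMono le_rfl hi.2 hi'.1 hi'.2
        (Or.inr hlt)).le

theorem tendsto_upperArc (h : Cell a b g p m q) (hP : ∀ᶠ i in l, P i ∈ Ico p m)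
    (hR : ∀ᶠ i in l, R i ∈ Ioc m q) (hPt : Tendsto P l (𝓝 p)) (hRt : Tendsto R l (𝓝 q)) :
    ∃ ε : ι → ℝ, Tendsto ε l (𝓝 0) ∧ ∀ᶠ i in l, ∀ x,
      |upperArc a b g (P i) (R i) (clamp (P i) (R i) x) - upperArc a b g p q (clamp p q x)|
        ≤ ε i := by
  obtain ⟨A, hA0, hA⟩ := exists_abs_bound_Icc h.ca
  obtain ⟨B, hB0, hB⟩ := exists_abs_bound_Icc (h.cpert (crit a b g p q))
  obtain ⟨G, hG0, hG⟩ := exists_abs_bound_Icc h.cg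
  have hμ := h.tendsto_crit hP hR hPt hRt
  refine ⟨fun i => 2 * (G * |crit a b g p q - crit a b g (P i) (R i)|) * (q - p) +
      (2 * B * ((P i - p) + (q - R i)) + Real.sqrt (2 * A * ((P i - p) + (q - R i)))), ?_, ?_⟩
  · have hd : Tendsto (fun i => (P i - p) + (q - R i)) l (𝓝 0) := by
      have := (hPt.sub_const p).add (hRt.const_sub q)
      simpa using this
    have h1 : Tendsto (fun i => 2 * (G * |crit a b g p q - crit a b g (P i) (R i)|) * (q - p)) l
        (𝓝 (2 * (G * |crit a b g p q - crit a b g p q|) * (q - p))) :=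
      (((hμ.const_sub _).abs.const_mul G).const_mul 2).mul_const _
    have h2 := (hd.const_mul (2 * B)).add ((hd.const_mul (2 * A)).sqrt)
    have h3 := h1.add h2
    simpa using h3
  · filter_upwards [hP, hR] with i hi hi' x
    rw [abs_sub_comm]
    refine h.upperArc_spec.abs_clamp_sub_le (h.sub hi.1 hi.2 hi'.2 hi'.1).upperArc_spec hi.1 hi.2
      hi'.1 hi'.2 h.left h.right hA0 hB0 (by positivity) hA hB (fun u hu => ?_) x
    have : pert b g (crit a b g p q) u - pert b g (crit a b g (P i) (R i)) u =
        g u * (crit a b g p q - crit a b g (P i) (R i)) := by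
      simp only [pert]
      ring
    rw [this, abs_mul]
    exact mul_le_mul_of_nonneg_right (hG u hu) (abs_nonneg _)

theorem tendsto_loopSet (h : Cell a b g p m q) (hP : ∀ᶠ i in l, P i ∈ Ico p m)
    (hR : ∀ᶠ i in l, R i ∈ Ioc m q) (hPt : Tendsto P l (𝓝 p)) (hRt : Tendsto R l (𝓝 q)) :
    Tendsto (fun i => Metric.hausdorffEDist (loopSet a b g (P i) (R i)) (loopSet a b g p q)) l
      (𝓝 0) := by
  have hd : Tendsto (fun i => |P i - p| + |R i - q|) l (𝓝 0) := by
    have := (hPt.sub_const p).abs.add (hRt.sub_const q).abs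
    simpa using this
  apply tendsto_hausdorffEDist_union
  · obtain ⟨ε, hε, hev⟩ := h.tendsto_upperArc hP hR hPt hRt
    refine tendsto_hausdorffEDist_of_le (ε := fun i => |P i - p| + |R i - q| + ε i)
      (by simpa using hd.add hε) ?_
    filter_upwards [hev, hP, hR] with i hi hi1 hi2
    exact hausdorffEDist_graphSet_le (hi1.2.trans hi2.1).le (h.hpm.trans h.hmq).le
      (by linarith [abs_nonneg (R i - q)]) (by linarith [abs_nonneg (P i - p)]) hi
  · obtain ⟨ε, hε, hev⟩ := h.neg.tendsto_upperArc hP hR hPt hRt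
    refine tendsto_hausdorffEDist_of_le (ε := fun i => |P i - p| + |R i - q| + ε i)
      (by simpa using hd.add hε) ?_
    filter_upwards [hev, hP, hR] with i hi hi1 hi2
    refine hausdorffEDist_graphSet_le (hi1.2.trans hi2.1).le (h.hpm.trans h.hmq).le
      (by linarith [abs_nonneg (R i - q)]) (by linarith [abs_nonneg (P i - p)]) fun x => ?_
    have := hi x
    rw [abs_sub_comm] at this
    rwa [neg_sub_neg]

/-- The bound tends to zero with the distance of the ends, so arcs around the centre shrink to it.
-/
theorem upperArc_le (h : Cell a b g p m q) {A B : ℝ} (hA : 0 ≤ A) (hB : 0 ≤ B)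
    (haA : ∀ u ∈ Icc p q, |a u| ≤ A) (hbB : ∀ u ∈ Icc p q, |pert b g (crit a b g p q) u| ≤ B)
    {u : ℝ} (hu : u ∈ Icc p q) :
    |upperArc a b g p q u| ≤ 2 * B * (q - p) + Real.sqrt (2 * A * (q - p)) := by
  have hs := h.upperArc_spec
  have hpq : p < q := h.hpm.trans h.hmq
  rw [abs_of_nonneg (hs.toIsGraph.nonneg hpq hu)]
  have hmono : ∀ d, d ≤ q - p → 2 * B * d + Real.sqrt (2 * A * d) ≤
      2 * B * (q - p) + Real.sqrt (2 * A * (q - p)) := fun d hd => by gcongr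
  rcases le_total u m with hum | hum
  · have i1 : Ioo p m ⊆ Icc p q := fun u hu => ⟨hu.1.le, (hu.2.trans h.hmq).le⟩
    have := (hs.toIsGraph.mono le_rfl h.hmq.le).le_bound hA hB
      (fun u hu => (le_abs_self _).trans (haA u (i1 hu)))
      (fun u hu => (le_abs_self _).trans (hbB u (i1 hu))) ⟨hu.1, hum⟩
    rw [hs.left] at this
    refine le_trans ?_ (hmono (m - p) (by linarith [h.hmq]))
    simpa using this
  · have i1 : ∀ u ∈ Ioo (-q) (-m), -u ∈ Icc p q := fun u hu =>
      ⟨by linarith [hu.2, h.hpm], by linarith [hu.1]⟩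
    have := (hs.refl.toIsGraph.mono le_rfl (neg_le_neg h.hpm.le)).le_bound hA hB
      (fun u hu => (neg_le_abs _).trans (haA _ (i1 u hu)))
      (fun u hu => (neg_le_abs _).trans (hbB _ (i1 u hu)))
      (u := -u) ⟨neg_le_neg hu.2, neg_le_neg hum⟩
    rw [hs.refl.left] at this
    refine le_trans ?_ (hmono (-m - -q) (by linarith [h.hpm]))
    simpa using this

theorem tendsto_upperArc_centre (h : Cell a b g p m q) (hP : ∀ᶠ i in l, P i ∈ Ico p m)
    (hR : ∀ᶠ i in l, R i ∈ Ioc m q) (hPt : Tendsto P l (𝓝 m)) (hRt : Tendsto R l (𝓝 m))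
    (hμ : Tendsto (fun i => crit a b g (P i) (R i)) l (𝓝 μ)) :
    ∃ ε : ι → ℝ, Tendsto ε l (𝓝 0) ∧ ∀ᶠ i in l, ∀ x,
      |upperArc a b g (P i) (R i) (clamp (P i) (R i) x) - 0| ≤ ε i := by
  obtain ⟨A, hA0, hA⟩ := exists_abs_bound_Icc h.ca
  obtain ⟨B, hB0, hB⟩ := exists_abs_bound_Icc h.cb
  obtain ⟨G, hG0, hG⟩ := exists_abs_bound_Icc h.cg
  refine ⟨fun i => 2 * (B + (|μ| + 1) * G) * (R i - P i) + Real.sqrt (2 * A * (R i - P i)), ?_, ?_⟩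
  · have hd : Tendsto (fun i => R i - P i) l (𝓝 0) := by simpa using hRt.sub hPt
    have := (hd.const_mul (2 * (B + (|μ| + 1) * G))).add ((hd.const_mul (2 * A)).sqrt)
    simpa using this
  · have hμ' : ∀ᶠ i in l, |crit a b g (P i) (R i)| < |μ| + 1 :=
      hμ.abs.eventually (gt_mem_nhds (by linarith))
    filter_upwards [hP, hR, hμ'] with i hi hi' hμi x
    rw [sub_zero]
    have hc := h.sub hi.1 hi.2 hi'.2 hi'.1
    have hsub : Icc (P i) (R i) ⊆ Icc p q := Icc_subset_Icc hi.1 hi'.2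
    refine hc.upperArc_le hA0 (by positivity) (fun u hu => hA u (hsub hu)) (fun u hu => ?_)
      (clamp_mem (hi.2.trans hi'.1).le x)
    refine (abs_add_le _ _).trans (add_le_add (hB u (hsub hu)) ?_)
    rw [abs_mul]
    exact mul_le_mul hμi.le (hG u (hsub hu)) (abs_nonneg _) (by positivity)

theorem tendsto_loopSet_centre (h : Cell a b g p m q) (hP : ∀ᶠ i in l, P i ∈ Ico p m)
    (hR : ∀ᶠ i in l, R i ∈ Ioc m q) (hPt : Tendsto P l (𝓝 m)) (hRt : Tendsto R l (𝓝 m)) {μ' : ℝ}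
    (hμ : Tendsto (fun i => crit a b g (P i) (R i)) l (𝓝 μ))
    (hμ' : Tendsto (fun i => crit a (-b) g (P i) (R i)) l (𝓝 μ')) :
    Tendsto (fun i => Metric.hausdorffEDist (loopSet a b g (P i) (R i)) {!₂[m, 0]}) l (𝓝 0) := by
  have hd : Tendsto (fun i => |P i - m| + |R i - m|) l (𝓝 0) := by
    have := (hPt.sub_const m).abs.add (hRt.sub_const m).abs
    simpa using this
  have e : ({!₂[m, 0]} : Set PhasePlane) = graphSet (fun _ => 0) m m ∪ graphSet (fun _ => 0) m m :=
    by simp [graphSet]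
  rw [e]
  apply tendsto_hausdorffEDist_union
  · obtain ⟨ε, hε, hev⟩ := h.tendsto_upperArc_centre hP hR hPt hRt hμ
    refine tendsto_hausdorffEDist_of_le (ε := fun i => |P i - m| + |R i - m| + ε i)
      (by simpa using hd.add hε) ?_
    filter_upwards [hev, hP, hR] with i hi hi1 hi2
    exact hausdorffEDist_graphSet_le (hi1.2.trans hi2.1).le le_rfl
      (by linarith [abs_nonneg (R i - m)]) (by linarith [abs_nonneg (P i - m)]) hi
  · obtain ⟨ε, hε, hev⟩ := h.neg.tendsto_upperArc_centre hP hR hPt hRt hμ'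
    refine tendsto_hausdorffEDist_of_le (ε := fun i => |P i - m| + |R i - m| + ε i)
      (by simpa using hd.add hε) ?_
    filter_upwards [hev, hP, hR] with i hi hi1 hi2
    refine hausdorffEDist_graphSet_le (hi1.2.trans hi2.1).le le_rfl
      (by linarith [abs_nonneg (R i - m)]) (by linarith [abs_nonneg (P i - m)]) fun x => ?_
    simpa using hi x

end Cell

/-! ### Closed orbits: fundamental period and uniqueness -/

open TrafficModel

theorem trajectory_shift (u w : ℝ → ℝ) (c : ℝ) :
    trajectory (fun z => u (z + c)) (fun z => w (z + c)) univ = trajectory u w univ := by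
  ext x
  constructor
  · rintro ⟨z, -, rfl⟩
    exact ⟨z + c, mem_univ _, rfl⟩
  · rintro ⟨z, -, rfl⟩
    exact ⟨z - c, mem_univ _, by simp⟩

theorem TrafficModel.IsPeriod.trajectory_Ico {u w : ℝ → ℝ} {Z : ℝ} (h : IsPeriod u w Z) :
    trajectory u w (Ico 0 Z) = trajectory u w univ := by
  apply subset_antisymm (image_mono (subset_univ _))
  rintro _ ⟨z, -, rfl⟩
  have hper : Function.Periodic (fun z => (u z, w z)) Z := fun z => Prod.ext (h.2 z).1 (h.2 z).2
  obtain ⟨y, hy, he⟩ := hper.exists_mem_Ico₀ h.1 z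
  have h1 : u z = u y := congrArg Prod.fst he
  have h2 : w z = w y := congrArg Prod.snd he
  exact ⟨y, hy, by simp only [h1, h2]⟩

theorem TrafficModel.IsPeriod.shift {u w : ℝ → ℝ} {Z : ℝ} (h : IsPeriod u w Z) (c : ℝ) :
    IsPeriod (fun z => u (z + c)) (fun z => w (z + c)) Z :=
  ⟨h.1, fun z => by
    have := h.2 (z + c)
    rwa [add_right_comm] at this⟩

theorem isPeriod_shift_iff {u w : ℝ → ℝ} {Z : ℝ} (c : ℝ) :
    IsPeriod (fun z => u (z + c)) (fun z => w (z + c)) Z ↔ IsPeriod u w Z := by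
  refine ⟨fun h => ?_, fun h => h.shift c⟩
  have := h.shift (-c)
  simpa using this

/-- A closed orbit which crosses the `u`-axis exactly in `p` and in `q`. -/
structure IsLoop (a β : ℝ → ℝ) (J : Set ℝ) (p q : ℝ) (V₁ V₂ u w : ℝ → ℝ) (T Z : ℝ) : Prop where
  orbit : IsOrbit a β J u w
  arc₁ : IsArc a β p q V₁
  arc₂ : IsArc a (-β) p q V₂
  hpq : p < q
  T_pos : 0 < T
  T_lt : T < Z
  per : ∀ z, u (z + Z) = u z ∧ w (z + Z) = w z
  u_zero : u 0 = p
  w_zero : w 0 = 0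
  u_T : u T = q
  w_T : w T = 0
  upper : ∀ z ∈ Ioo 0 T, u z ∈ Ioo p q ∧ w z = V₁ (u z)
  lower : ∀ z ∈ Ioo T Z, u z ∈ Ioo p q ∧ w z = -V₂ (u z)

namespace IsLoop

variable {a β V₁ V₂ u w u' w' : ℝ → ℝ} {J : Set ℝ} {p q T Z z x : ℝ}

theorem isPeriod (h : IsLoop a β J p q V₁ V₂ u w T Z) : IsPeriod u w Z :=
  ⟨h.T_pos.trans h.T_lt, h.per⟩

theorem u_Z (h : IsLoop a β J p q V₁ V₂ u w T Z) : u Z = p := by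
  have := (h.per 0).1
  rwa [zero_add, h.u_zero] at this

theorem w_Z (h : IsLoop a β J p q V₁ V₂ u w T Z) : w Z = 0 := by
  have := (h.per 0).2
  rwa [zero_add, h.w_zero] at this

theorem pos (h : IsLoop a β J p q V₁ V₂ u w T Z) (hz : z ∈ Ioo 0 T) : 0 < w z := by
  rw [(h.upper z hz).2]
  exact h.arc₁.pos _ (h.upper z hz).1

theorem neg (h : IsLoop a β J p q V₁ V₂ u w T Z) (hz : z ∈ Ioo T Z) : w z < 0 := by
  rw [(h.lower z hz).2]
  have := h.arc₂.pos _ (h.lower z hz).1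
  linarith

theorem cases_Ico (h : IsLoop a β J p q V₁ V₂ u w T Z) (hz : z ∈ Ico 0 Z) :
    (u z = p ∧ w z = 0) ∨ z ∈ Ioo 0 T ∨ (u z = q ∧ w z = 0) ∨ z ∈ Ioo T Z := by
  rcases eq_or_lt_of_le hz.1 with h0 | h0
  · exact Or.inl (h0 ▸ ⟨h.u_zero, h.w_zero⟩)
  rcases lt_trichotomy z T with h1 | h1 | h1
  · exact Or.inr (Or.inl ⟨h0, h1⟩)
  · exact Or.inr (Or.inr (Or.inl (h1 ▸ ⟨h.u_T, h.w_T⟩)))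
  · exact Or.inr (Or.inr (Or.inr ⟨h1, hz.2⟩))

theorem exists_Ico (h : IsLoop a β J p q V₁ V₂ u w T Z) (z : ℝ) :
    ∃ y ∈ Ico 0 Z, u z = u y ∧ w z = w y := by
  have hper : Function.Periodic (fun z => (u z, w z)) Z :=
    fun z => Prod.ext (h.per z).1 (h.per z).2
  obtain ⟨y, hy, he⟩ := hper.exists_mem_Ico₀ h.isPeriod.1 z
  exact ⟨y, hy, congrArg Prod.fst he, congrArg Prod.snd he⟩

theorem mem_Icc (h : IsLoop a β J p q V₁ V₂ u w T Z) (z : ℝ) : u z ∈ Icc p q := by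
  obtain ⟨y, hy, h1, -⟩ := h.exists_Ico z
  rw [h1]
  rcases h.cases_Ico hy with hc | hc | hc | hc
  · rw [hc.1]; exact left_mem_Icc.2 h.hpq.le
  · exact Ioo_subset_Icc_self (h.upper y hc).1
  · rw [hc.1]; exact right_mem_Icc.2 h.hpq.le
  · exact Ioo_subset_Icc_self (h.lower y hc).1

theorem eq_or_eq (h : IsLoop a β J p q V₁ V₂ u w T Z) (hz : w z = 0) : u z = p ∨ u z = q := by
  obtain ⟨y, hy, h1, h2⟩ := h.exists_Ico z
  rw [h2] at hz
  rw [h1]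
  rcases h.cases_Ico hy with hc | hc | hc | hc
  · exact Or.inl hc.1
  · exact absurd hz (h.pos hc).ne'
  · exact Or.inr hc.1
  · exact absurd hz (h.neg hc).ne

/-- Within `(0, Z)` the function `w` vanishes only at `T`, where `u` has the value `q` and not `p`.
-/
theorem le_of_isPeriod (h : IsLoop a β J p q V₁ V₂ u w T Z) {Z' : ℝ} (hZ : IsPeriod u w Z') :
    Z ≤ Z' := by
  by_contra hcon
  push Not at hcon
  obtain ⟨h1, h2⟩ := hZ.2 0
  rw [zero_add, h.w_zero] at h2
  rw [zero_add, h.u_zero] at h1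
  rcases lt_trichotomy Z' T with hlt | heq | hgt
  · exact absurd h2 (h.pos ⟨hZ.1, hlt⟩).ne'
  · rw [heq, h.u_T] at h1
    exact h.hpq.ne' h1
  · exact absurd h2 (h.neg ⟨hgt, hcon⟩).ne

theorem trajectory_univ (h : IsLoop a β J p q V₁ V₂ u w T Z) :
    trajectory u w univ = graphSet V₁ p q ∪ graphSet (fun x => -V₂ x) p q := by
  apply subset_antisymm
  · rintro _ ⟨z, -, rfl⟩
    obtain ⟨y, hy, h1, h2⟩ := h.exists_Ico z
    simp only [h1, h2]
    rcases h.cases_Ico hy with hc | hc | hc | hc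
    · exact Or.inl ⟨p, left_mem_Icc.2 h.hpq.le, by simp [hc, h.arc₁.left]⟩
    · exact Or.inl ⟨u y, Ioo_subset_Icc_self (h.upper y hc).1, by simp [(h.upper y hc).2]⟩
    · exact Or.inl ⟨q, right_mem_Icc.2 h.hpq.le, by simp [hc, h.arc₁.right]⟩
    · exact Or.inr ⟨u y, Ioo_subset_Icc_self (h.lower y hc).1, by simp [(h.lower y hc).2]⟩
  · have hc := h.orbit.continuous_fst
    rintro _ (⟨x, hx, rfl⟩ | ⟨x, hx, rfl⟩)
    · obtain ⟨z, hz, hzx⟩ := intermediate_value_Icc h.T_pos.le hc.continuousOn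
        (show x ∈ Icc (u 0) (u T) by rwa [h.u_zero, h.u_T])
      refine ⟨z, mem_univ _, ?_⟩
      have : w z = V₁ x := by
        rcases eq_or_lt_of_le hz.1 with h0 | h0
        · rw [← hzx, ← h0, h.w_zero, h.u_zero, h.arc₁.left]
        rcases eq_or_lt_of_le hz.2 with h1 | h1
        · rw [← hzx, h1, h.w_T, h.u_T, h.arc₁.right]
        · rw [(h.upper z ⟨h0, h1⟩).2, hzx]
      simp only [this, hzx]
    · obtain ⟨z, hz, hzx⟩ := intermediate_value_Icc' h.T_lt.le hc.continuousOn
        (show x ∈ Icc (u Z) (u T) by rwa [h.u_Z, h.u_T])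
      refine ⟨z, mem_univ _, ?_⟩
      have : w z = -V₂ x := by
        rcases eq_or_lt_of_le hz.1 with h0 | h0
        · rw [← hzx, ← h0, h.w_T, h.u_T, h.arc₂.right, neg_zero]
        rcases eq_or_lt_of_le hz.2 with h1 | h1
        · rw [← hzx, h1, h.w_Z, h.u_Z, h.arc₂.left, neg_zero]
        · rw [(h.lower z ⟨h0, h1⟩).2, hzx]
      simp only [this, hzx]

end IsLoop

/-- `O` is the orbit of a periodic solution through `(x, 0)`, with fundamental period `Z`. -/
def IsCycle (a β : ℝ → ℝ) (J : Set ℝ) (x Z : ℝ) (O : Set PhasePlane) : Prop :=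
  ∃ u w : ℝ → ℝ, IsOrbit a β J u w ∧ u 0 = x ∧ w 0 = 0 ∧
    IsPeriod u w Z ∧ (∀ Z', IsPeriod u w Z' → Z ≤ Z') ∧ O = trajectory u w (Ico 0 Z)

theorem IsLoop.isCycle_iff {a β V₁ V₂ u w : ℝ → ℝ} {J : Set ℝ} {p q T Z x Z' : ℝ}
    {O : Set PhasePlane} (h : IsLoop a β J p q V₁ V₂ u w T Z) (hJ : J.OrdConnected)
    (ha : LocLip a J) (hβ : LocLip β J) (hx : x = p ∨ x = q) :
    IsCycle a β J x Z' O ↔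
      Z' = Z ∧ O = graphSet V₁ p q ∪ graphSet (fun x => -V₂ x) p q := by
  obtain ⟨c, hcu, hcw⟩ : ∃ c, u c = x ∧ w c = 0 := by
    rcases hx with rfl | rfl
    exacts [⟨0, h.u_zero, h.w_zero⟩, ⟨T, h.u_T, h.w_T⟩]
  constructor
  · rintro ⟨u', w', hor, h0, hw0, hper, hmin, rfl⟩
    obtain ⟨rfl, rfl⟩ := IsOrbit.unique hJ ha hβ hor (h.orbit.shift c) (t₀ := 0)
      (by simp [h0, hcu]) (by simp [hw0, hcw])
    rw [hper.trajectory_Ico, trajectory_shift, h.trajectory_univ]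
    exact ⟨le_antisymm (hmin _ (h.isPeriod.shift c))
      (h.le_of_isPeriod ((isPeriod_shift_iff c).1 hper)), rfl⟩
  · rintro ⟨rfl, rfl⟩
    refine ⟨_, _, h.orbit.shift c, by simp [hcu], by simp [hcw], h.isPeriod.shift c,
      fun Z'' hZ => h.le_of_isPeriod ((isPeriod_shift_iff c).1 hZ), ?_⟩
    rw [(h.isPeriod.shift c).trajectory_Ico, trajectory_shift, h.trajectory_univ]

/-- The period of the closed orbit through `(p, 0)` and `(q, 0)`. -/
def loopTime (a b g : ℝ → ℝ) (J : Set ℝ) (p q : ℝ) : ℝ :=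
  Classical.epsilon fun Z => ∃ u w T, IsLoop a (pert b g (crit a b g p q)) J p q
    (upperArc a b g p q) (upperArc a (-b) g p q) u w T Z

theorem crit_neg_of_critGap {a b g : ℝ → ℝ} {p q : ℝ} (h : critGap a b g p q = 0) :
    crit a (-b) g p q = -crit a b g p q := by
  rw [critGap] at h
  linarith

theorem Cell.lowerArc_spec {a b g : ℝ → ℝ} {p m q : ℝ} (h : Cell a b g p m q)
    (h0 : critGap a b g p q = 0) :
    IsArc a (-pert b g (crit a b g p q)) p q (upperArc a (-b) g p q) := by
  have := h.neg.upperArc_spec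
  rwa [crit_neg_of_critGap h0, pert_neg] at this

namespace Cell

variable {a b g : ℝ → ℝ} {p m q p' q' : ℝ}

theorem critGap_inj_left (h : Cell a b g p m q) (h' : Cell a b g p' m q)
    (e : critGap a b g p q = critGap a b g p' q) : p = p' := by
  rcases lt_trichotomy p p' with hlt | heq | hlt
  · exact absurd e (h.critGap_strictMono hlt.le h'.hpm h.hmq le_rfl (Or.inl hlt)).ne
  · exact heq
  · exact absurd e (h'.critGap_strictMono hlt.le h.hpm h.hmq le_rfl (Or.inl hlt)).ne'

theorem critGap_inj_right (h : Cell a b g p m q) (h' : Cell a b g p m q')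
    (e : critGap a b g p q = critGap a b g p q') : q = q' := by
  rcases lt_trichotomy q q' with hlt | heq | hlt
  · exact absurd e (h'.critGap_strictMono le_rfl h.hpm h.hmq hlt.le (Or.inr hlt)).ne
  · exact heq
  · exact absurd e (h.critGap_strictMono le_rfl h.hpm h'.hmq hlt.le (Or.inr hlt)).ne'

end Cell

namespace Scene

variable {a b g u w : ℝ → ℝ} {J : Set ℝ} {e m s p q μ Z x : ℝ} {O : Set PhasePlane}

theorem exists_isLoop (S : Scene a b g J e m s) (hp : p ∈ Ioo e m) (hq : q ∈ Ioo m s)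
    (h0 : critGap a b g p q = 0) : ∃ u w T, IsLoop a (pert b g (crit a b g p q)) J p q
      (upperArc a b g p q) (upperArc a (-b) g p q) u w T (loopTime a b g J p q) := by
  have hc := S.cell' hp hq
  have hpq := hp.2.trans hq.1
  have hJ : Icc p q ⊆ J := fun x hx => S.sub ⟨hp.1.trans_le hx.1, hx.2.trans_lt hq.2⟩
  have harc := hc.upperArc_spec
  have harc' := hc.lowerArc_spec h0
  obtain ⟨u, w, T, Z, h1, h2, h3, h4, h5, h6, h7, h8, h9, h10⟩ :=
    exists_closed_orbit harc harc' (S.la.lipPair (S.lb.pert S.lg _) hJ) hpq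
      hJ (S.apos p hp).ne' (S.aneg q hq).ne
  have hex : ∃ Z, ∃ u w T, IsLoop a (pert b g (crit a b g p q)) J p q
    (upperArc a b g p q) (upperArc a (-b) g p q) u w T Z :=
    ⟨Z, u, w, T, h1, harc, harc', hpq, h2, h3, h4, h5, h6, h7, h8, h9, h10⟩
  exact Classical.epsilon_spec hex

/-- A periodic solution through `(x, 0)` is the loop over its own extremes, and a loop meets the
axis only there. So it shares one end with the given matched pair, and injectivity of the gap
identifies the other. -/
theorem isCycle_iff (S : Scene a b g J e m s) (hp : p ∈ Ioo e m) (hq : q ∈ Ioo m s)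
    (h0 : critGap a b g p q = 0) (hx : x = p ∨ x = q) : IsCycle a (pert b g μ) J x Z O ↔
      μ = crit a b g p q ∧ Z = loopTime a b g J p q ∧ O = loopSet a b g p q := by
  have key : IsCycle a (pert b g μ) J x Z O → μ = crit a b g p q := by
    rintro ⟨u, w, hor, hu0, hw0, hper, -, -⟩
    have hxs : x ∈ Ioo e s ∧ x ≠ m := by
      rcases hx with rfl | rfl
      exacts [⟨⟨hp.1, hp.2.trans S.hms⟩, hp.2.ne⟩, ⟨⟨S.hem.trans hq.1, hq.2⟩, hq.1.ne'⟩]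
    obtain ⟨p', hp', q', hq', h0', hμ, z, hzu, hzw⟩ := S.exists_matched_of_periodic hor
      (fun z => (hper.2 z).1) hper.1 (hu0.symm ▸ hxs.1) (hu0.symm ▸ hxs.2) hw0
    obtain ⟨u', w', T', hl⟩ := S.exists_isLoop hp' hq' h0'
    rw [hμ] at hl
    obtain ⟨e1, e2⟩ := IsOrbit.unique S.ord S.la (S.lb.pert S.lg μ) hl.orbit (hor.shift z)
      (t₀ := 0) (by simp [hl.u_zero, hzu]) (by simp [hl.w_zero, hzw])
    have h1 := hl.eq_or_eq (z := -z) (by rw [e2]; simp [hw0])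
    rw [e1] at h1
    simp only [neg_add_cancel, hu0] at h1
    rw [← hμ]
    -- The mixed cases would put the same point on both sides of the centre.
    rcases hx with rfl | rfl <;> rcases h1 with rfl | rfl
    · rw [(S.cell' hp hq).critGap_inj_right (S.cell' hp hq') (h0.trans h0'.symm)]
    · exact absurd hp.2 (lt_asymm hq'.1)
    · exact absurd hp'.2 (lt_asymm hq.1)
    · rw [(S.cell' hp hq).critGap_inj_left (S.cell' hp' hq) (h0.trans h0'.symm)]
  obtain ⟨u, w, T, hl⟩ := S.exists_isLoop hp hq h0
  have hiff := hl.isCycle_iff (Z' := Z) (O := O) S.ord S.la (S.lb.pert S.lg _) hx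
  constructor
  · intro h
    have hμ := key h
    rw [hμ] at h
    exact ⟨hμ, hiff.1 h⟩
  · rintro ⟨rfl, h⟩
    exact hiff.2 h

end Scene

/-! ### Homoclinic orbits and heteroclinic cycles -/

theorem continuous_plane : Continuous (fun x : ℝ × ℝ => (!₂[x.1, x.2] : PhasePlane)) := by
  refine (PiLp.continuous_toLp 2 _).comp (continuous_pi fun i => ?_)
  fin_cases i
  · exact continuous_fst
  · exact continuous_snd

theorem neg_plane (x y : ℝ) : -(!₂[x, y] : PhasePlane) = !₂[-x, -y] := by
  ext i
  fin_cases i <;> simp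

theorem graphSet_subset_closure {V u w : ℝ → ℝ} {p q : ℝ} {T : Set ℝ}
    (hV : ContinuousOn V (Icc p q)) (hpq : p < q) (hu : Ioo p q ⊆ u '' T)
    (hw : ∀ z ∈ T, w z = V (u z)) : graphSet V p q ⊆ closure (trajectory u w T) := by
  have h1 : ContinuousOn (fun x => (!₂[x, V x] : PhasePlane)) (closure (Ioo p q)) := by
    rw [closure_Ioo hpq.ne]
    exact continuous_plane.comp_continuousOn (continuousOn_id.prodMk hV)
  have h2 := h1.image_closure
  rw [closure_Ioo hpq.ne] at h2
  refine h2.trans (closure_mono ?_)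
  rintro _ ⟨x, hx, rfl⟩
  obtain ⟨z, hz, rfl⟩ := hu hx
  exact ⟨z, hz, by simp [hw z hz]⟩

/-- The closed arcs contain the equilibria that a connecting orbit only approaches. The Hausdorff
distance does not see this difference. -/
theorem hausdorffEDist_eq_of_closure {s t t' : Set PhasePlane} (h1 : t ⊆ t') (h2 : t' ⊆ closure t) :
    Metric.hausdorffEDist s t = Metric.hausdorffEDist s t' := by
  have : closure t = closure t' :=
    subset_antisymm (closure_mono h1) (closure_minimal h2 isClosed_closure)
  rw [← Metric.hausdorffEDist_closure_right, this, Metric.hausdorffEDist_closure_right]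

theorem trajectory_neg (u w : ℝ → ℝ) (T : Set ℝ) :
    trajectory (fun z => -u z) (fun z => -w z) T = Neg.neg '' trajectory u w T := by
  rw [trajectory, trajectory, image_image]
  simp only [neg_plane]

theorem graphSet_neg (V : ℝ → ℝ) (p q : ℝ) :
    graphSet (fun x => -V (-x)) (-q) (-p) = Neg.neg '' graphSet V p q := by
  rw [graphSet, graphSet, image_image, ← neg_Icc, ← image_neg_eq_neg, image_image]
  simp only [neg_plane, neg_neg]

variable {a β V₁ V₂ : ℝ → ℝ} {J : Set ℝ} {p q : ℝ}

theorem exists_homoclinic_right (h1 : IsArc a β p q V₁) (h2 : IsArc a (-β) p q V₂)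
    (hl : LipPair a β p q) (hpq : p < q) (hJ : Icc p q ⊆ J) (hap : a p ≠ 0) (haq : a q = 0) :
    ∃ u w, IsOrbit a β J u w ∧ u 0 = p ∧ w 0 = 0 ∧
      Tendsto u atBot (𝓝 q) ∧ Tendsto u atTop (𝓝 q) ∧
      Tendsto w atBot (𝓝 0) ∧ Tendsto w atTop (𝓝 0) ∧
      trajectory u w univ ⊆ graphSet V₁ p q ∪ graphSet (fun x => -V₂ x) p q ∧
      graphSet V₁ p q ∪ graphSet (fun x => -V₂ x) p q ⊆ closure (trajectory u w univ) := by
  obtain ⟨u, w, hor, hu0, hw0, hpos, hneg, l1, l2, l3, l4⟩ :=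
    exists_homoclinic_orbit h1 h2 hl hpq hJ hap haq
  refine ⟨u, w, hor, hu0, hw0, l1, l2, l3, l4, ?_, ?_⟩
  · rintro _ ⟨z, -, rfl⟩
    rcases lt_trichotomy z 0 with hz | rfl | hz
    · exact Or.inr ⟨u z, Ioo_subset_Icc_self (hneg z hz).1, by simp [(hneg z hz).2]⟩
    · exact Or.inl ⟨p, left_mem_Icc.2 hpq.le, by simp [hu0, hw0, h1.left]⟩
    · exact Or.inl ⟨u z, Ioo_subset_Icc_self (hpos z hz).1, by simp [(hpos z hz).2]⟩
  · have hc := hor.continuous_fst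
    have i1 : Ioo p q ⊆ u '' Ioi 0 := by
      refine isPreconnected_Ioi.intermediate_value_Ioo (l₁ := 𝓝[>] (0:ℝ)) (l₂ := atTop)
        (le_principal_iff.2 self_mem_nhdsWithin) (le_principal_iff.2 (Ioi_mem_atTop 0))
        hc.continuousOn ?_ l2
      exact hu0 ▸ (hc.tendsto 0).mono_left nhdsWithin_le_nhds
    have i2 : Ioo p q ⊆ u '' Iio 0 := by
      refine isPreconnected_Iio.intermediate_value_Ioo (l₁ := 𝓝[<] (0:ℝ)) (l₂ := atBot)
        (le_principal_iff.2 self_mem_nhdsWithin) (le_principal_iff.2 (Iio_mem_atBot 0))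
        hc.continuousOn ?_ l1
      exact hu0 ▸ (hc.tendsto 0).mono_left nhdsWithin_le_nhds
    refine union_subset ?_ ?_
    · exact (graphSet_subset_closure h1.cont hpq i1 fun z hz => (hpos z hz).2).trans
        (closure_mono (image_mono (subset_univ _)))
    · exact (graphSet_subset_closure h2.cont.neg hpq i2 fun z hz => (hneg z hz).2).trans
        (closure_mono (image_mono (subset_univ _)))

theorem exists_homoclinic_left (h1 : IsArc a β p q V₁) (h2 : IsArc a (-β) p q V₂)
    (hl : LipPair a β p q) (hpq : p < q) (hJ : Icc p q ⊆ J) (hap : a p = 0) (haq : a q ≠ 0) :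
    ∃ u w, IsOrbit a β J u w ∧ u 0 = q ∧ w 0 = 0 ∧
      Tendsto u atBot (𝓝 p) ∧ Tendsto u atTop (𝓝 p) ∧
      Tendsto w atBot (𝓝 0) ∧ Tendsto w atTop (𝓝 0) ∧
      trajectory u w univ ⊆ graphSet V₁ p q ∪ graphSet (fun x => -V₂ x) p q ∧
      graphSet V₁ p q ∪ graphSet (fun x => -V₂ x) p q ⊆ closure (trajectory u w univ) := by
  have e : oddRefl β = -oddRefl (-β) := by
    funext x
    simp [oddRefl]
  have h1' := h1.refl
  -- The reflection in space alone exchanges the half planes, so the mirror image of the second arc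
  -- takes the role of the upper one.
  rw [e] at h1'
  obtain ⟨u, w, hor, hu0, hw0, l1, l2, l3, l4, hs1, hs2⟩ :=
    exists_homoclinic_right (J := Neg.neg ⁻¹' J) h2.refl h1' hl.neg.oddRefl (neg_lt_neg hpq)
      (fun x hx => hJ ⟨by linarith [hx.2], by linarith [hx.1]⟩)
      (by simpa [oddRefl] using haq) (by simp [oddRefl, hap])
  have hset : graphSet V₁ p q ∪ graphSet (fun x => -V₂ x) p q = Neg.neg ''
      (graphSet (fun u => V₂ (-u)) (-q) (-p) ∪ graphSet (fun x => -V₁ (-x)) (-q) (-p)) := by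
    rw [image_union, ← graphSet_neg, ← graphSet_neg, union_comm]
    simp
  refine ⟨fun z => -u z, fun z => -w z, ?_, by simp [hu0], by simp [hw0],
    by simpa using l1.neg, by simpa using l2.neg, by simpa using l3.neg, by simpa using l4.neg,
    ?_, ?_⟩
  · have := hor.spaceRefl
    rw [oddRefl_oddRefl] at this
    intro z
    obtain ⟨t1, t2, t3⟩ := this z
    refine ⟨by simpa using t1, t2, t3.congr_deriv ?_⟩
    simp [oddRefl]
  · rw [hset, trajectory_neg]
    exact image_mono hs1
  · rw [hset, trajectory_neg]
    refine (image_mono hs2).trans ?_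
    exact image_closure_subset_closure_image continuous_neg

theorem exists_heteroclinic_cycle {m : ℝ} (h1 : IsArc a β p q V₁) (h2 : IsArc a (-β) p q V₂)
    (hl : LipPair a β p q) (hJ : Icc p q ⊆ J) (hap : a p = 0) (haq : a q = 0) (hm : m ∈ Ioo p q) :
    ∃ ub wb uf wf, IsOrbit a β J ub wb ∧ IsOrbit a β J uf wf ∧
      (ub 0 = m ∧ wb 0 = V₁ m) ∧ (uf 0 = m ∧ wf 0 = -V₂ m) ∧
      (∀ z, 0 < wb z) ∧ (∀ z, wf z < 0) ∧
      (Tendsto ub atBot (𝓝 p) ∧ Tendsto ub atTop (𝓝 q) ∧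
        Tendsto wb atBot (𝓝 0) ∧ Tendsto wb atTop (𝓝 0)) ∧
      (Tendsto uf atBot (𝓝 q) ∧ Tendsto uf atTop (𝓝 p) ∧
        Tendsto wf atBot (𝓝 0) ∧ Tendsto wf atTop (𝓝 0)) ∧
      trajectory ub wb univ ∪ trajectory uf wf univ ⊆
        graphSet V₁ p q ∪ graphSet (fun x => -V₂ x) p q ∧
      graphSet V₁ p q ∪ graphSet (fun x => -V₂ x) p q ⊆
        closure (trajectory ub wb univ ∪ trajectory uf wf univ) := by
  have hpq : p < q := hm.1.trans hm.2
  obtain ⟨ub, wb, hb, hb0, hbV, b1, b2, b3, b4⟩ :=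
    exists_heteroclinic_orbit h1 hl hJ hap haq hm
  obtain ⟨uf, wf, hf, hf0, hfV, f1, f2, f3, f4⟩ :=
    exists_heteroclinic_orbit h2 hl.neg hJ hap haq hm
  have hr := hf.reverse
  rw [neg_neg] at hr
  have c3 := (f3.comp tendsto_neg_atTop_atBot).neg
  have c4 := (f4.comp tendsto_neg_atBot_atTop).neg
  rw [neg_zero] at c3 c4
  have i1 : Ioo p q ⊆ ub '' univ := isPreconnected_univ.intermediate_value_Ioo (l₁ := atBot)
    (l₂ := atTop) (by simp) (by simp) hb.continuous_fst.continuousOn b1 b2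
  have i2 : Ioo p q ⊆ (fun z => uf (-z)) '' univ :=
    isPreconnected_univ.intermediate_value_Ioo (l₁ := atTop)
      (l₂ := atBot) (by simp) (by simp) hr.continuous_fst.continuousOn
      (f1.comp tendsto_neg_atTop_atBot) (f2.comp tendsto_neg_atBot_atTop)
  refine ⟨ub, wb, _, _, hb, hr, ⟨hb0, by rw [(hbV 0).2, hb0]⟩, ⟨by simp [hf0], by
      simp [(hfV 0).2, hf0]⟩, fun z => ?_, fun z => ?_, ⟨b1, b2, b3, b4⟩,
    ⟨f2.comp tendsto_neg_atBot_atTop, f1.comp tendsto_neg_atTop_atBot, c4, c3⟩,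
    union_subset_union ?_ ?_, ?_⟩
  · rw [(hbV z).2]
    exact h1.pos _ (hbV z).1
  · have := h2.pos _ (hfV (-z)).1
    simp only [(hfV (-z)).2]
    linarith
  · rintro _ ⟨z, -, rfl⟩
    exact ⟨ub z, Ioo_subset_Icc_self (hbV z).1, by simp [(hbV z).2]⟩
  · rintro _ ⟨z, -, rfl⟩
    exact ⟨uf (-z), Ioo_subset_Icc_self (hfV (-z)).1, by simp [(hfV (-z)).2]⟩
  · rw [closure_union]
    refine union_subset_union ?_ ?_
    · exact graphSet_subset_closure h1.cont hpq i1 fun z _ => (hbV z).2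
    · exact graphSet_subset_closure h2.cont.neg hpq i2 fun z _ => by simp [(hfV (-z)).2]

/-- `O` is a homoclinic orbit of `(s, 0)`. -/
def IsPulse (a β : ℝ → ℝ) (J : Set ℝ) (s : ℝ) (O : Set PhasePlane) : Prop :=
  ∃ u w : ℝ → ℝ, IsOrbit a β J u w ∧ (Tendsto u atBot (𝓝 s) ∧ Tendsto u atTop (𝓝 s) ∧
    Tendsto w atBot (𝓝 0) ∧ Tendsto w atTop (𝓝 0)) ∧
    (∃ z, ¬ (u z = s ∧ w z = 0)) ∧ O = trajectory u w univ

/-- `O` consists of an orbit from `(p, 0)` to `(q, 0)` in the upper half plane and an orbit from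
`(q, 0)` to `(p, 0)` in the lower half plane. -/
def IsHetCycle (a β : ℝ → ℝ) (J : Set ℝ) (p q : ℝ) (O : Set PhasePlane) : Prop :=
  ∃ ub wb uf wf : ℝ → ℝ,
    (IsOrbit a β J ub wb ∧ (Tendsto ub atBot (𝓝 p) ∧ Tendsto ub atTop (𝓝 q) ∧
      Tendsto wb atBot (𝓝 0) ∧ Tendsto wb atTop (𝓝 0)) ∧ ∀ z, 0 < wb z) ∧
    (IsOrbit a β J uf wf ∧ (Tendsto uf atBot (𝓝 q) ∧ Tendsto uf atTop (𝓝 p) ∧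
      Tendsto wf atBot (𝓝 0) ∧ Tendsto wf atTop (𝓝 0)) ∧ ∀ z, wf z < 0) ∧
    O = trajectory ub wb univ ∪ trajectory uf wf univ

namespace Scene

variable {b g u w : ℝ → ℝ} {e m s μ x : ℝ} {O : Set PhasePlane}

/-- Any homoclinic solution has its minimum at the same matched end, and there it passes through
`(p, 0)`; up to a time shift it is the solution constructed from the two arcs. The orbit is only
sandwiched between the loop and its own closure because it misses the equilibrium. -/
theorem isPulse_iff_right (S : Scene a b g J e m s) (hs : s ∈ J) (has : a s = 0)
    (hp : p ∈ Ioo e m) (h0 : critGap a b g p s = 0) : ∃ O₁, O₁ ⊆ loopSet a b g p s ∧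
      loopSet a b g p s ⊆ closure O₁ ∧
      ∀ μ O, IsPulse a (pert b g μ) J s O ↔ μ = crit a b g p s ∧ O = O₁ := by
  have hpJ : p ∈ J := S.sub ⟨hp.1, hp.2.trans S.hms⟩
  have hc := S.cell hpJ hp.1.le hp.2 hs S.hms le_rfl
  have hJ : Icc p s ⊆ J := S.ord.out hpJ hs
  have hps : p < s := hp.2.trans S.hms
  obtain ⟨u, w, hor, hu0, hw0, l1, l2, l3, l4, hs1, hs2⟩ := exists_homoclinic_right
    hc.upperArc_spec (hc.lowerArc_spec h0) (S.la.lipPair (S.lb.pert S.lg _) hJ) hps hJ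
    (S.apos p hp).ne' has
  refine ⟨_, hs1, hs2, fun μ O => ⟨?_, ?_⟩⟩
  · rintro ⟨u', w', hor', ⟨t1, t2, t3, t4⟩, hne, rfl⟩
    obtain ⟨p', hp', h0', hμ, z, hzu, hzw⟩ := S.exists_matched_of_pulse hs has hor' t1 t2 t3 t4 hne
    have hpJ' : p' ∈ J := S.sub ⟨hp'.1, hp'.2.trans S.hms⟩
    obtain rfl : p = p' := hc.critGap_inj_left
      (S.cell hpJ' hp'.1.le hp'.2 hs S.hms le_rfl) (h0.trans h0'.symm)
    refine ⟨hμ.symm, ?_⟩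
    rw [hμ] at hor
    obtain ⟨rfl, rfl⟩ := IsOrbit.unique S.ord S.la (S.lb.pert S.lg μ) hor (hor'.shift z)
      (t₀ := 0) (by simp [hu0, hzu]) (by simp [hw0, hzw])
    rw [trajectory_shift]
  · rintro ⟨rfl, rfl⟩
    exact ⟨u, w, hor, ⟨l1, l2, l3, l4⟩, ⟨0, fun h => hps.ne (hu0.symm.trans h.1)⟩, rfl⟩

theorem isPulse_iff_left (S : Scene a b g J e m s) (he : e ∈ J) (hae : a e = 0)
    (hq : q ∈ Ioo m s) (h0 : critGap a b g e q = 0) : ∃ O₁, O₁ ⊆ loopSet a b g e q ∧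
      loopSet a b g e q ⊆ closure O₁ ∧
      ∀ μ O, IsPulse a (pert b g μ) J e O ↔ μ = crit a b g e q ∧ O = O₁ := by
  have hqJ : q ∈ J := S.sub ⟨S.hem.trans hq.1, hq.2⟩
  have hc := S.cell he le_rfl S.hem hqJ hq.1 hq.2.le
  have hJ : Icc e q ⊆ J := S.ord.out he hqJ
  have heq : e < q := S.hem.trans hq.1
  obtain ⟨u, w, hor, hu0, hw0, l1, l2, l3, l4, hs1, hs2⟩ := exists_homoclinic_left
    hc.upperArc_spec (hc.lowerArc_spec h0) (S.la.lipPair (S.lb.pert S.lg _) hJ) heq hJ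
    hae (S.aneg q hq).ne
  refine ⟨_, hs1, hs2, fun μ O => ⟨?_, ?_⟩⟩
  · rintro ⟨u', w', hor', ⟨t1, t2, t3, t4⟩, hne, rfl⟩
    obtain ⟨q', hq', h0', hμ, z, hzu, hzw⟩ :=
      S.exists_matched_of_pulse' he hae hor' t1 t2 t3 t4 hne
    have hqJ' : q' ∈ J := S.sub ⟨S.hem.trans hq'.1, hq'.2⟩
    obtain rfl : q = q' := hc.critGap_inj_right
      (S.cell he le_rfl S.hem hqJ' hq'.1 hq'.2.le) (h0.trans h0'.symm)
    refine ⟨hμ.symm, ?_⟩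
    rw [hμ] at hor
    obtain ⟨rfl, rfl⟩ := IsOrbit.unique S.ord S.la (S.lb.pert S.lg μ) hor (hor'.shift z)
      (t₀ := 0) (by simp [hu0, hzu]) (by simp [hw0, hzw])
    rw [trajectory_shift]
  · rintro ⟨rfl, rfl⟩
    exact ⟨u, w, hor, ⟨l1, l2, l3, l4⟩, ⟨0, fun h => heq.ne' (hu0.symm.trans h.1)⟩, rfl⟩

/-- No information on the gap is assumed, so this also excludes cycles at every speed at which the
gap is nonzero. -/
theorem crit_of_hetCycle (S : Scene a b g J e m s) (he : e ∈ J) (hs : s ∈ J)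
    (h : IsHetCycle a (pert b g μ) J e s O) : critGap a b g e s = 0 ∧ crit a b g e s = μ := by
  obtain ⟨ub, wb, uf, wf, ⟨h1, ⟨b1, b2, b3, b4⟩, h2⟩, ⟨h3, ⟨f1, f2, f3, f4⟩, h4⟩, -⟩ := h
  have hc := S.cell he le_rfl S.hem hs S.hms le_rfl
  have e1 := h1.crit_eq_of_univ hc h2 b1 b3 b2 b4
  have hr := h3.reverse
  rw [← pert_neg] at hr
  have e2 := hr.crit_eq_of_univ hc.neg (fun z => by have := h4 (-z); simpa using this)
    (f2.comp tendsto_neg_atBot_atTop)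
    (by simpa using (f4.comp tendsto_neg_atBot_atTop).neg) (f1.comp tendsto_neg_atTop_atBot)
    (by simpa using (f3.comp tendsto_neg_atTop_atBot).neg)
  exact ⟨by rw [critGap, e1, e2]; ring, e1⟩

theorem isHetCycle_iff (S : Scene a b g J e m s) (he : e ∈ J) (hs : s ∈ J) (hae : a e = 0)
    (has : a s = 0) (h0 : critGap a b g e s = 0) : ∃ O₁, O₁ ⊆ loopSet a b g e s ∧
      loopSet a b g e s ⊆ closure O₁ ∧
      ∀ μ O, IsHetCycle a (pert b g μ) J e s O ↔ μ = crit a b g e s ∧ O = O₁ := by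
  have hc := S.cell he le_rfl S.hem hs S.hms le_rfl
  have hJ : Icc e s ⊆ J := S.ord.out he hs
  have hem : m ∈ Ioo e s := ⟨S.hem, S.hms⟩
  have key : ∀ μ O, IsHetCycle a (pert b g μ) J e s O → μ = crit a b g e s := fun μ O h =>
    (S.crit_of_hetCycle he hs h).2.symm
  obtain ⟨ub, wb, uf, wf, hb, hf, hb0, hf0, hbp, hfn, hbl, hfl, hs1, hs2⟩ :=
    exists_heteroclinic_cycle hc.upperArc_spec (hc.lowerArc_spec h0)
      (S.la.lipPair (S.lb.pert S.lg _) hJ) hJ hae has hem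
  refine ⟨_, hs1, hs2, fun μ O => ⟨fun h => ?_, ?_⟩⟩
  · have hμ := key μ O h
    refine ⟨hμ, ?_⟩
    obtain ⟨ub', wb', uf', wf', ⟨h1, ⟨b1, b2, b3, b4⟩, h2⟩, ⟨h3, ⟨f1, f2, f3, f4⟩, h4⟩, rfl⟩ := h
    have himg : ∀ {v : ℝ → ℝ}, Continuous v → ∀ {l₁ l₂ : Filter ℝ}, l₁.NeBot → l₂.NeBot →
        Tendsto v l₁ (𝓝 e) → Tendsto v l₂ (𝓝 s) → ∃ z, v z = m := by
      intro v hv l₁ l₂ hn₁ hn₂ t1 t2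
      obtain ⟨z, -, hz⟩ := isPreconnected_univ.intermediate_value_Ioo (l₁ := l₁) (l₂ := l₂)
        (by simp) (by simp) hv.continuousOn t1 t2 hem
      exact ⟨z, hz⟩
    obtain ⟨zb, hzb⟩ := himg h1.continuous_fst inferInstance inferInstance b1 b2
    obtain ⟨zf, hzf⟩ := himg h3.continuous_fst inferInstance inferInstance f2 f1
    -- Every connection passes over `m` at the height of the branch. Two of them thus have a common
    -- point and differ by a time shift.
    have hval : ∀ {b' u w : ℝ → ℝ} {ν z : ℝ}, Cell a b' g e m s → IsOrbit a (pert b' g ν) J u w →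
        (∀ z, 0 < w z) → Tendsto u atBot (𝓝 e) → Tendsto u atTop (𝓝 s) →
        Tendsto w atBot (𝓝 0) → u z = m → w z = leftVal a (pert b' g ν) e m := by
      intro b' u w ν z hc' hor hpos t1 t2 t3 hz
      have hsm := hor.strictMonoOn_of_pos ordConnected_univ (fun z _ => hpos z)
      refine hor.height_eq_leftVal hc'.left (hc'.cpertl ν) hz (l := atBot) ?_ t1 t3
      filter_upwards [eventually_le_atBot z] with y hy
      refine ⟨hy, fun x _ => ⟨hpos x, ?_⟩⟩
      refine lt_of_le_of_lt ?_ (hsm (mem_univ (x - 1)) (mem_univ x) (by linarith))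
      refine le_of_tendsto t1 ?_
      filter_upwards [eventually_le_atBot (x - 1)] with v hv
      exact hsm.monotoneOn (mem_univ _) (mem_univ _) hv
    rw [← hμ] at hb hf
    have v1 := hval hc hb hbp hbl.1 hbl.2.1 hbl.2.2.1 hb0.1
    have v2 := hval hc h1 h2 b1 b2 b3 hzb
    have hrev : ∀ {u w : ℝ → ℝ} {z : ℝ}, IsOrbit a (pert b g μ) J u w → (∀ z, w z < 0) →
        Tendsto u atBot (𝓝 s) → Tendsto u atTop (𝓝 e) → Tendsto w atTop (𝓝 0) → u z = m →
        -w z = leftVal a (pert (-b) g (-μ)) e m := by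
      intro u w z hor hneg t1 t2 t4 hz
      have hr := hor.reverse
      rw [← pert_neg] at hr
      have := hval (z := -z) hc.neg hr (fun z => by have := hneg (-z); simpa using this)
        (t2.comp tendsto_neg_atBot_atTop) (t1.comp tendsto_neg_atTop_atBot)
        (by simpa using (t4.comp tendsto_neg_atBot_atTop).neg) (by simpa using hz)
      simpa using this
    have v3 := hrev hf hfn hfl.1 hfl.2.1 hfl.2.2.2 hf0.1
    have v4 := hrev h3 h4 f1 f2 f4 hzf
    obtain ⟨rfl, rfl⟩ := IsOrbit.unique S.ord S.la (S.lb.pert S.lg μ) hb (h1.shift zb)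
      (t₀ := 0) (by simp [hb0, hzb]) (by simp only [zero_add]; rw [v1, v2])
    obtain ⟨rfl, rfl⟩ := IsOrbit.unique S.ord S.la (S.lb.pert S.lg μ) hf (h3.shift zf)
      (t₀ := 0) (by simp [hf0, hzf]) (by simp only [zero_add]; linarith)
    rw [trajectory_shift, trajectory_shift]
  · rintro ⟨rfl, rfl⟩
    exact ⟨ub, wb, uf, wf, ⟨hb, hbl, hbp⟩, ⟨hf, hfl, hfn⟩, rfl⟩

end Scene

/-! ### Limits of the period, of `μ` and of the orbits -/

/-- The distance to an equilibrium grows at most exponentially. -/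
theorem IsOrbit.energy_le {a β u w : ℝ → ℝ} {J : Set ℝ} {t₁ t₂ P Q s B : ℝ} {K : NNReal}
    (h : IsOrbit a β J u w) (h12 : t₁ ≤ t₂) (hu : ∀ z, u z ∈ Icc P Q)
    (hK : LipschitzOnWith K a (Icc P Q)) (hB : ∀ x ∈ Icc P Q, |β x| ≤ B) (hs : s ∈ Icc P Q)
    (has : a s = 0) :
    (u t₁ - s) ^ 2 + w t₁ ^ 2 ≤
      ((u t₂ - s) ^ 2 + w t₂ ^ 2) * Real.exp ((1 + K + 2 * B) * (t₂ - t₁)) := by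
  -- With `E = (u - s) ^ 2 + w ^ 2`, the terms `2 (u - s) w` and `2 w a` are at most `E` and `K E`
  -- in absolute value, and `2 β w ^ 2` is at most `2 B E`.
  set C : ℝ := 1 + K + 2 * B
  have hmono : MonotoneOn (fun z => ((u z - s) ^ 2 + w z ^ 2) * Real.exp (C * z)) (Icc t₁ t₂) := by
    apply monotoneOn_Icc_of_hasDerivAt (f' := fun z =>
      ((2 * (u z - s) * w z + 2 * w z * (a (u z) + β (u z) * w z)) +
        C * ((u z - s) ^ 2 + w z ^ 2)) * Real.exp (C * z))
    · have h1 := h.continuous_fst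
      have h2 := h.continuous_snd
      fun_prop
    · intro z _
      have h1 := (((h z).2.1.sub_const s).pow 2).add ((h z).2.2.pow 2)
      have h2 := ((hasDerivAt_id z).const_mul C).exp
      refine (h1.mul h2).congr_deriv ?_
      simp only [Pi.add_apply, Pi.pow_apply, Nat.cast_ofNat, Nat.add_one_sub_one, pow_one, id_eq,
        mul_one]
      ring
    · intro z _
      refine mul_nonneg ?_ (Real.exp_pos _).le
      have k1 : |a (u z)| ≤ K * |u z - s| := by
        have := hK.dist_le_mul _ (hu z) _ hs
        rwa [Real.dist_eq, Real.dist_eq, has, sub_zero] at this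
      have k2 := hB _ (hu z)
      have e1 : |w z * a (u z)| ≤ K * (|w z| * |u z - s|) := by
        rw [abs_mul]
        calc |w z| * |a (u z)| ≤ |w z| * (K * |u z - s|) := by gcongr
          _ = _ := by ring
      have e2 : |β (u z) * w z ^ 2| ≤ B * w z ^ 2 := by
        rw [abs_mul, abs_of_nonneg (sq_nonneg (w z))]
        gcongr
      have e3 : |w z| * |u z - s| ≤ ((u z - s) ^ 2 + w z ^ 2) / 2 := by
        rw [← sq_abs (u z - s), ← sq_abs (w z)]
        nlinarith [sq_nonneg (|w z| - |u z - s|)]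
      have e4 : |(u z - s) * w z| ≤ ((u z - s) ^ 2 + w z ^ 2) / 2 := by
        rw [abs_mul, mul_comm]
        exact e3
      have e5 : (K:ℝ) * (|w z| * |u z - s|) ≤ K * (((u z - s) ^ 2 + w z ^ 2) / 2) :=
        mul_le_mul_of_nonneg_left e3 K.2
      have e6 : 0 ≤ B * (u z - s) ^ 2 := mul_nonneg ((abs_nonneg _).trans k2) (sq_nonneg _)
      have f1 := (abs_le.1 e1).1
      have f2 := (abs_le.1 e2).1
      have f4 := (abs_le.1 e4).1
      simp only [C]
      nlinarith
  have := hmono (left_mem_Icc.2 h12) (right_mem_Icc.2 h12) h12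
  simp only at this
  have e : Real.exp (C * t₂) = Real.exp (C * (t₂ - t₁)) * Real.exp (C * t₁) := by
    rw [← Real.exp_add]
    ring_nf
  rw [e, ← mul_assoc] at this
  exact le_of_mul_le_mul_right this (Real.exp_pos _)

/-- The loop passes over `m`, at a definite distance from the equilibrium `s`. An end close to `s`
can be that close only if the period is long; for the left end the growth estimate is applied to the
reversed orbit. -/
theorem IsLoop.sq_le {a β V₁ V₂ u w : ℝ → ℝ} {J : Set ℝ} {p q T Z P Q s B m x : ℝ} {K : NNReal}
    (h : IsLoop a β J p q V₁ V₂ u w T Z) (hsub : Icc p q ⊆ Icc P Q)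
    (hK : LipschitzOnWith K a (Icc P Q)) (hB : ∀ x ∈ Icc P Q, |β x| ≤ B) (hs : s ∈ Icc P Q)
    (has : a s = 0) (hm : m ∈ Icc p q) (hx : x = p ∨ x = q) :
    (m - s) ^ 2 ≤ (x - s) ^ 2 * Real.exp ((1 + K + 2 * B) * Z) := by
  obtain ⟨z, hz, hzm⟩ := intermediate_value_Icc h.T_pos.le h.orbit.continuous_fst.continuousOn
    (show m ∈ Icc (u 0) (u T) by rwa [h.u_zero, h.u_T])
  have hB0 : 0 ≤ B := (abs_nonneg _).trans (hB s hs)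
  have hK0 : (0:ℝ) ≤ K := K.2
  have hTZ := h.T_lt
  have hexp : ∀ {d}, d ≤ Z → (x - s) ^ 2 * Real.exp ((1 + K + 2 * B) * d) ≤
      (x - s) ^ 2 * Real.exp ((1 + K + 2 * B) * Z) := by
    intro d hd
    gcongr
  have hmz : (m - s) ^ 2 ≤ (u z - s) ^ 2 + w z ^ 2 := by
    rw [hzm]
    linarith [sq_nonneg (w z)]
  rcases hx with rfl | rfl
  · have hB' : ∀ x ∈ Icc P Q, |(-β) x| ≤ B := fun x hx => by simpa using hB x hx
    have := h.orbit.reverse.energy_le (t₁ := -z) (t₂ := 0) (by linarith [hz.1])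
      (fun z => hsub (h.mem_Icc (-z))) hK hB' hs has
    simp only [neg_neg, neg_zero, h.u_zero, h.w_zero, sub_neg_eq_add, zero_add, even_two,
      Even.neg_pow, ne_eq, OfNat.ofNat_ne_zero, not_false_eq_true, zero_pow, add_zero] at this
    exact hmz.trans (this.trans (hexp (by linarith [hz.2])))
  · have := h.orbit.energy_le hz.2 (fun z => hsub (h.mem_Icc z)) hK hB hs has
    rw [h.u_T, h.w_T] at this
    simp only [ne_eq, OfNat.ofNat_ne_zero, not_false_eq_true, zero_pow, add_zero] at this
    exact hmz.trans (this.trans (hexp (by linarith [hz.1])))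

/-- The time spent in a half plane by an orbit which circles around an almost linear centre. -/
theorem IsOrbit.abs_omega_mul_sub_pi_le {a β u w : ℝ → ℝ} {J : Set ℝ} {s t m ω η₁ η₂ : ℝ}
    (h : IsOrbit a β J u w) (hst : s < t) (hws : w s = 0) (hwt : w t = 0)
    (hpos : ∀ z ∈ Ioo s t, 0 < w z) (hus : u s < m) (hut : m < u t) (hω : 0 < ω) (hη₁ : 0 ≤ η₁)
    (hη₂ : 0 ≤ η₂) (ha : ∀ z, |a (u z) + ω ^ 2 * (u z - m)| ≤ η₁ * |u z - m|)
    (hβ : ∀ z, |β (u z)| ≤ η₂) :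
    |ω * (t - s) - Real.pi| ≤ (η₁ / ω + η₂ / 2) * (t - s) := by
  set η := η₁ / ω + η₂ / 2
  -- The angle measured from the positive `w`-axis in the coordinates `(ω (u - m), w)`. For the
  -- linear centre it turns at speed `ω`; the deviations of `a` and `β` change the speed by at most
  -- `η`, and the angle runs from `-π / 2` to `π / 2`.
  set φ : ℝ → ℝ := fun z => Real.arctan (ω * (u z - m) / w z)
  have hd : ∀ z ∈ Ioo s t, ∃ d, HasDerivAt φ d z ∧ |d - ω| ≤ η := by
    intro z hz
    have hw := hpos z hz
    have h1 := ((((h z).2.1.sub_const m).const_mul ω).div (h z).2.2 hw.ne').arctan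
    refine ⟨_, h1, ?_⟩
    set x := u z - m
    set y := w z
    have hden : 0 < y ^ 2 + (ω * x) ^ 2 := by positivity
    have e : 1 / (1 + ((fun y => ω * (u y - m)) / w) z ^ 2) *
        ((ω * y * y - ω * x * (a (u z) + β (u z) * y)) / y ^ 2) - ω =
        -(ω * (x * (a (u z) + ω ^ 2 * x) + β (u z) * (x * y))) / (y ^ 2 + (ω * x) ^ 2) := by
      simp only [Pi.div_apply]
      change 1 / (1 + (ω * x / y) ^ 2) * _ - ω = _
      rw [div_pow, eq_div_iff hden.ne']
      have h2 : 1 + (ω * x) ^ 2 / y ^ 2 = (y ^ 2 + (ω * x) ^ 2) / y ^ 2 := by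
        field_simp
      rw [h2]
      field_simp
      ring
    rw [e, abs_div, abs_neg, abs_of_pos hden, div_le_iff₀ hden, abs_mul, abs_of_pos hω]
    have e1 : |x * (a (u z) + ω ^ 2 * x)| ≤ η₁ * x ^ 2 := by
      rw [abs_mul]
      calc |x| * |a (u z) + ω ^ 2 * x| ≤ |x| * (η₁ * |x|) :=
            mul_le_mul_of_nonneg_left (ha z) (abs_nonneg _)
        _ = η₁ * |x| ^ 2 := by ring
        _ = η₁ * x ^ 2 := by rw [sq_abs]
    have e2 : |β (u z) * (x * y)| ≤ η₂ * (|x| * y) := by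
      rw [abs_mul, abs_mul, abs_of_pos hw]
      exact mul_le_mul_of_nonneg_right (hβ z) (by positivity)
    have e3 : ω * (|x| * y) ≤ (y ^ 2 + (ω * x) ^ 2) / 2 := by
      have := sq_nonneg (y - ω * |x|)
      have h3 : (ω * x) ^ 2 = (ω * |x|) ^ 2 := by rw [mul_pow, mul_pow, sq_abs]
      rw [h3]
      nlinarith
    have e4 := abs_add_le (x * (a (u z) + ω ^ 2 * x)) (β (u z) * (x * y))
    calc ω * |x * (a (u z) + ω ^ 2 * x) + β (u z) * (x * y)|
        ≤ ω * (η₁ * x ^ 2 + η₂ * (|x| * y)) := by gcongr; linarith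
      _ = η₁ / ω * (ω * x) ^ 2 + η₂ * (ω * (|x| * y)) := by field_simp
      _ ≤ η₁ / ω * (y ^ 2 + (ω * x) ^ 2) + η₂ * ((y ^ 2 + (ω * x) ^ 2) / 2) := by
          gcongr
          linarith [sq_nonneg y]
      _ = η * (y ^ 2 + (ω * x) ^ 2) := by simp only [η]; ring
  choose! d hd hdη using hd
  have hlip : ∀ z₁ ∈ Ioo s t, ∀ z₂ ∈ Ioo s t, z₁ ≤ z₂ →
      |ω * (z₂ - z₁) - (φ z₂ - φ z₁)| ≤ η * (t - s) := by
    intro z₁ h1 z₂ h2 h12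
    have := (convex_Ioo s t).norm_image_sub_le_of_norm_hasDerivWithin_le
      (f := fun z => ω * z - φ z) (f' := fun z => ω - d z) (C := η)
      (fun z hz => (((hasDerivAt_id z).const_mul ω).sub (hd z hz)).hasDerivWithinAt.congr_deriv
        (by simp)) (fun z hz => by
          rw [Real.norm_eq_abs, abs_sub_comm]
          exact hdη z hz) h1 h2
    rw [Real.norm_eq_abs, Real.norm_eq_abs, abs_of_nonneg (sub_nonneg.2 h12)] at this
    have e : ω * (z₂ - z₁) - (φ z₂ - φ z₁) = ω * z₂ - φ z₂ - (ω * z₁ - φ z₁) := by ring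
    rw [e]
    refine this.trans ?_
    have : 0 ≤ η := by positivity
    exact mul_le_mul_of_nonneg_left (by linarith [h1.1, h2.2]) this
  have hwl : Tendsto w (𝓝[>] s) (𝓝[>] 0) := by
    refine tendsto_nhdsWithin_iff.2 ⟨?_, ?_⟩
    · exact hws ▸ (h.continuous_snd.tendsto s).mono_left nhdsWithin_le_nhds
    · filter_upwards [Ioo_mem_nhdsGT hst] with z hz using hpos z hz
  have hwr : Tendsto w (𝓝[<] t) (𝓝[>] 0) := by
    refine tendsto_nhdsWithin_iff.2 ⟨?_, ?_⟩
    · exact hwt ▸ (h.continuous_snd.tendsto t).mono_left nhdsWithin_le_nhds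
    · filter_upwards [Ioo_mem_nhdsLT hst] with z hz using hpos z hz
  have hul : Tendsto (fun z => ω * (u z - m)) (𝓝[>] s) (𝓝 (ω * (u s - m))) :=
    (((h.continuous_fst.tendsto s).sub_const m).const_mul ω).mono_left nhdsWithin_le_nhds
  have hur : Tendsto (fun z => ω * (u z - m)) (𝓝[<] t) (𝓝 (ω * (u t - m))) :=
    (((h.continuous_fst.tendsto t).sub_const m).const_mul ω).mono_left nhdsWithin_le_nhds
  have hφl : Tendsto φ (𝓝[>] s) (𝓝 (-(Real.pi / 2))) := by
    refine (Real.tendsto_arctan_atBot.mono_right nhdsWithin_le_nhds).comp ?_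
    exact hul.neg_mul_atTop (mul_neg_of_pos_of_neg hω (by linarith))
      (tendsto_inv_nhdsGT_zero.comp hwl)
  have hφr : Tendsto φ (𝓝[<] t) (𝓝 (Real.pi / 2)) := by
    refine (Real.tendsto_arctan_atTop.mono_right nhdsWithin_le_nhds).comp ?_
    exact hur.pos_mul_atTop (mul_pos hω (by linarith)) (tendsto_inv_nhdsGT_zero.comp hwr)
  set r := (s + t) / 2
  have hlim1 : ∀ z₂ ∈ Ioo s t, |ω * (z₂ - s) - (φ z₂ - -(Real.pi / 2))| ≤ η * (t - s) := by
    intro z₂ h2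
    have : Tendsto (fun z₁ => |ω * (z₂ - z₁) - (φ z₂ - φ z₁)|) (𝓝[>] s)
        (𝓝 |ω * (z₂ - s) - (φ z₂ - -(Real.pi / 2))|) :=
      (((((continuous_id.tendsto s).mono_left nhdsWithin_le_nhds).const_sub z₂).const_mul ω).sub
        (hφl.const_sub _)).abs
    refine le_of_tendsto this ?_
    filter_upwards [Ioo_mem_nhdsGT h2.1] with z hz
    exact hlip z ⟨hz.1, hz.2.trans h2.2⟩ z₂ h2 hz.2.le
  have hfin : Tendsto (fun z₂ => |ω * (z₂ - s) - (φ z₂ - -(Real.pi / 2))|) (𝓝[<] t)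
      (𝓝 |ω * (t - s) - (Real.pi / 2 - -(Real.pi / 2))|) :=
    (((((continuous_id.tendsto t).mono_left nhdsWithin_le_nhds).sub_const s).const_mul ω).sub
      (hφr.sub_const _)).abs
  have e : ω * (t - s) - Real.pi = ω * (t - s) - (Real.pi / 2 - -(Real.pi / 2)) := by ring
  rw [e]
  refine le_of_tendsto hfin ?_
  filter_upwards [Ioo_mem_nhdsLT hst] with z hz using hlim1 z hz

theorem IsLoop.abs_omega_mul_sub_le {a β V₁ V₂ u w : ℝ → ℝ} {J : Set ℝ} {p q T Z m ω η₁ η₂ : ℝ}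
    (h : IsLoop a β J p q V₁ V₂ u w T Z) (hm : m ∈ Ioo p q) (hω : 0 < ω) (hη₁ : 0 ≤ η₁)
    (hη₂ : 0 ≤ η₂) (ha : ∀ x ∈ Icc p q, |a x + ω ^ 2 * (x - m)| ≤ η₁ * |x - m|)
    (hβ : ∀ x ∈ Icc p q, |β x| ≤ η₂) :
    |ω * Z - 2 * Real.pi| ≤ (η₁ / ω + η₂ / 2) * Z := by
  have h1 := h.orbit.abs_omega_mul_sub_pi_le h.T_pos h.w_zero h.w_T (fun z hz => h.pos hz)
    (by rw [h.u_zero]; exact hm.1) (by rw [h.u_T]; exact hm.2) hω hη₁ hη₂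
    (fun z => ha _ (h.mem_Icc z)) (fun z => hβ _ (h.mem_Icc z))
  have h2 := h.orbit.reverse.abs_omega_mul_sub_pi_le (m := m) (s := -Z) (t := -T)
    (neg_lt_neg h.T_lt) (by simp [h.w_Z]) (by simp [h.w_T])
    (fun z hz => neg_pos.2 (h.neg ⟨by linarith [hz.2], by linarith [hz.1]⟩))
    (by rw [neg_neg, h.u_Z]; exact hm.1) (by rw [neg_neg, h.u_T]; exact hm.2) hω hη₁ hη₂
    (fun z => ha _ (h.mem_Icc _)) (fun z => by simpa using hβ _ (h.mem_Icc (-z)))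
  have e : ω * Z - 2 * Real.pi = (ω * (T - 0) - Real.pi) + (ω * (-T - -Z) - Real.pi) := by ring
  rw [e]
  refine (abs_add_le _ _).trans ((add_le_add h1 h2).trans_eq ?_)
  ring

namespace Scene

variable {a b g : ℝ → ℝ} {J : Set ℝ} {e m s p q μ s' ω : ℝ} {ι : Type*} {l : Filter ι}
  {P R X : ι → ℝ}

/-- The family `X` selects the end that tends to an equilibrium `s'`. All loops lie over one compact
interval and the values of `μ` are bounded, so the growth rate is uniform. -/
theorem tendsto_loopTime_atTop (S : Scene a b g J e m s) (hpq : Icc p q ⊆ J)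
    (hP : ∀ᶠ i in l, P i ∈ Ioo e m ∧ p ≤ P i) (hR : ∀ᶠ i in l, R i ∈ Ioo m s ∧ R i ≤ q)
    (h0 : ∀ᶠ i in l, critGap a b g (P i) (R i) = 0) (hs' : s' ∈ Icc p q) (has : a s' = 0)
    (hsm : s' ≠ m) (hX : ∀ᶠ i in l, X i = P i ∨ X i = R i) (hXt : Tendsto X l (𝓝 s'))
    (hμ : Tendsto (fun i => crit a b g (P i) (R i)) l (𝓝 μ)) :
    Tendsto (fun i => loopTime a b g J (P i) (R i)) l atTop := by
  obtain ⟨K, hK⟩ := S.la p q hpq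
  obtain ⟨B, hB0, hB⟩ := exists_abs_bound_Icc (S.lb.continuousOn_Icc hpq)
  obtain ⟨G, hG0, hG⟩ := exists_abs_bound_Icc (S.lg.continuousOn_Icc hpq)
  have hμ' : ∀ᶠ i in l, |crit a b g (P i) (R i)| < |μ| + 1 :=
    hμ.abs.eventually (gt_mem_nhds (by linarith))
  set C : ℝ := 1 + K + 2 * (B + (|μ| + 1) * G)
  have hC : 0 < C := by positivity
  rw [tendsto_atTop]
  intro Z
  have hlim : Tendsto (fun i => (X i - s') ^ 2 * Real.exp (C * Z)) l (𝓝 0) := by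
    have := ((hXt.sub_const s').pow 2).mul_const (Real.exp (C * Z))
    simpa using this
  have hms : 0 < (m - s') ^ 2 := by
    have : m - s' ≠ 0 := sub_ne_zero.2 hsm.symm
    positivity
  filter_upwards [hlim.eventually (gt_mem_nhds hms), hP, hR, h0, hX, hμ']
    with i hi hPi hRi h0i hXi hμi
  by_contra hcon
  push Not at hcon
  obtain ⟨u, w, T, hl⟩ := S.exists_isLoop hPi.1 hRi.1 h0i
  have := hl.sq_le (P := p) (Q := q) (Icc_subset_Icc hPi.2 hRi.2) hK
    (B := B + (|μ| + 1) * G) (fun x hx => ?_) hs' has (m := m) ⟨hPi.1.2.le, hRi.1.1.le⟩ hXi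
  · have h2 : Real.exp (C * loopTime a b g J (P i) (R i)) ≤ Real.exp (C * Z) := by
      gcongr
    have h3 := mul_le_mul_of_nonneg_left h2 (sq_nonneg (X i - s'))
    linarith
  · refine (abs_add_le _ _).trans (add_le_add (hB x hx) ?_)
    rw [abs_mul]
    exact mul_le_mul hμi.le (hG x hx) (abs_nonneg _) (by positivity)

/-- The divergence vanishes at some `ξ` between the two ends, hence `μ = -(b ξ / g ξ)` with `ξ`
squeezed to `m`. -/
theorem tendsto_crit_centre (S : Scene a b g J e m s) (hP : ∀ᶠ i in l, P i ∈ Ioo e m)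
    (hR : ∀ᶠ i in l, R i ∈ Ioo m s) (h0 : ∀ᶠ i in l, critGap a b g (P i) (R i) = 0)
    (hPt : Tendsto P l (𝓝 m)) (hRt : Tendsto R l (𝓝 m)) :
    Tendsto (fun i => crit a b g (P i) (R i)) l (𝓝 (-(b m / g m))) := by
  have hmJ : m ∈ J := S.sub ⟨S.hem, S.hms⟩
  have hgm := S.gpos m hmJ
  have hc : ContinuousAt (fun x => -(b x / g x)) m :=
    (S.db.continuousAt.div S.dg.continuousAt hgm.ne').neg
  have hex : ∀ i, ∃ ξ, (P i ∈ Ioo e m → R i ∈ Ioo m s → critGap a b g (P i) (R i) = 0 →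
      ξ ∈ Icc (P i) (R i) ∧ crit a b g (P i) (R i) = -(b ξ / g ξ)) := by
    intro i
    by_cases h : P i ∈ Ioo e m ∧ R i ∈ Ioo m s ∧ critGap a b g (P i) (R i) = 0
    · obtain ⟨h1, h2, h3⟩ := h
      have hcell := S.cell' h1 h2
      obtain ⟨ξ, hξ, he⟩ := hcell.exists_pert_eq_zero h3
      refine ⟨ξ, fun _ _ _ => ⟨hξ, ?_⟩⟩
      have hg := hcell.gpos ξ hξ
      simp only [pert] at he
      field_simp
      linarith
    · exact ⟨0, fun h1 h2 h3 => absurd ⟨h1, h2, h3⟩ h⟩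
  choose ξ hξ using hex
  have hξt : Tendsto ξ l (𝓝 m) := by
    refine tendsto_of_tendsto_of_tendsto_of_le_of_le' hPt hRt ?_ ?_
    · filter_upwards [hP, hR, h0] with i h1 h2 h3 using (hξ i h1 h2 h3).1.1
    · filter_upwards [hP, hR, h0] with i h1 h2 h3 using (hξ i h1 h2 h3).1.2
  refine (hc.tendsto.comp hξt).congr' ?_
  filter_upwards [hP, hR, h0] with i h1 h2 h3
  exact ((hξ i h1 h2 h3).2).symm

theorem tendsto_loopSet_centre (S : Scene a b g J e m s) (hP : ∀ᶠ i in l, P i ∈ Ioo e m)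
    (hR : ∀ᶠ i in l, R i ∈ Ioo m s) (h0 : ∀ᶠ i in l, critGap a b g (P i) (R i) = 0)
    (hPt : Tendsto P l (𝓝 m)) (hRt : Tendsto R l (𝓝 m)) :
    Tendsto (fun i => Metric.hausdorffEDist (loopSet a b g (P i) (R i)) {!₂[m, 0]}) l (𝓝 0) := by
  have hμ := S.tendsto_crit_centre hP hR h0 hPt hRt
  obtain ⟨p, hp⟩ := nonempty_Ioo.2 S.hem
  obtain ⟨q, hq⟩ := nonempty_Ioo.2 S.hms
  refine (S.cell' hp hq).tendsto_loopSet_centre (μ' := - -(b m / g m)) ?_ ?_ hPt hRt hμ ?_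
  · filter_upwards [hP, hPt.eventually (lt_mem_nhds hp.2)] with i h1 h2 using ⟨h2.le, h1.2⟩
  · filter_upwards [hR, hRt.eventually (gt_mem_nhds hq.1)] with i h1 h2 using ⟨h1.1, h2.le⟩
  · refine hμ.neg.congr' ?_
    filter_upwards [h0] with i hi using (crit_neg_of_critGap hi).symm

theorem tendsto_loopTime_centre (S : Scene a b g J e m s) (hP : ∀ᶠ i in l, P i ∈ Ioo e m)
    (hR : ∀ᶠ i in l, R i ∈ Ioo m s) (h0 : ∀ᶠ i in l, critGap a b g (P i) (R i) = 0)
    (hPt : Tendsto P l (𝓝 m)) (hRt : Tendsto R l (𝓝 m)) (hω : 0 < ω)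
    (ha : HasDerivAt a (-ω ^ 2) m) :
    Tendsto (fun i => loopTime a b g J (P i) (R i)) l (𝓝 (2 * Real.pi / ω)) := by
  have hμ := S.tendsto_crit_centre hP hR h0 hPt hRt
  have hgm := S.gpos m (S.sub ⟨S.hem, S.hms⟩)
  have key : ∀ ε > 0, ∀ᶠ i in l,
      |ω * loopTime a b g J (P i) (R i) - 2 * Real.pi| ≤ ε * loopTime a b g J (P i) (R i) ∧
        0 < loopTime a b g J (P i) (R i) := by
    intro ε hε
    have e1 : 0 < ε * ω / 2 := by positivity
    have h1 : ∀ᶠ x in 𝓝 m, |a x + ω ^ 2 * (x - m)| ≤ ε * ω / 2 * |x - m| := by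
      have := (hasDerivAt_iff_isLittleO.1 ha).bound e1
      filter_upwards [this] with x hx
      rw [Real.norm_eq_abs, Real.norm_eq_abs, S.zero, sub_zero, smul_eq_mul] at hx
      convert hx using 2
      ring
    have h2 : ∀ᶠ y in 𝓝 (m, -(b m / g m)), |b y.1 + y.2 * g y.1| < ε := by
      have hb : ContinuousAt (fun y : ℝ × ℝ => b y.1) (m, -(b m / g m)) :=
        ContinuousAt.comp (f := Prod.fst) S.db.continuousAt continuousAt_fst
      have hg : ContinuousAt (fun y : ℝ × ℝ => g y.1) (m, -(b m / g m)) :=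
        ContinuousAt.comp (f := Prod.fst) S.dg.continuousAt continuousAt_fst
      have hc := (hb.add (continuousAt_snd.mul hg)).abs
      refine hc.eventually (gt_mem_nhds ?_)
      have : b m + -(b m / g m) * g m = 0 := by
        field_simp
        ring
      change |b m + -(b m / g m) * g m| < ε
      rwa [this, abs_zero]
    rw [nhds_prod_eq] at h2
    obtain ⟨s₁, hs₁, s₂, hs₂, h12⟩ := eventually_prod_iff.1 h2
    obtain ⟨x₁, x₂, hx, hxs⟩ := (mem_nhds_iff_exists_Ioo_subset).1 (h1.and hs₁)
    have hPx := hPt.eventually (Ioo_mem_nhds hx.1 hx.2)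
    have hRx := hRt.eventually (Ioo_mem_nhds hx.1 hx.2)
    filter_upwards [hP, hR, h0, hPx, hRx, hμ.eventually hs₂] with i hPi hRi h0i hPxi hRxi hμi
    obtain ⟨u, w, T, hl⟩ := S.exists_isLoop hPi hRi h0i
    have hin : ∀ x ∈ Icc (P i) (R i), x ∈ Ioo x₁ x₂ := fun x hx =>
      ⟨hPxi.1.trans_le hx.1, hx.2.trans_lt hRxi.2⟩
    refine ⟨?_, hl.isPeriod.1⟩
    have := hl.abs_omega_mul_sub_le ⟨hPi.2, hRi.1⟩ hω e1.le hε.le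
      (fun x hx => (hxs (hin x hx)).1) (fun x hx => (h12 (hxs (hin x hx)).2 hμi).le)
    convert this using 2
    field_simp
    ring
  rw [Metric.tendsto_nhds]
  intro δ hδ
  have hπ := Real.pi_pos
  -- The first bound gives `ω Z ≤ 4 π`; then `ε Z ω ≤ 4 π ε`, which the second bound makes at most
  -- `δ ω ^ 2 / 2`.
  set ε := min (ω / 2) (δ * ω ^ 2 / (8 * Real.pi))
  have hε : 0 < ε := lt_min (by positivity) (by positivity)
  filter_upwards [key ε hε] with i hi
  obtain ⟨hi1, hi2⟩ := hi
  set Z := loopTime a b g J (P i) (R i)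
  have hε1 : ε ≤ ω / 2 := min_le_left _ _
  have hε2 : ε * (8 * Real.pi) ≤ δ * ω ^ 2 := (le_div_iff₀ (by positivity)).1 (min_le_right _ _)
  have hZ : ω * Z ≤ 4 * Real.pi := by
    have := (abs_le.1 hi1).2
    nlinarith
  have e : Z - 2 * Real.pi / ω = (ω * Z - 2 * Real.pi) / ω := by field_simp
  rw [Real.dist_eq, e, abs_div, abs_of_pos hω, div_lt_iff₀ hω]
  refine hi1.trans_lt ?_
  have h3 : ε * Z * ω ≤ ε * (4 * Real.pi) := by nlinarith
  have h4 : ε * Z * ω < δ * ω * ω := by nlinarith [mul_pos hδ (pow_pos hω 2)]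
  exact lt_of_mul_lt_mul_right h4 hω.le

end Scene

/-! ### The partner of a given end and its limits -/

namespace Cell

variable {a b g : ℝ → ℝ} {p m q : ℝ}

theorem critGap_refl (h : Cell a b g p m q) :
    critGap (oddRefl a) (oddRefl b) (fun u => g (-u)) (-q) (-p) = -critGap a b g p q := by
  have e : -oddRefl b = oddRefl (-b) := by
    funext x
    simp [oddRefl]
  rw [critGap, critGap, h.crit_refl, e, h.neg.crit_refl]
  ring

/-- The lower end of the closed orbit with a given upper end. -/
theorem exists_matched_left (h : Cell a b g p m q) (h0 : critGap a b g p q = 0) :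
    ∃ P : ℝ → ℝ, (∀ x ∈ Ioo m q, P x ∈ Ioo p m ∧ critGap a b g (P x) x = 0) ∧
      Tendsto P (𝓝[Ioo m q] q) (𝓝 p) ∧ Tendsto P (𝓝[Ioo m q] m) (𝓝 m) := by
  have hcell : ∀ x ∈ Ioo m q, Cell a b g p m x := fun x hx => h.sub le_rfl h.hpm hx.2.le hx.1
  have hex : ∀ x, ∃ y, x ∈ Ioo m q → y ∈ Ioo p m ∧ critGap a b g y x = 0 := by
    intro x
    by_cases hx : x ∈ Ioo m q
    · have hc := hcell x hx
      -- The gap vanishes at the outer pair and decreases when the right end moves inwards; near the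
      -- centre it is positive, and the partner lies in between.
      have hneg : critGap a b g p x < 0 := by
        rw [← h0]
        exact h.critGap_strictMono le_rfl h.hpm hx.1 hx.2.le (Or.inr hx.2)
      obtain ⟨z, hz, hzm⟩ := (hc.eventually_critGap_pos.and (Ioo_mem_nhdsLT h.hpm)).exists
      obtain ⟨y, hy, hy0⟩ := intermediate_value_Icc hzm.1.le
        (hc.continuousOn_critGap_left.mono fun t ht => ⟨ht.1, ht.2.trans_lt hzm.2⟩)
        (show (0:ℝ) ∈ Icc _ _ from ⟨hneg.le, hz.le⟩)
      refine ⟨y, fun _ => ⟨⟨lt_of_le_of_ne hy.1 ?_, hy.2.trans_lt hzm.2⟩, hy0⟩⟩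
      rintro rfl
      simp only at hy0
      linarith
    · exact ⟨0, fun h => absurd h hx⟩
  choose P hP using hex
  refine ⟨P, hP, ?_, ?_⟩
  · refine tendsto_order.2 ⟨fun p' hp' => ?_, fun p' hp' => ?_⟩
    · filter_upwards [self_mem_nhdsWithin] with x hx using hp'.trans (hP x hx).1.1
    · set p'' := min p' ((p + m) / 2)
      have h1 : p < p'' := lt_min hp' (by linarith [h.hpm])
      have h2 : p'' < m := (min_le_right _ _).trans_lt (by linarith [h.hpm])
      have hc := h.sub h1.le h2 le_rfl h.hmq
      -- The gap at `(p'', x)` is still positive for `x` near `q`, so by monotonicity the zero `P x`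
      -- lies to the left of `p''`.
      have hpos : 0 < critGap a b g p'' q := by
        rw [← h0]
        exact h.critGap_strictMono h1.le h2 h.hmq le_rfl (Or.inl h1)
      have ht : Tendsto (fun x => critGap a b g p'' x) (𝓝[Ioo m q] q) (𝓝 (critGap a b g p'' q)) :=
        (hc.continuousOn_critGap_right q ⟨h.hmq, le_rfl⟩).mono Ioo_subset_Ioc_self
      filter_upwards [ht.eventually (lt_mem_nhds hpos), self_mem_nhdsWithin] with x hx hxm
      refine lt_of_lt_of_le ?_ (min_le_left p' ((p + m) / 2))
      by_contra hcon
      push Not at hcon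
      obtain ⟨hPx, hPx0⟩ := hP x hxm
      rcases eq_or_lt_of_le hcon with he | hlt
      · have he' : p'' = P x := he
        rw [he', hPx0] at hx
        exact lt_irrefl _ hx
      · have := (h.sub h1.le h2 hxm.2.le hxm.1).critGap_strictMono hcon hPx.2 hxm.1 le_rfl
          (Or.inl hlt)
        linarith
  · refine tendsto_order.2 ⟨fun p' hp' => ?_, fun p' hp' => ?_⟩
    · set p'' := max p' p
      have h1 : p ≤ p'' := le_max_right _ _
      have h2 : p'' < m := max_lt hp' h.hpm
      have hc := h.sub h1 h2 le_rfl h.hmq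
      have hev : ∀ᶠ x in 𝓝[Ioo m q] m, critGap a b g p'' x < 0 :=
        hc.eventually_critGap_neg.filter_mono (nhdsWithin_mono m Ioo_subset_Ioi_self)
      filter_upwards [hev, self_mem_nhdsWithin] with x hx hxm
      refine lt_of_le_of_lt (le_max_left p' p) ?_
      by_contra hcon
      push Not at hcon
      obtain ⟨hPx, hPx0⟩ := hP x hxm
      have hcon' : P x ≤ p'' := hcon
      rcases eq_or_lt_of_le hcon' with he | hlt
      · rw [← he, hPx0] at hx
        exact lt_irrefl _ hx
      · have := (h.sub hPx.1.le hPx.2 hxm.2.le hxm.1).critGap_strictMono hcon' h2 hxm.1 le_rfl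
          (Or.inl hlt)
        linarith
    · filter_upwards [self_mem_nhdsWithin] with x hx using (hP x hx).1.2.trans hp'

theorem exists_matched_right (h : Cell a b g p m q) (h0 : critGap a b g p q = 0) :
    ∃ R : ℝ → ℝ, (∀ x ∈ Ioo p m, R x ∈ Ioo m q ∧ critGap a b g x (R x) = 0) ∧
      Tendsto R (𝓝[Ioo p m] p) (𝓝 q) ∧ Tendsto R (𝓝[Ioo p m] m) (𝓝 m) := by
  obtain ⟨P, hP, h1, h2⟩ := h.refl.exists_matched_left (by rw [h.critGap_refl, h0, neg_zero])
  have hneg : ∀ y, Tendsto (fun x : ℝ => -x) (𝓝[Ioo p m] y) (𝓝[Ioo (-m) (-p)] (-y)) := by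
    intro y
    refine tendsto_nhdsWithin_iff.2 ⟨(continuous_neg.tendsto y).mono_left nhdsWithin_le_nhds, ?_⟩
    filter_upwards [self_mem_nhdsWithin] with x hx using ⟨neg_lt_neg hx.2, neg_lt_neg hx.1⟩
  refine ⟨fun x => -P (-x), fun x hx => ?_, ?_, ?_⟩
  · obtain ⟨e1, e2⟩ := hP (-x) ⟨neg_lt_neg hx.2, neg_lt_neg hx.1⟩
    have hR : -P (-x) ∈ Ioo m q := ⟨by linarith [e1.2], by linarith [e1.1]⟩
    refine ⟨hR, ?_⟩
    have := (h.sub hx.1.le hx.2 hR.2.le hR.1).critGap_refl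
    rw [neg_neg, e2] at this
    linarith
  · simpa using (h1.comp (hneg p)).neg
  · simpa using (h2.comp (hneg m)).neg

end Cell

/-! ### The shape of `V` and of `K u - V u` -/

namespace TrafficModel

variable {M : TrafficModel} {K c u : ℝ}

namespace A1

theorem hasDerivAt (h : M.A1) (hu : 0 < u) : HasDerivAt M.V (deriv M.V u) u :=
  ((h.contDiffOn_two.differentiableOn two_ne_zero).differentiableAt (Ioi_mem_nhds hu)).hasDerivAt

theorem continuousOn (h : M.A1) : ContinuousOn M.V (Ici 0) := h.contDiffOn_one.continuousOn

theorem contDiffOn_deriv (h : M.A1) : ContDiffOn ℝ 1 (deriv M.V) (Ioi 0) :=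
  h.contDiffOn_two.deriv_of_isOpen isOpen_Ioi (by norm_num)

theorem hasDerivAt_deriv (h : M.A1) (hu : 0 < u) :
    HasDerivAt (deriv M.V) (deriv (deriv M.V) u) u :=
  ((h.contDiffOn_deriv.differentiableOn one_ne_zero).differentiableAt (Ioi_mem_nhds hu)).hasDerivAt

theorem continuousOn_deriv_deriv (h : M.A1) : ContinuousOn (deriv (deriv M.V)) (Ioi 0) :=
  h.contDiffOn_deriv.continuousOn_deriv_of_isOpen isOpen_Ioi le_rfl

theorem continuousOn_deriv (h : M.A1) : ContinuousOn (deriv M.V) (Ioi 0) :=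
  h.contDiffOn_deriv.continuousOn

theorem sign_const {T : Set ℝ} {f : ℝ → ℝ} (hT : IsPreconnected T) (hf : ContinuousOn f T)
    (h0 : ∀ x ∈ T, f x ≠ 0) : (∀ x ∈ T, 0 < f x) ∨ ∀ x ∈ T, f x < 0 := by
  by_contra hcon
  push Not at hcon
  obtain ⟨⟨x, hx, hx'⟩, y, hy, hy'⟩ := hcon
  obtain ⟨z, hz, hz0⟩ := hT.intermediate_value hx hy hf ⟨hx', hy'⟩
  exact h0 z hz hz0

/-- The second derivative has a fixed sign here; were it negative, `V'` would decrease towards its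
maximum. -/
theorem deriv_deriv_pos (h : M.A1) : ∀ u ∈ Ioo 0 M.UM, 0 < deriv (deriv M.V) u := by
  rcases sign_const isPreconnected_Ioo (h.continuousOn_deriv_deriv.mono
    fun x hx => hx.1) (fun x hx h0 => hx.2.ne ((h.UM_root x hx.1).1 h0))
    with h1 | h1
  · exact h1
  · exfalso
    have hanti : StrictAntiOn (deriv M.V) (Icc (M.UM / 2) M.UM) := by
      have hU := h.UM_pos
      apply strictAntiOn_of_deriv_neg (convex_Icc _ _)
        (h.continuousOn_deriv.mono fun x hx => lt_of_lt_of_le (half_pos hU) hx.1)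
      intro x hx
      rw [interior_Icc] at hx
      exact h1 x ⟨(half_pos hU).trans hx.1, hx.2⟩
    have hU := h.UM_pos
    have := hanti (left_mem_Icc.2 (by linarith)) (right_mem_Icc.2 (by linarith)) (by linarith)
    linarith [h.UM_max _ (half_pos hU)]

theorem deriv_deriv_neg (h : M.A1) : ∀ u ∈ Ioi M.UM, deriv (deriv M.V) u < 0 := by
  have hU := h.UM_pos
  rcases sign_const isPreconnected_Ioi (h.continuousOn_deriv_deriv.mono
    (Ioi_subset_Ioi hU.le)) (fun x hx h0 => (ne_of_gt hx) ((h.UM_root x (hU.trans hx)).1 h0))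
    with h1 | h1
  · exfalso
    have hmono : StrictMonoOn (deriv M.V) (Ici M.UM) := by
      apply strictMonoOn_of_deriv_pos (convex_Ici _)
        (h.continuousOn_deriv.mono fun x hx => lt_of_lt_of_le hU hx)
      intro x hx
      rw [interior_Ici] at hx
      exact h1 x hx
    have := hmono self_mem_Ici (show M.UM + 1 ∈ Ici M.UM from by simp) (by linarith)
    linarith [h.UM_max (M.UM + 1) (by linarith)]
  · exact h1

theorem strictMonoOn_deriv (h : M.A1) : StrictMonoOn (deriv M.V) (Ioc 0 M.UM) := by
  apply strictMonoOn_of_deriv_pos (convex_Ioc _ _) (h.continuousOn_deriv.mono fun x hx => hx.1)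
  intro x hx
  rw [interior_Ioc] at hx
  exact h.deriv_deriv_pos x hx

theorem strictAntiOn_deriv (h : M.A1) : StrictAntiOn (deriv M.V) (Ici M.UM) := by
  apply strictAntiOn_of_deriv_neg (convex_Ici _)
    (h.continuousOn_deriv.mono fun x hx => lt_of_lt_of_le h.UM_pos hx)
  intro x hx
  rw [interior_Ici] at hx
  exact h.deriv_deriv_neg x hx

theorem tendsto_deriv_zero (h : M.A1) : Tendsto (deriv M.V) (𝓝[>] 0) (𝓝 M.K0) := by
  have hc : ContinuousOn (derivWithin M.V (Ici 0)) (Ici 0) :=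
    h.contDiffOn_one.continuousOn_derivWithin (uniqueDiffOn_Ici 0) le_rfl
  have h1 : Tendsto (derivWithin M.V (Ici 0)) (𝓝[>] 0) (𝓝 M.K0) :=
    (hc 0 self_mem_Ici).mono Ioi_subset_Ici_self
  refine h1.congr' ?_
  filter_upwards [self_mem_nhdsWithin] with x hx
  exact derivWithin_of_mem_nhds (Ici_mem_nhds hx)

theorem K0_nonneg (h : M.A1) : 0 ≤ M.K0 := by
  refine ge_of_tendsto h.tendsto_deriv_zero ?_
  filter_upwards [self_mem_nhdsWithin] with x hx using (h.deriv_pos x hx).le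

theorem K0_lt (h : M.A1) (hu : u ∈ Ioc 0 M.UM) : M.K0 < deriv M.V u := by
  have hu2 : u / 2 ∈ Ioc 0 M.UM := ⟨half_pos hu.1, by linarith [hu.1, hu.2]⟩
  refine lt_of_le_of_lt ?_ (h.strictMonoOn_deriv hu2 hu (by linarith [hu.1]))
  refine le_of_tendsto h.tendsto_deriv_zero ?_
  filter_upwards [Ioo_mem_nhdsGT hu2.1] with x hx
  exact (h.strictMonoOn_deriv ⟨hx.1, hx.2.le.trans hu2.2⟩ hu2 hx.2).le

theorem exists_left (h : M.A1) (h0 : M.K0 < K) (hM : K < M.KM) :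
    ∃ u ∈ Ioo 0 M.UM, deriv M.V u = K := by
  have hev := h.tendsto_deriv_zero.eventually (gt_mem_nhds h0)
  obtain ⟨x, hx, hx0⟩ := (hev.and (Ioo_mem_nhdsGT h.UM_pos)).exists
  obtain ⟨u, hu, huK⟩ := intermediate_value_Ioo hx0.2.le
    (h.continuousOn_deriv.mono fun y hy => hx0.1.trans_le hy.1) ⟨hx, hM⟩
  exact ⟨u, ⟨hx0.1.trans hu.1, hu.2⟩, huK⟩

theorem exists_right (h : M.A1) (h0 : 0 < K) (hM : K < M.KM) :
    ∃ u ∈ Ioi M.UM, deriv M.V u = K := by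
  obtain ⟨x, hx, hx0⟩ := ((h.deriv_tendsto.eventually (gt_mem_nhds h0)).and
    (eventually_gt_atTop M.UM)).exists
  obtain ⟨u, hu, huK⟩ := intermediate_value_Ioo' hx0.le
    (h.continuousOn_deriv.mono fun y hy => h.UM_pos.trans_le hy.1) ⟨hx, hM⟩
  exact ⟨u, hu.1, huK⟩

end A1

/-- The function `u ↦ K u - V u`. -/
def phi (M : TrafficModel) (K u : ℝ) : ℝ := K * u - M.V u

theorem hasDerivAt_phi (h : M.A1) (hu : 0 < u) :
    HasDerivAt (M.phi K) (K - deriv M.V u) u :=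
  (((hasDerivAt_id u).const_mul K).sub (h.hasDerivAt hu)).congr_deriv (by simp)

theorem continuousOn_phi (h : M.A1) : ContinuousOn (M.phi K) (Ici 0) :=
  (continuousOn_const.mul continuousOn_id).sub h.continuousOn

theorem strictMonoOn_phi (h : M.A1) {T : Set ℝ} (hT : Convex ℝ T) (hT0 : T ⊆ Ici 0)
    (hV : ∀ u ∈ interior T, 0 < u ∧ deriv M.V u < K) : StrictMonoOn (M.phi K) T := by
  apply strictMonoOn_of_deriv_pos hT ((continuousOn_phi h).mono hT0)
  intro u hu
  obtain ⟨h1, h2⟩ := hV u hu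
  rw [(hasDerivAt_phi h h1).deriv]
  linarith

theorem strictAntiOn_phi (h : M.A1) {T : Set ℝ} (hT : Convex ℝ T) (hT0 : T ⊆ Ici 0)
    (hV : ∀ u ∈ interior T, 0 < u ∧ K < deriv M.V u) : StrictAntiOn (M.phi K) T := by
  apply strictAntiOn_of_deriv_neg hT ((continuousOn_phi h).mono hT0)
  intro u hu
  obtain ⟨h1, h2⟩ := hV u hu
  rw [(hasDerivAt_phi h h1).deriv]
  linarith

/-- The shape of `phi` if its critical points are `x < y`. -/
structure Shape (M : TrafficModel) (K x y : ℝ) : Prop where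
  x_mem : x ∈ Ioo 0 M.UM
  y_mem : y ∈ Ioi M.UM
  dx : deriv M.V x = K
  dy : deriv M.V y = K

theorem Shape.lt_of_Ioo {x y : ℝ} (hS : M.Shape K x y) (h : M.A1) (hu : u ∈ Ioo x y) :
    K < deriv M.V u := by
  rcases le_total u M.UM with hU | hU
  · rw [← hS.dx]
    exact h.strictMonoOn_deriv ⟨hS.x_mem.1, hS.x_mem.2.le⟩ ⟨hS.x_mem.1.trans hu.1, hU⟩ hu.1
  · rw [← hS.dy]
    exact h.strictAntiOn_deriv hU (Ioi_subset_Ici_self hS.y_mem) hu.2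

theorem Shape.lt_of_Ioo_zero {x y : ℝ} (hS : M.Shape K x y) (h : M.A1) (hu : u ∈ Ioo 0 x) :
    deriv M.V u < K := by
  rw [← hS.dx]
  exact h.strictMonoOn_deriv ⟨hu.1, (hu.2.trans hS.x_mem.2).le⟩ ⟨hS.x_mem.1, hS.x_mem.2.le⟩ hu.2

theorem lt_of_Ioi {y : ℝ} (h : M.A1) (hy : y ∈ Ioi M.UM) (hd : deriv M.V y = K) (hu : y < u) :
    deriv M.V u < K := by
  rw [← hd]
  exact h.strictAntiOn_deriv (Ioi_subset_Ici_self hy) ((show M.UM < y from hy).trans hu).le hu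

theorem lt_of_Ioo_UM {y : ℝ} (h : M.A1) (hy : y ∈ Ioi M.UM) (hd : deriv M.V y = K)
    (hu : u ∈ Ioo M.UM y) : K < deriv M.V u := by
  rw [← hd]
  exact h.strictAntiOn_deriv hu.1.le (Ioi_subset_Ici_self hy) hu.2

theorem uM_spec (h : M.A1) (h0 : M.K0 < K) (hM : K < M.KM) :
    M.uM K ∈ Ioo 0 M.UM ∧ deriv M.V (M.uM K) = K := by
  obtain ⟨x, hx, hxK⟩ := h.exists_left h0 hM
  have hspec : M.uM K ∈ Ioo 0 M.UM ∧ IsLocalMax (fun v => K * v - M.V v) (M.uM K) := by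
    refine Classical.epsilon_spec (p := fun u : ℝ => u ∈ Ioo 0 M.UM ∧
      IsLocalMax (fun v => K * v - M.V v) u) ⟨x, hx, ?_⟩
    have hm : ∀ u ∈ Ioo 0 M.UM, M.phi K u ≤ M.phi K x := by
      intro u hu
      rcases le_total u x with hux | hux
      · refine (strictMonoOn_phi h (convex_Ioc 0 x) (fun y hy => hy.1.le) fun y hy => ?_).monotoneOn
          ⟨hu.1, hux⟩ ⟨hx.1, le_rfl⟩ hux
        rw [interior_Ioc] at hy
        refine ⟨hy.1, ?_⟩
        rw [← hxK]
        exact h.strictMonoOn_deriv ⟨hy.1, (hy.2.trans hx.2).le⟩ ⟨hx.1, hx.2.le⟩ hy.2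
      · refine (strictAntiOn_phi h (convex_Ico x M.UM) (fun y hy => (hx.1.trans_le hy.1).le)
          fun y hy => ?_).antitoneOn ⟨le_rfl, hx.2⟩ ⟨hux, hu.2⟩ hux
        rw [interior_Ico] at hy
        refine ⟨hx.1.trans hy.1, ?_⟩
        rw [← hxK]
        exact h.strictMonoOn_deriv ⟨hx.1, hx.2.le⟩ ⟨hx.1.trans hy.1, hy.2.le⟩ hy.1
    filter_upwards [Ioo_mem_nhds hx.1 hx.2] with u hu using hm u hu
  refine ⟨hspec.1, ?_⟩
  have := hspec.2.hasDerivAt_eq_zero (hasDerivAt_phi (K := K) h hspec.1.1)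
  linarith

theorem um_spec (h : M.A1) (h0 : 0 < K) (hM : K < M.KM) :
    M.um K ∈ Ioi M.UM ∧ deriv M.V (M.um K) = K := by
  obtain ⟨y, hy, hyK⟩ := h.exists_right h0 hM
  have hU := h.UM_pos
  have hspec : M.um K ∈ Ioi M.UM ∧ IsLocalMin (fun v => K * v - M.V v) (M.um K) := by
    refine Classical.epsilon_spec (p := fun u : ℝ => u ∈ Ioi M.UM ∧
      IsLocalMin (fun v => K * v - M.V v) u) ⟨y, hy, ?_⟩
    have hm : ∀ u ∈ Ioi M.UM, M.phi K y ≤ M.phi K u := by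
      intro u hu
      rcases le_total u y with hux | hux
      · refine (strictAntiOn_phi h (convex_Ioc M.UM y) (fun z hz => (hU.trans hz.1).le)
          fun z hz => ?_).antitoneOn ⟨hu, hux⟩ ⟨hy, le_rfl⟩ hux
        rw [interior_Ioc] at hz
        exact ⟨hU.trans hz.1, lt_of_Ioo_UM h hy hyK hz⟩
      · refine (strictMonoOn_phi h (convex_Ici y) (fun z hz => ((hU.trans hy).trans_le hz).le)
          fun z hz => ?_).monotoneOn self_mem_Ici hux hux
        rw [interior_Ici] at hz
        exact ⟨(hU.trans hy).trans hz, lt_of_Ioi h hy hyK hz⟩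
    filter_upwards [Ioi_mem_nhds hy] with u hu using hm u hu
  refine ⟨hspec.1, ?_⟩
  have := hspec.2.hasDerivAt_eq_zero (hasDerivAt_phi (K := K) h (hU.trans hspec.1))
  linarith

theorem shape (h : M.A1) (h0 : M.K0 < K) (hM : K < M.KM) : M.Shape K (M.uM K) (M.um K) :=
  ⟨(uM_spec h h0 hM).1, (um_spec h (h.K0_nonneg.trans_lt h0) hM).1, (uM_spec h h0 hM).2,
    (um_spec h (h.K0_nonneg.trans_lt h0) hM).2⟩

/-- Since `c_m` is a minimum over `[U_M, ∞)`, its dependence on `K` can be controlled by testing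
with single points, without differentiating `u_m`. -/
theorem cm_le_phi (h : M.A1) (h0 : 0 < K) (hM : K < M.KM) (hu : M.UM ≤ u) :
    M.cm K ≤ M.phi K u := by
  obtain ⟨hy, hyK⟩ := um_spec h h0 hM
  have hU := h.UM_pos
  rcases le_total u (M.um K) with hux | hux
  · refine (strictAntiOn_phi h (convex_Icc M.UM (M.um K)) (fun z hz => (hU.trans_le hz.1).le)
      fun z hz => ?_).antitoneOn ⟨hu, hux⟩ ⟨le_of_lt hy, le_rfl⟩ hux
    rw [interior_Icc] at hz
    exact ⟨hU.trans hz.1, lt_of_Ioo_UM h hy hyK hz⟩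
  · refine (strictMonoOn_phi h (convex_Ici (M.um K)) (fun z hz => ((hU.trans hy).trans_le hz).le)
      fun z hz => ?_).monotoneOn self_mem_Ici hux hux
    rw [interior_Ici] at hz
    exact ⟨(hU.trans hy).trans hz, lt_of_Ioi h hy hyK hz⟩

/-- The inequality `c_m(K) < c₀` means that `K u < V u - V 0` for some `u ≥ U_M`. Hence `K₁` is the
maximum of the secant slope `(V u - V 0) / u` over `[U_M, ∞)`. -/
theorem K1_spec (h : M.A1) : M.K1 ∈ Ioo M.K0 M.KM ∧
    (∀ K ∈ Ioo 0 M.K1, M.cm K < M.c0) ∧ M.cm M.K1 = M.c0 ∧ ∀ K ∈ Ioo M.K1 M.KM, M.c0 < M.cm K := by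
  have hU := h.UM_pos
  refine Classical.epsilon_spec (p := fun k : ℝ => k ∈ Ioo M.K0 M.KM ∧
    (∀ K ∈ Ioo 0 k, M.cm K < M.c0) ∧ M.cm k = M.c0 ∧ ∀ K ∈ Ioo k M.KM, M.c0 < M.cm K) ?_
  set r : ℝ → ℝ := fun u => (M.V u - M.V 0) / u with hr
  have hrc : ContinuousOn r (Ici M.UM) :=
    ((h.continuousOn.mono (Ici_subset_Ici.2 hU.le)).sub continuousOn_const).div continuousOn_id
      fun x hx => (hU.trans_le hx).ne'
  obtain ⟨ξ, hξ, hξd⟩ := exists_deriv_eq_slope M.V hU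
    (h.continuousOn.mono Icc_subset_Ici_self)
    fun x hx => (h.hasDerivAt hx.1).differentiableAt.differentiableWithinAt
  have hrU : r M.UM = deriv M.V ξ := by rw [hξd, hr]; simp
  have h1 : M.K0 < r M.UM := hrU ▸ h.K0_lt ⟨hξ.1, hξ.2.le⟩
  have h2 : r M.UM < M.KM := hrU ▸ h.strictMonoOn_deriv ⟨hξ.1, hξ.2.le⟩ ⟨hU, le_rfl⟩ hξ.2
  have hr0 : 0 < r M.UM := h.K0_nonneg.trans_lt h1
  -- `V` grows at most like `(r U_M / 2) u` plus a constant, so the maximum of the secant slope is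
  -- attained.
  have hbig : ∀ᶠ u in atTop, r u ≤ r M.UM := by
    have hlim : Tendsto (fun u => r M.UM / 2 + (-(M.cm (r M.UM / 2)) - M.V 0) / u) atTop
        (𝓝 (r M.UM / 2 + 0)) :=
      tendsto_const_nhds.add (tendsto_id.const_div_atTop _)
    filter_upwards [hlim.eventually (gt_mem_nhds (show r M.UM / 2 + 0 < r M.UM by linarith)),
      eventually_ge_atTop M.UM] with u hu hu'
    refine le_trans ?_ hu.le
    have hup : 0 < u := hU.trans_le hu'
    have := cm_le_phi h (half_pos hr0) (by linarith) hu'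
    simp only [phi] at this
    change (M.V u - M.V 0) / u ≤ _
    rw [add_div' _ _ _ hup.ne']
    exact div_le_div_of_nonneg_right (by linarith) hup.le
  obtain ⟨x, hx, hmax⟩ := hrc.exists_isMaxOn' isClosed_Ici (x₀ := M.UM) self_mem_Ici (by
    rw [cocompact_eq_atBot_atTop, inf_sup_right, eventually_sup]
    constructor
    · have : atBot ⊓ 𝓟 (Ici M.UM) = ⊥ := by
        rw [inf_principal_eq_bot]
        filter_upwards [eventually_lt_atBot M.UM] with u hu hu'
        exact absurd hu (not_lt.2 hu')
      rw [this]
      exact eventually_bot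
    · exact hbig.filter_mono inf_le_left)
  have hmax' : ∀ u, M.UM ≤ u → r u ≤ r x := fun u hu => hmax hu
  have hx0 : 0 < x := hU.trans_le hx
  have hk0 : M.K0 < r x := h1.trans_le (hmax' _ le_rfl)
  have hk0' : 0 < r x := h.K0_nonneg.trans_lt hk0
  have hVx : M.V x = r x * x + M.V 0 := by rw [hr]; field_simp; ring
  -- The secant slope at `U_M` is already below `K_M`, and beyond `U_M` the graph of `V` rises with
  -- slope at most `K_M`.
  have hkM : r x < M.KM := by
    have hVU : M.V M.UM = r M.UM * M.UM + M.V 0 := by rw [hr]; field_simp; ring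
    have hle := (convex_Icc M.UM x).image_sub_le_mul_sub_of_deriv_le (C := M.KM)
      (h.continuousOn.mono fun y hy => hU.le.trans hy.1)
      (fun y hy => by
        rw [interior_Icc] at hy
        exact (h.hasDerivAt (hU.trans hy.1)).differentiableAt.differentiableWithinAt)
      (fun y hy => by
        rw [interior_Icc] at hy
        exact h.UM_max y (hU.trans hy.1)) M.UM ⟨le_rfl, hx⟩ x ⟨hx, le_rfl⟩ hx
    have h3 := mul_lt_mul_of_pos_right h2 hU
    have : r x * x < M.KM * x := by linarith
    exact lt_of_mul_lt_mul_right this hx0.le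
  refine ⟨r x, ⟨hk0, hkM⟩, fun K hK => ?_, ?_, fun K hK => ?_⟩
  · have := cm_le_phi h hK.1 (hK.2.trans hkM) hx
    refine this.trans_lt ?_
    have h3 := mul_lt_mul_of_pos_right hK.2 hx0
    simp only [phi, c0]
    linarith
  · apply le_antisymm
    · refine (cm_le_phi h hk0' hkM hx).trans_eq ?_
      simp only [phi, c0]
      linarith
    · have hy := (um_spec h hk0' hkM).1
      have hy0 : 0 < M.um (r x) := hU.trans hy
      have := (div_le_iff₀ hy0).1 (hmax' _ (le_of_lt hy))
      simp only [cm, c0]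
      linarith
  · have hy := (um_spec h (hk0'.trans hK.1) hK.2).1
    have hy0 : 0 < M.um K := hU.trans hy
    have := (div_le_iff₀ hy0).1 (hmax' _ (le_of_lt hy))
    have h3 := mul_lt_mul_of_pos_right hK.1 hy0
    simp only [cm, c0]
    linarith

end TrafficModel

/-! ### Quadratic lower bounds at simple and double zeros -/

theorem HasDerivAt.exists_quadratic_le {a : ℝ → ℝ} {a' m : ℝ} (h : HasDerivAt a a' m)
    (h0 : a m = 0) (ha' : a' ≠ 0) : ∃ k > 0, ∀ᶠ u in 𝓝 m, k * (u - m) ^ 2 ≤ |a u| := by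
  have hpos : 0 < |a'| / 2 := by positivity
  refine ⟨|a'| / 2, hpos, ?_⟩
  have h1 := (hasDerivAt_iff_isLittleO.1 h).bound hpos
  filter_upwards [h1, Icc_mem_nhds (show m - 1 < m by linarith) (show m < m + 1 by linarith)]
    with u hu hu'
  rw [h0, sub_zero, smul_eq_mul, Real.norm_eq_abs, Real.norm_eq_abs] at hu
  have h2 : |(u - m) * a'| ≤ |a u| + |a u - (u - m) * a'| := by
    have := abs_sub (a u) (a u - (u - m) * a')
    simpa using this
  rw [abs_mul] at h2
  have h3 : |u - m| ≤ 1 := abs_le.2 ⟨by linarith [hu'.1], by linarith [hu'.2]⟩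
  have h4 : (u - m) ^ 2 ≤ |u - m| := by
    rw [← sq_abs]
    nlinarith [abs_nonneg (u - m)]
  have h5 := mul_le_mul_of_nonneg_left h4 hpos.le
  linarith

/-- A function with a nondegenerate critical point at which it vanishes. -/
theorem exists_quadratic_le_left {F F' : ℝ → ℝ} {d x m : ℝ} (hx : x < m)
    (hF : ∀ u ∈ Ioc x m, HasDerivAt F (F' u) u) (hF' : HasDerivAt F' d m) (h0 : F m = 0)
    (h0' : F' m = 0) (hd : d ≠ 0) : ∃ k > 0, ∀ᶠ u in 𝓝[<] m, k * (u - m) ^ 2 ≤ |F u| := by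
  have key : ∀ {F F' : ℝ → ℝ} {d : ℝ}, (∀ u ∈ Ioc x m, HasDerivAt F (F' u) u) →
      HasDerivAt F' d m → F m = 0 → F' m = 0 → 0 < d →
      ∀ᶠ u in 𝓝[<] m, d / 4 * (u - m) ^ 2 ≤ |F u| := by
    intro F F' d hF hF' h0 h0' hd
    have h1 := ((hasDerivAt_iff_isLittleO.1 hF').bound (half_pos hd)).filter_mono
      (nhdsWithin_le_nhds (s := Iio m))
    obtain ⟨y, hy, hys⟩ := (mem_nhdsLT_iff_exists_Ioo_subset' hx).1 h1
    have hm : max x y < m := max_lt hx hy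
    filter_upwards [Ioo_mem_nhdsLT hm] with u hu
    have hxu : x < u := (le_max_left _ _).trans_lt hu.1
    have hyu : y < u := (le_max_right _ _).trans_lt hu.1
    -- Near `m` the derivative `F'` is within a factor of two of `d * (v - m)`; integrating half of
    -- it gives the constant `d / 4`.
    have hanti : AntitoneOn (fun v => F v - d / 4 * (v - m) ^ 2) (Icc u m) := by
      apply antitoneOn_Icc_of_hasDerivAt (f' := fun v => F' v - d / 2 * (v - m))
      · refine ContinuousOn.sub (fun v hv => ?_) (by fun_prop)
        exact (hF v ⟨hxu.trans_le hv.1, hv.2⟩).continuousAt.continuousWithinAt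
      · intro v hv
        refine ((hF v ⟨hxu.trans hv.1, hv.2.le⟩).sub
          ((((hasDerivAt_id v).sub_const m).pow 2).const_mul (d / 4))).congr_deriv ?_
        simp only [id_eq, Nat.cast_ofNat, Nat.add_one_sub_one, pow_one, mul_one]
        ring
      · intro v hv
        have : ‖F' v - F' m - (v - m) • d‖ ≤ d / 2 * ‖v - m‖ := hys ⟨hyu.trans hv.1, hv.2⟩
        rw [h0', sub_zero, smul_eq_mul, Real.norm_eq_abs, Real.norm_eq_abs,
          abs_of_neg (sub_neg.2 hv.2)] at this
        have := (abs_le.1 this).2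
        nlinarith
    have := hanti (left_mem_Icc.2 hu.2.le) (right_mem_Icc.2 hu.2.le) hu.2.le
    simp only [h0, sub_self] at this
    refine le_trans ?_ (le_abs_self _)
    linarith
  rcases lt_or_gt_of_ne hd with hd | hd
  · refine ⟨-d / 4, by linarith, ?_⟩
    have := key (F := fun u => -F u) (F' := fun u => -F' u) (fun u hu => (hF u hu).neg) hF'.neg
      (by simp [h0]) (by simp [h0']) (neg_pos.2 hd)
    simpa using this
  · exact ⟨d / 4, by linarith, key hF hF' h0 h0' hd⟩

/-! ### The coefficients of the traffic model and the sign patterns of `f` -/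

namespace TrafficModel

variable {M : TrafficModel} {K c μ u : ℝ}

/-- The coefficient `g₁ f`. -/
def acoef (M : TrafficModel) (K c u : ℝ) : ℝ := M.g1 u * M.f K c u

/-- The coefficient `g₂ f'`. -/
def bcoef (M : TrafficModel) (K u : ℝ) : ℝ := M.g2 u * ((K - deriv M.V u) / K)

theorem f_eq (K c u : ℝ) : M.f K c u = (M.phi K u - c) / K := rfl

theorem hasDerivAt_f (h : M.A1) (hu : 0 < u) :
    HasDerivAt (M.f K c) ((K - deriv M.V u) / K) u :=
  ((hasDerivAt_phi h hu).sub_const c).div_const K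

theorem isSolution_iff (h : M.A1) {u w : ℝ → ℝ} : M.IsSolution K c μ u w ↔
    IsOrbit (M.acoef K c) (pert (M.bcoef K) M.g2 μ) (Ioi 0) u w := by
  refine forall_congr' fun z => and_congr_right fun hz => and_congr_right fun _ => ?_
  have e : M.g2 (u z) * M.h K c (u z) μ = pert (M.bcoef K) M.g2 μ (u z) := by
    simp only [TrafficModel.h, (hasDerivAt_f h hz).deriv, pert, bcoef]
    ring
  rw [e, acoef]

theorem g1_pos (hτ : 0 < M.τ) (h2 : M.A2) (hu : 0 < u) : 0 < M.g1 u := by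
  have := h2.pos u⁻¹ (inv_pos.2 hu)
  simp only [g1]
  positivity

theorem g2_eq (u : ℝ) : M.g2 u = u / 2 * M.g1 u := by
  simp only [g2, g1]
  rw [mul_assoc 2, ← div_div, div_eq_mul_one_div (u / 2)]

theorem g2_pos (hτ : 0 < M.τ) (h2 : M.A2) (hu : 0 < u) : 0 < M.g2 u := by
  rw [g2_eq]
  have := g1_pos hτ h2 hu
  positivity

theorem contDiffOn_g1 (hτ : 0 < M.τ) (h2 : M.A2) : ContDiffOn ℝ 1 M.g1 (Ioi 0) := by
  have h1 : ContDiffOn ℝ 1 (fun u : ℝ => M.κ u⁻¹) (Ioi 0) :=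
    h2.contDiffOn.comp (contDiffOn_id.inv fun x hx => (ne_of_gt hx)) fun x hx =>
      inv_pos.2 (show (0:ℝ) < x from hx)
  refine contDiffOn_const.div (contDiffOn_const.mul h1) fun x hx => ?_
  have := h2.pos x⁻¹ (inv_pos.2 hx)
  positivity

theorem contDiffOn_g2 (hτ : 0 < M.τ) (h2 : M.A2) : ContDiffOn ℝ 1 M.g2 (Ioi 0) := by
  rw [show M.g2 = fun u => u / 2 * M.g1 u from funext g2_eq]
  exact (contDiffOn_id.div_const 2).mul (contDiffOn_g1 hτ h2)

theorem contDiffOn_f (h : M.A1) : ContDiffOn ℝ 1 (M.f K c) (Ioi 0) :=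
  (((contDiffOn_const.mul contDiffOn_id).sub (h.contDiffOn_one.mono Ioi_subset_Ici_self)).sub
    contDiffOn_const).div_const K

theorem contDiffOn_acoef (hτ : 0 < M.τ) (h : M.A1) (h2 : M.A2) :
    ContDiffOn ℝ 1 (M.acoef K c) (Ioi 0) := (contDiffOn_g1 hτ h2).mul (contDiffOn_f h)

theorem contDiffOn_bcoef (hτ : 0 < M.τ) (h : M.A1) (h2 : M.A2) :
    ContDiffOn ℝ 1 (M.bcoef K) (Ioi 0) :=
  (contDiffOn_g2 hτ h2).mul ((contDiffOn_const.sub h.contDiffOn_deriv).div_const K)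

theorem hasDerivAt_acoef (hτ : 0 < M.τ) (h : M.A1) (h2 : M.A2) (hu : 0 < u)
    (h0 : M.f K c u = 0) : HasDerivAt (M.acoef K c) (M.g1 u * ((K - deriv M.V u) / K)) u := by
  have hd := (((contDiffOn_g1 hτ h2).differentiableOn one_ne_zero).differentiableAt
    (Ioi_mem_nhds hu)).hasDerivAt
  exact (hd.mul (hasDerivAt_f h hu)).congr_deriv (by rw [h0]; ring)

theorem differentiableAt_bcoef (hτ : 0 < M.τ) (h : M.A1) (h2 : M.A2) (hu : 0 < u) :
    DifferentiableAt ℝ (M.bcoef K) u :=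
  ((contDiffOn_bcoef hτ h h2).differentiableOn one_ne_zero).differentiableAt (Ioi_mem_nhds hu)

theorem differentiableAt_g2 (hτ : 0 < M.τ) (h2 : M.A2) (hu : 0 < u) :
    DifferentiableAt ℝ M.g2 u :=
  ((contDiffOn_g2 hτ h2).differentiableOn one_ne_zero).differentiableAt (Ioi_mem_nhds hu)

theorem acoef_pos (hτ : 0 < M.τ) (h2 : M.A2) (hK : 0 < K) (hu : 0 < u) :
    0 < M.acoef K c u ↔ c < M.phi K u := by
  rw [acoef, f_eq, mul_pos_iff_of_pos_left (g1_pos hτ h2 hu), div_pos_iff_of_pos_right hK,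
    sub_pos]

theorem acoef_neg (hτ : 0 < M.τ) (h2 : M.A2) (hK : 0 < K) (hu : 0 < u) :
    M.acoef K c u < 0 ↔ M.phi K u < c := by
  have hg := g1_pos hτ h2 hu
  rw [acoef, f_eq]
  constructor
  · intro h
    by_contra hc
    push Not at hc
    have h1 := sub_nonneg.2 hc
    have : 0 ≤ M.g1 u * ((M.phi K u - c) / K) := by positivity
    linarith
  · intro h
    exact mul_neg_of_pos_of_neg hg (div_neg_of_neg_of_pos (by linarith) hK)

/-- The sign pattern of `f`. -/
structure Pattern (M : TrafficModel) (K c e m s : ℝ) : Prop where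
  nonneg : 0 ≤ e
  e_lt : e < M.uM K
  m_mem : m ∈ Ioo (M.uM K) (M.um K)
  s_mem : s ∈ Ioi (M.um K)
  low : ∀ u ∈ Ioo 0 e, M.phi K u < c
  mid : ∀ u ∈ Ioo e m, c < M.phi K u
  high : ∀ u ∈ Ioo m s, M.phi K u < c
  top : ∀ u ∈ Ioi s, c < M.phi K u
  e_zero : 0 < e → M.phi K e = c
  m_zero : M.phi K m = c
  s_zero : M.phi K s = c

section Shapes

variable {e m s : ℝ}

theorem phi_zero : M.phi K 0 = M.c0 := by simp [phi, c0]

theorem strictMonoOn_phi_left (h : M.A1) (h0 : M.K0 < K) (hM : K < M.KM) :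
    StrictMonoOn (M.phi K) (Icc 0 (M.uM K)) := by
  refine strictMonoOn_phi h (convex_Icc _ _) (fun u hu => hu.1) fun u hu => ?_
  rw [interior_Icc] at hu
  exact ⟨hu.1, (shape h h0 hM).lt_of_Ioo_zero h hu⟩

theorem uM_lt_um (h : M.A1) (h0 : M.K0 < K) (hM : K < M.KM) : M.uM K < M.um K :=
  (shape h h0 hM).x_mem.2.trans (shape h h0 hM).y_mem

theorem uM_pos (h : M.A1) (h0 : M.K0 < K) (hM : K < M.KM) : 0 < M.uM K :=
  (shape h h0 hM).x_mem.1

theorem strictAntiOn_phi_mid (h : M.A1) (h0 : M.K0 < K) (hM : K < M.KM) :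
    StrictAntiOn (M.phi K) (Icc (M.uM K) (M.um K)) := by
  have hx := uM_pos h h0 hM
  refine strictAntiOn_phi h (convex_Icc _ _) (fun u hu => hx.le.trans hu.1) fun u hu => ?_
  rw [interior_Icc] at hu
  exact ⟨hx.trans hu.1, (shape h h0 hM).lt_of_Ioo h hu⟩

theorem strictMonoOn_phi_right (h : M.A1) (h0 : M.K0 < K) (hM : K < M.KM) :
    StrictMonoOn (M.phi K) (Ici (M.um K)) := by
  have hy := (uM_pos h h0 hM).trans (uM_lt_um h h0 hM)
  refine strictMonoOn_phi h (convex_Ici _) (fun u hu => hy.le.trans hu) fun u hu => ?_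
  rw [interior_Ici] at hu
  exact ⟨hy.trans hu, lt_of_Ioi h (shape h h0 hM).y_mem (shape h h0 hM).dy hu⟩

theorem cm_lt_cM (h : M.A1) (h0 : M.K0 < K) (hM : K < M.KM) : M.cm K < M.cM K :=
  strictAntiOn_phi_mid h h0 hM (left_mem_Icc.2 (uM_lt_um h h0 hM).le)
    (right_mem_Icc.2 (uM_lt_um h h0 hM).le) (uM_lt_um h h0 hM)

theorem c0_lt_cM (h : M.A1) (h0 : M.K0 < K) (hM : K < M.KM) : M.c0 < M.cM K := by
  rw [← phi_zero (K := K)]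
  exact strictMonoOn_phi_left h h0 hM (left_mem_Icc.2 (uM_pos h h0 hM).le)
    (right_mem_Icc.2 (uM_pos h h0 hM).le) (uM_pos h h0 hM)

theorem exists_phi_gt (h : M.A1) (h0 : M.K0 < K) (hM : K < M.KM) (c : ℝ) :
    ∃ u, M.um K < u ∧ c < M.phi K u := by
  have hK : 0 < K := h.K0_nonneg.trans_lt h0
  -- Half of the slope pays for the growth: `phi K u = phi (K / 2) u + (K / 2) u ≥ c_m(K / 2) + (K /
  -- 2) u`.
  obtain ⟨u, hu1, hu2⟩ := ((eventually_gt_atTop (max (M.um K) M.UM)).and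
    (eventually_gt_atTop ((c - M.cm (K / 2)) / (K / 2)))).exists
  refine ⟨u, (le_max_left _ _).trans_lt hu1, ?_⟩
  have h1 := cm_le_phi h (half_pos hK) (by linarith) ((le_max_right _ _).trans hu1.le)
  rw [div_lt_iff₀ (half_pos hK)] at hu2
  simp only [phi] at h1 ⊢
  linarith

theorem exists_mid_high (h : M.A1) (h0 : M.K0 < K) (hM : K < M.KM) (hc : M.cm K < c)
    (hc' : c < M.cM K) : ∃ m ∈ Ioo (M.uM K) (M.um K), ∃ s ∈ Ioi (M.um K),
      M.phi K m = c ∧ M.phi K s = c := by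
  have hx := uM_pos h h0 hM
  have hxy := uM_lt_um h h0 hM
  obtain ⟨m, hm, hmc⟩ := intermediate_value_Ioo' hxy.le
    ((continuousOn_phi (K := K) h).mono fun u hu => hx.le.trans hu.1) ⟨hc, hc'⟩
  obtain ⟨v, hv, hvc⟩ := exists_phi_gt h h0 hM c
  obtain ⟨s, hs, hsc⟩ := intermediate_value_Ioo hv.le
    ((continuousOn_phi (K := K) h).mono fun u hu => (hx.trans hxy).le.trans hu.1) ⟨hc, hvc⟩
  exact ⟨m, hm, s, hs.1, hmc, hsc⟩

theorem pattern_of (h : M.A1) (h0 : M.K0 < K) (hM : K < M.KM) (he0 : 0 ≤ e) (he : e < M.uM K)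
    (hlow : ∀ u ∈ Ioo 0 e, M.phi K u < c) (hlow' : c ≤ M.phi K e) (hez : 0 < e → M.phi K e = c)
    (hm : m ∈ Ioo (M.uM K) (M.um K)) (hs : s ∈ Ioi (M.um K)) (hmc : M.phi K m = c)
    (hsc : M.phi K s = c) : M.Pattern K c e m s := by
  have hxy := uM_lt_um h h0 hM
  refine ⟨he0, he, hm, hs, hlow, fun u hu => ?_, fun u hu => ?_, fun u hu => ?_, hez, hmc, hsc⟩
  · rcases le_total u (M.uM K) with hux | hux
    · exact hlow'.trans_lt (strictMonoOn_phi_left h h0 hM ⟨he0, he.le⟩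
        ⟨he0.trans hu.1.le, hux⟩ hu.1)
    · rw [← hmc]
      exact strictAntiOn_phi_mid h h0 hM ⟨hux, (hu.2.trans hm.2).le⟩ ⟨hm.1.le, hm.2.le⟩ hu.2
  · rcases le_total u (M.um K) with hux | hux
    · rw [← hmc]
      exact strictAntiOn_phi_mid h h0 hM ⟨hm.1.le, hm.2.le⟩ ⟨(hm.1.trans hu.1).le, hux⟩ hu.1
    · rw [← hsc]
      exact strictMonoOn_phi_right h h0 hM hux (Ioi_subset_Ici_self hs) hu.2
  · rw [← hsc]
    exact strictMonoOn_phi_right h h0 hM (Ioi_subset_Ici_self hs)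
      (show M.um K ≤ u from (le_of_lt hs).trans (le_of_lt hu)) hu

theorem exists_pattern_three (h : M.A1) (h0 : M.K0 < K) (hM : K < M.KM) (hc : M.c1 K < c)
    (hc' : c < M.cM K) : ∃ e m s, 0 < e ∧ M.Pattern K c e m s := by
  have hx := uM_pos h h0 hM
  obtain ⟨m, hm, s, hs, hmc, hsc⟩ := exists_mid_high h h0 hM ((le_max_right _ _).trans_lt hc) hc'
  have hc0 : M.phi K 0 < c := phi_zero.trans_lt ((le_max_left _ _).trans_lt hc)
  obtain ⟨e, he, hec⟩ := intermediate_value_Ioo hx.le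
    ((continuousOn_phi (K := K) h).mono fun u hu => hu.1) ⟨hc0, hc'⟩
  refine ⟨e, m, s, he.1, pattern_of h h0 hM he.1.le he.2 (fun u hu => ?_) hec.ge (fun _ => hec)
    hm hs hmc hsc⟩
  rw [← hec]
  exact strictMonoOn_phi_left h h0 hM ⟨hu.1.le, (hu.2.trans he.2).le⟩ ⟨he.1.le, he.2.le⟩ hu.2

/-- With only two positive zeros the place of the smallest one is taken by `e = 0`, so both regions
share the same pattern. -/
theorem exists_pattern_two (h : M.A1) (h0 : M.K0 < K) (hM : K < M.KM) (hc : M.cm K < c)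
    (hc' : c ≤ M.c0) : ∃ m s, M.Pattern K c 0 m s := by
  have hx := uM_pos h h0 hM
  obtain ⟨m, hm, s, hs, hmc, hsc⟩ := exists_mid_high h h0 hM hc
    (hc'.trans_lt (c0_lt_cM h h0 hM))
  exact ⟨m, s, pattern_of h h0 hM le_rfl hx (fun u hu => absurd (hu.1.trans hu.2) (lt_irrefl _))
    (by rwa [phi_zero]) (fun h => absurd h (lt_irrefl _)) hm hs hmc hsc⟩

namespace Pattern

theorem hem (hP : M.Pattern K c e m s) : e < m := hP.e_lt.trans hP.m_mem.1

theorem hms (hP : M.Pattern K c e m s) : m < s := hP.m_mem.2.trans hP.s_mem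

theorem m_pos (hP : M.Pattern K c e m s) : 0 < m := hP.nonneg.trans_lt hP.hem

theorem eq_zero_iff (hP : M.Pattern K c e m s) (hu : 0 < u) :
    M.phi K u = c ↔ u = e ∨ u = m ∨ u = s := by
  constructor
  · intro h0
    rcases lt_trichotomy u e with h | h | h
    · exact absurd h0 (hP.low u ⟨hu, h⟩).ne
    · exact Or.inl h
    rcases lt_trichotomy u m with h' | h' | h'
    · exact absurd h0 (hP.mid u ⟨h, h'⟩).ne'
    · exact Or.inr (Or.inl h')
    rcases lt_trichotomy u s with h'' | h'' | h''
    · exact absurd h0 (hP.high u ⟨h', h''⟩).ne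
    · exact Or.inr (Or.inr h'')
    · exact absurd h0 (hP.top u h'').ne'
  · rintro (rfl | rfl | rfl)
    exacts [hP.e_zero hu, hP.m_zero, hP.s_zero]

theorem f_eq_zero_iff (hP : M.Pattern K c e m s) (hK : 0 < K) (hu : 0 < u) :
    M.f K c u = 0 ↔ u = e ∨ u = m ∨ u = s := by
  rw [f_eq, div_eq_zero_iff, or_iff_left hK.ne', sub_eq_zero, hP.eq_zero_iff hu]

theorem threeZeros (hP : M.Pattern K c e m s) (hK : 0 < K) (he : 0 < e) :
    M.ThreeZeros K c e m s := ⟨he, hP.hem, hP.hms, fun _ hu => hP.f_eq_zero_iff hK hu⟩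

theorem twoZeros (hP : M.Pattern K c 0 m s) (hK : 0 < K) : M.TwoZeros K c m s := by
  refine ⟨hP.m_pos, hP.hms, fun u hu => ?_⟩
  rw [hP.f_eq_zero_iff hK hu, or_iff_right hu.ne']

theorem deriv_lt (hP : M.Pattern K c e m s) (h : M.A1) (h0 : M.K0 < K) (hM : K < M.KM) :
    K < deriv M.V m := (shape h h0 hM).lt_of_Ioo h hP.m_mem

theorem scene (hP : M.Pattern K c e m s) (hτ : 0 < M.τ) (h : M.A1) (h2 : M.A2) (h0 : M.K0 < K)
    (hM : K < M.KM) : Scene (M.acoef K c) (M.bcoef K) M.g2 (Ioi 0) e m s := by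
  have hK : 0 < K := h.K0_nonneg.trans_lt h0
  have hm0 := hP.m_pos
  have hfm := (hP.f_eq_zero_iff hK hm0).2 (Or.inr (Or.inl rfl))
  have ham : M.acoef K c m = 0 := by rw [acoef, hfm, mul_zero]
  refine ⟨hP.hem, hP.hms, ordConnected_Ioi, .of_contDiffOn isOpen_Ioi (contDiffOn_acoef hτ h h2),
    .of_contDiffOn isOpen_Ioi (contDiffOn_bcoef hτ h h2),
    .of_contDiffOn isOpen_Ioi (contDiffOn_g2 hτ h2), fun x hx => hP.nonneg.trans_lt hx.1,
    fun x hx => g2_pos hτ h2 hx, ham, fun x hx => ?_, fun x hx => ?_, fun x hx hxs ha => ?_,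
    fun x hx hxe ha => ?_, ?_, differentiableAt_bcoef hτ h h2 hm0, differentiableAt_g2 hτ h2 hm0⟩
  · exact (acoef_pos hτ h2 hK (hP.nonneg.trans_lt hx.1)).2 (hP.mid x hx)
  · exact (acoef_neg hτ h2 hK (hm0.trans hx.1)).2 (hP.high x hx)
  · have ha' := (acoef_pos hτ h2 hK hx).1 ha
    refine ⟨?_, ?_⟩
    · by_contra hcon
      push Not at hcon
      rcases eq_or_lt_of_le hcon with rfl | hlt
      · exact ha'.ne' (hP.e_zero hx)
      · exact lt_asymm ha' (hP.low x ⟨hx, hlt⟩)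
    · by_contra hcon
      push Not at hcon
      rcases eq_or_lt_of_le hcon with rfl | hlt
      · exact ha'.ne' hP.m_zero
      · exact lt_asymm ha' (hP.high x ⟨hlt, hxs⟩)
  · have ha' := (acoef_neg hτ h2 hK hx).1 ha
    refine ⟨?_, ?_⟩
    · by_contra hcon
      push Not at hcon
      rcases eq_or_lt_of_le hcon with rfl | hlt
      · exact ha'.ne hP.m_zero
      · exact lt_asymm ha' (hP.mid x ⟨hxe, hlt⟩)
    · by_contra hcon
      push Not at hcon
      rcases eq_or_lt_of_le hcon with rfl | hlt
      · exact ha'.ne hP.s_zero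
      · exact lt_asymm ha' (hP.top x hlt)
  · refine (hasDerivAt_acoef hτ h h2 hm0 hfm).exists_quadratic_le ham ?_
    have h3 := hP.deriv_lt h h0 hM
    exact mul_ne_zero (g1_pos hτ h2 hm0).ne' (div_ne_zero (by linarith) hK.ne')

end Pattern

theorem ThreeZeros.unique {e' m' s' : ℝ} (h : M.ThreeZeros K c e m s)
    (h' : M.ThreeZeros K c e' m' s') : e' = e ∧ m' = m ∧ s' = s := by
  obtain ⟨a1, a2, a3, a4⟩ := h
  obtain ⟨b1, b2, b3, b4⟩ := h'
  have k : ∀ u, 0 < u → ((u = e ∨ u = m ∨ u = s) ↔ (u = e' ∨ u = m' ∨ u = s')) :=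
    fun u hu => (a4 u hu).symm.trans (b4 u hu)
  have t1 := (k e' b1).2 (by simp)
  have t2 := (k m' (b1.trans b2)).2 (by simp)
  have t3 := (k s' (b1.trans (b2.trans b3))).2 (by simp)
  rcases t1 with t1 | t1 | t1 <;> rcases t2 with t2 | t2 | t2 <;> rcases t3 with t3 | t3 | t3 <;>
    first | exact ⟨t1, t2, t3⟩ | (exfalso; linarith)

end Shapes

end TrafficModel

/-! ### Dependence of the heights on `a` when its zeros move -/

section Perturbation

variable {ι : Type*} {l : Filter ι} {a β : ℝ → ℝ} {α : ι → ℝ → ℝ} {p m q Q : ℝ} {x y δ : ι → ℝ}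

/-- The starting point is fixed and the centre moves inwards, so the perturbed and the unperturbed
branch can be compared on the whole perturbed interval. -/
theorem tendsto_leftVal_of_approx (hl : LeftCell a p m) (hβ : ContinuousOn β (Icc p m))
    (hx : ∀ᶠ i in l, p ≤ x i ∧ x i ≤ m) (hα : ∀ᶠ i in l, LeftCell (α i) p (x i))
    (hxt : Tendsto x l (𝓝 m)) (hδ : Tendsto δ l (𝓝 0))
    (hδa : ∀ᶠ i in l, ∀ u ∈ Icc p m, |α i u - a u| ≤ δ i) :
    Tendsto (fun i => leftVal (α i) β p (x i)) l (𝓝 (leftVal a β p m)) := by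
  obtain ⟨hV, hV0⟩ := hl.spec hβ
  set V := branch a β p m
  have hVt : Tendsto (fun i => V (x i)) l (𝓝 (leftVal a β p m)) :=
    ((hV.cont m (right_mem_Icc.2 hl.le)).tendsto).comp (tendsto_nhdsWithin_iff.2 ⟨hxt, hx⟩)
  have hε : Tendsto (fun i => Real.sqrt (2 * δ i * (m - p))) l (𝓝 0) := by
    have := ((hδ.const_mul 2).mul_const (m - p)).sqrt
    simpa using this
  have hdiff : Tendsto (fun i => leftVal (α i) β p (x i) - V (x i)) l (𝓝 0) := by
    refine squeeze_zero_norm' ?_ hε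
    filter_upwards [hx, hα, hδa] with i hxi hαi hδi
    have hβi : ContinuousOn β (Icc p (x i)) := hβ.mono (Icc_subset_Icc le_rfl hxi.2)
    obtain ⟨hW, hW0⟩ := hαi.spec hβi
    have hδ0 : 0 ≤ δ i := (abs_nonneg _).trans (hδi p (left_mem_Icc.2 hl.le))
    have := hW.abs_sub_le (hV.mono le_rfl hxi.2) (fun u hu => (hαi.pos u hu).le)
      (fun u hu => (hl.pos u ⟨hu.1, hu.2.trans_le hxi.2⟩).le) hδ0 le_rfl
      (fun u hu => hδi u ⟨hu.1.le, (hu.2.trans_le hxi.2).le⟩) (by simp)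
      (right_mem_Icc.2 hxi.1)
    rw [hW0, hV0] at this
    rw [Real.norm_eq_abs]
    rw [sub_zero, mul_zero, zero_mul, zero_add, zero_pow two_ne_zero, zero_add] at this
    refine this.trans (Real.sqrt_le_sqrt ?_)
    exact mul_le_mul_of_nonneg_left (by linarith [hxi.2]) (by positivity)
  simpa using hdiff.add hVt

/-- Upper semicontinuity of `leftVal`, if the interval grows on both sides. -/
theorem eventually_leftVal_lt_of_approx {P : ℝ} {N : ℝ} (hl : LeftCell a p m)
    (hβ : ContinuousOn β (Icc P Q)) (ha : ContinuousOn a (Icc P Q)) (hP : P ≤ p) (hQ : m ≤ Q)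
    (hx : ∀ᶠ i in l, P ≤ x i ∧ x i ≤ p) (hy : ∀ᶠ i in l, m ≤ y i ∧ y i ≤ Q)
    (hα : ∀ᶠ i in l, LeftCell (α i) (x i) (y i))
    (hxt : Tendsto x l (𝓝 p)) (hyt : Tendsto y l (𝓝 m)) (hδ : Tendsto δ l (𝓝 0))
    (hδa : ∀ᶠ i in l, ∀ u ∈ Icc P Q, |α i u - a u| ≤ δ i) (hN : leftVal a β p m < N) :
    ∀ᶠ i in l, leftVal (α i) β (x i) (y i) < N := by
  obtain ⟨A, hA0, hA⟩ := exists_abs_bound_Icc ha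
  obtain ⟨B, hB0, hB⟩ := exists_abs_bound_Icc hβ
  have hpm := hl.le
  obtain ⟨hV, hV0⟩ := hl.spec (hβ.mono (Icc_subset_Icc hP hQ))
  have hVn : 0 ≤ leftVal a β p m := hl.leftVal_nonneg (hβ.mono (Icc_subset_Icc hP hQ))
  set V := branch a β p m
  have hVm : V m = leftVal a β p m := rfl
  set ε₁ : ι → ℝ := fun i => 2 * B * (p - x i) + Real.sqrt (2 * (A + 1) * (p - x i))
  have hε₁ : Tendsto ε₁ l (𝓝 0) := by
    have hd : Tendsto (fun i => p - x i) l (𝓝 0) := by simpa using hxt.const_sub p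
    have := (hd.const_mul (2 * B)).add ((hd.const_mul (2 * (A + 1))).sqrt)
    simpa using this
  set ε₂ : ι → ℝ := fun i => Real.sqrt (ε₁ i ^ 2 + 2 * δ i * (m - p))
  have hε₂ : Tendsto ε₂ l (𝓝 0) := by
    have := ((hε₁.pow 2).add ((hδ.const_mul 2).mul_const (m - p))).sqrt
    simpa using this
  have hfin : Tendsto (fun i => 2 * B * (y i - m) +
      Real.sqrt ((V m + ε₂ i) ^ 2 + 2 * (A + 1) * (y i - m))) l (𝓝 (V m)) := by
    have hd : Tendsto (fun i => y i - m) l (𝓝 0) := by simpa using hyt.sub_const m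
    have := (hd.const_mul (2 * B)).add
      ((((hε₂.const_add (V m)).pow 2).add (hd.const_mul (2 * (A + 1)))).sqrt)
    simpa [Real.sqrt_sq (hVm ▸ hVn : 0 ≤ V m)] using this
  filter_upwards [hx, hy, hα, hδa, hδ.eventually (gt_mem_nhds one_pos),
    hfin.eventually (gt_mem_nhds (hVm ▸ hN))] with i hxi hyi hαi hδi hδ1 hfi
  refine lt_of_le_of_lt ?_ hfi
  have hβi : ContinuousOn β (Icc (x i) (y i)) := hβ.mono (Icc_subset_Icc hxi.1 hyi.2)
  obtain ⟨hW, hW0⟩ := hαi.spec hβi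
  set W := branch (α i) β (x i) (y i)
  have hin : ∀ u ∈ Icc (x i) (y i), u ∈ Icc P Q := fun u hu =>
    ⟨hxi.1.trans hu.1, hu.2.trans hyi.2⟩
  have hαA : ∀ u ∈ Icc (x i) (y i), α i u ≤ A + 1 := fun u hu => by
    have h1 := (abs_le.1 (hδi u (hin u hu))).2
    have h2 := (abs_le.1 (hA u (hin u hu))).2
    linarith
  have hβB : ∀ u ∈ Icc (x i) (y i), β u ≤ B := fun u hu => (abs_le.1 (hB u (hin u hu))).2
  have hδ0 : 0 ≤ δ i := (abs_nonneg _).trans (hδi p ⟨hP, hpm.trans hQ⟩)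
  have hA1 : (0:ℝ) ≤ A + 1 := by linarith
  have hWn : ∀ u ∈ Icc (x i) (y i), 0 ≤ W u := fun u hu => hαi.branch_nonneg hβi hu
  have s1 : W p ≤ ε₁ i := by
    have := (hW.mono le_rfl (hpm.trans hyi.1)).le_bound hA1 hB0
      (fun u hu => hαA u ⟨hu.1.le, hu.2.le.trans (hpm.trans hyi.1)⟩)
      (fun u hu => hβB u ⟨hu.1.le, hu.2.le.trans (hpm.trans hyi.1)⟩) (right_mem_Icc.2 hxi.2)
    rw [hW0] at this
    simpa [ε₁] using this
  have s2 : W m ≤ V m + ε₂ i := by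
    have := (hW.mono hxi.2 hyi.1).abs_sub_le hV
      (fun u hu => (hαi.pos u ⟨hxi.2.trans_lt hu.1, hu.2.trans_le hyi.1⟩).le)
      (fun u hu => (hl.pos u hu).le) hδ0 le_rfl
      (fun u hu => hδi u ⟨hP.trans hu.1.le, hu.2.le.trans hQ⟩) (by simp) (right_mem_Icc.2 hpm)
    rw [hV0, sub_zero, mul_zero, zero_mul, zero_add] at this
    have h1 : Real.sqrt (W p ^ 2 + 2 * δ i * (m - p)) ≤ ε₂ i := by
      apply Real.sqrt_le_sqrt
      have := pow_le_pow_left₀ (hWn p ⟨hxi.2, hpm.trans hyi.1⟩) s1 2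
      linarith
    linarith [(abs_le.1 this).2]
  have s3 := (hW.mono (hxi.2.trans hpm) le_rfl).le_bound hA1 hB0
    (fun u hu => hαA u ⟨(hxi.2.trans hpm).trans hu.1.le, hu.2.le⟩)
    (fun u hu => hβB u ⟨(hxi.2.trans hpm).trans hu.1.le, hu.2.le⟩) (right_mem_Icc.2 hyi.1)
  refine s3.trans (add_le_add le_rfl (Real.sqrt_le_sqrt ?_))
  have := pow_le_pow_left₀ (hWn m ⟨hxi.2.trans hpm, hyi.1⟩) s2 2
  linarith

/-- Tailored to increasing `c`: the centre moves left and the last zero moves right. The case `m =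
q`, where the two have merged, is included. -/
theorem eventually_rightVal_lt_leftVal (hl : LeftCell a p m) (hr : RightCell a m q)
    (hβ : ContinuousOn β (Icc p Q)) (ha : ContinuousOn a (Icc p Q)) (hQ : q ≤ Q)
    (hx : ∀ᶠ i in l, p ≤ x i ∧ x i ≤ m) (hy : ∀ᶠ i in l, q ≤ y i ∧ y i ≤ Q)
    (hα : ∀ᶠ i in l, LeftCell (α i) p (x i)) (hα' : ∀ᶠ i in l, RightCell (α i) (x i) (y i))
    (hxt : Tendsto x l (𝓝 m)) (hyt : Tendsto y l (𝓝 q)) (hδ : Tendsto δ l (𝓝 0))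
    (hδa : ∀ᶠ i in l, ∀ u ∈ Icc p Q, |α i u - a u| ≤ δ i)
    (h : rightVal a β m q < leftVal a β p m) :
    ∀ᶠ i in l, rightVal (α i) β (x i) (y i) < leftVal (α i) β p (x i) := by
  obtain ⟨N, hN1, hN2⟩ := exists_between h
  have h1 := tendsto_leftVal_of_approx hl (hβ.mono (Icc_subset_Icc le_rfl (hr.le.trans hQ))) hx hα
    hxt hδ (hδa.mono fun i hi u hu => hi u ⟨hu.1, hu.2.trans (hr.le.trans hQ)⟩)
  have h2 := eventually_leftVal_lt_of_approx (l := l) (x := fun i => -y i) (y := fun i => -x i)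
    (α := fun i => oddRefl (α i)) (N := N) hr.refl hβ.oddRefl ha.oddRefl (neg_le_neg hQ)
    (neg_le_neg hl.le) (hy.mono fun i hi => ⟨neg_le_neg hi.2, neg_le_neg hi.1⟩)
    (hx.mono fun i hi => ⟨neg_le_neg hi.2, neg_le_neg hi.1⟩) (hα'.mono fun i hi => hi.refl)
    hyt.neg hxt.neg hδ (hδa.mono fun i hi u hu => by
      have := hi (-u) ⟨by linarith [hu.2], by linarith [hu.1]⟩
      rw [abs_sub_comm] at this
      simp only [oddRefl]
      rwa [neg_sub_neg]) hN1
  filter_upwards [h1.eventually (lt_mem_nhds hN2), h2] with i hi1 hi2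
  exact lt_trans hi2 hi1

/-- Tailored to decreasing `c`: the first zero moves left and the centre moves right. Here `p = m`
is allowed. -/
theorem eventually_leftVal_lt_rightVal {P : ℝ} (hl : LeftCell a p m) (hr : RightCell a m q)
    (hβ : ContinuousOn β (Icc P q)) (ha : ContinuousOn a (Icc P q)) (hP : P ≤ p)
    (hx : ∀ᶠ i in l, P ≤ x i ∧ x i ≤ p) (hy : ∀ᶠ i in l, m ≤ y i ∧ y i ≤ q)
    (hα : ∀ᶠ i in l, LeftCell (α i) (x i) (y i)) (hα' : ∀ᶠ i in l, RightCell (α i) (y i) q)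
    (hxt : Tendsto x l (𝓝 p)) (hyt : Tendsto y l (𝓝 m)) (hδ : Tendsto δ l (𝓝 0))
    (hδa : ∀ᶠ i in l, ∀ u ∈ Icc P q, |α i u - a u| ≤ δ i)
    (h : leftVal a β p m < rightVal a β m q) :
    ∀ᶠ i in l, leftVal (α i) β (x i) (y i) < rightVal (α i) β (y i) q := by
  obtain ⟨N, hN1, hN2⟩ := exists_between h
  have h1 := tendsto_leftVal_of_approx (l := l) (x := fun i => -y i)
    (α := fun i => oddRefl (α i)) hr.refl
    (hβ.mono (Icc_subset_Icc (hP.trans hl.le) le_rfl)).oddRefl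
    (hy.mono fun i hi => ⟨neg_le_neg hi.2, neg_le_neg hi.1⟩) (hα'.mono fun i hi => hi.refl)
    hyt.neg hδ (hδa.mono fun i hi u hu => by
      have := hi (-u) ⟨by linarith [hu.2, hl.le], by linarith [hu.1]⟩
      rw [abs_sub_comm] at this
      simp only [oddRefl]
      rwa [neg_sub_neg])
  have h2 := eventually_leftVal_lt_of_approx hl hβ ha hP hr.le hx hy hα hxt hyt hδ hδa hN1
  filter_upwards [h1.eventually (lt_mem_nhds hN2), h2] with i hi1 hi2
  exact lt_trans hi2 hi1

end Perturbation

/-- Comparison of the connections of two systems. -/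
theorem crit_lt_crit {a₁ a₂ b g : ℝ → ℝ} {p₁ m₁ q₁ p₂ m₂ q₂ : ℝ} (h1 : Cell a₁ b g p₁ m₁ q₁)
    (h2 : Cell a₂ b g p₂ m₂ q₂) (hp : p₁ < p₂) (hm : m₂ ≤ m₁) (hq : q₁ ≤ q₂)
    (ha : ∀ u ∈ Icc p₂ q₁, a₂ u ≤ a₁ u) : crit a₁ b g p₁ q₁ < crit a₂ b g p₂ q₂ := by
  obtain ⟨v₁, hv₁⟩ := h1.crit_spec
  obtain ⟨v₂, hv₂⟩ := h2.crit_spec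
  by_contra hcon
  push Not at hcon
  refine hv₁.not_ordered hv₂ hp.le h2.hpm hm h1.hmq hq h1.left h1.right h2.left h2.right ha
    (fun u hu => ?_) (Or.inl hp)
  have := (h1.gpos u ⟨hp.le.trans hu.1, hu.2⟩).le
  simp only [pert]
  nlinarith

theorem critGap_lt_critGap {a₁ a₂ b g : ℝ → ℝ} {p₁ m₁ q₁ p₂ m₂ q₂ : ℝ}
    (h1 : Cell a₁ b g p₁ m₁ q₁) (h2 : Cell a₂ b g p₂ m₂ q₂) (hp : p₁ < p₂) (hm : m₂ ≤ m₁)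
    (hq : q₁ ≤ q₂) (ha : ∀ u ∈ Icc p₂ q₁, a₂ u ≤ a₁ u) :
    critGap a₁ b g p₁ q₁ < critGap a₂ b g p₂ q₂ :=
  add_lt_add (crit_lt_crit h1 h2 hp hm hq ha) (crit_lt_crit h1.neg h2.neg hp hm hq ha)

/-! ### Blow-up at a point where the primitive of `g` tends to `-∞` -/

section BlowUp

variable {a b β g Γ : ℝ → ℝ} {d m s k μ : ℝ}

theorem le_leftVal_of_le {p : ℝ} {B N : ℝ} (hl : LeftCell a p m) (hβ : ContinuousOn β (Icc p m))
    (hd : d ∈ Icc p m) (hβB : ∀ u ∈ Icc d m, -B ≤ β u)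
    (hN : N ≤ branch a β p m d) : N - B * (m - d) ≤ leftVal a β p m := by
  obtain ⟨hV, -⟩ := hl.spec hβ
  have hmono : MonotoneOn (fun u => branch a β p m u + B * (u - d)) (Icc d m) := by
    apply monotoneOn_Icc_of_hasDerivAt (f' := fun u => a u / branch a β p m u + β u + B)
    · exact (hV.mono hd.1 le_rfl).cont.add (by fun_prop)
    · intro u hu
      refine (((hV.mono hd.1 le_rfl).deriv u hu).add
        (((hasDerivAt_id u).sub_const d).const_mul B)).congr_deriv (by simp)
    · intro u hu
      have h1 := hβB u (Ioo_subset_Icc_self hu)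
      have h2 := hl.pos u ⟨hd.1.trans_lt hu.1, hu.2⟩
      have h3 := (hV.mono hd.1 le_rfl).pos u hu
      have : 0 < a u / branch a β p m u := div_pos h2 h3
      linarith
  have := hmono (left_mem_Icc.2 hd.2) (right_mem_Icc.2 hd.2) hd.2
  simp only [sub_self, mul_zero, add_zero] at this
  simp only [leftVal]
  linarith

/-- The slope is at least `β ≥ k g`, so the height exceeds `k` times the increment of the primitive.
-/
theorem le_branch_of_coeff {p : ℝ} (hl : LeftCell a p m) (hβ : ContinuousOn β (Icc p m))
    (hd : d ∈ Icc p m) (hΓc : ContinuousOn Γ (Icc p d)) (hΓ : ∀ u ∈ Ioo p d, HasDerivAt Γ (g u) u)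
    (hβg : ∀ u ∈ Ioo p d, k * g u ≤ β u) : k * (Γ d - Γ p) ≤ branch a β p m d := by
  obtain ⟨hV, hV0⟩ := hl.spec hβ
  have hmono : MonotoneOn (fun u => branch a β p m u - k * Γ u) (Icc p d) := by
    apply monotoneOn_Icc_of_hasDerivAt (f' := fun u => a u / branch a β p m u + β u - k * g u)
    · exact (hV.mono le_rfl hd.2).cont.sub (hΓc.const_smul k)
    · intro u hu
      exact ((hV.mono le_rfl hd.2).deriv u hu).sub ((hΓ u hu).const_mul k)
    · intro u hu
      have h1 := hβg u hu
      have h2 := hl.pos u ⟨hu.1, hu.2.trans_le hd.2⟩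
      have h3 := (hV.mono le_rfl hd.2).pos u hu
      have : 0 < a u / branch a β p m u := div_pos h2 h3
      linarith
  have := hmono (left_mem_Icc.2 hd.1) (right_mem_Icc.2 hd.1) hd.1
  simp only [hV0] at this
  linarith

/-- Where the coefficient of `w` is only known to be nonnegative, the force does the work: the
derivative of `v ^ 2 / 2` is at least `a ≥ k g`. -/
theorem le_branch_sq_of_force {p : ℝ} (hl : LeftCell a p m) (hβ : ContinuousOn β (Icc p m))
    (hd : d ∈ Icc p m) (hΓc : ContinuousOn Γ (Icc p d)) (hΓ : ∀ u ∈ Ioo p d, HasDerivAt Γ (g u) u)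
    (hag : ∀ u ∈ Ioo p d, k * g u ≤ a u) (hβ0 : ∀ u ∈ Ioo p d, 0 ≤ β u) :
    2 * k * (Γ d - Γ p) ≤ branch a β p m d ^ 2 := by
  obtain ⟨hV, hV0⟩ := hl.spec hβ
  have hmono : MonotoneOn (fun u => branch a β p m u ^ 2 - 2 * k * Γ u) (Icc p d) := by
    apply monotoneOn_Icc_of_hasDerivAt
      (f' := fun u => 2 * (a u + β u * branch a β p m u) - 2 * k * g u)
    · exact ((hV.mono le_rfl hd.2).cont.pow 2).sub (hΓc.const_smul (2 * k))
    · intro u hu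
      have h3 := (hV.mono le_rfl hd.2).pos u hu
      refine ((((hV.mono le_rfl hd.2).deriv u hu).pow 2).sub
        ((hΓ u hu).const_mul (2 * k))).congr_deriv ?_
      simp only [Nat.cast_ofNat, Nat.add_one_sub_one, pow_one]
      field_simp
    · intro u hu
      have h1 := hag u hu
      have h3 := (hV.mono le_rfl hd.2).pos u hu
      have := mul_nonneg (hβ0 u hu) h3.le
      linarith
  have := hmono (left_mem_Icc.2 hd.1) (right_mem_Icc.2 hd.1) hd.1
  simp only [hV0] at this
  linarith

/-- If the primitive of `g` tends to `-∞` at `0`, then `critGap` becomes negative. -/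
theorem exists_critGap_neg {μ₀ : ℝ} (hd : d ∈ Ioo 0 m)
    (hc : ∀ p ∈ Ioo 0 m, Cell a b g p m s) (hΓ : ∀ u, 0 < u → HasDerivAt Γ (g u) u)
    (hΓb : ∀ N, ∃ p₀ > 0, ∀ p ∈ Ioc 0 p₀, Γ p < N) (hk : 0 < k)
    (hag : ∀ u ∈ Ioo 0 d, k * g u ≤ a u) (hβ₀ : ∀ u ∈ Ioo 0 d, pert b g μ₀ u ≤ 0)
    (hβ : ∀ μ > μ₀, ∃ ε > 0, ∃ d' ∈ Ioo 0 m, ∀ u ∈ Ioo 0 d', ε * g u ≤ pert b g μ u) :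
    ∃ p ∈ Ioo 0 m, critGap a b g p s < 0 := by
  have hcont : ∀ {p x : ℝ}, 0 < p → ContinuousOn Γ (Icc p x) := fun hp u hu =>
    (hΓ u (hp.trans_le hu.1)).continuousAt.continuousWithinAt
  have hder : ∀ {p x : ℝ}, 0 < p → ∀ u ∈ Ioo p x, HasDerivAt Γ (g u) u := fun hp u hu =>
    hΓ u (hp.trans hu.1)
  -- At the borderline value `μ₀` the lower half plane has a nonnegative coefficient near `0`, so
  -- the force alone drives the branches up. The strict inequality gained here is spent in the upper
  -- half plane.
  have step1 : ∃ p ∈ Ioo 0 m, crit a (-b) g p s < -μ₀ := by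
    have hcd := hc d hd
    obtain ⟨B, hB0, hB⟩ := exists_abs_bound_Icc (hcd.neg.cpertl (-μ₀))
    set N := rightVal a (pert (-b) g (-μ₀)) m s + B * (m - d) + 1
    have hN0 : 0 < N := by
      have h1 := hcd.neg.rightVal_nonneg (μ := -μ₀)
      have h2 : 0 ≤ B * (m - d) := mul_nonneg hB0 (by linarith [hd.2])
      positivity
    obtain ⟨p₀, hp₀, hp⟩ := hΓb (Γ d - N ^ 2 / (2 * k))
    set p := min p₀ d
    have hp0 : 0 < p := lt_min hp₀ hd.1
    have hpd : p ≤ d := min_le_right _ _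
    have hpm : p ∈ Ioo 0 m := ⟨hp0, hpd.trans_lt hd.2⟩
    refine ⟨p, hpm, (hc p hpm).neg.crit_lt_iff.2 ?_⟩
    have h1 := hp p ⟨hp0, min_le_left _ _⟩
    have hcp := (hc p hpm).neg
    have h2 := le_branch_sq_of_force hcp.left (hcp.cpertl (-μ₀)) ⟨hpd, hd.2.le⟩ (hcont hp0)
      (hder hp0) (fun u hu => hag u ⟨hp0.trans hu.1, hu.2⟩) (fun u hu => by
        rw [pert_neg]
        exact neg_nonneg.2 (hβ₀ u ⟨hp0.trans hu.1, hu.2⟩))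
    have h3 : N ^ 2 ≤ branch a (pert (-b) g (-μ₀)) p m d ^ 2 := by
      refine le_trans ?_ h2
      have : N ^ 2 / (2 * k) ≤ Γ d - Γ p := by linarith
      rw [div_le_iff₀ (by positivity)] at this
      linarith
    have h4 : N ≤ branch a (pert (-b) g (-μ₀)) p m d :=
      le_of_sq_le_sq h3 (hcp.left.branch_nonneg (hcp.cpertl _) ⟨hpd, hd.2.le⟩)
    have h5 := le_leftVal_of_le hcp.left (hcp.cpertl (-μ₀)) ⟨hpd, hd.2.le⟩
      (fun u hu => (abs_le.1 (hB u hu)).1) h4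
    simp only [N] at h5
    linarith
  obtain ⟨p₁, hp₁, hlt⟩ := step1
  -- Since `-ν > μ₀`, the upper coefficient dominates a multiple of `g` near `0`, and for small `p`
  -- the upper critical value falls below `-ν` while the lower one stays below `ν`.
  obtain ⟨ν, hν1, hν2⟩ := exists_between hlt
  obtain ⟨ε, hε, d', hd', hβ'⟩ := hβ (-ν) (by linarith)
  have hcd := hc d' hd'
  obtain ⟨B, hB0, hB⟩ := exists_abs_bound_Icc (hcd.cpertl (-ν))
  set N := rightVal a (pert b g (-ν)) m s + B * (m - d') + 1
  obtain ⟨p₀, hp₀, hp⟩ := hΓb (Γ d' - N / ε)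
  set p := min (min p₀ d') p₁
  have hp0 : 0 < p := lt_min (lt_min hp₀ hd'.1) hp₁.1
  have hpd : p ≤ d' := (min_le_left _ _).trans (min_le_right _ _)
  have hpm : p ∈ Ioo 0 m := ⟨hp0, hpd.trans_lt hd'.2⟩
  have hcp := hc p hpm
  refine ⟨p, hpm, ?_⟩
  have e1 : crit a (-b) g p s ≤ crit a (-b) g p₁ s := by
    rcases eq_or_lt_of_le (min_le_right (min p₀ d') p₁) with he | hl
    · rw [show p = p₁ from he]
    · exact (hcp.neg.crit_strictMono (le_of_lt hl) hp₁.2 hcp.hmq le_rfl (Or.inl hl)).le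
  have e2 : crit a b g p s < -ν := by
    refine hcp.crit_lt_iff.2 ?_
    have h1 := hp p ⟨hp0, (min_le_left _ _).trans (min_le_left _ _)⟩
    have h2 := le_branch_of_coeff hcp.left (hcp.cpertl (-ν)) ⟨hpd, hd'.2.le⟩ (hcont hp0)
      (hder hp0) (fun u hu => hβ' u ⟨hp0.trans hu.1, hu.2⟩)
    have h3 : N ≤ branch a (pert b g (-ν)) p m d' := by
      refine le_trans ?_ h2
      have : N / ε ≤ Γ d' - Γ p := by linarith
      rwa [div_le_iff₀' hε] at this
    have h5 := le_leftVal_of_le hcp.left (hcp.cpertl (-ν)) ⟨hpd, hd'.2.le⟩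
      (fun u hu => (abs_le.1 (hB u hu)).1) h3
    simp only [N] at h5
    linarith
  rw [critGap]
  linarith

end BlowUp

/-! ### Consequences of the divergent integral -/

namespace TrafficModel

open MeasureTheory

variable {M : TrafficModel} {K c μ u m s : ℝ}

/-- A primitive of `g₂`. -/
def primG2 (M : TrafficModel) (x : ℝ) : ℝ := ∫ t in (1:ℝ)..x, M.g2 t

theorem hasDerivAt_primG2 (hτ : 0 < M.τ) (h2 : M.A2) (hu : 0 < u) :
    HasDerivAt M.primG2 (M.g2 u) u := by
  have hc : ContinuousOn M.g2 (Ioi 0) := (contDiffOn_g2 hτ h2).continuousOn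
  refine intervalIntegral.integral_hasDerivAt_right ?_ ?_ (hc.continuousAt (Ioi_mem_nhds hu))
  · refine (hc.mono fun x hx => ?_).intervalIntegrable
    exact (lt_min one_pos hu).trans_le hx.1
  · exact hc.stronglyMeasurableAtFilter isOpen_Ioi u hu

theorem monotoneOn_primG2 (hτ : 0 < M.τ) (h2 : M.A2) : MonotoneOn M.primG2 (Ioi 0) := by
  refine monotoneOn_of_deriv_nonneg (convex_Ioi 0)
    (fun u hu => (hasDerivAt_primG2 hτ h2 hu).continuousAt.continuousWithinAt)
    (fun u hu => ?_) fun u hu => ?_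
  · rw [interior_Ioi] at hu
    exact (hasDerivAt_primG2 hτ h2 hu).differentiableAt.differentiableWithinAt
  · rw [interior_Ioi] at hu
    rw [(hasDerivAt_primG2 hτ h2 hu).deriv]
    exact (g2_pos hτ h2 hu).le

/-- The substitution `u = 1 / ρ` turns `2 τ g₂(u) du` into `dρ / (ρ ^ 3 κ(ρ))` up to orientation. A
primitive of `g₂` bounded below near `0` would make the integral in (H) finite. -/
theorem exists_primG2_lt (hτ : 0 < M.τ) (h2 : M.A2) (hH : M.H) (N : ℝ) :
    ∃ p₀ > 0, ∀ p ∈ Ioc 0 p₀, M.primG2 p < N := by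
  by_contra hcon
  push Not at hcon
  have hN : ∀ p, 0 < p → N ≤ M.primG2 p := by
    intro p hp
    obtain ⟨q, hq, hqN⟩ := hcon p hp
    exact hqN.trans (monotoneOn_primG2 hτ h2 hq.1 hp hq.2)
  set F : ℝ → ℝ := fun ρ => 1 / (ρ ^ 3 * M.κ ρ) with hF
  have hpos : ∀ ρ, 0 < ρ → 0 < F ρ := fun ρ hρ => by
    have := h2.pos ρ hρ
    simp only [hF]
    positivity
  have hFc : ContinuousOn F (Ioi 0) := by
    refine continuousOn_const.div ((continuousOn_id.pow 3).mul h2.contDiffOn.continuousOn)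
      fun ρ hρ => ?_
    have h1 := h2.pos ρ hρ
    have : 0 < ρ := hρ
    positivity
  have hΨ : ∀ ρ, 0 < ρ → HasDerivAt (fun ρ => -(2 * M.τ) * M.primG2 ρ⁻¹) (F ρ) ρ := by
    intro ρ hρ
    have h1 := h2.pos ρ hρ
    refine (((hasDerivAt_primG2 hτ h2 (inv_pos.2 hρ)).comp ρ
      (hasDerivAt_inv hρ.ne')).const_mul (-(2 * M.τ))).congr_deriv ?_
    simp only [hF, g2, inv_inv]
    field_simp
  have hii : ∀ b : ℝ, 1 ≤ b → IntervalIntegrable F volume 1 b := fun b hb => by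
    refine (hFc.mono fun x hx => ?_).intervalIntegrable
    rw [uIcc_of_le hb] at hx
    exact one_pos.trans_le hx.1
  have hint : IntegrableOn F (Ioi 1) := by
    refine integrableOn_Ioi_of_intervalIntegral_norm_bounded
      (-(2 * M.τ) * N - -(2 * M.τ) * M.primG2 1⁻¹) 1 (l := atTop) (b := id) (fun b => ?_)
      tendsto_id ?_
    · rcases le_total 1 b with hb | hb
      · exact (intervalIntegrable_iff_integrableOn_Ioc_of_le hb).1 (hii b hb)
      · simp [Ioc_eq_empty (not_lt.2 hb)]
    · filter_upwards [eventually_ge_atTop 1] with b hb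
      have hb0 : (0:ℝ) < b := one_pos.trans_le hb
      have e1 : ∫ x in (1:ℝ)..id b, ‖F x‖ = ∫ x in (1:ℝ)..b, F x := by
        refine intervalIntegral.integral_congr fun x hx => ?_
        rw [id, uIcc_of_le hb] at hx
        exact Real.norm_of_nonneg (hpos x (one_pos.trans_le hx.1)).le
      have e2 : ∫ x in (1:ℝ)..b, F x = -(2 * M.τ) * M.primG2 b⁻¹ - -(2 * M.τ) * M.primG2 1⁻¹ := by
        refine intervalIntegral.integral_eq_sub_of_hasDerivAt
          (f := fun ρ => -(2 * M.τ) * M.primG2 ρ⁻¹) (fun x hx => ?_) (hii b hb)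
        rw [uIcc_of_le hb] at hx
        exact hΨ x (one_pos.trans_le hx.1)
      rw [e1, e2]
      have := mul_le_mul_of_nonneg_left (hN b⁻¹ (inv_pos.2 hb0)) (show 0 ≤ 2 * M.τ by positivity)
      linarith
  exact (Integrable.lintegral_lt_top hint).ne hH

theorem exists_critGap_neg_of_H (hτ : 0 < M.τ) (h : M.A1) (h2 : M.A2) (hH : M.H)
    (h0 : M.K0 < K) (hM : K < M.KM) (hP : M.Pattern K c 0 m s) (hc : c ≤ M.c0) :
    ∃ p ∈ Ioo 0 m, critGap (M.acoef K c) (M.bcoef K) M.g2 p s < 0 := by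
  have hK : 0 < K := h.K0_nonneg.trans_lt h0
  have hx := uM_pos h h0 hM
  have hS := hP.scene hτ h h2 h0 hM
  set d := M.uM K / 2 with hd
  have hd0 : 0 < d := half_pos hx
  have hdu : d < M.uM K := half_lt_self hx
  have hVd : deriv M.V d < K := (shape h h0 hM).lt_of_Ioo_zero h ⟨hd0, hdu⟩
  have hK0d : ∀ u ∈ Ioo 0 d, deriv M.V u < deriv M.V d := fun u hu =>
    h.strictMonoOn_deriv ⟨hu.1, (hu.2.trans (hdu.trans (shape h h0 hM).x_mem.2)).le⟩
      ⟨hd0, (hdu.trans (shape h h0 hM).x_mem.2).le⟩ hu.2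
  have hpert : ∀ μ u, pert (M.bcoef K) M.g2 μ u = M.g2 u * ((K - deriv M.V u) / K + μ) :=
    fun μ u => by simp only [pert, bcoef]; ring
  -- The value `μ₀` annihilates the limit of `f' + μ` at `0`. The factor `2` in `k` comes from `g₂ =
  -- (u / 2) g₁`.
  refine exists_critGap_neg (d := d) (k := 2 * ((K - deriv M.V d) / K))
    (μ₀ := (M.K0 - K) / K) ⟨hd0, hdu.trans hP.m_mem.1⟩ (fun p hp => ?_)
    (fun u hu => hasDerivAt_primG2 hτ h2 hu) (exists_primG2_lt hτ h2 hH) ?_ (fun u hu => ?_)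
    (fun u hu => ?_) fun μ hμ => ?_
  · exact hS.cell hp.1 hp.1.le hp.2 (hP.m_pos.trans hP.hms) hP.hms le_rfl
  · have : 0 < K - deriv M.V d := sub_pos.2 hVd
    positivity
  · have hmono : StrictMonoOn (M.phi (deriv M.V d)) (Icc 0 d) := by
      refine strictMonoOn_phi h (convex_Icc _ _) (fun v hv => hv.1) fun v hv => ?_
      rw [interior_Icc] at hv
      exact ⟨hv.1, hK0d v hv⟩
    have h1 := hmono (left_mem_Icc.2 hd0.le) ⟨hu.1.le, hu.2.le⟩ hu.1
    simp only [phi] at h1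
    have h3 : (K - deriv M.V d) * u ≤ M.phi K u - c := by
      simp only [phi, c0] at hc ⊢
      linarith
    have hg := g1_pos hτ h2 hu.1
    rw [acoef, f_eq, g2_eq]
    have h4 : (K - deriv M.V d) / K * u ≤ (M.phi K u - c) / K := by
      rw [div_mul_eq_mul_div]
      exact div_le_div_of_nonneg_right h3 hK.le
    have := mul_le_mul_of_nonneg_left h4 hg.le
    linarith
  · rw [hpert, ← add_div]
    have h1 := h.K0_lt ⟨hu.1, (hu.2.trans (hdu.trans (shape h h0 hM).x_mem.2)).le⟩
    exact mul_nonpos_of_nonneg_of_nonpos (g2_pos hτ h2 hu.1).le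
      (div_nonpos_of_nonpos_of_nonneg (by linarith) hK.le)
  · have hε : 0 < ((K - M.K0) / K + μ) / 2 := by
      have : (M.K0 - K) / K + (K - M.K0) / K = 0 := by rw [← add_div]; simp
      linarith
    have hlim : Tendsto (fun u => (K - deriv M.V u) / K + μ) (𝓝[>] 0)
        (𝓝 ((K - M.K0) / K + μ)) :=
      ((h.tendsto_deriv_zero.const_sub K).div_const K).add_const μ
    have hev := hlim.eventually (lt_mem_nhds (show ((K - M.K0) / K + μ) / 2 < _ by linarith))
    obtain ⟨d', hd', hd''⟩ := (mem_nhdsGT_iff_exists_Ioo_subset' hP.m_pos).1 hev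
    have hd'0 : 0 < d' := hd'
    refine ⟨_, hε, min d' (m / 2), ⟨lt_min hd'0 (half_pos hP.m_pos),
      (min_le_right _ _).trans_lt (half_lt_self hP.m_pos)⟩, fun u hu => ?_⟩
    have h3 : ((K - M.K0) / K + μ) / 2 < (K - deriv M.V u) / K + μ :=
      hd'' ⟨hu.1, hu.2.trans_le (min_le_left _ _)⟩
    rw [hpert, mul_comm]
    exact mul_le_mul_of_nonneg_left h3.le (g2_pos hτ h2 hu.1).le

end TrafficModel

theorem StrictMonoOn.tendsto_of_tendsto_comp {ι : Type*} {l : Filter ι} {F : ℝ → ℝ} {S : Set ℝ}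
    {x : ι → ℝ} {y : ℝ} (hF : StrictMonoOn F S) (hS : S.OrdConnected) (hx : ∀ᶠ i in l, x i ∈ S)
    (hy : y ∈ S) (h : Tendsto (fun i => F (x i)) l (𝓝 (F y))) : Tendsto x l (𝓝 y) := by
  refine tendsto_order.2 ⟨fun z hz => ?_, fun z hz => ?_⟩
  · by_cases hzS : z ∈ S
    · filter_upwards [hx, h.eventually (lt_mem_nhds (hF hzS hy hz))] with i h1 h2
      exact (hF.lt_iff_lt hzS h1).1 h2
    · filter_upwards [hx] with i h1
      by_contra hcon
      exact hzS (hS.out h1 hy ⟨not_lt.1 hcon, hz.le⟩)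
  · by_cases hzS : z ∈ S
    · filter_upwards [hx, h.eventually (gt_mem_nhds (hF hy hzS hz))] with i h1 h2
      exact (hF.lt_iff_lt h1 hzS).1 h2
    · filter_upwards [hx] with i h1
      by_contra hcon
      exact hzS (hS.out hy h1 ⟨hz.le, not_lt.1 hcon⟩)

theorem StrictAntiOn.tendsto_of_tendsto_comp {ι : Type*} {l : Filter ι} {F : ℝ → ℝ} {S : Set ℝ}
    {x : ι → ℝ} {y : ℝ} (hF : StrictAntiOn F S) (hS : S.OrdConnected) (hx : ∀ᶠ i in l, x i ∈ S)
    (hy : y ∈ S) (h : Tendsto (fun i => F (x i)) l (𝓝 (F y))) : Tendsto x l (𝓝 y) :=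
  hF.neg.tendsto_of_tendsto_comp hS hx hy h.neg

/-! ### The sign of the gap at nearby speeds -/

namespace TrafficModel

variable {M : TrafficModel} {K c c' μ u p q : ℝ}

theorem continuousOn_pert_bcoef (hτ : 0 < M.τ) (h : M.A1) (h2 : M.A2) (μ : ℝ) :
    ContinuousOn (pert (M.bcoef K) M.g2 μ) (Ioi 0) :=
  (contDiffOn_bcoef hτ h h2).continuousOn.add
    (continuousOn_const.mul (contDiffOn_g2 hτ h2).continuousOn)

theorem exists_acoef_lipschitz (hτ : 0 < M.τ) (h2 : M.A2) (hK : 0 < K) (hp : 0 < p) (q : ℝ) :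
    ∃ G, ∀ c c', ∀ u ∈ Icc p q, |M.acoef K c' u - M.acoef K c u| ≤ G * |c' - c| := by
  obtain ⟨G, hG0, hG⟩ := exists_abs_bound_Icc ((contDiffOn_g1 hτ h2).continuousOn.mono
    fun u (hu : u ∈ Icc p q) => hp.trans_le hu.1)
  refine ⟨G / K, fun c c' u hu => ?_⟩
  have : M.acoef K c' u - M.acoef K c u = M.g1 u * ((c - c') / K) := by
    simp only [acoef, f_eq]
    ring
  rw [this, abs_mul, abs_div, abs_of_pos hK, abs_sub_comm, div_mul_eq_mul_div, ← mul_div_assoc]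
  exact div_le_div_of_nonneg_right (mul_le_mul_of_nonneg_right (hG u hu) (abs_nonneg _)) hK.le

theorem tendsto_mul_abs_sub (G c : ℝ) (s : Set ℝ) :
    Tendsto (fun c' => G * |c' - c|) (𝓝[s] c) (𝓝 0) := by
  have : ContinuousAt (fun c' => G * |c' - c|) c := by fun_prop
  simpa using this.tendsto.mono_left (nhdsWithin_le_nhds (s := s))

theorem phi_lt_of_between (h : M.A1) (h0 : M.K0 < K) (hM : K < M.KM) {m s : ℝ}
    (hm : m ∈ Icc (M.uM K) (M.um K)) (hs : M.um K ≤ s) (hmc : M.phi K m = c)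
    (hsc : M.phi K s = c) (hu : u ∈ Ioo m s) : M.phi K u < c := by
  rcases le_total u (M.um K) with hux | hux
  · rw [← hmc]
    exact strictAntiOn_phi_mid h h0 hM hm ⟨hm.1.trans hu.1.le, hux⟩ hu.1
  · rw [← hsc]
    exact strictMonoOn_phi_right h h0 hM hux hs hu.2

theorem lt_phi_of_between (h : M.A1) (h0 : M.K0 < K) (hM : K < M.KM) {e m : ℝ}
    (he : e ∈ Icc 0 (M.uM K)) (hm : m ∈ Icc (M.uM K) (M.um K)) (hec : M.phi K e = c)
    (hmc : M.phi K m = c) (hu : u ∈ Ioo e m) : c < M.phi K u := by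
  rcases le_total u (M.uM K) with hux | hux
  · rw [← hec]
    exact strictMonoOn_phi_left h h0 hM he ⟨he.1.trans hu.1.le, hux⟩ hu.1
  · rw [← hmc]
    exact strictAntiOn_phi_mid h h0 hM ⟨hux, hu.2.le.trans hm.2⟩ hm hu.2

section Family

variable {e m s : ℝ → ℝ} {m₀ s₀ e₀ : ℝ}

/-- One `μ` witnessing the height inequalities in both half planes for an interior starting point
`p` still works for `c'` slightly above `c`. Moving the start from `p` out to `e c'` only lowers the
gap. Because `e` itself never enters the limit, `c` may be an end of the interval at which zeros of
`f` are lost or merge. -/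
theorem eventually_critGap_neg (hτ : 0 < M.τ) (h : M.A1) (h2 : M.A2) (h0 : M.K0 < K)
    (hM : K < M.KM) (hF : ∀ c ∈ Ioo (M.c1 K) (M.cM K), 0 < e c ∧ M.Pattern K c (e c) (m c) (s c))
    (hc : c ∈ Ico (M.c1 K) (M.cM K)) (hp : 0 < p) (hpm : p < m₀)
    (hm : m₀ ∈ Icc (M.uM K) (M.um K)) (hs : M.um K ≤ s₀) (hmc : M.phi K m₀ = c)
    (hsc : M.phi K s₀ = c) (hpos : ∀ u ∈ Ico p m₀, c < M.phi K u)
    (h₁ : rightVal (M.acoef K c) (pert (M.bcoef K) M.g2 μ) m₀ s₀ <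
      leftVal (M.acoef K c) (pert (M.bcoef K) M.g2 μ) p m₀)
    (h₂ : rightVal (M.acoef K c) (pert (-M.bcoef K) M.g2 (-μ)) m₀ s₀ <
      leftVal (M.acoef K c) (pert (-M.bcoef K) M.g2 (-μ)) p m₀) :
    ∀ᶠ c' in 𝓝[>] c, critGap (M.acoef K c') (M.bcoef K) M.g2 (e c') (s c') < 0 := by
  have hK : 0 < K := h.K0_nonneg.trans_lt h0
  have hI : ∀ᶠ c' in 𝓝[>] c, c' ∈ Ioo (M.c1 K) (M.cM K) ∧ c < c' := by
    filter_upwards [Ioo_mem_nhdsGT hc.2] with c' hc'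
    exact ⟨⟨hc.1.trans_lt hc'.1, hc'.2⟩, hc'.1⟩
  have hct : Tendsto (fun c' : ℝ => c') (𝓝[>] c) (𝓝 c) := nhdsWithin_le_nhds
  have hmt : Tendsto m (𝓝[>] c) (𝓝 m₀) := by
    refine (strictAntiOn_phi_mid h h0 hM).tendsto_of_tendsto_comp ordConnected_Icc
      (hI.mono fun c' hc' => Ioo_subset_Icc_self (hF c' hc'.1).2.m_mem) hm ?_
    rw [hmc]
    exact hct.congr' (hI.mono fun c' hc' => (hF c' hc'.1).2.m_zero.symm)
  have hst : Tendsto s (𝓝[>] c) (𝓝 s₀) := by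
    refine (strictMonoOn_phi_right h h0 hM).tendsto_of_tendsto_comp ordConnected_Ici
      (hI.mono fun c' hc' => Ioi_subset_Ici_self (hF c' hc'.1).2.s_mem) hs ?_
    rw [hsc]
    exact hct.congr' (hI.mono fun c' hc' => (hF c' hc'.1).2.s_zero.symm)
  have hms₀ : m₀ ≤ s₀ := hm.2.trans hs
  have hx : ∀ᶠ c' in 𝓝[>] c, p ≤ m c' ∧ m c' ≤ m₀ := by
    filter_upwards [hI, hmt.eventually (lt_mem_nhds hpm)] with c' hc' hpc
    have hP := (hF c' hc'.1).2
    refine ⟨hpc.le, (strictAntiOn_phi_mid h h0 hM).le_iff_ge hm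
      (Ioo_subset_Icc_self hP.m_mem) |>.1 ?_⟩
    rw [hmc, hP.m_zero]
    exact hc'.2.le
  have hy : ∀ᶠ c' in 𝓝[>] c, s₀ ≤ s c' ∧ s c' ≤ s₀ + 1 := by
    filter_upwards [hI, hst.eventually (gt_mem_nhds (lt_add_one s₀))] with c' hc' hsc'
    have hP := (hF c' hc'.1).2
    refine ⟨(strictMonoOn_phi_right h h0 hM).le_iff_le hs
      (Ioi_subset_Ici_self hP.s_mem) |>.1 ?_, hsc'.le⟩
    rw [hsc, hP.s_zero]
    exact hc'.2.le
  have hcell : ∀ᶠ c' in 𝓝[>] c, p ∈ Ioo (e c') (m c') := by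
    filter_upwards [hI, hmt.eventually (lt_mem_nhds hpm),
      hct.eventually (gt_mem_nhds (hpos p (left_mem_Ico.2 hpm)))] with c' hc' hpc hc'p
    have hP := (hF c' hc'.1).2
    refine ⟨?_, hpc⟩
    by_contra hcon
    push Not at hcon
    rcases eq_or_lt_of_le hcon with he | hlt
    · rw [he, hP.e_zero (hF c' hc'.1).1] at hc'p
      exact lt_irrefl _ hc'p
    · exact lt_asymm hc'p (hP.low p ⟨hp, hlt⟩)
  have hsub : Icc p (s₀ + 1) ⊆ Ioi 0 := fun u hu => hp.trans_le hu.1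
  have hac : ContinuousOn (M.acoef K c) (Icc p (s₀ + 1)) :=
    (contDiffOn_acoef hτ h h2).continuousOn.mono hsub
  have hl : LeftCell (M.acoef K c) p m₀ :=
    ⟨hpm.le, hac.mono (Icc_subset_Icc le_rfl (by linarith)), fun u hu =>
      (acoef_pos hτ h2 hK (hp.trans hu.1)).2 (hpos u ⟨hu.1.le, hu.2⟩)⟩
  have hr : RightCell (M.acoef K c) m₀ s₀ :=
    ⟨hms₀, hac.mono (Icc_subset_Icc hpm.le (by linarith)), fun u hu =>
      (acoef_neg hτ h2 hK ((hp.trans hpm).trans hu.1)).2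
        (phi_lt_of_between h h0 hM hm hs hmc hsc hu)⟩
  have hC : ∀ᶠ c' in 𝓝[>] c,
      Cell (M.acoef K c') (M.bcoef K) M.g2 (e c') (m c') (s c') := by
    filter_upwards [hI] with c' hc'
    obtain ⟨he, hP⟩ := hF c' hc'.1
    exact (hP.scene hτ h h2 h0 hM).cell he le_rfl hP.hem (hP.m_pos.trans hP.hms) hP.hms le_rfl
  obtain ⟨G, hG⟩ := exists_acoef_lipschitz (q := s₀ + 1) hτ h2 hK hp
  have key : ∀ {β : ℝ → ℝ}, ContinuousOn β (Icc p (s₀ + 1)) →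
      rightVal (M.acoef K c) β m₀ s₀ < leftVal (M.acoef K c) β p m₀ →
      ∀ᶠ c' in 𝓝[>] c, rightVal (M.acoef K c') β (m c') (s c') <
        leftVal (M.acoef K c') β p (m c') := by
    intro β hβ hlt
    refine eventually_rightVal_lt_leftVal hl hr hβ hac (by linarith) hx hy ?_ ?_ hmt hst
      (tendsto_mul_abs_sub G c _) (Eventually.of_forall fun c' u hu => hG c c' u hu) hlt
    · filter_upwards [hcell, hC] with c' h3 h4 using h4.left.mono h3.1.le h3.2.le
    · filter_upwards [hC] with c' h4 using h4.right
  have hβ := (continuousOn_pert_bcoef (K := K) hτ h h2 μ).mono hsub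
  filter_upwards [hcell, hC, key hβ h₁, key (by rw [pert_neg]; exact hβ.neg) h₂]
    with c' h3 h4 h5 h6
  have h7 := h4.sub h3.1.le h3.2 le_rfl h4.hmq
  have h8 := h7.crit_lt_iff.2 h5
  have h9 := h7.neg.crit_lt_iff.2 h6
  have h10 := h4.critGap_strictMono h3.1.le h3.2 h4.hmq le_rfl (Or.inl h3.1)
  have h11 : critGap (M.acoef K c') (M.bcoef K) M.g2 p (s c') < 0 := by
    rw [critGap]
    linarith
  exact h10.trans h11

theorem eventually_critGap_pos (hτ : 0 < M.τ) (h : M.A1) (h2 : M.A2) (h0 : M.K0 < K)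
    (hM : K < M.KM) (hF : ∀ c ∈ Ioo (M.c1 K) (M.cM K), 0 < e c ∧ M.Pattern K c (e c) (m c) (s c))
    (hc : c ∈ Ioc (M.c1 K) (M.cM K)) (he₀ : e₀ ∈ Ioc 0 (M.uM K)) (hmq : m₀ < q)
    (hm : m₀ ∈ Icc (M.uM K) (M.um K)) (hec : M.phi K e₀ = c) (hmc : M.phi K m₀ = c)
    (hneg : ∀ u ∈ Ioc m₀ q, M.phi K u < c)
    (h₁ : leftVal (M.acoef K c) (pert (M.bcoef K) M.g2 μ) e₀ m₀ <
      rightVal (M.acoef K c) (pert (M.bcoef K) M.g2 μ) m₀ q)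
    (h₂ : leftVal (M.acoef K c) (pert (-M.bcoef K) M.g2 (-μ)) e₀ m₀ <
      rightVal (M.acoef K c) (pert (-M.bcoef K) M.g2 (-μ)) m₀ q) :
    ∀ᶠ c' in 𝓝[<] c, 0 < critGap (M.acoef K c') (M.bcoef K) M.g2 (e c') (s c') := by
  have hK : 0 < K := h.K0_nonneg.trans_lt h0
  have hI : ∀ᶠ c' in 𝓝[<] c, c' ∈ Ioo (M.c1 K) (M.cM K) ∧ c' < c := by
    filter_upwards [Ioo_mem_nhdsLT hc.1] with c' hc'
    exact ⟨⟨hc'.1, hc'.2.trans_le hc.2⟩, hc'.2⟩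
  have hct : Tendsto (fun c' : ℝ => c') (𝓝[<] c) (𝓝 c) := nhdsWithin_le_nhds
  have hmt : Tendsto m (𝓝[<] c) (𝓝 m₀) := by
    refine (strictAntiOn_phi_mid h h0 hM).tendsto_of_tendsto_comp ordConnected_Icc
      (hI.mono fun c' hc' => Ioo_subset_Icc_self (hF c' hc'.1).2.m_mem) hm ?_
    rw [hmc]
    exact hct.congr' (hI.mono fun c' hc' => (hF c' hc'.1).2.m_zero.symm)
  have he₀' : e₀ ∈ Icc 0 (M.uM K) := Ioc_subset_Icc_self he₀
  have hemem : ∀ c' ∈ Ioo (M.c1 K) (M.cM K), e c' ∈ Icc 0 (M.uM K) := fun c' hc' =>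
    ⟨(hF c' hc').1.le, (hF c' hc').2.e_lt.le⟩
  have het : Tendsto e (𝓝[<] c) (𝓝 e₀) := by
    refine (strictMonoOn_phi_left h h0 hM).tendsto_of_tendsto_comp ordConnected_Icc
      (hI.mono fun c' hc' => hemem c' hc'.1) he₀' ?_
    rw [hec]
    exact hct.congr' (hI.mono fun c' hc' => ((hF c' hc'.1).2.e_zero (hF c' hc'.1).1).symm)
  have hem₀ : e₀ ≤ m₀ := he₀.2.trans hm.1
  have hP₀ : 0 < e₀ / 2 := half_pos he₀.1
  have hx : ∀ᶠ c' in 𝓝[<] c, e₀ / 2 ≤ e c' ∧ e c' ≤ e₀ := by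
    filter_upwards [hI, het.eventually (lt_mem_nhds (half_lt_self he₀.1))] with c' hc' hpc
    obtain ⟨he, hP⟩ := hF c' hc'.1
    refine ⟨hpc.le, (strictMonoOn_phi_left h h0 hM).le_iff_le (hemem c' hc'.1) he₀' |>.1 ?_⟩
    rw [hec, hP.e_zero he]
    exact hc'.2.le
  have hy : ∀ᶠ c' in 𝓝[<] c, m₀ ≤ m c' ∧ m c' ≤ q := by
    filter_upwards [hI, hmt.eventually (gt_mem_nhds hmq)] with c' hc' hmc'
    have hP := (hF c' hc'.1).2
    refine ⟨(strictAntiOn_phi_mid h h0 hM).le_iff_ge (Ioo_subset_Icc_self hP.m_mem) hm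
      |>.1 ?_, hmc'.le⟩
    rw [hmc, hP.m_zero]
    exact hc'.2.le
  have hcell : ∀ᶠ c' in 𝓝[<] c, q ∈ Ioo (m c') (s c') := by
    filter_upwards [hI, hmt.eventually (gt_mem_nhds hmq),
      hct.eventually (lt_mem_nhds (hneg q (right_mem_Ioc.2 hmq)))] with c' hc' hpc hc'p
    have hP := (hF c' hc'.1).2
    refine ⟨hpc, ?_⟩
    by_contra hcon
    push Not at hcon
    rcases eq_or_lt_of_le hcon with he | hlt
    · rw [← he, hP.s_zero] at hc'p
      exact lt_irrefl _ hc'p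
    · exact lt_asymm hc'p (hP.top q hlt)
  have hsub : Icc (e₀ / 2) q ⊆ Ioi 0 := fun u hu => hP₀.trans_le hu.1
  have hac : ContinuousOn (M.acoef K c) (Icc (e₀ / 2) q) :=
    (contDiffOn_acoef hτ h h2).continuousOn.mono hsub
  have hl : LeftCell (M.acoef K c) e₀ m₀ :=
    ⟨hem₀, hac.mono (Icc_subset_Icc (by linarith) hmq.le), fun u hu =>
      (acoef_pos hτ h2 hK (he₀.1.trans hu.1)).2
        (lt_phi_of_between h h0 hM he₀' hm hec hmc hu)⟩
  have hr : RightCell (M.acoef K c) m₀ q :=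
    ⟨hmq.le, hac.mono (Icc_subset_Icc (by linarith) le_rfl), fun u hu =>
      (acoef_neg hτ h2 hK ((he₀.1.trans_le hem₀).trans hu.1)).2 (hneg u ⟨hu.1, hu.2.le⟩)⟩
  have hC : ∀ᶠ c' in 𝓝[<] c,
      Cell (M.acoef K c') (M.bcoef K) M.g2 (e c') (m c') (s c') := by
    filter_upwards [hI] with c' hc'
    obtain ⟨he, hP⟩ := hF c' hc'.1
    exact (hP.scene hτ h h2 h0 hM).cell he le_rfl hP.hem (hP.m_pos.trans hP.hms) hP.hms le_rfl
  obtain ⟨G, hG⟩ := exists_acoef_lipschitz (q := q) hτ h2 hK hP₀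
  have key : ∀ {β : ℝ → ℝ}, ContinuousOn β (Icc (e₀ / 2) q) →
      leftVal (M.acoef K c) β e₀ m₀ < rightVal (M.acoef K c) β m₀ q →
      ∀ᶠ c' in 𝓝[<] c, leftVal (M.acoef K c') β (e c') (m c') <
        rightVal (M.acoef K c') β (m c') q := by
    intro β hβ hlt
    refine eventually_leftVal_lt_rightVal hl hr hβ hac (by linarith) hx hy ?_ ?_ het hmt
      (tendsto_mul_abs_sub G c _) (Eventually.of_forall fun c' u hu => hG c c' u hu) hlt
    · filter_upwards [hC] with c' h4 using h4.left
    · filter_upwards [hcell, hC] with c' h3 h4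
      exact (h4.sub le_rfl h4.hpm h3.2.le h3.1).right
  have hβ := (continuousOn_pert_bcoef (K := K) hτ h h2 μ).mono hsub
  filter_upwards [hcell, hC, key hβ h₁, key (by rw [pert_neg]; exact hβ.neg) h₂]
    with c' h3 h4 h5 h6
  have h7 := h4.sub le_rfl h4.hpm h3.2.le h3.1
  have h8 := h7.lt_crit_iff.2 h5
  have h9 := h7.neg.lt_crit_iff.2 h6
  have h10 := h4.critGap_strictMono le_rfl h4.hpm h3.1 h3.2.le (Or.inr h3.2)
  have h11 : 0 < critGap (M.acoef K c') (M.bcoef K) M.g2 (e c') q := by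
    rw [critGap]
    linarith
  exact h11.trans h10

end Family

end TrafficModel

/-- A negative gap leaves room for a single `μ` that is supercritical above the axis and, with
opposite sign, below it. -/
theorem Cell.exists_of_critGap_neg {a b g : ℝ → ℝ} {p m q : ℝ} (h : Cell a b g p m q)
    (h0 : critGap a b g p q < 0) : ∃ μ,
      rightVal a (pert b g μ) m q < leftVal a (pert b g μ) p m ∧
      rightVal a (pert (-b) g (-μ)) m q < leftVal a (pert (-b) g (-μ)) p m := by
  obtain ⟨μ, h1, h2⟩ := exists_between (show crit a b g p q < -crit a (-b) g p q by
    rw [critGap] at h0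
    linarith)
  exact ⟨μ, h.crit_lt_iff.1 h1, h.neg.crit_lt_iff.1 (by linarith)⟩

theorem Cell.exists_of_critGap_pos {a b g : ℝ → ℝ} {p m q : ℝ} (h : Cell a b g p m q)
    (h0 : 0 < critGap a b g p q) : ∃ μ,
      leftVal a (pert b g μ) p m < rightVal a (pert b g μ) m q ∧
      leftVal a (pert (-b) g (-μ)) p m < rightVal a (pert (-b) g (-μ)) m q := by
  obtain ⟨μ, h1, h2⟩ := exists_between (show -crit a (-b) g p q < crit a b g p q by
    rw [critGap] at h0
    linarith)
  exact ⟨μ, h.lt_crit_iff.1 h2, h.neg.lt_crit_iff.1 (by linarith)⟩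

theorem Cell.exists_critGap_neg_right {a b g : ℝ → ℝ} {p m q : ℝ} (h : Cell a b g p m q)
    (h0 : critGap a b g p q < 0) : ∃ p' ∈ Ioo p m, critGap a b g p' q < 0 := by
  have hc := (h.continuousOn_critGap_left p (left_mem_Ico.2 h.hpm)).eventually (gt_mem_nhds h0)
  rw [nhdsWithin_Ico_eq_nhdsGE h.hpm] at hc
  obtain ⟨p', h1, h2⟩ := ((hc.filter_mono (nhdsWithin_mono p Ioi_subset_Ici_self)).and
    (Ioo_mem_nhdsGT h.hpm)).exists
  exact ⟨p', h2, h1⟩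

theorem Cell.exists_critGap_pos_left {a b g : ℝ → ℝ} {p m q : ℝ} (h : Cell a b g p m q)
    (h0 : 0 < critGap a b g p q) : ∃ q' ∈ Ioo m q, 0 < critGap a b g p q' := by
  have hc := (h.continuousOn_critGap_right q (right_mem_Ioc.2 h.hmq)).eventually (lt_mem_nhds h0)
  rw [nhdsWithin_Ioc_eq_nhdsLE h.hmq] at hc
  obtain ⟨q', h1, h2⟩ := ((hc.filter_mono (nhdsWithin_mono q Iio_subset_Iic_self)).and
    (Ioo_mem_nhdsLT h.hmq)).exists
  exact ⟨q', h2, h1⟩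

/-! ### The gap at the ends of the speed interval and the balanced speed -/

namespace TrafficModel

variable {M : TrafficModel} {K c μ u m : ℝ} {β : ℝ → ℝ}

theorem exists_quadratic_le_acoef {ι : Type*} {l : Filter ι} {y : ι → ℝ} (hτ : 0 < M.τ)
    (h2 : M.A2) (hK : 0 < K) (hm : 0 < m) (hy : Tendsto y l (𝓝 m))
    (hk : ∃ k > 0, ∀ᶠ i in l, k * (y i - m) ^ 2 ≤ |M.phi K (y i) - c|) :
    ∃ k > 0, ∀ᶠ i in l, k * (y i - m) ^ 2 ≤ |M.acoef K c (y i)| := by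
  obtain ⟨k, hk0, hk⟩ := hk
  have hg := g1_pos hτ h2 hm
  have hgt : Tendsto (fun i => M.g1 (y i)) l (𝓝 (M.g1 m)) :=
    ((contDiffOn_g1 hτ h2).continuousOn.continuousAt (Ioi_mem_nhds hm)).tendsto.comp hy
  refine ⟨M.g1 m / 2 * (k / K), by positivity, ?_⟩
  filter_upwards [hk, hgt.eventually (lt_mem_nhds (half_lt_self hg))] with i h3 h4
  rw [acoef, f_eq, abs_mul, abs_div, abs_of_pos hK, mul_assoc, div_mul_eq_mul_div k]
  exact mul_le_mul (h4.le.trans (le_abs_self _)) (div_le_div_of_nonneg_right h3 hK.le)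
    (by positivity) (abs_nonneg _)

/-- At `c = c_m` the force has a double zero at `u_m`, nondegenerate since `V'' ≠ 0` there, and the
coefficient of `w` vanishes at least linearly. This is the critical case in which the branch just
survives. -/
theorem leftVal_um_pos (hτ : 0 < M.τ) (h : M.A1) (h2 : M.A2) (h0 : M.K0 < K) (hM : K < M.KM)
    (hβ : ContinuousOn β (Ioi 0)) (hd : DifferentiableAt ℝ β (M.um K)) (hβ0 : β (M.um K) = 0) :
    0 < leftVal (M.acoef K (M.cm K)) β (M.uM K) (M.um K) := by
  have hK : 0 < K := h.K0_nonneg.trans_lt h0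
  have hx := uM_pos h h0 hM
  have hxy := uM_lt_um h h0 hM
  have hsub : Icc (M.uM K) (M.um K) ⊆ Ioi 0 := fun u hu => hx.trans_le hu.1
  have hS := shape h h0 hM
  have hUy : M.UM < M.um K := hS.y_mem
  refine leftVal_pos ⟨hxy.le, (contDiffOn_acoef hτ h h2).continuousOn.mono hsub, fun u hu => ?_⟩
    hxy (hβ.mono hsub) ?_ hd hβ0.ge
  · exact (acoef_pos hτ h2 hK (hx.trans hu.1)).2 (strictAntiOn_phi_mid h h0 hM
      (Ioo_subset_Icc_self hu) (right_mem_Icc.2 hxy.le) hu.2)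
  · refine exists_quadratic_le_acoef (y := fun u => u) hτ h2 hK (hx.trans hxy)
      nhdsWithin_le_nhds ?_
    refine exists_quadratic_le_left (F' := fun u => K - deriv M.V u) hUy (fun u hu =>
      (hasDerivAt_phi h (h.UM_pos.trans hu.1)).sub_const _)
      ((h.hasDerivAt_deriv (hx.trans hxy)).const_sub K) (sub_self _) (by rw [hS.dy, sub_self]) ?_
    exact (neg_pos.2 (h.deriv_deriv_neg _ hS.y_mem)).ne'

theorem rightVal_uM_pos (hτ : 0 < M.τ) (h : M.A1) (h2 : M.A2) (h0 : M.K0 < K) (hM : K < M.KM)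
    (hβ : ContinuousOn β (Ioi 0)) (hd : DifferentiableAt ℝ β (M.uM K)) (hβ0 : β (M.uM K) = 0) :
    0 < rightVal (M.acoef K (M.cM K)) β (M.uM K) (M.um K) := by
  have hK : 0 < K := h.K0_nonneg.trans_lt h0
  have hx := uM_pos h h0 hM
  have hxy := uM_lt_um h h0 hM
  have hsub : Icc (M.uM K) (M.um K) ⊆ Ioi 0 := fun u hu => hx.trans_le hu.1
  have hS := shape h h0 hM
  have hr : RightCell (M.acoef K (M.cM K)) (M.uM K) (M.um K) :=
    ⟨hxy.le, (contDiffOn_acoef hτ h h2).continuousOn.mono hsub, fun u hu =>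
      (acoef_neg hτ h2 hK (hx.trans hu.1)).2 (strictAntiOn_phi_mid h h0 hM
        (left_mem_Icc.2 hxy.le) (Ioo_subset_Icc_self hu) hu.1)⟩
  refine leftVal_pos hr.refl (neg_lt_neg hxy) (hβ.mono hsub).oddRefl ?_ ?_ (by
    simp [oddRefl, hβ0])
  · have hyt : Tendsto (fun x : ℝ => -x) (𝓝[<] (-M.uM K)) (𝓝 (M.uM K)) := by
      have := (continuous_neg (G := ℝ)).tendsto (-M.uM K)
      rw [neg_neg] at this
      exact this.mono_left nhdsWithin_le_nhds
    have hq : ∃ k > 0, ∀ᶠ x in 𝓝[<] (-M.uM K),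
        k * (x - -M.uM K) ^ 2 ≤ |M.phi K (-x) - M.cM K| := by
      refine exists_quadratic_le_left (F' := fun x => -(K - deriv M.V (-x)))
        (d := -deriv (deriv M.V) (M.uM K)) (neg_lt_neg hxy) (fun x hx' => ?_) ?_ ?_ ?_ ?_
      · have hx0 : 0 < -x := hx.trans_le (by linarith [hx'.2])
        exact (((hasDerivAt_phi h hx0).comp x (hasDerivAt_neg x)).sub_const _).congr_deriv
          (by simp)
      · have h3 : HasDerivAt (deriv M.V) (deriv (deriv M.V) (M.uM K)) (- -M.uM K) := by
          rw [neg_neg]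
          exact h.hasDerivAt_deriv hx
        exact ((h3.comp (-M.uM K) (hasDerivAt_neg _)).const_sub K).neg.congr_deriv (by simp)
      · rw [neg_neg]
        exact sub_self _
      · simp only [neg_neg]
        rw [hS.dx, sub_self, neg_zero]
      · exact (neg_neg_of_pos (h.deriv_deriv_pos _ hS.x_mem)).ne
    have e : ∀ x : ℝ, (-x - M.uM K) ^ 2 = (x - -M.uM K) ^ 2 := fun x => by ring
    obtain ⟨k, hk, hk'⟩ := exists_quadratic_le_acoef (c := M.cM K) hτ h2 hK hx hyt
      (by simpa only [e] using hq)
    refine ⟨k, hk, hk'.mono fun x hx' => ?_⟩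
    rw [e] at hx'
    simpa [oddRefl] using hx'
  · have h3 : DifferentiableAt ℝ β (- -M.uM K) := by rwa [neg_neg]
    exact (h3.comp (-M.uM K) differentiableAt_id.neg).neg

theorem differentiableAt_pert_zero (hτ : 0 < M.τ) (h : M.A1) (h2 : M.A2) (hu : 0 < u) :
    DifferentiableAt ℝ (pert (M.bcoef K) M.g2 0) u :=
  (differentiableAt_bcoef hτ h h2 hu).add ((differentiableAt_g2 hτ h2 hu).const_mul 0)

theorem pert_zero_eq_zero (hV : deriv M.V u = K) : pert (M.bcoef K) M.g2 0 u = 0 := by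
  simp [pert, bcoef, hV]

theorem C.bounds (hC : M.C K) (h : M.A1) : M.K0 < K ∧ K < M.KM := by
  have h1 := (K1_spec h).1
  rcases hC with hC | ⟨-, hC⟩
  · exact ⟨h1.1.trans hC.1, hC.2⟩
  · exact ⟨hC.1, hC.2.trans_lt h1.2⟩

theorem C.H_of_lt (hC : M.C K) (h : M.A1) (hc : M.cm K < M.c0) : M.H := by
  rcases hC with hC | ⟨hH, -⟩
  · exact absurd hc (not_lt.2 ((K1_spec h).2.2.2 K hC).le)
  · exact hH

section Family

variable {e m s : ℝ → ℝ}

/-- If `c₁ = c_m`, the zeros `u₀` and `u₂` merge, the right height is zero and the left one positive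
with `μ = 0`. Otherwise `u₁` tends to `0`, (C) yields (H), and the blow-up argument applies. -/
theorem eventually_critGap_neg_c1 (hτ : 0 < M.τ) (h : M.A1) (h2 : M.A2) (hC : M.C K)
    (hF : ∀ c ∈ Ioo (M.c1 K) (M.cM K), 0 < e c ∧ M.Pattern K c (e c) (m c) (s c)) :
    ∀ᶠ c' in 𝓝[>] (M.c1 K), critGap (M.acoef K c') (M.bcoef K) M.g2 (e c') (s c') < 0 := by
  obtain ⟨h0, hM⟩ := hC.bounds h
  have hx := uM_pos h h0 hM
  have hxy := uM_lt_um h h0 hM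
  have hc1 : M.c1 K ∈ Ico (M.c1 K) (M.cM K) :=
    ⟨le_rfl, max_lt (c0_lt_cM h h0 hM) (cm_lt_cM h h0 hM)⟩
  rcases le_or_gt M.c0 (M.cm K) with hcm | hcm
  · have e1 : M.c1 K = M.cm K := max_eq_right hcm
    have hβ := continuousOn_pert_bcoef (K := K) hτ h h2 0
    have hd := differentiableAt_pert_zero (K := K) hτ h h2 (hx.trans hxy)
    have hz := pert_zero_eq_zero (shape h h0 hM).dy
    have key : ∀ {β : ℝ → ℝ}, ContinuousOn β (Ioi 0) → DifferentiableAt ℝ β (M.um K) →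
        β (M.um K) = 0 → rightVal (M.acoef K (M.c1 K)) β (M.um K) (M.um K) <
          leftVal (M.acoef K (M.c1 K)) β (M.uM K) (M.um K) := by
      intro β hβ hd hz
      rw [e1]
      have hsub : Icc (M.um K) (M.um K) ⊆ Ioi 0 := fun u hu => (hx.trans hxy).trans_le hu.1
      have hr : RightCell (M.acoef K (M.cm K)) (M.um K) (M.um K) :=
        ⟨le_rfl, (contDiffOn_acoef hτ h h2).continuousOn.mono hsub, fun u hu =>
          absurd (hu.1.trans hu.2) (lt_irrefl _)⟩
      rw [rightVal, hr.refl.leftVal_self (hβ.mono hsub).oddRefl]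
      exact leftVal_um_pos hτ h h2 h0 hM hβ hd hz
    refine eventually_critGap_neg (p := M.uM K) (m₀ := M.um K) (s₀ := M.um K) (μ := 0) hτ h h2 h0
      hM hF hc1 hx hxy ⟨hxy.le, le_rfl⟩ le_rfl e1.symm e1.symm (fun u hu => ?_) (key hβ hd hz) ?_
    · rw [e1]
      exact strictAntiOn_phi_mid h h0 hM (Ico_subset_Icc_self hu) (right_mem_Icc.2 hxy.le) hu.2
    · rw [pert_neg]
      exact key hβ.neg hd.neg (by simp [hz])
  · have e1 : M.c1 K = M.c0 := max_eq_left hcm.le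
    obtain ⟨m₀, s₀, hP⟩ := exists_pattern_two h h0 hM hcm le_rfl
    obtain ⟨p, hp, hp0⟩ := exists_critGap_neg_of_H hτ h h2 (hC.H_of_lt h hcm) h0 hM hP le_rfl
    have hcell := (hP.scene hτ h h2 h0 hM).cell hp.1 hp.1.le hp.2 (hP.m_pos.trans hP.hms) hP.hms
      le_rfl
    obtain ⟨μ, h₁, h₂⟩ := hcell.exists_of_critGap_neg hp0
    rw [← e1] at hP h₁ h₂
    exact eventually_critGap_neg hτ h h2 h0 hM hF hc1 hp.1 hp.2 (Ioo_subset_Icc_self hP.m_mem)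
      (le_of_lt hP.s_mem) hP.m_zero hP.s_zero (fun u hu => hP.mid u ⟨hp.1.trans_le hu.1, hu.2⟩)
      h₁ h₂

theorem eventually_critGap_pos_cM (hτ : 0 < M.τ) (h : M.A1) (h2 : M.A2) (h0 : M.K0 < K)
    (hM : K < M.KM)
    (hF : ∀ c ∈ Ioo (M.c1 K) (M.cM K), 0 < e c ∧ M.Pattern K c (e c) (m c) (s c)) :
    ∀ᶠ c' in 𝓝[<] (M.cM K), 0 < critGap (M.acoef K c') (M.bcoef K) M.g2 (e c') (s c') := by
  have hx := uM_pos h h0 hM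
  have hxy := uM_lt_um h h0 hM
  have hβ := continuousOn_pert_bcoef (K := K) hτ h h2 0
  have hd := differentiableAt_pert_zero (K := K) hτ h h2 hx
  have hz := pert_zero_eq_zero (shape h h0 hM).dx
  have key : ∀ {β : ℝ → ℝ}, ContinuousOn β (Ioi 0) → DifferentiableAt ℝ β (M.uM K) →
      β (M.uM K) = 0 → leftVal (M.acoef K (M.cM K)) β (M.uM K) (M.uM K) <
        rightVal (M.acoef K (M.cM K)) β (M.uM K) (M.um K) := by
    intro β hβ hd hz
    have hsub : Icc (M.uM K) (M.uM K) ⊆ Ioi 0 := fun u hu => hx.trans_le hu.1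
    have hl : LeftCell (M.acoef K (M.cM K)) (M.uM K) (M.uM K) :=
      ⟨le_rfl, (contDiffOn_acoef hτ h h2).continuousOn.mono hsub, fun u hu =>
        absurd (hu.1.trans hu.2) (lt_irrefl _)⟩
    rw [hl.leftVal_self (hβ.mono hsub)]
    exact rightVal_uM_pos hτ h h2 h0 hM hβ hd hz
  refine eventually_critGap_pos (e₀ := M.uM K) (m₀ := M.uM K) (q := M.um K) (μ := 0) hτ h h2 h0
    hM hF ⟨max_lt (c0_lt_cM h h0 hM) (cm_lt_cM h h0 hM), le_rfl⟩ ⟨hx, le_rfl⟩ hxy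
    ⟨le_rfl, hxy.le⟩ rfl rfl (fun u hu => ?_) (key hβ hd hz) ?_
  · exact strictAntiOn_phi_mid h h0 hM (left_mem_Icc.2 hxy.le) (Ioc_subset_Icc_self hu) hu.1
  · rw [pert_neg]
    exact key hβ.neg hd.neg (by simp [hz])

/-- Raising `c` lowers the force everywhere, moves the outer zeros to the right and the centre to
the left. Each change demands a larger `μ` in both half planes. -/
theorem critGap_strictMonoOn (hτ : 0 < M.τ) (h : M.A1) (h2 : M.A2) (h0 : M.K0 < K) (hM : K < M.KM)
    (hF : ∀ c ∈ Ioo (M.c1 K) (M.cM K), 0 < e c ∧ M.Pattern K c (e c) (m c) (s c)) :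
    StrictMonoOn (fun c => critGap (M.acoef K c) (M.bcoef K) M.g2 (e c) (s c))
      (Ioo (M.c1 K) (M.cM K)) := by
  intro c hc c' hc' hcc
  have hK : 0 < K := h.K0_nonneg.trans_lt h0
  obtain ⟨he, hP⟩ := hF c hc
  obtain ⟨he', hP'⟩ := hF c' hc'
  have hcell : ∀ c ∈ Ioo (M.c1 K) (M.cM K),
      Cell (M.acoef K c) (M.bcoef K) M.g2 (e c) (m c) (s c) := fun c hc =>
    ((hF c hc).2.scene hτ h h2 h0 hM).cell (hF c hc).1 le_rfl (hF c hc).2.hem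
      ((hF c hc).2.m_pos.trans (hF c hc).2.hms) (hF c hc).2.hms le_rfl
  refine critGap_lt_critGap (hcell c hc) (hcell c' hc') ?_ ?_ ?_ fun u hu => ?_
  · refine (strictMonoOn_phi_left h h0 hM).lt_iff_lt ⟨he.le, hP.e_lt.le⟩ ⟨he'.le, hP'.e_lt.le⟩
      |>.1 ?_
    rwa [hP.e_zero he, hP'.e_zero he']
  · refine (strictAntiOn_phi_mid h h0 hM).le_iff_ge (Ioo_subset_Icc_self hP.m_mem)
      (Ioo_subset_Icc_self hP'.m_mem) |>.1 ?_
    rw [hP.m_zero, hP'.m_zero]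
    exact hcc.le
  · refine (strictMonoOn_phi_right h h0 hM).le_iff_le (Ioi_subset_Ici_self hP.s_mem)
      (Ioi_subset_Ici_self hP'.s_mem) |>.1 ?_
    rw [hP.s_zero, hP'.s_zero]
    exact hcc.le
  · have hg := g1_pos hτ h2 (he'.trans_le hu.1)
    simp only [acoef, f_eq]
    exact mul_le_mul_of_nonneg_left (div_le_div_of_nonneg_right (by linarith) hK.le) hg.le

end Family

/-- The speed at which the two heteroclinic connections occur for the same `μ`. -/
theorem exists_balanced_speed (hτ : 0 < M.τ) (h : M.A1) (h2 : M.A2) (hC : M.C K) :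
    ∃ cs ∈ Ioo (M.c1 K) (M.cM K), ∀ c ∈ Ioo (M.c1 K) (M.cM K), ∀ e m s, 0 < e →
      M.Pattern K c e m s →
      (c < cs → critGap (M.acoef K c) (M.bcoef K) M.g2 e s < 0) ∧
      (cs < c → 0 < critGap (M.acoef K c) (M.bcoef K) M.g2 e s) ∧
      (c = cs → critGap (M.acoef K c) (M.bcoef K) M.g2 e s = 0) := by
  obtain ⟨h0, hM⟩ := hC.bounds h
  have hK : 0 < K := h.K0_nonneg.trans_lt h0
  have hex : ∀ c, ∃ e m s, c ∈ Ioo (M.c1 K) (M.cM K) → 0 < e ∧ M.Pattern K c e m s := by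
    intro c
    by_cases hc : c ∈ Ioo (M.c1 K) (M.cM K)
    · obtain ⟨e, m, s, hP⟩ := exists_pattern_three h h0 hM hc.1 hc.2
      exact ⟨e, m, s, fun _ => hP⟩
    · exact ⟨0, 0, 0, fun hc' => absurd hc' hc⟩
  choose e m s hF using hex
  set D : ℝ → ℝ := fun c => critGap (M.acoef K c) (M.bcoef K) M.g2 (e c) (s c)
  have hD : StrictMonoOn D (Ioo (M.c1 K) (M.cM K)) := critGap_strictMonoOn hτ h h2 h0 hM hF
  have hcell : ∀ c ∈ Ioo (M.c1 K) (M.cM K),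
      Cell (M.acoef K c) (M.bcoef K) M.g2 (e c) (m c) (s c) := fun c hc =>
    ((hF c hc).2.scene hτ h h2 h0 hM).cell (hF c hc).1 le_rfl (hF c hc).2.hem
      ((hF c hc).2.m_pos.trans (hF c hc).2.hms) (hF c hc).2.hms le_rfl
  have hc1M : M.c1 K < M.cM K := max_lt (c0_lt_cM h h0 hM) (cm_lt_cM h h0 hM)
  obtain ⟨ca, hca0, hca⟩ := ((eventually_critGap_neg_c1 hτ h h2 hC hF).and
    (Ioo_mem_nhdsGT hc1M)).exists
  obtain ⟨cb, hcb0, hcb⟩ := ((eventually_critGap_pos_cM hτ h h2 h0 hM hF).and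
    (Ioo_mem_nhdsLT hc1M)).exists
  set T : Set ℝ := {c | c ∈ Ioo (M.c1 K) (M.cM K) ∧ D c < 0}
  have hbound : ∀ c' ∈ Ioo (M.c1 K) (M.cM K), 0 < D c' → c' ∈ upperBounds T := by
    intro c' hc' hpos c hc
    by_contra hcon
    push Not at hcon
    exact lt_asymm (hpos.trans (hD hc' hc.1 hcon)) hc.2
  have hTb : BddAbove T := ⟨cb, hbound cb hcb hcb0⟩
  have hTn : T.Nonempty := ⟨ca, hca, hca0⟩
  have hcs : sSup T ∈ Ioo (M.c1 K) (M.cM K) :=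
    ⟨hca.1.trans_le (le_csSup hTb ⟨hca, hca0⟩),
      (csSup_le hTn (hbound cb hcb hcb0)).trans_lt hcb.2⟩
  -- Continuity of `D` is not needed: a negative value would persist slightly to the right of the
  -- supremum, a positive one slightly to the left.
  have hzero : D (sSup T) = 0 := by
    obtain ⟨he, hP⟩ := hF _ hcs
    have hC' := hcell _ hcs
    rcases lt_trichotomy (D (sSup T)) 0 with hlt | heq | hgt
    · exfalso
      obtain ⟨p, hp, hp0⟩ := hC'.exists_critGap_neg_right hlt
      obtain ⟨μ, h₁, h₂⟩ := (hC'.sub hp.1.le hp.2 le_rfl hC'.hmq).exists_of_critGap_neg hp0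
      obtain ⟨c', h3, h4⟩ := ((eventually_critGap_neg hτ h h2 h0 hM hF (Ioo_subset_Ico_self hcs)
        (he.trans hp.1) hp.2 (Ioo_subset_Icc_self hP.m_mem) (le_of_lt hP.s_mem) hP.m_zero
        hP.s_zero (fun u hu => hP.mid u ⟨hp.1.trans_le hu.1, hu.2⟩) h₁ h₂).and
        (Ioo_mem_nhdsGT hcs.2)).exists
      exact absurd (le_csSup hTb (show c' ∈ T from ⟨⟨hcs.1.trans h4.1, h4.2⟩, h3⟩))
        (not_le.2 h4.1)
    · exact heq
    · exfalso
      obtain ⟨q, hq, hq0⟩ := hC'.exists_critGap_pos_left hgt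
      obtain ⟨μ, h₁, h₂⟩ := (hC'.sub le_rfl hC'.hpm hq.2.le hq.1).exists_of_critGap_pos hq0
      obtain ⟨c', h3, h4⟩ := ((eventually_critGap_pos hτ h h2 h0 hM hF (Ioo_subset_Ioc_self hcs)
        ⟨he, hP.e_lt.le⟩ hq.1 (Ioo_subset_Icc_self hP.m_mem) (hP.e_zero he) hP.m_zero
        (fun u hu => hP.high u ⟨hu.1, hu.2.trans_lt hq.2⟩) h₁ h₂).and
        (Ioo_mem_nhdsLT hcs.1)).exists
      exact absurd (csSup_le hTn (hbound c' ⟨h4.1, h4.2.trans hcs.2⟩ h3)) (not_le.2 h4.2)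
  refine ⟨sSup T, hcs, fun c hc e' m' s' he' hP' => ?_⟩
  obtain ⟨r1, -, r3⟩ := ThreeZeros.unique ((hF c hc).2.threeZeros hK (hF c hc).1)
    (hP'.threeZeros hK he')
  rw [r1, r3]
  refine ⟨fun hlt => ?_, fun hlt => ?_, fun heq => ?_⟩
  · exact (hD hc hcs hlt).trans_eq hzero
  · exact hzero.symm.trans_lt (hD hcs hc hlt)
  · rw [heq]
    exact hzero

end TrafficModel

/-! ### Assembly for the traffic model -/

theorem Cell.exists_critGap_eq_zero_left {a b g : ℝ → ℝ} {p m q : ℝ} (h : Cell a b g p m q)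
    (h0 : critGap a b g p q < 0) : ∃ p' ∈ Ioo p m, critGap a b g p' q = 0 := by
  obtain ⟨z, hz, hzm⟩ := (h.eventually_critGap_pos.and (Ioo_mem_nhdsLT h.hpm)).exists
  obtain ⟨y, hy, hy0⟩ := intermediate_value_Ioo hzm.1.le (h.continuousOn_critGap_left.mono
    fun x hx => ⟨hx.1, hx.2.trans_lt hzm.2⟩) ⟨h0, hz⟩
  exact ⟨y, ⟨hy.1, hy.2.trans hzm.2⟩, hy0⟩

theorem Cell.exists_critGap_eq_zero_right {a b g : ℝ → ℝ} {p m q : ℝ} (h : Cell a b g p m q)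
    (h0 : 0 < critGap a b g p q) : ∃ q' ∈ Ioo m q, critGap a b g p q' = 0 := by
  obtain ⟨z, hz, hzm⟩ := (h.eventually_critGap_neg.and (Ioo_mem_nhdsGT h.hmq)).exists
  obtain ⟨y, hy, hy0⟩ := intermediate_value_Ioo hzm.2.le (h.continuousOn_critGap_right.mono
    fun x hx => ⟨hzm.1.trans_le hx.1, hx.2⟩) ⟨hz, h0⟩
  exact ⟨y, ⟨hzm.1.trans hy.1, hy.2⟩, hy0⟩

namespace TrafficModel

variable {M : TrafficModel} {K c μ Z x e m s p q : ℝ} {O : Set PhasePlane}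

theorem isPeriodicOrbit_iff (h : M.A1) : M.IsPeriodicOrbit K c x μ Z O ↔
    IsCycle (M.acoef K c) (pert (M.bcoef K) M.g2 μ) (Ioi 0) x Z O := by
  simp only [IsPeriodicOrbit, IsCycle, isSolution_iff h]

theorem isPulseOrbit_iff (h : M.A1) : M.IsPulseOrbit K c x μ O ↔
    IsPulse (M.acoef K c) (pert (M.bcoef K) M.g2 μ) (Ioi 0) x O := by
  simp only [IsPulseOrbit, IsPulse, Connects, isSolution_iff h, and_assoc]

theorem isHeteroclinicCycle_iff (h : M.A1) (hP : M.ThreeZeros K c e m s) :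
    M.IsHeteroclinicCycle K c μ O ↔
      IsHetCycle (M.acoef K c) (pert (M.bcoef K) M.g2 μ) (Ioi 0) e s O := by
  have : M.IsHeteroclinicCycle K c μ O ↔ ∃ ub wb uf wf : ℝ → ℝ,
      (M.Connects K c μ e s ub wb ∧ ∀ z, 0 < wb z) ∧
      (M.Connects K c μ s e uf wf ∧ ∀ z, wf z < 0) ∧
      O = trajectory ub wb univ ∪ trajectory uf wf univ := by
    constructor
    · rintro ⟨e', m', s', h', hh⟩
      obtain ⟨rfl, rfl, rfl⟩ := hP.unique h'
      exact hh
    · exact fun hh => ⟨e, m, s, hP, hh⟩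
  rw [this]
  simp only [IsHetCycle, Connects, isSolution_iff h, and_assoc]

/-- The functions `P` and `R` give, for each `x` in `Q`, the ends of a closed orbit through
`(x, 0)`. -/
def Matched (M : TrafficModel) (K c p m q : ℝ) (Q : Set ℝ) (P R : ℝ → ℝ) : Prop :=
  ∀ x ∈ Q, P x ∈ Ioo p m ∧ R x ∈ Ioo m q ∧
    critGap (M.acoef K c) (M.bcoef K) M.g2 (P x) (R x) = 0 ∧ (x = P x ∨ x = R x)

/-- The parameter for which the orbit has the ends `P x` and `R x`. -/
def muFamily (M : TrafficModel) (K c : ℝ) (P R : ℝ → ℝ) (x : ℝ) : ℝ :=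
  crit (M.acoef K c) (M.bcoef K) M.g2 (P x) (R x)

/-- The period of the orbit with the ends `P x` and `R x`. -/
def periodFamily (M : TrafficModel) (K c : ℝ) (P R : ℝ → ℝ) (x : ℝ) : ℝ :=
  loopTime (M.acoef K c) (M.bcoef K) M.g2 (Ioi 0) (P x) (R x)

/-- The orbit with the ends `P x` and `R x`. -/
def orbitFamily (M : TrafficModel) (K c : ℝ) (P R : ℝ → ℝ) (x : ℝ) : Set PhasePlane :=
  loopSet (M.acoef K c) (M.bcoef K) M.g2 (P x) (R x)

namespace Pattern

variable {P R : ℝ → ℝ} {Q : Set ℝ} {l : Filter ℝ}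

theorem acoef_eq_zero (hP : M.Pattern K c e m s) (hK : 0 < K) (hx : 0 < x)
    (hx' : x = e ∨ x = m ∨ x = s) : M.acoef K c x = 0 := by
  rw [acoef, (hP.f_eq_zero_iff hK hx).2 hx', mul_zero]

theorem isPeriodicFamily (hPat : M.Pattern K c e m s) (hτ : 0 < M.τ) (h : M.A1) (h2 : M.A2)
    (h0 : M.K0 < K) (hM : K < M.KM) (he : e ≤ p) (hs : q ≤ s) (hm : M.Matched K c p m q Q P R) :
    M.IsPeriodicFamily K c Q (M.muFamily K c P R) (M.periodFamily K c P R)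
      (M.orbitFamily K c P R) := by
  intro x hx μ Z O
  obtain ⟨h1, h3, h4, h5⟩ := hm x hx
  rw [isPeriodicOrbit_iff h]
  exact (hPat.scene hτ h h2 h0 hM).isCycle_iff ⟨he.trans_lt h1.1, h1.2⟩
    ⟨h3.1, h3.2.trans_le hs⟩ h4 h5

theorem hopfLimit (hPat : M.Pattern K c e m s) (hτ : 0 < M.τ) (h : M.A1) (h2 : M.A2)
    (h0 : M.K0 < K) (hM : K < M.KM) (he : e ≤ p) (hs : q ≤ s) (hm : M.Matched K c p m q Q P R)
    (hPt : Tendsto P (𝓝[Q] m) (𝓝 m)) (hRt : Tendsto R (𝓝[Q] m) (𝓝 m)) :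
    M.HopfLimit K c m Q (M.muFamily K c P R) (M.periodFamily K c P R)
      (M.orbitFamily K c P R) := by
  have hK : 0 < K := h.K0_nonneg.trans_lt h0
  have hS := hPat.scene hτ h h2 h0 hM
  have hm0 := hPat.m_pos
  have hPe : ∀ᶠ x in 𝓝[Q] m, P x ∈ Ioo e m := by
    filter_upwards [self_mem_nhdsWithin] with x hx
    exact ⟨he.trans_lt (hm x hx).1.1, (hm x hx).1.2⟩
  have hRe : ∀ᶠ x in 𝓝[Q] m, R x ∈ Ioo m s := by
    filter_upwards [self_mem_nhdsWithin] with x hx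
    exact ⟨(hm x hx).2.1.1, (hm x hx).2.1.2.trans_le hs⟩
  have hgap : ∀ᶠ x in 𝓝[Q] m, critGap (M.acoef K c) (M.bcoef K) M.g2 (P x) (R x) = 0 := by
    filter_upwards [self_mem_nhdsWithin] with x hx using (hm x hx).2.2.1
  have hg1 := g1_pos hτ h2 hm0
  have hg2 := g2_pos hτ h2 hm0
  have hd : deriv (M.f K c) m = (K - deriv M.V m) / K := (hasDerivAt_f h hm0).deriv
  have hneg : deriv (M.f K c) m < 0 := by
    rw [hd]
    exact div_neg_of_neg_of_pos (sub_neg.2 (hPat.deriv_lt h h0 hM)) hK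
  have hpos : 0 < -(M.g1 m * deriv (M.f K c) m) := neg_pos.2 (mul_neg_of_pos_of_neg hg1 hneg)
  refine ⟨?_, ?_, hS.tendsto_loopSet_centre hPe hRe hgap hPt hRt⟩
  · have h3 := hS.tendsto_crit_centre hPe hRe hgap hPt hRt
    rwa [bcoef, mul_div_cancel_left₀ _ hg2.ne', ← hd] at h3
  · refine hS.tendsto_loopTime_centre hPe hRe hgap hPt hRt (Real.sqrt_pos.2 hpos) ?_
    rw [omega0, Real.sq_sqrt hpos.le, neg_neg, hd]
    exact hasDerivAt_acoef hτ h h2 hm0 ((hPat.f_eq_zero_iff hK hm0).2 (Or.inr (Or.inl rfl)))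

/-- One statement serves both homoclinic cases and both limits at the cycle: `x` is an end of the
outer pair that is an equilibrium, and `O` is the limiting orbit without its equilibria. -/
theorem endLimit (hPat : M.Pattern K c e m s) (hτ : 0 < M.τ) (h : M.A1) (h2 : M.A2)
    (h0 : M.K0 < K) (hM : K < M.KM) (hp : 0 < p) (he : e ≤ p) (hpm : p < m) (hmq : m < q)
    (hs : q ≤ s) (hm : M.Matched K c p m q Q P R) (hl : Q ∈ l) (hPt : Tendsto P l (𝓝 p))
    (hRt : Tendsto R l (𝓝 q)) (hx : x = p ∨ x = q) (hx' : x = e ∨ x = s)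
    (hxt : Tendsto (fun y => y) l (𝓝 x)) (hO : O ⊆ loopSet (M.acoef K c) (M.bcoef K) M.g2 p q)
    (hO' : loopSet (M.acoef K c) (M.bcoef K) M.g2 p q ⊆ closure O) :
    Tendsto (M.muFamily K c P R) l (𝓝 (crit (M.acoef K c) (M.bcoef K) M.g2 p q)) ∧
      Tendsto (M.periodFamily K c P R) l atTop ∧ OrbitTendsto (M.orbitFamily K c P R) l O := by
  have hK : 0 < K := h.K0_nonneg.trans_lt h0
  have hS := hPat.scene hτ h h2 h0 hM
  have hq0 : 0 < q := hp.trans (hpm.trans hmq)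
  have hx0 : 0 < x := by
    rcases hx with rfl | rfl
    exacts [hp, hq0]
  have hC := hS.cell hp he hpm hq0 hmq hs
  have hPe : ∀ᶠ y in l, P y ∈ Ico p m := by
    filter_upwards [hl] with y hy using Ioo_subset_Ico_self (hm y hy).1
  have hRe : ∀ᶠ y in l, R y ∈ Ioc m q := by
    filter_upwards [hl] with y hy using Ioo_subset_Ioc_self (hm y hy).2.1
  have hμ := hC.tendsto_crit hPe hRe hPt hRt
  refine ⟨hμ, ?_, ?_⟩
  · refine hS.tendsto_loopTime_atTop (p := p) (q := q) (s' := x) (X := fun y => y)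
      (fun u hu => hp.trans_le hu.1) ?_ ?_ ?_ ?_ ?_ ?_ ?_ hxt hμ
    · filter_upwards [hl] with y hy
      have := (hm y hy).1
      exact ⟨⟨he.trans_lt this.1, this.2⟩, this.1.le⟩
    · filter_upwards [hl] with y hy
      have := (hm y hy).2.1
      exact ⟨⟨this.1, this.2.trans_le hs⟩, this.2.le⟩
    · filter_upwards [hl] with y hy using (hm y hy).2.2.1
    · rcases hx with rfl | rfl
      exacts [left_mem_Icc.2 (hpm.trans hmq).le, right_mem_Icc.2 (hpm.trans hmq).le]
    · exact hPat.acoef_eq_zero hK hx0 (hx'.imp_right Or.inr)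
    · rcases hx' with rfl | rfl
      exacts [hPat.hem.ne, hPat.hms.ne']
    · filter_upwards [hl] with y hy using (hm y hy).2.2.2
  · have h3 := hC.tendsto_loopSet hPe hRe hPt hRt
    simp only [OrbitTendsto, hausdorffEDist_eq_of_closure hO hO']
    exact h3

/-- The pulse at the largest zero of `f` and the periodic orbits inside it. -/
theorem pulse_right (hPat : M.Pattern K c e m s) (hτ : 0 < M.τ) (h : M.A1) (h2 : M.A2)
    (h0 : M.K0 < K) (hM : K < M.KM) (hp : p ∈ Ioo e m)
    (hgap : critGap (M.acoef K c) (M.bcoef K) M.g2 p s < 0) :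
    ∃ (μ2 : ℝ) (O2 : Set PhasePlane),
      (∀ (μ : ℝ) (O : Set PhasePlane), M.IsPulseOrbit K c s μ O ↔ μ = μ2 ∧ O = O2) ∧
      ∃ (μper Zper : ℝ → ℝ) (Oper : ℝ → Set PhasePlane),
        M.IsPeriodicFamily K c (Ioo m s) μper Zper Oper ∧
        M.HopfLimit K c m (Ioo m s) μper Zper Oper ∧
        Tendsto μper (𝓝[Ioo m s] s) (𝓝 μ2) ∧
        Tendsto Zper (𝓝[Ioo m s] s) atTop ∧
        OrbitTendsto Oper (𝓝[Ioo m s] s) O2 := by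
  have hK : 0 < K := h.K0_nonneg.trans_lt h0
  have hS := hPat.scene hτ h h2 h0 hM
  have hs0 : 0 < s := hPat.m_pos.trans hPat.hms
  have hcell : ∀ {p}, p ∈ Ioo e m → Cell (M.acoef K c) (M.bcoef K) M.g2 p m s := fun hp =>
    hS.cell (hPat.nonneg.trans_lt hp.1) hp.1.le hp.2 hs0 hPat.hms le_rfl
  obtain ⟨r, hr, hr0⟩ := (hcell hp).exists_critGap_eq_zero_left hgap
  have hre : r ∈ Ioo e m := ⟨hp.1.trans hr.1, hr.2⟩
  obtain ⟨O2, hO, hO', hpulse⟩ := hS.isPulse_iff_right hs0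
    (hPat.acoef_eq_zero hK hs0 (Or.inr (Or.inr rfl))) hre hr0
  obtain ⟨P, hP, hPs, hPm⟩ := (hcell hre).exists_matched_left hr0
  have hmat : M.Matched K c r m s (Ioo m s) P (fun x => x) := fun x hx =>
    ⟨(hP x hx).1, hx, (hP x hx).2, Or.inr rfl⟩
  refine ⟨crit (M.acoef K c) (M.bcoef K) M.g2 r s, O2, fun μ O => ?_, _, _, _,
    hPat.isPeriodicFamily hτ h h2 h0 hM hre.1.le le_rfl hmat,
    hPat.hopfLimit hτ h h2 h0 hM hre.1.le le_rfl hmat hPm nhdsWithin_le_nhds,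
    hPat.endLimit hτ h h2 h0 hM (hPat.nonneg.trans_lt hre.1) hre.1.le hre.2 hPat.hms le_rfl hmat
      self_mem_nhdsWithin hPs nhdsWithin_le_nhds (Or.inr rfl) (Or.inr rfl) nhdsWithin_le_nhds
      hO hO'⟩
  rw [isPulseOrbit_iff h]
  exact hpulse μ O

/-- The pulse at the smallest zero of `f` and the periodic orbits inside it. -/
theorem pulse_left (hPat : M.Pattern K c e m s) (hτ : 0 < M.τ) (h : M.A1) (h2 : M.A2)
    (h0 : M.K0 < K) (hM : K < M.KM) (he : 0 < e)
    (hgap : 0 < critGap (M.acoef K c) (M.bcoef K) M.g2 e s) :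
    ∃ (μ1 : ℝ) (O1 : Set PhasePlane),
      (∀ (μ : ℝ) (O : Set PhasePlane), M.IsPulseOrbit K c e μ O ↔ μ = μ1 ∧ O = O1) ∧
      ∃ (μper Zper : ℝ → ℝ) (Oper : ℝ → Set PhasePlane),
        M.IsPeriodicFamily K c (Ioo e m) μper Zper Oper ∧
        M.HopfLimit K c m (Ioo e m) μper Zper Oper ∧
        Tendsto μper (𝓝[Ioo e m] e) (𝓝 μ1) ∧
        Tendsto Zper (𝓝[Ioo e m] e) atTop ∧
        OrbitTendsto Oper (𝓝[Ioo e m] e) O1 := by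
  have hK : 0 < K := h.K0_nonneg.trans_lt h0
  have hS := hPat.scene hτ h h2 h0 hM
  have hcell : ∀ {q}, q ∈ Ioc m s → Cell (M.acoef K c) (M.bcoef K) M.g2 e m q := fun hq =>
    hS.cell he le_rfl hPat.hem (hPat.m_pos.trans hq.1) hq.1 hq.2
  obtain ⟨r, hr, hr0⟩ := (hcell (right_mem_Ioc.2 hPat.hms)).exists_critGap_eq_zero_right hgap
  obtain ⟨O1, hO, hO', hpulse⟩ := hS.isPulse_iff_left he
    (hPat.acoef_eq_zero hK he (Or.inl rfl)) hr hr0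
  obtain ⟨R, hR, hRe, hRm⟩ := (hcell (Ioo_subset_Ioc_self hr)).exists_matched_right hr0
  have hmat : M.Matched K c e m r (Ioo e m) (fun x => x) R := fun x hx =>
    ⟨hx, (hR x hx).1, (hR x hx).2, Or.inl rfl⟩
  refine ⟨crit (M.acoef K c) (M.bcoef K) M.g2 e r, O1, fun μ O => ?_, _, _, _,
    hPat.isPeriodicFamily hτ h h2 h0 hM le_rfl hr.2.le hmat,
    hPat.hopfLimit hτ h h2 h0 hM le_rfl hr.2.le hmat nhdsWithin_le_nhds hRm,
    hPat.endLimit hτ h h2 h0 hM he le_rfl hPat.hem hr.1 hr.2.le hmat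
      self_mem_nhdsWithin nhdsWithin_le_nhds hRe (Or.inl rfl) (Or.inl rfl) nhdsWithin_le_nhds
      hO hO'⟩
  rw [isPulseOrbit_iff h]
  exact hpulse μ O

/-- The heteroclinic cycle and the periodic orbits inside it. -/
theorem hetCycle (hPat : M.Pattern K c e m s) (hτ : 0 < M.τ) (h : M.A1) (h2 : M.A2)
    (h0 : M.K0 < K) (hM : K < M.KM) (he : 0 < e)
    (hgap : critGap (M.acoef K c) (M.bcoef K) M.g2 e s = 0) :
    ∃ (μs : ℝ) (Os : Set PhasePlane),
      (∀ (μ : ℝ) (O : Set PhasePlane), M.IsHeteroclinicCycle K c μ O ↔ μ = μs ∧ O = Os) ∧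
      ∃ (μper Zper : ℝ → ℝ) (Oper : ℝ → Set PhasePlane),
        M.IsPeriodicFamily K c (Ioo e m ∪ Ioo m s) μper Zper Oper ∧
        M.HopfLimit K c m (Ioo e m ∪ Ioo m s) μper Zper Oper ∧
        (Tendsto μper (𝓝[Ioo e m] e) (𝓝 μs) ∧ Tendsto Zper (𝓝[Ioo e m] e) atTop ∧
          OrbitTendsto Oper (𝓝[Ioo e m] e) Os) ∧
        (Tendsto μper (𝓝[Ioo m s] s) (𝓝 μs) ∧ Tendsto Zper (𝓝[Ioo m s] s) atTop ∧
          OrbitTendsto Oper (𝓝[Ioo m s] s) Os) := by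
  have hK : 0 < K := h.K0_nonneg.trans_lt h0
  have hS := hPat.scene hτ h h2 h0 hM
  have hs0 : 0 < s := hPat.m_pos.trans hPat.hms
  have hcell := hS.cell he le_rfl hPat.hem hs0 hPat.hms le_rfl
  obtain ⟨Os, hO, hO', hhet⟩ := hS.isHetCycle_iff he hs0
    (hPat.acoef_eq_zero hK he (Or.inl rfl)) (hPat.acoef_eq_zero hK hs0 (Or.inr (Or.inr rfl))) hgap
  obtain ⟨P, hP, hPs, hPm⟩ := hcell.exists_matched_left hgap
  obtain ⟨R, hR, hRe, hRm⟩ := hcell.exists_matched_right hgap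
  -- Left of the centre `x` is the lower end of its orbit, right of it the upper end; the value at
  -- `m` plays no role.
  set P' : ℝ → ℝ := fun x => if x < m then x else P x with hP'
  set R' : ℝ → ℝ := fun x => if x < m then R x else x with hR'
  have eP : ∀ x ∈ Ioo e m, x = P' x := fun x hx => (if_pos hx.2).symm
  have eP' : ∀ x ∈ Ioo m s, P x = P' x := fun x hx => (if_neg (not_lt.2 hx.1.le)).symm
  have eR : ∀ x ∈ Ioo e m, R x = R' x := fun x hx => (if_pos hx.2).symm
  have eR' : ∀ x ∈ Ioo m s, x = R' x := fun x hx => (if_neg (not_lt.2 hx.1.le)).symm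
  have hmat : M.Matched K c e m s (Ioo e m ∪ Ioo m s) P' R' := by
    rintro x (hx | hx)
    · rw [← eP x hx, ← eR x hx]
      exact ⟨hx, (hR x hx).1, (hR x hx).2, Or.inl rfl⟩
    · rw [← eP' x hx, ← eR' x hx]
      exact ⟨(hP x hx).1, hx, (hP x hx).2, Or.inr rfl⟩
  have tend : ∀ {F F' : ℝ → ℝ} {A : Set ℝ} {y z : ℝ}, (∀ x ∈ A, F x = F' x) →
      Tendsto F (𝓝[A] y) (𝓝 z) → Tendsto F' (𝓝[A] y) (𝓝 z) := fun hA hF =>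
    hF.congr' (eventually_of_mem self_mem_nhdsWithin hA)
  refine ⟨crit (M.acoef K c) (M.bcoef K) M.g2 e s, Os, fun μ O => ?_, M.muFamily K c P' R',
    M.periodFamily K c P' R', M.orbitFamily K c P' R',
    hPat.isPeriodicFamily hτ h h2 h0 hM le_rfl le_rfl hmat,
    hPat.hopfLimit hτ h h2 h0 hM le_rfl le_rfl hmat ?_ ?_,
    hPat.endLimit hτ h h2 h0 hM he le_rfl hPat.hem hPat.hms le_rfl hmat
      (mem_of_superset self_mem_nhdsWithin subset_union_left) (tend eP nhdsWithin_le_nhds)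
      (tend eR hRe) (Or.inl rfl) (Or.inl rfl) nhdsWithin_le_nhds hO hO',
    hPat.endLimit hτ h h2 h0 hM he le_rfl hPat.hem hPat.hms le_rfl hmat
      (mem_of_superset self_mem_nhdsWithin subset_union_right) (tend eP' hPs)
      (tend eR' nhdsWithin_le_nhds) (Or.inr rfl) (Or.inr rfl) nhdsWithin_le_nhds hO hO'⟩
  · rw [isHeteroclinicCycle_iff h (hPat.threeZeros hK he)]
    exact hhet μ O
  · rw [nhdsWithin_union]
    exact (tend eP nhdsWithin_le_nhds).sup (tend eP' hPm)
  · rw [nhdsWithin_union]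
    exact (tend eR hRm).sup (tend eR' nhdsWithin_le_nhds)

end Pattern

end TrafficModel

end

theorem proposition6p2 (M : TrafficModel) (hτ : 0 < M.τ) (hA1 : M.A1) (hA2 : M.A2)
    (K : ℝ) (hC : M.C K) :
    ∃ (cs μs : ℝ) (Os : Set PhasePlane),
      -- `cs = c_*(K)`, `μs = μ_*`, `Os = O_*`
      (K, cs) ∈ M.D1 ∧
      (∀ c : ℝ, (K, c) ∈ M.D1 → ∀ (μ : ℝ) (O : Set PhasePlane),
        M.IsHeteroclinicCycle K c μ O ↔ c = cs ∧ μ = μs ∧ O = Os) ∧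
      -- the region `D_{1,1}`
      (∀ c : ℝ, (K, c) ∈ M.D1 → cs < c →
        ∃ u1 u0 u2 : ℝ, M.ThreeZeros K c u1 u0 u2 ∧
        ∃ (μ1 : ℝ) (O1 : Set PhasePlane),
          (∀ (μ : ℝ) (O : Set PhasePlane), M.IsPulseOrbit K c u1 μ O ↔ μ = μ1 ∧ O = O1) ∧
        ∃ (μper Zper : ℝ → ℝ) (Oper : ℝ → Set PhasePlane),
          M.IsPeriodicFamily K c (Set.Ioo u1 u0) μper Zper Oper ∧
          M.HopfLimit K c u0 (Set.Ioo u1 u0) μper Zper Oper ∧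
          Tendsto μper (𝓝[Set.Ioo u1 u0] u1) (𝓝 μ1) ∧
          Tendsto Zper (𝓝[Set.Ioo u1 u0] u1) atTop ∧
          OrbitTendsto Oper (𝓝[Set.Ioo u1 u0] u1) O1) ∧
      -- the region `D_{1,2} ∪ D_2`
      (∀ c : ℝ, ((K, c) ∈ M.D1 ∧ c < cs) ∨ (K, c) ∈ M.D2 →
        ∃ u0 u2 : ℝ,
          ((K, c) ∈ M.D1 → ∃ u1 : ℝ, M.ThreeZeros K c u1 u0 u2) ∧
          ((K, c) ∈ M.D2 → M.TwoZeros K c u0 u2) ∧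
        ∃ (μ2 : ℝ) (O2 : Set PhasePlane),
          (∀ (μ : ℝ) (O : Set PhasePlane), M.IsPulseOrbit K c u2 μ O ↔ μ = μ2 ∧ O = O2) ∧
        ∃ (μper Zper : ℝ → ℝ) (Oper : ℝ → Set PhasePlane),
          M.IsPeriodicFamily K c (Set.Ioo u0 u2) μper Zper Oper ∧
          M.HopfLimit K c u0 (Set.Ioo u0 u2) μper Zper Oper ∧
          Tendsto μper (𝓝[Set.Ioo u0 u2] u2) (𝓝 μ2) ∧
          Tendsto Zper (𝓝[Set.Ioo u0 u2] u2) atTop ∧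
          OrbitTendsto Oper (𝓝[Set.Ioo u0 u2] u2) O2) ∧
      -- the region `D_{1,3}`
      (∃ u1 u0 u2 : ℝ, M.ThreeZeros K cs u1 u0 u2 ∧
        ∃ (μper Zper : ℝ → ℝ) (Oper : ℝ → Set PhasePlane),
          M.IsPeriodicFamily K cs (Set.Ioo u1 u0 ∪ Set.Ioo u0 u2) μper Zper Oper ∧
          M.HopfLimit K cs u0 (Set.Ioo u1 u0 ∪ Set.Ioo u0 u2) μper Zper Oper ∧
          (Tendsto μper (𝓝[Set.Ioo u1 u0] u1) (𝓝 μs) ∧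
            Tendsto Zper (𝓝[Set.Ioo u1 u0] u1) atTop ∧
            OrbitTendsto Oper (𝓝[Set.Ioo u1 u0] u1) Os) ∧
          (Tendsto μper (𝓝[Set.Ioo u0 u2] u2) (𝓝 μs) ∧
            Tendsto Zper (𝓝[Set.Ioo u0 u2] u2) atTop ∧
            OrbitTendsto Oper (𝓝[Set.Ioo u0 u2] u2) Os)) := by
  obtain ⟨h0, hM⟩ := hC.bounds hA1
  have hK : 0 < K := hA1.K0_nonneg.trans_lt h0
  obtain ⟨cs, hcs, hbal⟩ := TrafficModel.exists_balanced_speed hτ hA1 hA2 hC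
  obtain ⟨e, m, s, he, hPat⟩ := TrafficModel.exists_pattern_three hA1 h0 hM hcs.1 hcs.2
  obtain ⟨μs, Os, hhet, hfam⟩ := hPat.hetCycle hτ hA1 hA2 h0 hM he
    ((hbal cs hcs e m s he hPat).2.2 rfl)
  refine ⟨cs, μs, Os, ⟨h0, hM, hcs.1, hcs.2⟩, fun c hc μ O => ?_, fun c hc hlt => ?_,
    fun c hc => ?_, e, m, s, hPat.threeZeros hK he, hfam⟩
  · have hc' : c ∈ Ioo (M.c1 K) (M.cM K) := hc.2.2
    constructor
    · intro hcyc
      obtain ⟨e', m', s', he', hPat'⟩ := TrafficModel.exists_pattern_three hA1 h0 hM hc'.1 hc'.2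
      obtain ⟨h1, h3, h4⟩ := hbal c hc' e' m' s' he' hPat'
      have hgap := ((hPat'.scene hτ hA1 hA2 h0 hM).crit_of_hetCycle he'
        (hPat'.m_pos.trans hPat'.hms)
        ((TrafficModel.isHeteroclinicCycle_iff hA1 (hPat'.threeZeros hK he')).1 hcyc)).1
      -- A cycle forces the gap to vanish, which happens at one speed only.
      have hccs : c = cs := by
        rcases lt_trichotomy c cs with hlt | heq | hgt
        · exact absurd hgap (h1 hlt).ne
        · exact heq
        · exact absurd hgap (h3 hgt).ne'
      rw [hccs] at hcyc
      exact ⟨hccs, (hhet μ O).1 hcyc⟩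
    · rintro ⟨rfl, hO⟩
      exact (hhet μ O).2 hO
  · obtain ⟨e', m', s', he', hPat'⟩ :=
      TrafficModel.exists_pattern_three hA1 h0 hM hc.2.2.1 hc.2.2.2
    exact ⟨e', m', s', hPat'.threeZeros hK he', hPat'.pulse_left hτ hA1 hA2 h0 hM he'
      ((hbal c hc.2.2 e' m' s' he' hPat').2.1 hlt)⟩
  · by_cases hD : (K, c) ∈ M.D1
    · have hlt : c < cs := by
        rcases hc with ⟨-, hlt⟩ | hD2
        · exact hlt
        · have hc0 : M.c0 < c := (le_max_left _ _).trans_lt hD.2.2.1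
          rcases hD2 with ⟨-, -, h1⟩ | ⟨-, -, -, h1⟩
          · exact absurd h1 hc0.ne'
          · exact absurd h1 (lt_asymm hc0)
      have hnot : (K, c) ∉ M.D2 := by
        have hc0 : M.c0 < c := (le_max_left _ _).trans_lt hD.2.2.1
        rintro (⟨-, -, h1⟩ | ⟨-, -, -, h1⟩)
        · exact hc0.ne' h1
        · exact lt_asymm hc0 h1
      obtain ⟨e', m', s', he', hPat'⟩ :=
        TrafficModel.exists_pattern_three hA1 h0 hM hD.2.2.1 hD.2.2.2
      have hcell := (hPat'.scene hτ hA1 hA2 h0 hM).cell he' le_rfl hPat'.hem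
        (hPat'.m_pos.trans hPat'.hms) hPat'.hms le_rfl
      -- The pulse construction wants a negative gap at an interior left end, since on `D₂` the end
      -- `e = 0` is not available.
      obtain ⟨p, hp, hp0⟩ := hcell.exists_critGap_neg_right
        ((hbal c hD.2.2 e' m' s' he' hPat').1 hlt)
      exact ⟨m', s', fun _ => ⟨e', hPat'.threeZeros hK he'⟩, fun h => absurd h hnot,
        hPat'.pulse_right hτ hA1 hA2 h0 hM hp hp0⟩
    · have hD2 : (K, c) ∈ M.D2 := hc.resolve_left fun h => hD h.1
      have hcm0 : K < M.K1 → M.cm K < M.c0 := fun h1 => (TrafficModel.K1_spec hA1).2.1 K ⟨hK, h1⟩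
      obtain ⟨hK1, hcm, hcc⟩ : K < M.K1 ∧ M.cm K < c ∧ c ≤ M.c0 := by
        rcases hD2 with ⟨-, h1, h3⟩ | ⟨-, h1, h3, h4⟩
        · exact ⟨h1, (hcm0 h1).trans_eq h3.symm, h3.le⟩
        · exact ⟨h1, h3, h4.le⟩
      obtain ⟨m', s', hPat'⟩ := TrafficModel.exists_pattern_two hA1 h0 hM hcm hcc
      -- On `D₂` one has `K < K₁`, so `c_m < c₀` and (C) can only hold through its second
      -- alternative.
      obtain ⟨p, hp, hp0⟩ := TrafficModel.exists_critGap_neg_of_H hτ hA1 hA2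
        (hC.H_of_lt hA1 (hcm0 hK1)) h0 hM hPat' hcc
      exact ⟨m', s', fun h => absurd h hD, fun _ => hPat'.twoZeros hK,
        hPat'.pulse_right hτ hA1 hA2 h0 hM hp hp0⟩
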